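/- Let $0<q<1$, $\ell\ge 1$, $N\in\mathbb Z$, $[x]=\frac{q^x-q^{-x}}{q-q^{-1}}$. **Algebras.** $U_q(su(\ell+1))$ is the Hopf $*$-algebra generated by $K_i=K_i^*$, $K_i^{-1}$, $E_i$, $F_i=E_i^*$ ($1\le i\le\ell$) with $[K_i,K_j]=0$, $K_iE_iK_i^{-1}=qE_i$, $K_iE_jK_i^{-1}=q^{-1/2}E_j$ if $|i-j|=1$ and $=E_j$ if $|i-j|>1$, $[E_i,F_j]=\delta_{ij}\frac{K_i^2-K_i^{-2}}{q-q^{-1}}$, $E_i^2E_j-(q+q^{-1})E_iE_jE_i+E_jE_i^2=0$ if $|i-j|=1$, $[E_i,E_j]=0$ if $|i-j|>1$, and the conjugated relations; $\Delta(K_i)=K_i\otimes K_i$, $\Delta(E_i)=E_i\otimes K_i+K_i^{-1}\otimes E_i$, $\epsilon(K_i)=1$, $\epsilon(E_i)=0$, $S(K_i)=K_i^{-1}$, $S(E_i)=-qE_i$. It is enlarged by the positive group-like roots $\hat K=(K_1K_2^2\cdots K_\ell^\ell)^{2/(\ell+1)}$ and $\hat K^{1/\ell}$. Put $M_{i,i}=E_i$,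 $M_{j,k}=E_jM_{j+1,k}-q^{-1}M_{j+1,k}E_j$ for $j<k$, $N_{j,k}=(K_j\cdots K_\ell)(K_{k+1}\cdots K_\ell)\hat K^{-1}$, $X_i=N_{i,\ell}M_{i,\ell}^*$, and $$\mathcal C_q=\sum_{i=1}^\ell\tfrac{q^{\ell+2-2i}}{(q-q^{-1})^2}N_{i,i-1}^2+\tfrac{q^{-\ell}}{(q-q^{-1})^2}\hat K^{-2}+\sum_{1\le j\le k\le\ell}q^{\ell+1-2j}M_{j,k}^*N_{j,k}^2M_{j,k}-\tfrac{[\ell+1]}{(q-q^{-1})^2}.$$ $\mathcal C'_q$ is the analogous element of the subalgebra $U_q(su(\ell))$ generated by the $K_i^{\pm1},E_i,F_i$ with $i<\ell$ (replace $\ell$ by $\ell-1$ and $\hat K$ by $\hat K^{(\ell+1)/\ell}K_\ell^{-2}$). **Coordinate algebra.** $\mathcal A=\mathcal A(SU_q(\ell+1))$ is the $*$-algebra generated by the matrix coefficients of the vector representation inside the dual of the enlarged algebra $U_q(su(\ell+1))$, with the convolution product, $a^*(x)=\overline{a(S(x)^*)}$ and right action $(a\triangleleft h)(x)=a(hx)$;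 here the vector representation on $\mathbb C^{\ell+1}$ is $E_iv_i=v_{i+1}$, $F_iv_{i+1}=v_i$, $K_iv_j=q^{\frac12(\delta_{i+1,j}-\delta_{i,j})}v_j$ (all other $E_iv_j$, $F_iv_j$ zero). Put $\mathcal L_ha=a\triangleleft S^{-1}(h)$. **Forms.** Let $\mathrm{Gr}=\bigoplus_kW_k$ be the $q$-Grassmann algebra: vectors with components $w_s$, $s\subseteq\{1,\dots,\ell\}$ (degree $k=|s|$), and $$(v\wedge_q w)_s=\sum_{t\subseteq s}(-q^{-1})^{\#\{(a,b)\in t\times(s\smallsetminus t):\,b<a\}}v_tw_{s\smallsetminus t}.$$ Let $\mathfrak e^L_i$ be left multiplication by the basis vector $e^i$ of $W_1$ and $\mathfrak i^L_i$ its adjoint. $U_q(su(\ell))$ acts on $W_k$ by $\sigma_k$: with $j\#s=1_{j\in s}-1_{j+1\in s}$, $(\sigma_k(K_j)w)_s=q^{\frac12 j\#s}w_s$; $(\sigma_k(E_j)w)_s=w_{s'}$ if $j\#s=1$, where $s'$ is $s$ with $j$ replaced by $j+1$, and $0$ otherwise; $(\sigma_k(F_j)w)_s=w_{s'}$ if $j\#s=-1$,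 where $s'$ is $s$ with $j+1$ replaced by $j$, and $0$ otherwise. It is extended by $\sigma^N_k(\hat K)=q^{k-\frac{\ell}{\ell+1}N}$. Then $\Omega^k_N$ is the set of $\omega\in\mathcal A\otimes W_k$ with $(\mathcal L_{h_{(1)}}\otimes\sigma^N_k(h_{(2)}))\omega=\epsilon(h)\omega$ for all $h$ in the algebra generated by $U_q(su(\ell))$ and $\hat K^{\pm1}$. Put $$\bar\partial=\sum_{i=1}^\ell\mathcal L_{\hat KX_i}\otimes\mathfrak e^L_i,\qquad \bar\partial^\dagger=\sum_{i=1}^\ell\mathcal L_{X_i^*\hat K}\otimes\mathfrak i^L_i,\qquad D_N|_{\Omega^k_N}=q^{\frac12(k-N)}\bar\partial+q^{\frac12(k-N-1)}\bar\partial^\dagger .$$ The right action of $U_q(su(\ell+1))$ on forms is componentwise. **Theorem.** (0) $\bar\partial^\dagger$ is the Hermitian conjugate of $\bar\partial$: on $\mathcal A\otimes\mathrm{Gr}$ one has $\langle\bar\partial^\dagger\omega,\eta\rangle=\langle\omega,\bar\partial\eta\rangle$ for $\langle\omega,\eta\rangle=\varphi(\sum_s\omega_s^*\eta_s)$, $\varphi$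 the Haar state (the linear functional with $\varphi(1)=1$ and $\varphi(a\triangleleft h)=\epsilon(h)\varphi(a)$). (1) The Casimirs are related by $$\mathcal C_q=q\hat K^{\frac2\ell}\Big(\mathcal C'_q+\tfrac{[\ell]}{(q-q^{-1})^2}\Big)+\tfrac{q^{-\ell}}{(q-q^{-1})^2}\hat K^{-2}+\sum_{i=1}^\ell q^{\ell+1-2i}M_{i,\ell}^*N_{i,\ell}^2M_{i,\ell}-\tfrac{[\ell+1]}{(q-q^{-1})^2}.$$ For every $0\le k\le\ell$ and every $\omega\in\Omega^k_N$: (2) $\displaystyle(\bar\partial\bar\partial^\dagger+\bar\partial^\dagger\bar\partial)\omega=\omega\triangleleft\Big(q^{\frac{2N}{\ell+1}}\sum_{i=1}^\ell q^{-2i}X_iX_i^*+q^{N-\ell-k}[k][\ell+1-N]\Big)$; (3) $\displaystyle q^{2(k-N)}(\bar\partial\bar\partial^\dagger+q^2\bar\partial^\dagger\bar\partial)\omega=\omega\triangleleft\Big(q^{\frac{2(\ell+1-N)}{\ell+1}}\sum_{i=1}^\ell q^{-2i}S^{-1}(X_iX_i^*)+q^{-N-\ell+k+1}[\ell-k][N]\Big)$;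 (4) $\displaystyle(1+q)D_N^2\omega=q^{k-\frac{\ell-1}{\ell+1}N}\sum_{i=1}^\ell q^{-2i}\,\omega\triangleleft X_iX_i^*+q^{\frac{\ell-1}{\ell+1}N-k+1}\sum_{i=1}^\ell q^{-2i}\,\omega\triangleleft S^{-1}(X_iX_i^*)+q^{-\ell}\big([k][\ell+1-N]+[\ell-k][N]\big)\omega$; (5) $\displaystyle\omega\triangleleft\Big(\mathcal C_q-\sum_{i=1}^\ell q^{\ell+1-2i}X_iX_i^*\Big)=\tfrac{1}{(q-q^{-1})^2}\Big(q^{1-\frac{2N}{\ell+1}}\big([\ell]+(q-q^{-1})q^{\ell-k+1}[k]\big)+q^{-2k+\ell(\frac{2N}{\ell+1}-1)}-[\ell+1]\Big)\,\omega$. (6) For every $0\le k\le\ell$ there is a constant $c\in\mathbb C$ such that for all $\omega\in\Omega^k_N$ $$(1+q)D_N^2\omega=q^{k-\frac{\ell-1}{\ell+1}N-\ell-1}\,\omega\triangleleft\mathcal C_q+q^{\frac{\ell-1}{\ell+1}N-k-\ell}\,\omega\triangleleft S^{-1}(\mathcal C_q)+c\,\omega .$$ -/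

import Mathlib

open scoped TensorProduct

noncomputable section

namespace QProj

/-- The index set `{1, …, n}`. -/
abbrev Idx (n : ℕ) : Type := ↥(Finset.Icc 1 n)

/-- The power `q ^ x` with real exponent, as a complex number. -/
def qpow (q : Set.Ioo (0 : ℝ) 1) (x : ℝ) : ℂ := (((q : ℝ) ^ x : ℝ) : ℂ)

/-- The `q`-number `[x] = (q ^ x - q ^ (-x)) / (q - q⁻¹)`. -/
def qnum (q : Set.Ioo (0 : ℝ) 1) (x : ℝ) : ℂ :=
  (qpow q x - qpow q (-x)) / (qpow q 1 - qpow q (-1))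

/-- Generators of the quantised enveloping algebra of `su(ℓ+1)`, enlarged by a root `κ` of
`K₁ K₂² ⋯ K_ℓ^ℓ`. -/
inductive Gen (ℓ : ℕ) : Type
  | K (i : Idx ℓ)
  | Kinv (i : Idx ℓ)
  | E (i : Idx ℓ)
  | F (i : Idx ℓ)
  | kap
  | kapinv

/-- `|i - j| = 1`. -/
def Near {ℓ : ℕ} (i j : Idx ℓ) : Prop := (i : ℕ) + 1 = j ∨ (j : ℕ) + 1 = i

instance {ℓ : ℕ} (i j : Idx ℓ) : Decidable (Near i j) := by
  unfold Near; infer_instance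

/-- Half of the Cartan matrix: `K_i E_j K_i⁻¹ = q ^ (wt i j) E_j`. -/
def wt {ℓ : ℕ} (i j : Idx ℓ) : ℝ := if i = j then 1 else if Near i j then -1 / 2 else 0

/-- `κ E_i κ⁻¹ = q ^ (wtk i) E_i`. -/
def wtk {ℓ : ℕ} (i : Idx ℓ) : ℝ := if (i : ℕ) = ℓ then 1 / (ℓ : ℝ) else 0

/-- The ordered product `f 1 * (f 2) ^ 2 * ⋯ * (f ℓ) ^ ℓ`. -/
def rootProd {T : Type*} [Monoid T] (ℓ : ℕ) (f : Idx ℓ → T) : T :=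
  ((List.finRange ℓ).map fun i : Fin ℓ =>
    f ⟨(i : ℕ) + 1, Finset.mem_Icc.mpr ⟨by omega, by omega⟩⟩ ^ ((i : ℕ) + 1)).prod

/-- The defining relations. -/
inductive Rel (ℓ : ℕ) (q : Set.Ioo (0 : ℝ) 1) :
    FreeAlgebra ℂ (Gen ℓ) → FreeAlgebra ℂ (Gen ℓ) → Prop
  | K_mul_Kinv (i : Idx ℓ) : Rel ℓ q (.ι ℂ (.K i) * .ι ℂ (.Kinv i)) 1
  | Kinv_mul_K (i : Idx ℓ) : Rel ℓ q (.ι ℂ (.Kinv i) * .ι ℂ (.K i)) 1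
  | kap_mul_kapinv : Rel ℓ q (.ι ℂ .kap * .ι ℂ .kapinv) 1
  | kapinv_mul_kap : Rel ℓ q (.ι ℂ .kapinv * .ι ℂ .kap) 1
  | K_comm (i j : Idx ℓ) : Rel ℓ q (.ι ℂ (.K i) * .ι ℂ (.K j)) (.ι ℂ (.K j) * .ι ℂ (.K i))
  | kap_K (i : Idx ℓ) : Rel ℓ q (.ι ℂ .kap * .ι ℂ (.K i)) (.ι ℂ (.K i) * .ι ℂ .kap)
  | K_E (i j : Idx ℓ) :
      Rel ℓ q (.ι ℂ (.K i) * .ι ℂ (.E j)) (qpow q (wt i j) • (.ι ℂ (.E j) * .ι ℂ (.K i)))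
  | K_F (i j : Idx ℓ) :
      Rel ℓ q (.ι ℂ (.K i) * .ι ℂ (.F j)) (qpow q (-wt i j) • (.ι ℂ (.F j) * .ι ℂ (.K i)))
  | kap_E (i : Idx ℓ) :
      Rel ℓ q (.ι ℂ .kap * .ι ℂ (.E i)) (qpow q (wtk i) • (.ι ℂ (.E i) * .ι ℂ .kap))
  | kap_F (i : Idx ℓ) :
      Rel ℓ q (.ι ℂ .kap * .ι ℂ (.F i)) (qpow q (-wtk i) • (.ι ℂ (.F i) * .ι ℂ .kap))
  | E_F (i : Idx ℓ) :
      Rel ℓ q (.ι ℂ (.E i) * .ι ℂ (.F i) - .ι ℂ (.F i) * .ι ℂ (.E i))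
        ((qpow q 1 - qpow q (-1))⁻¹ • (.ι ℂ (.K i) ^ 2 - .ι ℂ (.Kinv i) ^ 2))
  | E_F_ne (i j : Idx ℓ) (h : i ≠ j) :
      Rel ℓ q (.ι ℂ (.E i) * .ι ℂ (.F j)) (.ι ℂ (.F j) * .ι ℂ (.E i))
  | serre_E (i j : Idx ℓ) (h : Near i j) :
      Rel ℓ q (.ι ℂ (.E i) * .ι ℂ (.E i) * .ι ℂ (.E j) + .ι ℂ (.E j) * .ι ℂ (.E i) * .ι ℂ (.E i))
        ((qpow q 1 + qpow q (-1)) • (.ι ℂ (.E i) * .ι ℂ (.E j) * .ι ℂ (.E i)))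
  | serre_F (i j : Idx ℓ) (h : Near i j) :
      Rel ℓ q (.ι ℂ (.F i) * .ι ℂ (.F i) * .ι ℂ (.F j) + .ι ℂ (.F j) * .ι ℂ (.F i) * .ι ℂ (.F i))
        ((qpow q 1 + qpow q (-1)) • (.ι ℂ (.F i) * .ι ℂ (.F j) * .ι ℂ (.F i)))
  | comm_E (i j : Idx ℓ) (h : ¬ Near i j) :
      Rel ℓ q (.ι ℂ (.E i) * .ι ℂ (.E j)) (.ι ℂ (.E j) * .ι ℂ (.E i))
  | comm_F (i j : Idx ℓ) (h : ¬ Near i j) :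
      Rel ℓ q (.ι ℂ (.F i) * .ι ℂ (.F j)) (.ι ℂ (.F j) * .ι ℂ (.F i))
  | root : Rel ℓ q (.ι ℂ .kap ^ (ℓ * (ℓ + 1) / 2)) (rootProd ℓ fun i => .ι ℂ (.K i))

/-- The algebra `U_q(su(ℓ+1))`, enlarged by `κ` and its inverse. -/
def U (ℓ : ℕ) (q : Set.Ioo (0 : ℝ) 1) : Type := RingQuot (Rel ℓ q)

instance (ℓ : ℕ) (q : Set.Ioo (0 : ℝ) 1) : Ring (U ℓ q) :=
  inferInstanceAs (Ring (RingQuot (Rel ℓ q)))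

instance (ℓ : ℕ) (q : Set.Ioo (0 : ℝ) 1) : Algebra ℂ (U ℓ q) :=
  inferInstanceAs (Algebra ℂ (RingQuot (Rel ℓ q)))

variable {ℓ : ℕ} {q : Set.Ioo (0 : ℝ) 1}

/-- The quotient map from the free algebra. -/
def mkU (ℓ : ℕ) (q : Set.Ioo (0 : ℝ) 1) : FreeAlgebra ℂ (Gen ℓ) →ₐ[ℂ] U ℓ q :=
  RingQuot.mkAlgHom ℂ (Rel ℓ q)

/-- The image of a generator in the algebra. -/
def gen (q : Set.Ioo (0 : ℝ) 1) (x : Gen ℓ) : U ℓ q := mkU ℓ q (FreeAlgebra.ι ℂ x)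

/-- A family of elements satisfying the defining relations. -/
structure Sat {T : Type*} [Ring T] [Algebra ℂ T] (q : Set.Ioo (0 : ℝ) 1) (f : Gen ℓ → T) :
    Prop where
  K_mul_Kinv : ∀ i, f (.K i) * f (.Kinv i) = 1
  Kinv_mul_K : ∀ i, f (.Kinv i) * f (.K i) = 1
  kap_mul_kapinv : f .kap * f .kapinv = 1
  kapinv_mul_kap : f .kapinv * f .kap = 1
  K_comm : ∀ i j, f (.K i) * f (.K j) = f (.K j) * f (.K i)
  kap_K : ∀ i, f .kap * f (.K i) = f (.K i) * f .kap
  K_E : ∀ i j, f (.K i) * f (.E j) = qpow q (wt i j) • (f (.E j) * f (.K i))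
  K_F : ∀ i j, f (.K i) * f (.F j) = qpow q (-wt i j) • (f (.F j) * f (.K i))
  kap_E : ∀ i, f .kap * f (.E i) = qpow q (wtk i) • (f (.E i) * f .kap)
  kap_F : ∀ i, f .kap * f (.F i) = qpow q (-wtk i) • (f (.F i) * f .kap)
  E_F : ∀ i, f (.E i) * f (.F i) - f (.F i) * f (.E i) =
    (qpow q 1 - qpow q (-1))⁻¹ • (f (.K i) ^ 2 - f (.Kinv i) ^ 2)
  E_F_ne : ∀ i j, i ≠ j → f (.E i) * f (.F j) = f (.F j) * f (.E i)
  serre_E : ∀ i j, Near i j → f (.E i) * f (.E i) * f (.E j) + f (.E j) * f (.E i) * f (.E i) =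
    (qpow q 1 + qpow q (-1)) • (f (.E i) * f (.E j) * f (.E i))
  serre_F : ∀ i j, Near i j → f (.F i) * f (.F i) * f (.F j) + f (.F j) * f (.F i) * f (.F i) =
    (qpow q 1 + qpow q (-1)) • (f (.F i) * f (.F j) * f (.F i))
  comm_E : ∀ i j, ¬ Near i j → f (.E i) * f (.E j) = f (.E j) * f (.E i)
  comm_F : ∀ i j, ¬ Near i j → f (.F i) * f (.F j) = f (.F j) * f (.F i)
  root : f .kap ^ (ℓ * (ℓ + 1) / 2) = rootProd ℓ fun i => f (.K i)

theorem map_rootProd {S T H : Type*} [Monoid S] [Monoid T] [FunLike H S T] [MonoidHomClass H S T]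
    (φ : H) (f : Idx ℓ → S) : φ (rootProd ℓ f) = rootProd ℓ fun i => φ (f i) := by
  simp only [rootProd, map_list_prod, List.map_map]
  congr 1
  refine List.map_congr_left fun i _ => ?_
  simp

theorem sat_gen : Sat q (gen (ℓ := ℓ) q) := by
  have key : ∀ {x y : FreeAlgebra ℂ (Gen ℓ)}, Rel ℓ q x y →
      mkU ℓ q x = mkU ℓ q y :=
    fun h => RingQuot.mkAlgHom_rel ℂ h
  constructor
  · intro i; simpa [gen] using key (.K_mul_Kinv i)
  · intro i; simpa [gen] using key (.Kinv_mul_K i)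
  · simpa [gen] using key .kap_mul_kapinv
  · simpa [gen] using key .kapinv_mul_kap
  · intro i j; simpa [gen] using key (.K_comm i j)
  · intro i; simpa [gen] using key (.kap_K i)
  · intro i j; simpa [gen] using key (.K_E i j)
  · intro i j; simpa [gen] using key (.K_F i j)
  · intro i; simpa [gen] using key (.kap_E i)
  · intro i; simpa [gen] using key (.kap_F i)
  · intro i; simpa [gen] using key (.E_F i)
  · intro i j h; simpa [gen] using key (.E_F_ne i j h)
  · intro i j h; simpa [gen] using key (.serre_E i j h)
  · intro i j h; simpa [gen] using key (.serre_F i j h)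
  · intro i j h; simpa [gen] using key (.comm_E i j h)
  · intro i j h; simpa [gen] using key (.comm_F i j h)
  · have := key (.root)
    rw [map_rootProd, map_pow] at this
    exact this

/-- The universal property of the algebra. -/
def lift {T : Type*} [Ring T] [Algebra ℂ T] (f : Gen ℓ → T) (hf : Sat q f) : U ℓ q →ₐ[ℂ] T :=
  RingQuot.liftAlgHom ℂ ⟨FreeAlgebra.lift ℂ f, by
    intro x y h
    induction h with
    | K_mul_Kinv i => simpa using hf.K_mul_Kinv i
    | Kinv_mul_K i => simpa using hf.Kinv_mul_K i
    | kap_mul_kapinv => simpa using hf.kap_mul_kapinv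
    | kapinv_mul_kap => simpa using hf.kapinv_mul_kap
    | K_comm i j => simpa using hf.K_comm i j
    | kap_K i => simpa using hf.kap_K i
    | K_E i j => simpa using hf.K_E i j
    | K_F i j => simpa using hf.K_F i j
    | kap_E i => simpa using hf.kap_E i
    | kap_F i => simpa using hf.kap_F i
    | E_F i => simpa using hf.E_F i
    | E_F_ne i j h => simpa using hf.E_F_ne i j h
    | serre_E i j h => simpa using hf.serre_E i j h
    | serre_F i j h => simpa using hf.serre_F i j h
    | comm_E i j h => simpa using hf.comm_E i j h
    | comm_F i j h => simpa using hf.comm_F i j h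
    | root => rw [map_rootProd, map_pow]; simpa using hf.root⟩

theorem lift_gen {T : Type*} [Ring T] [Algebra ℂ T] (f : Gen ℓ → T) (hf : Sat q f) (x : Gen ℓ) :
    lift f hf (gen q x) = f x := by
  refine (RingQuot.liftAlgHom_mkAlgHom_apply ℂ _ _ _).trans ?_
  simp

theorem U_induction {P : U ℓ q → Prop} (halg : ∀ c : ℂ, P (algebraMap ℂ _ c))
    (hgen : ∀ x, P (gen q x)) (hmul : ∀ a b, P a → P b → P (a * b))
    (hadd : ∀ a b, P a → P b → P (a + b)) (x : U ℓ q) : P x := by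
  obtain ⟨y, rfl⟩ : ∃ y, mkU ℓ q y = x := RingQuot.mkAlgHom_surjective ℂ (Rel ℓ q) x
  induction y using FreeAlgebra.induction with
  | grade0 c => rw [AlgHom.commutes]; exact halg c
  | grade1 x => exact hgen x
  | mul a b ha hb => rw [map_mul]; exact hmul _ _ ha hb
  | add a b ha hb => rw [map_add]; exact hadd _ _ ha hb

theorem U_hom_ext {T : Type*} [Semiring T] [Algebra ℂ T] {f g : U ℓ q →ₐ[ℂ] T}
    (h : ∀ x, f (gen q x) = g (gen q x)) : f = g := by
  ext x
  induction x using U_induction with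
  | halg c => simp
  | hgen x => exact h x
  | hmul a b ha hb => simp [ha, hb]
  | hadd a b ha hb => simp [ha, hb]

theorem qpow_add (q : Set.Ioo (0 : ℝ) 1) (x y : ℝ) : qpow q (x + y) = qpow q x * qpow q y := by
  simp [qpow, Real.rpow_add q.2.1]

theorem qpow_zero (q : Set.Ioo (0 : ℝ) 1) : qpow q 0 = 1 := by simp [qpow]

theorem qpow_ne (q : Set.Ioo (0 : ℝ) 1) (x : ℝ) : qpow q x ≠ 0 := by
  simpa [qpow] using (Real.rpow_pos_of_pos q.2.1 x).ne'

theorem qpow_neg (q : Set.Ioo (0 : ℝ) 1) (x : ℝ) : qpow q (-x) = (qpow q x)⁻¹ := by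
  simp [qpow, Real.rpow_neg q.2.1.le]

theorem qpow_pow (q : Set.Ioo (0 : ℝ) 1) (x : ℝ) (n : ℕ) : qpow q x ^ n = qpow q (x * n) := by
  simp [qpow, Real.rpow_mul q.2.1.le]

theorem conj_qpow (q : Set.Ioo (0 : ℝ) 1) (x : ℝ) : starRingEnd ℂ (qpow q x) = qpow q x := by
  simp [qpow]

theorem near_symm {i j : Idx ℓ} : Near i j ↔ Near j i := by unfold Near; tauto

theorem not_near_self (i : Idx ℓ) : ¬ Near i i := by unfold Near; omega

theorem wt_comm (i j : Idx ℓ) : wt i j = wt j i := by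
  unfold wt; simp only [near_symm (i := i), eq_comm (a := i)]

/-- The counit. -/
def counitGen : Gen ℓ → ℂ
  | .K _ => 1
  | .Kinv _ => 1
  | .E _ => 0
  | .F _ => 0
  | .kap => 1
  | .kapinv => 1

theorem sat_counit : Sat q (counitGen (ℓ := ℓ)) := by
  constructor <;> intros <;> simp [counitGen, rootProd]

def counitHom : U ℓ q →ₐ[ℂ] ℂ := lift _ sat_counit

/-- A product of pairwise commuting factors may be formed in the opposite order. -/
theorem rootProd_op {T : Type*} [Monoid T] (g : Idx ℓ → T) (hg : ∀ i j, Commute (g i) (g j)) :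
    rootProd ℓ (fun i => MulOpposite.op (g i)) = MulOpposite.op (rootProd ℓ g) := by
  unfold rootProd
  rw [MulOpposite.op_list_prod]
  set l := (List.finRange ℓ).map fun i : Fin ℓ =>
    g ⟨(i : ℕ) + 1, Finset.mem_Icc.mpr ⟨by omega, by omega⟩⟩ ^ ((i : ℕ) + 1) with hl
  have h1 : ((List.finRange ℓ).map fun i : Fin ℓ =>
      MulOpposite.op (g ⟨(i : ℕ) + 1, Finset.mem_Icc.mpr ⟨by omega, by omega⟩⟩) ^ ((i : ℕ) + 1)) =
      l.map MulOpposite.op := by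
    rw [hl, List.map_map]; rfl
  rw [h1]
  refine List.Perm.prod_eq' (List.reverse_perm _).symm ?_
  rw [List.pairwise_map]
  refine List.pairwise_of_forall_mem_list fun a ha b hb => ?_
  rw [hl, List.mem_map] at ha hb
  obtain ⟨i, -, rfl⟩ := ha
  obtain ⟨j, -, rfl⟩ := hb
  exact ((hg _ _).pow_pow _ _).op

section Sat

variable {T : Type*} [Ring T] [Algebra ℂ T] {f : Gen ℓ → T}

theorem Sat.Kinv_E (hf : Sat q f) (i j : Idx ℓ) :
    f (.Kinv i) * f (.E j) = qpow q (-wt i j) • (f (.E j) * f (.Kinv i)) := by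
  have h : f (.E j) * f (.K i) = qpow q (-wt i j) • (f (.K i) * f (.E j)) := by
    rw [hf.K_E, smul_smul, ← qpow_add]; simp [qpow_zero]
  calc f (.Kinv i) * f (.E j) = f (.Kinv i) * (f (.E j) * f (.K i)) * f (.Kinv i) := by
        rw [mul_assoc, mul_assoc, hf.K_mul_Kinv, mul_one]
    _ = _ := by
        rw [h, mul_smul_comm, smul_mul_assoc, ← mul_assoc (f (.Kinv i)), hf.Kinv_mul_K, one_mul]

theorem Sat.Kinv_F (hf : Sat q f) (i j : Idx ℓ) :
    f (.Kinv i) * f (.F j) = qpow q (wt i j) • (f (.F j) * f (.Kinv i)) := by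
  have h : f (.F j) * f (.K i) = qpow q (wt i j) • (f (.K i) * f (.F j)) := by
    rw [hf.K_F, smul_smul, ← qpow_add]; simp [qpow_zero]
  calc f (.Kinv i) * f (.F j) = f (.Kinv i) * (f (.F j) * f (.K i)) * f (.Kinv i) := by
        rw [mul_assoc, mul_assoc, hf.K_mul_Kinv, mul_one]
    _ = _ := by
        rw [h, mul_smul_comm, smul_mul_assoc, ← mul_assoc (f (.Kinv i)), hf.Kinv_mul_K, one_mul]

theorem Sat.kapinv_E (hf : Sat q f) (j : Idx ℓ) :
    f .kapinv * f (.E j) = qpow q (-wtk j) • (f (.E j) * f .kapinv) := by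
  have h : f (.E j) * f .kap = qpow q (-wtk j) • (f .kap * f (.E j)) := by
    rw [hf.kap_E, smul_smul, ← qpow_add]; simp [qpow_zero]
  calc f .kapinv * f (.E j) = f .kapinv * (f (.E j) * f .kap) * f .kapinv := by
        rw [mul_assoc, mul_assoc, hf.kap_mul_kapinv, mul_one]
    _ = _ := by
        rw [h, mul_smul_comm, smul_mul_assoc, ← mul_assoc (f .kapinv), hf.kapinv_mul_kap, one_mul]

theorem Sat.kapinv_F (hf : Sat q f) (j : Idx ℓ) :
    f .kapinv * f (.F j) = qpow q (wtk j) • (f (.F j) * f .kapinv) := by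
  have h : f (.F j) * f .kap = qpow q (wtk j) • (f .kap * f (.F j)) := by
    rw [hf.kap_F, smul_smul, ← qpow_add]; simp [qpow_zero]
  calc f .kapinv * f (.F j) = f .kapinv * (f (.F j) * f .kap) * f .kapinv := by
        rw [mul_assoc, mul_assoc, hf.kap_mul_kapinv, mul_one]
    _ = _ := by
        rw [h, mul_smul_comm, smul_mul_assoc, ← mul_assoc (f .kapinv), hf.kapinv_mul_kap, one_mul]

theorem Sat.isUnitK (hf : Sat q f) (i : Idx ℓ) :
    ∃ u : Tˣ, (u : T) = f (.K i) ∧ ((u⁻¹ : Tˣ) : T) = f (.Kinv i) :=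
  ⟨⟨f (.K i), f (.Kinv i), hf.K_mul_Kinv i, hf.Kinv_mul_K i⟩, rfl, rfl⟩

theorem Sat.isUnitkap (hf : Sat q f) :
    ∃ u : Tˣ, (u : T) = f .kap ∧ ((u⁻¹ : Tˣ) : T) = f .kapinv :=
  ⟨⟨f .kap, f .kapinv, hf.kap_mul_kapinv, hf.kapinv_mul_kap⟩, rfl, rfl⟩

theorem Sat.commKK (hf : Sat q f) (i j : Idx ℓ) : Commute (f (.K i)) (f (.K j)) := hf.K_comm i j

theorem Sat.commKinvK (hf : Sat q f) (i j : Idx ℓ) : Commute (f (.Kinv i)) (f (.K j)) := by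
  obtain ⟨u, hu, hu'⟩ := hf.isUnitK i
  have := hf.commKK i j
  rw [← hu] at this; rw [← hu']
  exact this.units_inv_left

theorem Sat.commKinvKinv (hf : Sat q f) (i j : Idx ℓ) : Commute (f (.Kinv i)) (f (.Kinv j)) := by
  obtain ⟨u, hu, hu'⟩ := hf.isUnitK j
  have := hf.commKinvK i j
  rw [← hu] at this; rw [← hu']
  exact this.units_inv_right

theorem Sat.commkapinvKinv (hf : Sat q f) (i : Idx ℓ) :
    Commute (f .kapinv) (f (.Kinv i)) := by
  obtain ⟨u, hu, hu'⟩ := hf.isUnitK i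
  obtain ⟨v, hv, hv'⟩ := hf.isUnitkap
  have : Commute (f .kap) (f (.K i)) := hf.kap_K i
  rw [← hu, ← hv] at this; rw [← hu', ← hv']
  exact this.units_inv_left.units_inv_right

theorem Sat.root_inv (hf : Sat q f) :
    f .kapinv ^ (ℓ * (ℓ + 1) / 2) = rootProd ℓ fun i => f (.Kinv i) := by
  choose u hu hu' using hf.isUnitK
  obtain ⟨v, hv, hv'⟩ := hf.isUnitkap
  have hc : ∀ i j, Commute (u i)⁻¹ (u j)⁻¹ := fun i j => by
    have := hf.commKinvKinv i j
    rw [← hu', ← hu'] at this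
    exact Units.ext this
  have h0 : (v ^ (ℓ * (ℓ + 1) / 2) : Tˣ) = rootProd ℓ u := by
    apply Units.ext
    have := hf.root
    rw [← hv] at this
    simp only [← hu] at this
    rw [Units.val_pow_eq_pow_val, this]
    exact (map_rootProd (Units.coeHom T) u).symm
  have h1 : rootProd ℓ (fun i => (u i)⁻¹) = (rootProd ℓ u)⁻¹ := by
    have e := map_rootProd (MulEquiv.inv' Tˣ) u
    have h2 := rootProd_op (fun i => (u i)⁻¹) hc
    exact MulOpposite.op_injective (h2.symm.trans e.symm)
  have h3 : (v⁻¹ ^ (ℓ * (ℓ + 1) / 2) : Tˣ) = rootProd ℓ (fun i => (u i)⁻¹) := by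
    rw [h1, ← h0, inv_pow]
  have h4 := congrArg (Units.coeHom T) h3
  rw [map_rootProd, map_pow] at h4
  simpa [hu', hv'] using h4

end Sat

theorem serre_sum {T : Type*} [Ring T] [Algebra ℂ T] (a b a' b' : T) (c : ℂ) (hc : c ≠ 0)
    (h1 : b * a = (c⁻¹ * c⁻¹) • (a * b)) (h2 : b * a' = c • (a' * b)) (h3 : b' * a = c • (a * b'))
    (ha : a * a * a' + a' * a * a = (c + c⁻¹) • (a * a' * a))
    (hb : b * b * b' + b' * b * b = (c + c⁻¹) • (b * b' * b)) :
    (a + b) * (a + b) * (a' + b') + (a' + b') * (a + b) * (a + b) =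
      (c + c⁻¹) • ((a + b) * (a' + b') * (a + b)) := by
  have e1 : b * b * a' = (c * c) • (a' * b * b) := by
    rw [mul_assoc, h2, mul_smul_comm, ← mul_assoc, h2, smul_mul_assoc, smul_smul]
  have e2 : b * a' * b = c • (a' * b * b) := by rw [h2, smul_mul_assoc]
  have e3 : a * b * a' = c • (a * a' * b) := by
    rw [mul_assoc, h2, mul_smul_comm, mul_assoc]
  have e4 : b * a * a' = c⁻¹ • (a * a' * b) := by
    rw [h1, smul_mul_assoc, e3, smul_smul]; congr 1; field_simp
  have e6 : a' * b * a = (c⁻¹ * c⁻¹) • (a' * a * b) := by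
    rw [mul_assoc, h1, mul_smul_comm, mul_assoc]
  have e5 : b * a' * a = c⁻¹ • (a' * a * b) := by
    rw [h2, smul_mul_assoc, e6, smul_smul]; congr 1; field_simp
  have f1 : b * a * b' = (c⁻¹ * c⁻¹) • (a * b * b') := by rw [h1, smul_mul_assoc]
  have f2 : a * b' * a = c • (a * a * b') := by
    rw [mul_assoc, h3, mul_smul_comm, mul_assoc]
  have f3 : b * b' * a = c⁻¹ • (a * b * b') := by
    rw [mul_assoc, h3, mul_smul_comm, ← mul_assoc, f1, smul_smul]; congr 1; field_simp
  have f4 : b' * a * a = (c * c) • (a * a * b') := by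
    rw [h3, smul_mul_assoc, f2, smul_smul]
  have f5 : b' * a * b = c • (a * b' * b) := by rw [h3, smul_mul_assoc]
  have f6 : b' * b * a = c⁻¹ • (a * b' * b) := by
    rw [mul_assoc, h1, mul_smul_comm, ← mul_assoc, f5, smul_smul]; congr 1; field_simp
  have hL : (a + b) * (a + b) * (a' + b') + (a' + b') * (a + b) * (a + b) =
      (a * a * a' + a' * a * a) + (b * b * b' + b' * b * b)
      + (a * b * a' + b * a * a' + a' * a * b + a' * b * a)
      + (b * b * a' + a' * b * b)
      + (a * a * b' + b' * a * a)
      + (a * b * b' + b * a * b' + b' * a * b + b' * b * a) := by noncomm_ring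
  have hR : (a + b) * (a' + b') * (a + b) =
      a * a' * a + b * b' * b + (a * a' * b + b * a' * a) + b * a' * b + a * b' * a
      + (a * b' * b + b * b' * a) := by noncomm_ring
  rw [hL, hR, ha, hb, e1, e2, e3, e4, e5, e6, f1, f2, f3, f4, f5, f6]
  match_scalars <;> field_simp <;> ring

/-- The coproduct on generators. -/
def comulGen (q : Set.Ioo (0 : ℝ) 1) : Gen ℓ → U ℓ q ⊗[ℂ] U ℓ q
  | .K i => gen q (.K i) ⊗ₜ gen q (.K i)
  | .Kinv i => gen q (.Kinv i) ⊗ₜ gen q (.Kinv i)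
  | .E i => gen q (.E i) ⊗ₜ gen q (.K i) + gen q (.Kinv i) ⊗ₜ gen q (.E i)
  | .F i => gen q (.F i) ⊗ₜ gen q (.K i) + gen q (.Kinv i) ⊗ₜ gen q (.F i)
  | .kap => gen q .kap ⊗ₜ gen q .kap
  | .kapinv => gen q .kapinv ⊗ₜ gen q .kapinv

theorem wt_near {i j : Idx ℓ} (h : Near i j) : wt i j = -1 / 2 := by
  unfold wt
  rw [if_neg (by rintro rfl; exact not_near_self _ h), if_pos h]

theorem E_K (i j : Idx ℓ) : gen q (.E j) * gen q (.K i) =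
    qpow q (-wt i j) • (gen q (.K i) * gen q (.E j)) := by
  rw [sat_gen.K_E, smul_smul, ← qpow_add]; simp [qpow_zero]

theorem F_K (i j : Idx ℓ) : gen q (.F j) * gen q (.K i) =
    qpow q (wt i j) • (gen q (.K i) * gen q (.F j)) := by
  rw [sat_gen.K_F, smul_smul, ← qpow_add]; simp [qpow_zero]

open Algebra.TensorProduct in
theorem comul_swap_E (i j : Idx ℓ) :
    (gen q (.Kinv i) ⊗ₜ[ℂ] gen q (.E i)) * (gen q (.E j) ⊗ₜ gen q (.K j)) =
      qpow q (-2 * wt i j) • ((gen q (.E j) ⊗ₜ gen q (.K j)) *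
        (gen q (.Kinv i) ⊗ₜ[ℂ] gen q (.E i))) := by
  rw [tmul_mul_tmul, tmul_mul_tmul, sat_gen.Kinv_E, E_K, TensorProduct.smul_tmul_smul,
    wt_comm j i, ← qpow_add]
  congr 2; ring

open Algebra.TensorProduct in
theorem comul_swap_F (i j : Idx ℓ) :
    (gen q (.Kinv i) ⊗ₜ[ℂ] gen q (.F i)) * (gen q (.F j) ⊗ₜ gen q (.K j)) =
      qpow q (2 * wt i j) • ((gen q (.F j) ⊗ₜ gen q (.K j)) *
        (gen q (.Kinv i) ⊗ₜ[ℂ] gen q (.F i))) := by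
  rw [tmul_mul_tmul, tmul_mul_tmul, sat_gen.Kinv_F, F_K, TensorProduct.smul_tmul_smul,
    wt_comm j i, ← qpow_add]
  congr 2; ring

theorem wt_not_near {i j : Idx ℓ} (hij : i ≠ j) (h : ¬ Near i j) : wt i j = 0 := by
  unfold wt; rw [if_neg hij, if_neg h]

theorem wt_self (i : Idx ℓ) : wt i i = 1 := by simp [wt]

open Algebra.TensorProduct in
theorem sat_comul : Sat q (comulGen (ℓ := ℓ) q) := by
  have g := sat_gen (ℓ := ℓ) (q := q)
  have qi : (qpow q 1)⁻¹ = qpow q (-1) := (qpow_neg q 1).symm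
  constructor
  · intro i; simp [comulGen, g.K_mul_Kinv, one_def]
  · intro i; simp [comulGen, g.Kinv_mul_K, one_def]
  · simp [comulGen, g.kap_mul_kapinv, one_def]
  · simp [comulGen, g.kapinv_mul_kap, one_def]
  · intro i j; simp only [comulGen, tmul_mul_tmul]; rw [g.K_comm i j]
  · intro i; simp only [comulGen, tmul_mul_tmul]; rw [g.kap_K i]
  · intro i j
    simp only [comulGen, mul_add, add_mul, tmul_mul_tmul, g.K_E, g.K_comm i j, smul_add,
      (g.commKinvK j i).eq, TensorProduct.smul_tmul', TensorProduct.tmul_smul]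
  · intro i j
    simp only [comulGen, mul_add, add_mul, tmul_mul_tmul, g.K_F, g.K_comm i j, smul_add,
      (g.commKinvK j i).eq, TensorProduct.smul_tmul', TensorProduct.tmul_smul]
  · intro i
    have h : gen q .kap * gen q (.Kinv i) = gen q (.Kinv i) * gen q .kap := by
      obtain ⟨u, hu, hu'⟩ := g.isUnitK i
      have : Commute (gen q .kap) (gen q (.K i)) := g.kap_K i
      rw [← hu] at this; rw [← hu']
      exact this.units_inv_right
    simp only [comulGen, mul_add, add_mul, tmul_mul_tmul, g.kap_E, g.kap_K, h, smul_add,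
      TensorProduct.smul_tmul', TensorProduct.tmul_smul]
  · intro i
    have h : gen q .kap * gen q (.Kinv i) = gen q (.Kinv i) * gen q .kap := by
      obtain ⟨u, hu, hu'⟩ := g.isUnitK i
      have : Commute (gen q .kap) (gen q (.K i)) := g.kap_K i
      rw [← hu] at this; rw [← hu']
      exact this.units_inv_right
    simp only [comulGen, mul_add, add_mul, tmul_mul_tmul, g.kap_F, g.kap_K, h, smul_add,
      TensorProduct.smul_tmul', TensorProduct.tmul_smul]
  · intro i
    have hs : qpow q (-wt i i) * qpow q (wt i i) = 1 := by
      rw [← qpow_add]; simp [qpow_zero]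
    have hs' : qpow q (wt i i) * qpow q (-wt i i) = 1 := by
      rw [← qpow_add]; simp [qpow_zero]
    have c1 : (gen q (.Kinv i) * gen q (.E i)) ⊗ₜ[ℂ] (gen q (.F i) * gen q (.K i)) =
        (gen q (.E i) * gen q (.Kinv i)) ⊗ₜ[ℂ] (gen q (.K i) * gen q (.F i)) := by
      rw [g.Kinv_E, F_K, TensorProduct.smul_tmul_smul, hs, one_smul]
    have c2 : (gen q (.Kinv i) * gen q (.F i)) ⊗ₜ[ℂ] (gen q (.E i) * gen q (.K i)) =
        (gen q (.F i) * gen q (.Kinv i)) ⊗ₜ[ℂ] (gen q (.K i) * gen q (.E i)) := by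
      rw [g.Kinv_F, E_K, TensorProduct.smul_tmul_smul, hs', one_smul]
    have hEF : gen q (.E i) * gen q (.F i) = gen q (.F i) * gen q (.E i) +
        (qpow q 1 - qpow q (-1))⁻¹ • (gen q (.K i) ^ 2 - gen q (.Kinv i) ^ 2) := by
      rw [← g.E_F i]; abel
    simp only [comulGen, mul_add, add_mul, tmul_mul_tmul, c1, c2, hEF, tmul_pow,
      TensorProduct.add_tmul, TensorProduct.tmul_add, TensorProduct.tmul_smul,
      ← TensorProduct.smul_tmul', TensorProduct.sub_tmul, TensorProduct.tmul_sub, ← pow_two]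
    module
  · intro i j hij
    have hs : qpow q (-wt j i) * qpow q (wt i j) = 1 := by
      rw [← qpow_add, wt_comm]; simp [qpow_zero]
    have hs' : qpow q (wt i j) * qpow q (-wt j i) = 1 := by
      rw [← qpow_add, wt_comm]; simp [qpow_zero]
    have c1 : (gen q (.Kinv j) * gen q (.E i)) ⊗ₜ[ℂ] (gen q (.F j) * gen q (.K i)) =
        (gen q (.E i) * gen q (.Kinv j)) ⊗ₜ[ℂ] (gen q (.K i) * gen q (.F j)) := by
      rw [g.Kinv_E, F_K, TensorProduct.smul_tmul_smul, hs, one_smul]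
    have c2 : (gen q (.Kinv i) * gen q (.F j)) ⊗ₜ[ℂ] (gen q (.E i) * gen q (.K j)) =
        (gen q (.F j) * gen q (.Kinv i)) ⊗ₜ[ℂ] (gen q (.K j) * gen q (.E i)) := by
      rw [g.Kinv_F, E_K, TensorProduct.smul_tmul_smul, hs', one_smul]
    simp only [comulGen, mul_add, add_mul, tmul_mul_tmul, c1, c2, g.E_F_ne i j hij,
      g.K_comm i j, (g.commKinvKinv i j).eq]
    abel
  · intro i j h
    rw [← qi]
    refine serre_sum _ _ _ _ _ (qpow_ne q 1) ?_ ?_ ?_ ?_ ?_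
    · rw [comul_swap_E, wt_self, ← qpow_neg, ← qpow_add]; congr 2; norm_num
    · rw [comul_swap_E, wt_near h]; congr 2; norm_num
    · rw [comul_swap_E, wt_near (near_symm.1 h)]; congr 2; norm_num
    · simp only [tmul_mul_tmul]
      rw [g.K_comm j i, mul_assoc (gen q (.K i)) (gen q (.K j)), g.K_comm j i, ← mul_assoc,
        ← TensorProduct.add_tmul, g.serre_E i j h, qi, TensorProduct.smul_tmul']
    · simp only [tmul_mul_tmul]
      rw [(g.commKinvKinv j i).eq, mul_assoc (gen q (.Kinv i)) (gen q (.Kinv j)),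
        (g.commKinvKinv j i).eq, ← mul_assoc,
        ← TensorProduct.tmul_add, g.serre_E i j h, qi, TensorProduct.tmul_smul]
  · intro i j h
    have qi' : qpow q 1 = (qpow q (-1))⁻¹ := by rw [qpow_neg, inv_inv]
    rw [add_comm (qpow q 1), qi']
    refine serre_sum _ _ _ _ _ (qpow_ne q (-1)) ?_ ?_ ?_ ?_ ?_
    · rw [comul_swap_F, wt_self, ← qi', ← qpow_add]; congr 2; norm_num
    · rw [comul_swap_F, wt_near h]; congr 2; norm_num
    · rw [comul_swap_F, wt_near (near_symm.1 h)]; congr 2; norm_num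
    · simp only [tmul_mul_tmul]
      rw [g.K_comm j i, mul_assoc (gen q (.K i)) (gen q (.K j)), g.K_comm j i, ← mul_assoc,
        ← TensorProduct.add_tmul, g.serre_F i j h, ← qi', add_comm, TensorProduct.smul_tmul']
    · simp only [tmul_mul_tmul]
      rw [(g.commKinvKinv j i).eq, mul_assoc (gen q (.Kinv i)) (gen q (.Kinv j)),
        (g.commKinvKinv j i).eq, ← mul_assoc,
        ← TensorProduct.tmul_add, g.serre_F i j h, ← qi', add_comm, TensorProduct.tmul_smul]
  · intro i j h
    by_cases hij : i = j
    · rw [hij]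
    have c1 := comul_swap_E (q := q) i j
    have c2 := comul_swap_E (q := q) j i
    rw [wt_not_near hij h] at c1
    rw [wt_comm, wt_not_near hij h] at c2
    simp only [mul_zero, qpow_zero, one_smul] at c1 c2
    simp only [comulGen, mul_add, add_mul, c1, c2]
    simp only [tmul_mul_tmul, g.comm_E i j h, g.K_comm i j, (g.commKinvKinv i j).eq]
    abel
  · intro i j h
    by_cases hij : i = j
    · rw [hij]
    have c1 := comul_swap_F (q := q) i j
    have c2 := comul_swap_F (q := q) j i
    rw [wt_not_near hij h] at c1
    rw [wt_comm, wt_not_near hij h] at c2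
    simp only [mul_zero, qpow_zero, one_smul] at c1 c2
    simp only [comulGen, mul_add, add_mul, c1, c2]
    simp only [tmul_mul_tmul, g.comm_F i j h, g.K_comm i j, (g.commKinvKinv i j).eq]
    abel
  · let d : U ℓ q →* U ℓ q ⊗[ℂ] U ℓ q :=
      { toFun := fun x => x ⊗ₜ x, map_one' := rfl, map_mul' := by intro x y; simp }
    have := congrArg d g.root
    rw [map_rootProd, map_pow] at this
    exact this

/-- The coproduct. -/
def comulHom : U ℓ q →ₐ[ℂ] U ℓ q ⊗[ℂ] U ℓ q := lift _ sat_comul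

instance : Bialgebra ℂ (U ℓ q) :=
  Bialgebra.ofAlgHom comulHom counitHom
    (by
      refine U_hom_ext fun x => ?_
      cases x <;>
      simp [comulHom, lift_gen, comulGen, TensorProduct.add_tmul, TensorProduct.tmul_add, add_assoc])
    (by
      refine U_hom_ext fun x => ?_
      cases x <;>
      simp [comulHom, counitHom, lift_gen, comulGen, counitGen])
    (by
      refine U_hom_ext fun x => ?_
      cases x <;>
      simp [comulHom, counitHom, lift_gen, comulGen, counitGen])

theorem E_Kinv (i j : Idx ℓ) : gen q (.E j) * gen q (.Kinv i) =
    qpow q (wt i j) • (gen q (.Kinv i) * gen q (.E j)) := by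
  rw [sat_gen.Kinv_E, smul_smul, ← qpow_add]; simp [qpow_zero]

theorem F_Kinv (i j : Idx ℓ) : gen q (.F j) * gen q (.Kinv i) =
    qpow q (-wt i j) • (gen q (.Kinv i) * gen q (.F j)) := by
  rw [sat_gen.Kinv_F, smul_smul, ← qpow_add]; simp [qpow_zero]

theorem E_kapinv (j : Idx ℓ) : gen q (.E j) * gen q .kapinv =
    qpow q (wtk j) • (gen q .kapinv * gen q (.E j)) := by
  rw [sat_gen.kapinv_E, smul_smul, ← qpow_add]; simp [qpow_zero]

theorem F_kapinv (j : Idx ℓ) : gen q (.F j) * gen q .kapinv =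
    qpow q (-wtk j) • (gen q .kapinv * gen q (.F j)) := by
  rw [sat_gen.kapinv_F, smul_smul, ← qpow_add]; simp [qpow_zero]

theorem E_kap (j : Idx ℓ) : gen q (.E j) * gen q .kap =
    qpow q (-wtk j) • (gen q .kap * gen q (.E j)) := by
  rw [sat_gen.kap_E, smul_smul, ← qpow_add]; simp [qpow_zero]

theorem F_kap (j : Idx ℓ) : gen q (.F j) * gen q .kap =
    qpow q (wtk j) • (gen q .kap * gen q (.F j)) := by
  rw [sat_gen.kap_F, smul_smul, ← qpow_add]; simp [qpow_zero]

open MulOpposite in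
/-- The antipode (`c = 1`) and its inverse (`c = -1`) on generators. -/
def antipodeGen (q : Set.Ioo (0 : ℝ) 1) (c : ℝ) : Gen ℓ → (U ℓ q)ᵐᵒᵖ
  | .K i => op (gen q (.Kinv i))
  | .Kinv i => op (gen q (.K i))
  | .E i => op (-qpow q c • gen q (.E i))
  | .F i => op (-qpow q (-c) • gen q (.F i))
  | .kap => op (gen q .kapinv)
  | .kapinv => op (gen q .kap)

open MulOpposite in
theorem sat_antipode (c : ℝ) : Sat q (antipodeGen (ℓ := ℓ) q c) := by
  have g := sat_gen (ℓ := ℓ) (q := q)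
  have hc : qpow q (-c) * qpow q c = 1 := by rw [← qpow_add]; simp [qpow_zero]
  have hc' : qpow q c * qpow q (-c) = 1 := by rw [← qpow_add]; simp [qpow_zero]
  constructor
  · intro i; simp [antipodeGen, ← op_mul, g.K_mul_Kinv]
  · intro i; simp [antipodeGen, ← op_mul, g.Kinv_mul_K]
  · simp [antipodeGen, ← op_mul, g.kap_mul_kapinv]
  · simp [antipodeGen, ← op_mul, g.kapinv_mul_kap]
  · intro i j; simp only [antipodeGen, ← op_mul]; rw [(g.commKinvKinv j i).eq]
  · intro i; simp only [antipodeGen, ← op_mul]; rw [(g.commkapinvKinv i).eq]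
  · intro i j
    simp only [antipodeGen, ← op_mul, ← op_smul, smul_mul_assoc, mul_smul_comm, E_Kinv]
    rw [smul_comm]
  · intro i j
    simp only [antipodeGen, ← op_mul, ← op_smul, smul_mul_assoc, mul_smul_comm, F_Kinv]
    rw [smul_comm]
  · intro i
    simp only [antipodeGen, ← op_mul, ← op_smul, smul_mul_assoc, mul_smul_comm, E_kapinv]
    rw [smul_comm]
  · intro i
    simp only [antipodeGen, ← op_mul, ← op_smul, smul_mul_assoc, mul_smul_comm, F_kapinv]
    rw [smul_comm]
  · intro i
    simp only [antipodeGen, ← op_mul, ← op_smul, ← op_sub, ← op_pow, smul_mul_assoc,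
      mul_smul_comm, smul_smul, neg_mul_neg, hc, hc', one_smul]
    rw [← neg_sub, g.E_F, ← smul_neg, neg_sub]
  · intro i j h
    simp only [antipodeGen, ← op_mul, smul_mul_assoc,
      mul_smul_comm, smul_smul, neg_mul_neg, hc, hc', one_smul]
    rw [g.E_F_ne i j h]
  · intro i j h
    simp only [antipodeGen, ← op_mul, ← op_smul, ← op_add, smul_mul_assoc, mul_smul_comm,
      ← smul_add, ← mul_assoc]
    rw [add_comm, g.serre_E i j h]
    congr 1; module
  · intro i j h
    simp only [antipodeGen, ← op_mul, ← op_smul, ← op_add, smul_mul_assoc, mul_smul_comm,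
      ← smul_add, ← mul_assoc]
    rw [add_comm, g.serre_F i j h]
    congr 1; module
  · intro i j h
    simp only [antipodeGen, ← op_mul, smul_mul_assoc, mul_smul_comm]
    rw [g.comm_E i j h]
  · intro i j h
    simp only [antipodeGen, ← op_mul, smul_mul_assoc, mul_smul_comm]
    rw [g.comm_F i j h]
  · simp only [antipodeGen]
    rw [rootProd_op _ g.commKinvKinv, ← op_pow, g.root_inv]

/-- The antipode, as a homomorphism to the opposite algebra. -/
def antipodeHom : U ℓ q →ₐ[ℂ] (U ℓ q)ᵐᵒᵖ := lift _ (sat_antipode 1)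

/-- The inverse of the antipode, as a homomorphism to the opposite algebra. -/
def antipodeInvHom : U ℓ q →ₐ[ℂ] (U ℓ q)ᵐᵒᵖ := lift _ (sat_antipode (-1))

/-- The antipode. -/
def S (x : U ℓ q) : U ℓ q := (antipodeHom x).unop

/-- The inverse of the antipode. -/
def Sinv (x : U ℓ q) : U ℓ q := (antipodeInvHom x).unop

theorem S_mul (x y : U ℓ q) : S (x * y) = S y * S x := by simp [S]

theorem Sinv_mul (x y : U ℓ q) : Sinv (x * y) = Sinv y * Sinv x := by simp [Sinv]

theorem Sinv_S (x : U ℓ q) : Sinv (S x) = x := by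
  have hc : qpow q (-1) * qpow q 1 = 1 := by rw [← qpow_add]; simp [qpow_zero]
  have hc' : qpow q 1 * qpow q (-1) = 1 := by rw [← qpow_add]; simp [qpow_zero]
  induction x using U_induction with
  | halg c => simp [S, Sinv]
  | hgen x =>
    cases x <;> simp [S, Sinv, antipodeHom, antipodeInvHom, lift_gen, antipodeGen, smul_smul, hc, hc']
  | hmul a b ha hb => rw [S_mul, Sinv_mul, ha, hb]
  | hadd a b ha hb => simp only [S, Sinv, map_add, MulOpposite.unop_add] at *; rw [ha, hb]

theorem S_Sinv (x : U ℓ q) : S (Sinv x) = x := by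
  have hc : qpow q (-1) * qpow q 1 = 1 := by rw [← qpow_add]; simp [qpow_zero]
  have hc' : qpow q 1 * qpow q (-1) = 1 := by rw [← qpow_add]; simp [qpow_zero]
  induction x using U_induction with
  | halg c => simp [S, Sinv]
  | hgen x =>
    cases x <;> simp [S, Sinv, antipodeHom, antipodeInvHom, lift_gen, antipodeGen, smul_smul, hc, hc']
  | hmul a b ha hb => rw [Sinv_mul, S_mul, ha, hb]
  | hadd a b ha hb => simp only [S, Sinv, map_add, MulOpposite.unop_add] at *; rw [ha, hb]

/-- An algebra with the conjugate complex structure. -/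
def Cj (T : Type*) : Type _ := T

instance (T : Type*) [Ring T] : Ring (Cj T) := inferInstanceAs (Ring T)

instance (T : Type*) [Ring T] [Algebra ℂ T] : Algebra ℂ (Cj T) :=
  ((algebraMap ℂ T).comp (starRingEnd ℂ)).toAlgebra' fun c x =>
    Algebra.commutes (R := ℂ) (A := T) (starRingEnd ℂ c) x

/-- The identity map to the conjugate algebra. -/
def toCj {T : Type*} [Ring T] : T ≃+* Cj T := RingEquiv.refl T

theorem toCj_smul {T : Type*} [Ring T] [Algebra ℂ T] (c : ℂ) (x : T) :
    toCj (c • x) = starRingEnd ℂ c • toCj x := by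
  have h : ∀ (d : ℂ) (y : Cj T), d • y = toCj (algebraMap ℂ T (starRingEnd ℂ d)) * y :=
    fun d y => rfl
  rw [h, Complex.conj_conj, ← map_mul, Algebra.smul_def]

theorem toCj_algebraMap {T : Type*} [Ring T] [Algebra ℂ T] (c : ℂ) :
    algebraMap ℂ (Cj T) c = toCj (algebraMap ℂ T (starRingEnd ℂ c)) := rfl

theorem toCj_qsmul {T : Type*} [Ring T] [Algebra ℂ T] (x : ℝ) (y : T) :
    qpow q x • toCj y = toCj (qpow q x • y) := by
  rw [toCj_smul, conj_qpow]

/-- A family of elements satisfies the relations in an algebra if it does so in its conjugate,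
since the coefficients in the relations are real. -/
theorem Sat.cj {T : Type*} [Ring T] [Algebra ℂ T] {f : Gen ℓ → T} (hf : Sat q f) :
    Sat q (fun x => toCj (f x)) := by
  have hr : starRingEnd ℂ (qpow q 1 - qpow q (-1))⁻¹ = (qpow q 1 - qpow q (-1))⁻¹ := by
    rw [map_inv₀, map_sub, conj_qpow, conj_qpow]
  have hr' : starRingEnd ℂ (qpow q 1 + qpow q (-1)) = qpow q 1 + qpow q (-1) := by
    rw [map_add, conj_qpow, conj_qpow]
  constructor
  · intro i; rw [← map_mul, hf.K_mul_Kinv, map_one]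
  · intro i; rw [← map_mul, hf.Kinv_mul_K, map_one]
  · rw [← map_mul, hf.kap_mul_kapinv, map_one]
  · rw [← map_mul, hf.kapinv_mul_kap, map_one]
  · intro i j; rw [← map_mul, hf.K_comm, map_mul]
  · intro i; rw [← map_mul, hf.kap_K, map_mul]
  · intro i j; rw [← map_mul, hf.K_E, toCj_smul, conj_qpow, map_mul]
  · intro i j; rw [← map_mul, hf.K_F, toCj_smul, conj_qpow, map_mul]
  · intro i; rw [← map_mul, hf.kap_E, toCj_smul, conj_qpow, map_mul]
  · intro i; rw [← map_mul, hf.kap_F, toCj_smul, conj_qpow, map_mul]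
  · intro i
    simp only [← map_mul, ← map_sub, ← map_pow]; rw [hf.E_F, toCj_smul, hr]
  · intro i j h; rw [← map_mul, hf.E_F_ne i j h, map_mul]
  · intro i j h
    simp only [← map_mul, ← map_add]; rw [hf.serre_E i j h, toCj_smul, hr']
  · intro i j h
    simp only [← map_mul, ← map_add]; rw [hf.serre_F i j h, toCj_smul, hr']
  · intro i j h; rw [← map_mul, hf.comm_E i j h, map_mul]
  · intro i j h; rw [← map_mul, hf.comm_F i j h, map_mul]
  · rw [← map_pow, hf.root, map_rootProd]

open MulOpposite in
/-- The involution on generators: `K` and `κ` are self-adjoint and `E_i` is adjoint to `F_i`. -/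
def starGen (q : Set.Ioo (0 : ℝ) 1) : Gen ℓ → (U ℓ q)ᵐᵒᵖ
  | .K i => op (gen q (.K i))
  | .Kinv i => op (gen q (.Kinv i))
  | .E i => op (gen q (.F i))
  | .F i => op (gen q (.E i))
  | .kap => op (gen q .kap)
  | .kapinv => op (gen q .kapinv)

open MulOpposite in
theorem sat_star : Sat q (starGen (ℓ := ℓ) q) := by
  have g := sat_gen (ℓ := ℓ) (q := q)
  constructor
  · intro i; simp [starGen, ← op_mul, g.Kinv_mul_K]
  · intro i; simp [starGen, ← op_mul, g.K_mul_Kinv]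
  · simp [starGen, ← op_mul, g.kapinv_mul_kap]
  · simp [starGen, ← op_mul, g.kap_mul_kapinv]
  · intro i j; simp only [starGen, ← op_mul]; rw [g.K_comm]
  · intro i; simp only [starGen, ← op_mul]; rw [g.kap_K]
  · intro i j; simp only [starGen, ← op_mul, ← op_smul, F_K]
  · intro i j; simp only [starGen, ← op_mul, ← op_smul, E_K]
  · intro i; simp only [starGen, ← op_mul, ← op_smul, F_kap]
  · intro i; simp only [starGen, ← op_mul, ← op_smul, E_kap]
  · intro i
    simp only [starGen, ← op_mul, ← op_smul, ← op_sub, ← op_pow]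
    rw [g.E_F]
  · intro i j h; simp only [starGen, ← op_mul]; rw [g.E_F_ne j i h.symm]
  · intro i j h
    simp only [starGen, ← op_mul, ← op_smul, ← op_add, ← mul_assoc]
    rw [add_comm, g.serre_F i j h]
  · intro i j h
    simp only [starGen, ← op_mul, ← op_smul, ← op_add, ← mul_assoc]
    rw [add_comm, g.serre_E i j h]
  · intro i j h; simp only [starGen, ← op_mul]; rw [g.comm_F i j h]
  · intro i j h; simp only [starGen, ← op_mul]; rw [g.comm_E i j h]
  · simp only [starGen]
    rw [rootProd_op _ g.commKK, ← op_pow, g.root]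

/-- The involution, as a conjugate linear homomorphism to the opposite algebra. -/
def starHom : U ℓ q →ₐ[ℂ] Cj (U ℓ q)ᵐᵒᵖ := lift _ sat_star.cj

instance : Star (U ℓ q) := ⟨fun x => (toCj.symm (starHom x)).unop⟩

theorem star_def (x : U ℓ q) : star x = (toCj.symm (starHom x)).unop := rfl

theorem star_gen (x : Gen ℓ) : star (gen q x) = (starGen q x).unop := by
  rw [star_def, starHom, lift_gen, RingEquiv.symm_apply_apply]

theorem star_algebraMap (c : ℂ) :
    star (algebraMap ℂ (U ℓ q) c) = algebraMap ℂ (U ℓ q) (starRingEnd ℂ c) := by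
  rw [star_def, AlgHom.commutes, toCj_algebraMap, RingEquiv.symm_apply_apply]; rfl

theorem star_mul_aux (x y : U ℓ q) : star (x * y) = star y * star x := by
  simp [star_def]

theorem star_add_aux (x y : U ℓ q) : star (x + y) = star x + star y := by
  simp [star_def]

instance : StarRing (U ℓ q) where
  star_involutive x := by
    induction x using U_induction with
    | halg c => simp [star_algebraMap]
    | hgen x => cases x <;> simp [star_gen, starGen]
    | hmul a b ha hb => rw [star_mul_aux, star_mul_aux, ha, hb]
    | hadd a b ha hb => rw [star_add_aux, star_add_aux, ha, hb]
  star_mul := star_mul_aux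
  star_add := star_add_aux

instance : StarModule ℂ (U ℓ q) where
  star_smul c x := by
    rw [Algebra.smul_def, star_mul, star_algebraMap, Algebra.smul_def, ← Algebra.commutes]; rfl

/-- The map `x ↦ S(x)^*`. -/
def theta : U ℓ q →+* U ℓ q where
  toFun x := star (S x)
  map_one' := by simp [S]
  map_zero' := by simp [S]
  map_mul' x y := by rw [S_mul, star_mul]
  map_add' x y := by simp [S]

theorem theta_apply (x : U ℓ q) : theta x = star (S x) := rfl

theorem theta_algebraMap (c : ℂ) :
    theta (algebraMap ℂ (U ℓ q) c) = algebraMap ℂ (U ℓ q) (starRingEnd ℂ c) := by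
  rw [theta_apply, S, AlgHom.commutes, MulOpposite.algebraMap_apply, MulOpposite.unop_op,
    star_algebraMap]

theorem theta_smul (c : ℂ) (x : U ℓ q) : theta (c • x) = starRingEnd ℂ c • theta x := by
  rw [Algebra.smul_def, map_mul, theta_algebraMap, Algebra.smul_def]

/-- `x ↦ S(x)^*` on generators. -/
def thetaGen (q : Set.Ioo (0 : ℝ) 1) : Gen ℓ → U ℓ q
  | .K i => gen q (.Kinv i)
  | .Kinv i => gen q (.K i)
  | .E i => -qpow q 1 • gen q (.F i)
  | .F i => -qpow q (-1) • gen q (.E i)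
  | .kap => gen q .kapinv
  | .kapinv => gen q .kap

theorem theta_gen (x : Gen ℓ) : theta (gen q x) = thetaGen q x := by
  cases x <;>
  simp [theta_apply, S, antipodeHom, lift_gen, antipodeGen, star_gen, starGen, thetaGen,
    conj_qpow]

theorem theta_theta (x : U ℓ q) : theta (theta x) = x := by
  have hc : qpow q (-1) * qpow q 1 = 1 := by rw [← qpow_add]; simp [qpow_zero]
  have hc' : qpow q 1 * qpow q (-1) = 1 := by rw [← qpow_add]; simp [qpow_zero]
  induction x using U_induction with
  | halg c => simp [theta_algebraMap]
  | hgen x =>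
    cases x <;> simp [theta_gen, thetaGen, theta_smul, conj_qpow, smul_smul, hc, hc']
  | hmul a b ha hb => rw [map_mul, map_mul, ha, hb]
  | hadd a b ha hb => rw [map_add, map_add, ha, hb]

/-- The conjugate linear map `x ⊗ y ↦ θ(y) ⊗ θ(x)`, where `θ(x) = S(x)^*`. -/
def theta₂ : U ℓ q ⊗[ℂ] U ℓ q →ₐ[ℂ] Cj (U ℓ q ⊗[ℂ] U ℓ q) :=
  Algebra.TensorProduct.lift
    { toRingHom := toCj.toRingHom.comp
        ((Algebra.TensorProduct.includeRight (R := ℂ) (A := U ℓ q) (B := U ℓ q)).toRingHom.comp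
          theta)
      commutes' := fun c => by
        simp [theta_algebraMap, toCj_algebraMap] }
    { toRingHom := toCj.toRingHom.comp
        ((Algebra.TensorProduct.includeLeft (R := ℂ) (S := ℂ) (A := U ℓ q)
          (B := U ℓ q)).toRingHom.comp theta)
      commutes' := fun c => by
        simp [theta_algebraMap, toCj_algebraMap, Algebra.TensorProduct.algebraMap_apply] }
    (fun x y => by
      simp [Commute, SemiconjBy, ← map_mul])

theorem theta₂_tmul (x y : U ℓ q) : theta₂ (x ⊗ₜ y) = toCj (theta y ⊗ₜ theta x) := by
  simp [theta₂, ← map_mul]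

theorem comul_gen (x : Gen ℓ) :
    Coalgebra.comul (R := ℂ) (gen q x) = comulGen q x := lift_gen _ _ x

theorem counit_gen (x : Gen ℓ) :
    Coalgebra.counit (R := ℂ) (gen q x) = counitGen x := lift_gen _ _ x

theorem comul_theta (x : U ℓ q) :
    toCj (Coalgebra.comul (R := ℂ) (theta x)) = theta₂ (Coalgebra.comul (R := ℂ) x) := by
  induction x using U_induction with
  | halg c =>
    rw [theta_algebraMap, Bialgebra.comul_algebraMap, Bialgebra.comul_algebraMap,
      AlgHom.commutes, toCj_algebraMap]
  | hgen x =>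
    rw [theta_gen, comul_gen]
    cases x with
    | K i => rw [comulGen, theta₂_tmul, theta_gen, thetaGen, comul_gen]; rfl
    | Kinv i => rw [comulGen, theta₂_tmul, theta_gen, thetaGen, comul_gen]; rfl
    | kap => rw [comulGen, theta₂_tmul, theta_gen, thetaGen, comul_gen]; rfl
    | kapinv => rw [comulGen, theta₂_tmul, theta_gen, thetaGen, comul_gen]; rfl
    | E i =>
      rw [thetaGen, map_smul, comul_gen, comulGen, map_add theta₂, theta₂_tmul,
        theta₂_tmul, ← map_add]
      refine congrArg toCj ?_
      simp only [comulGen, theta_gen, thetaGen, TensorProduct.tmul_smul,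
        ← TensorProduct.smul_tmul', smul_add]
      abel
    | F i =>
      rw [thetaGen, map_smul, comul_gen, comulGen, comulGen, map_add theta₂, theta₂_tmul,
        theta₂_tmul, ← map_add]
      refine congrArg toCj ?_
      simp only [comulGen, theta_gen, thetaGen, TensorProduct.tmul_smul,
        ← TensorProduct.smul_tmul', smul_add]
      abel
  | hmul a b ha hb => rw [map_mul, Bialgebra.comul_mul, map_mul, ha, hb, Bialgebra.comul_mul, map_mul]
  | hadd a b ha hb => rw [map_add, map_add, map_add, map_add, map_add, ha, hb]

theorem counit_theta (x : U ℓ q) :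
    Coalgebra.counit (R := ℂ) (theta x) = starRingEnd ℂ (Coalgebra.counit (R := ℂ) x) := by
  induction x using U_induction with
  | halg c => rw [theta_algebraMap, Bialgebra.counit_algebraMap, Bialgebra.counit_algebraMap]
  | hgen x =>
    rw [theta_gen, counit_gen]
    cases x <;> simp [thetaGen, counitGen, counit_gen]
  | hmul a b ha hb => rw [map_mul, Bialgebra.counit_mul, ha, hb, Bialgebra.counit_mul, map_mul]
  | hadd a b ha hb => rw [map_add, map_add, map_add, map_add, ha, hb]

/-- `i`, as an element of `{1, …, ℓ+1}`. -/
def emb (i : Idx ℓ) : Idx (ℓ + 1) :=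
  ⟨i, Finset.mem_Icc.mpr (by have := Finset.mem_Icc.mp i.2; omega)⟩

/-- `i + 1`, as an element of `{1, …, ℓ+1}`. -/
def inc (i : Idx ℓ) : Idx (ℓ + 1) :=
  ⟨(i : ℕ) + 1, Finset.mem_Icc.mpr (by have := Finset.mem_Icc.mp i.2; omega)⟩

/-- `K_i` acts on the `j`-th basis vector of the vector representation by `q ^ (wtV i j)`. -/
def wtV (i : Idx ℓ) (j : Idx (ℓ + 1)) : ℝ :=
  ((if j = inc i then 1 else 0) - (if j = emb i then 1 else 0)) / 2

/-- `κ` acts on the `j`-th basis vector of the vector representation by `q ^ (wtkV j)`. -/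
def wtkV (j : Idx (ℓ + 1)) : ℝ :=
  if (j : ℕ) = ℓ + 1 then 1 / ((ℓ : ℝ) + 1) else -1 / ((ℓ : ℝ) * ((ℓ : ℝ) + 1))

/-- The vector representation on generators. -/
def vecGen (q : Set.Ioo (0 : ℝ) 1) : Gen ℓ → Matrix (Idx (ℓ + 1)) (Idx (ℓ + 1)) ℂ
  | .K i => Matrix.diagonal fun j => qpow q (wtV i j)
  | .Kinv i => Matrix.diagonal fun j => qpow q (-wtV i j)
  | .E i => Matrix.single (inc i) (emb i) 1
  | .F i => Matrix.single (emb i) (inc i) 1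
  | .kap => Matrix.diagonal fun j => qpow q (wtkV j)
  | .kapinv => Matrix.diagonal fun j => qpow q (-wtkV j)

theorem emb_inj {i j : Idx ℓ} : emb i = emb j ↔ i = j := by
  rw [Subtype.ext_iff, Subtype.ext_iff]; rfl

theorem inc_inj {i j : Idx ℓ} : inc i = inc j ↔ i = j := by
  rw [Subtype.ext_iff, Subtype.ext_iff]; exact Nat.add_right_cancel_iff

theorem emb_ne_inc_of_not_near {i j : Idx ℓ} (h : ¬ Near i j) : emb i ≠ inc j := by
  intro e; apply h; right; simpa [emb, inc, Subtype.ext_iff] using e.symm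

theorem emb_ne_inc_self (i : Idx ℓ) : emb i ≠ inc i := by
  simp [emb, inc, Subtype.ext_iff]

theorem wtV_inc (i j : Idx ℓ) : wtV i (inc j) - wtV i (emb j) = wt i j := by
  unfold wtV wt Near
  simp only [inc_inj, emb_inj, eq_comm (a := j)]
  by_cases h1 : i = j
  · subst h1; simp [emb, inc, Subtype.ext_iff]; norm_num
  · have h1' : ¬ ((i : ℕ) = j) := fun e => h1 (Subtype.ext e)
    have h1'' : ¬ ((j : ℕ) = i) := fun e => h1' e.symm
    simp only [emb, inc, Subtype.mk.injEq, h1, h1', h1'', if_false]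
    by_cases h2 : (i : ℕ) + 1 = j
    · have : ¬ ((j : ℕ) + 1 = i) := by omega
      simp only [h2, this, Ne.symm this, if_true, if_false, true_or]; norm_num
    · by_cases h3 : (j : ℕ) + 1 = i
      · simp only [h2, h3, Ne.symm h2, if_true, if_false, or_true]; norm_num
      · simp only [h2, h3, Ne.symm h2, Ne.symm h3, if_false, or_self]; norm_num

theorem wtkV_inc (j : Idx ℓ) : wtkV (inc j) - wtkV (emb j) = wtk j := by
  have hj := Finset.mem_Icc.mp j.2
  have h0 : (ℓ : ℝ) ≠ 0 := by have : ℓ ≠ 0 := by omega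
                              exact_mod_cast this
  have h1 : (ℓ : ℝ) + 1 ≠ 0 := by positivity
  have h2 : (j : ℕ) ≠ ℓ + 1 := by omega
  unfold wtkV wtk
  simp only [emb, inc, Nat.add_right_cancel_iff, h2, if_false]
  split_ifs
  · field_simp; ring
  · simp

theorem rootProd_diagonal {κ : Type*} [Fintype κ] [DecidableEq κ] (f : Idx ℓ → κ → ℝ) :
    rootProd ℓ (fun i => Matrix.diagonal fun j => qpow q (f i j)) =
      Matrix.diagonal fun j => qpow q
        (∑ i : Fin ℓ, f ⟨(i : ℕ) + 1, Finset.mem_Icc.mpr ⟨by omega, by omega⟩⟩ j * ((i : ℕ) + 1)) := by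
  have h := map_rootProd (ℓ := ℓ) (Matrix.diagonalRingHom κ ℂ) (fun i j => qpow q (f i j))
  refine Eq.trans h.symm ?_
  rw [Matrix.diagonalRingHom_apply]
  congr 1
  funext j
  have h2 := map_rootProd (ℓ := ℓ) (Pi.evalMonoidHom (fun _ : κ => ℂ) j) (fun i j => qpow q (f i j))
  refine Eq.trans h2 ?_
  simp only [Pi.evalMonoidHom_apply, rootProd, qpow_pow]
  rw [← List.ofFn_eq_map, List.prod_ofFn]
  have : ∀ (s : Finset (Fin ℓ)) (g : Fin ℓ → ℝ), ∏ i ∈ s, qpow q (g i) = qpow q (∑ i ∈ s, g i) := by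
    intro s g
    induction s using Finset.cons_induction with
    | empty => simp [qpow_zero]
    | cons a s ha ih => rw [Finset.prod_cons, Finset.sum_cons, qpow_add, ih]
  rw [this]
  push_cast
  rfl

theorem sum_wtV (j : Idx (ℓ + 1)) :
    ∑ i : Fin ℓ, wtV ⟨(i : ℕ) + 1, Finset.mem_Icc.mpr ⟨by omega, by omega⟩⟩ j * ((i : ℕ) + 1) =
      if (j : ℕ) = ℓ + 1 then (ℓ : ℝ) / 2 else -1 / 2 := by
  have hj := Finset.mem_Icc.mp j.2
  have key : ∀ i : Fin ℓ,
      wtV ⟨(i : ℕ) + 1, Finset.mem_Icc.mpr ⟨by omega, by omega⟩⟩ j * (((i : ℕ) : ℝ) + 1) =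
      (if (i : ℕ) + 2 = j then ((i : ℕ) + 1 : ℝ) / 2 else 0) -
        (if (i : ℕ) + 1 = j then ((i : ℕ) + 1 : ℝ) / 2 else 0) := by
    intro i
    simp only [wtV, emb, inc, Subtype.ext_iff, eq_comm (a := (j : ℕ)), add_assoc, Nat.reduceAdd]
    split_ifs <;> ring
  rw [Finset.sum_congr rfl fun i _ => key i, Finset.sum_sub_distrib,
    Fin.sum_univ_eq_sum_range (fun i => if i + 2 = (j : ℕ) then ((i : ℝ) + 1) / 2 else 0),
    Fin.sum_univ_eq_sum_range (fun i => if i + 1 = (j : ℕ) then ((i : ℝ) + 1) / 2 else 0)]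
  obtain ⟨m, hm⟩ : ∃ m, (j : ℕ) = m + 1 := ⟨j - 1, by omega⟩
  rw [hm] at hj ⊢
  have h1 : ∑ i ∈ Finset.range ℓ, (if i + 2 = m + 1 then ((i : ℝ) + 1) / 2 else 0) = (m : ℝ) / 2 := by
    rcases m with _ | m
    · simp
    · simp only [Nat.reduceEqDiff, Finset.sum_ite_eq', Finset.mem_range]
      rw [if_pos (by omega)]; push_cast; ring
  have h2 : ∑ i ∈ Finset.range ℓ, (if i + 1 = m + 1 then ((i : ℝ) + 1) / 2 else 0) =
      if m < ℓ then ((m : ℝ) + 1) / 2 else 0 := by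
    simp
  rw [h1, h2]
  by_cases h : m = ℓ
  · subst h; simp
  · rw [if_pos (by omega), if_neg (by omega)]; ring

theorem sat_vec : Sat q (vecGen (ℓ := ℓ) q) := by
  have hq : qpow q 1 - qpow q (-1) ≠ 0 := by
    have h1 := q.2.1
    have h2 := q.2.2
    intro h
    rw [sub_eq_zero] at h
    simp only [qpow, Complex.ofReal_inj, Real.rpow_one, Real.rpow_neg_one] at h
    have : (1 : ℝ) < (q : ℝ)⁻¹ := (one_lt_inv₀ h1).2 h2
    linarith
  have inv1 : ∀ x, qpow q x * qpow q (-x) = 1 := fun x => by rw [← qpow_add]; simp [qpow_zero]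
  have inv2 : ∀ x, qpow q (-x) * qpow q x = 1 := fun x => by rw [← qpow_add]; simp [qpow_zero]
  have s0 : ∀ i j k l : Idx (ℓ + 1), j ≠ k →
      Matrix.single i j (1 : ℂ) * Matrix.single k l 1 = 0 := fun i j k l h => by
    rw [Matrix.single_mul_single_of_ne _ _ _ _ h]
  have diag_single : ∀ (d : Idx (ℓ + 1) → ℂ) (i j : Idx (ℓ + 1)),
      Matrix.diagonal d * Matrix.single i j (1 : ℂ) = Matrix.single i j (d i) := fun d i j => by
    ext a b
    by_cases h : i = a
    · subst h; simp [Matrix.single_apply]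
    · simp [Matrix.single_apply, h]
  have single_diag : ∀ (d : Idx (ℓ + 1) → ℂ) (i j : Idx (ℓ + 1)),
      Matrix.single i j (1 : ℂ) * Matrix.diagonal d = Matrix.single i j (d j) := fun d i j => by
    ext a b
    by_cases h : j = b
    · subst h; simp [Matrix.single_apply]
    · simp [Matrix.single_apply, h]
  constructor
  · intro i; simp [vecGen, inv1]
  · intro i; simp [vecGen, inv2]
  · simp [vecGen, inv1]
  · simp [vecGen, inv2]
  · intro i j; simp [vecGen, mul_comm]
  · intro i; simp [vecGen, mul_comm]
  · intro i j
    simp only [vecGen, diag_single, single_diag, Matrix.smul_single]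
    congr 1
    rw [smul_eq_mul, ← qpow_add, ← wtV_inc]; congr 1; ring
  · intro i j
    simp only [vecGen, diag_single, single_diag, Matrix.smul_single]
    congr 1
    rw [smul_eq_mul, ← qpow_add, ← wtV_inc]; congr 1; ring
  · intro j
    simp only [vecGen, diag_single, single_diag, Matrix.smul_single]
    congr 1
    rw [smul_eq_mul, ← qpow_add, ← wtkV_inc]; congr 1; ring
  · intro j
    simp only [vecGen, diag_single, single_diag, Matrix.smul_single]
    congr 1
    rw [smul_eq_mul, ← qpow_add, ← wtkV_inc]; congr 1; ring
  · intro i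
    have hne := emb_ne_inc_self i
    simp only [vecGen, Matrix.single_mul_single_same, Matrix.diagonal_pow, mul_one]
    ext a b
    simp only [Matrix.sub_apply, Matrix.smul_apply, Matrix.diagonal_apply, Matrix.single_apply,
      Pi.pow_apply, qpow_pow, smul_eq_mul, wtV]
    by_cases hab : a = b
    · subst hab
      by_cases h1 : a = inc i
      · subst h1
        simp only [hne, hne.symm, and_self, if_true, if_false]
        norm_num
        rw [inv_mul_cancel₀]
        simpa using hq
      · by_cases h2 : a = emb i
        · subst h2
          simp only [hne, hne.symm, and_self, if_true, if_false]
          norm_num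
          rw [← neg_sub (qpow q 1) (qpow q (-1)), mul_neg, inv_mul_cancel₀ hq]
        · simp [h1, h2, Ne.symm h1, Ne.symm h2, qpow_zero]
    · have h1 : ¬ (inc i = a ∧ inc i = b) := fun h => hab (h.1.symm.trans h.2)
      have h2 : ¬ (emb i = a ∧ emb i = b) := fun h => hab (h.1.symm.trans h.2)
      simp [hab, h1, h2]
  · intro i j h
    simp only [vecGen]
    rw [s0 _ _ _ _ (fun e => h (emb_inj.1 e)), s0 _ _ _ _ (fun e => h (inc_inj.1 e).symm)]
  · intro i j h
    have hii := s0 (inc i) (emb i) (inc i) (emb i) (emb_ne_inc_self i)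
    simp only [vecGen]
    rw [hii, mul_assoc (Matrix.single (inc j) (emb j) (1 : ℂ)), hii, zero_mul, mul_zero]
    rcases h with h | h
    · rw [s0 (inc i) (emb i) (inc j) (emb j) (by simp only [emb, inc, ne_eq, Subtype.ext_iff]; omega)]
      simp
    · rw [mul_assoc, s0 (inc j) (emb j) (inc i) (emb i)
        (by simp only [emb, inc, ne_eq, Subtype.ext_iff]; omega)]
      simp
  · intro i j h
    have hii := s0 (emb i) (inc i) (emb i) (inc i) (emb_ne_inc_self i).symm
    simp only [vecGen]
    rw [hii, mul_assoc (Matrix.single (emb j) (inc j) (1 : ℂ)), hii, zero_mul, mul_zero]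
    rcases h with h | h
    · rw [mul_assoc, s0 (emb j) (inc j) (emb i) (inc i)
        (by simp only [emb, inc, ne_eq, Subtype.ext_iff]; omega)]
      simp
    · rw [s0 (emb i) (inc i) (emb j) (inc j) (by simp only [emb, inc, ne_eq, Subtype.ext_iff]; omega)]
      simp
  · intro i j h
    simp only [vecGen]
    rw [s0 _ _ _ _ (emb_ne_inc_of_not_near h),
      s0 _ _ _ _ (emb_ne_inc_of_not_near (fun e => h (near_symm.1 e)))]
  · intro i j h
    simp only [vecGen]
    rw [s0 _ _ _ _ (emb_ne_inc_of_not_near (fun e => h (near_symm.1 e))).symm,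
      s0 _ _ _ _ (emb_ne_inc_of_not_near h).symm]
  · simp only [vecGen]
    rw [rootProd_diagonal, Matrix.diagonal_pow]
    congr 1
    funext j
    rw [Pi.pow_apply, qpow_pow, sum_wtV, wtkV]
    congr 1
    have h2 : ((ℓ * (ℓ + 1) / 2 : ℕ) : ℝ) = (ℓ : ℝ) * (ℓ + 1) / 2 := by
      rw [Nat.cast_div (Nat.even_mul_succ_self ℓ).two_dvd (by norm_num)]; push_cast; ring
    rw [h2]
    have h1 : (ℓ : ℝ) + 1 ≠ 0 := by positivity
    split_ifs with h
    · field_simp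
    · have hj := Finset.mem_Icc.mp j.2
      have h0 : (ℓ : ℝ) ≠ 0 := by have : ℓ ≠ 0 := by omega
                                  exact_mod_cast this
      field_simp

/-- The vector representation of dimension `ℓ + 1`. -/
def vecRep : U ℓ q →ₐ[ℂ] Matrix (Idx (ℓ + 1)) (Idx (ℓ + 1)) ℂ := lift _ sat_vec

/-- The linear dual of `U`, with the convolution product. -/
abbrev Dual (ℓ : ℕ) (q : Set.Ioo (0 : ℝ) 1) : Type := WithConv (U ℓ q →ₗ[ℂ] ℂ)

/-- The right action `(f ◁ h)(x) = f (h x)` of `U` on its dual. -/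
def ractD (f : Dual ℓ q) (h : U ℓ q) : Dual ℓ q :=
  WithConv.toConv (f.ofConv ∘ₗ LinearMap.mulLeft ℂ h)

/-- The involution `f^*(x) = conj (f (S(x)^*))` of the dual. -/
def starD (f : Dual ℓ q) : Dual ℓ q :=
  WithConv.toConv
    { toFun := fun x => starRingEnd ℂ (f.ofConv (theta x))
      map_add' := fun x y => by simp
      map_smul' := fun c x => by simp [theta_smul] }

/-- The matrix coefficients `u^i_j` of the vector representation. -/
def coef (q : Set.Ioo (0 : ℝ) 1) (i j : Idx (ℓ + 1)) : Dual ℓ q :=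
  WithConv.toConv
    { toFun := fun x => vecRep x i j
      map_add' := fun x y => by simp
      map_smul' := fun c x => by simp }

/-- The coordinate algebra `A(SU_q(ℓ+1))`: the `*`-algebra generated by the matrix coefficients
of the vector representation inside the dual of `U`. -/
def coordAlg (ℓ : ℕ) (q : Set.Ioo (0 : ℝ) 1) : Subalgebra ℂ (Dual ℓ q) :=
  Algebra.adjoin ℂ (Set.range (fun p : Idx (ℓ + 1) × Idx (ℓ + 1) => coef q p.1 p.2) ∪
    Set.range (fun p : Idx (ℓ + 1) × Idx (ℓ + 1) => starD (coef q p.1 p.2)))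

theorem coef_mem (i j : Idx (ℓ + 1)) : coef q i j ∈ coordAlg ℓ q :=
  Algebra.subset_adjoin (Or.inl ⟨(i, j), rfl⟩)

theorem starD_coef_mem (i j : Idx (ℓ + 1)) : starD (coef q i j) ∈ coordAlg ℓ q :=
  Algebra.subset_adjoin (Or.inr ⟨(i, j), rfl⟩)

theorem dual_ext {f g : Dual ℓ q} (h : ∀ x, f.ofConv x = g.ofConv x) : f = g :=
  WithConv.ext (LinearMap.ext h)

theorem ractD_apply (f : Dual ℓ q) (h x : U ℓ q) : (ractD f h).ofConv x = f.ofConv (h * x) := rfl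

theorem starD_apply (f : Dual ℓ q) (x : U ℓ q) :
    (starD f).ofConv x = starRingEnd ℂ (f.ofConv (theta x)) := rfl

theorem dual_mul_apply (f g : Dual ℓ q) (x : U ℓ q) : (f * g).ofConv x =
    LinearMap.mul' ℂ ℂ (TensorProduct.map f.ofConv g.ofConv (Coalgebra.comul (R := ℂ) x)) := rfl

theorem starD_smul (c : ℂ) (f : Dual ℓ q) : starD (c • f) = starRingEnd ℂ c • starD f :=
  dual_ext fun x => by simp [starD_apply]

theorem starD_add (f g : Dual ℓ q) : starD (f + g) = starD f + starD g :=
  dual_ext fun x => by simp [starD_apply]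

theorem starD_starD (f : Dual ℓ q) : starD (starD f) = f :=
  dual_ext fun x => by simp [starD_apply, theta_theta]

theorem starD_mul (f g : Dual ℓ q) : starD (f * g) = starD g * starD f := by
  refine dual_ext fun x => ?_
  rw [starD_apply, dual_mul_apply, dual_mul_apply]
  have h : Coalgebra.comul (R := ℂ) (theta x) =
      toCj.symm (theta₂ (Coalgebra.comul (R := ℂ) x)) := by
    rw [← comul_theta, RingEquiv.symm_apply_apply]
  rw [h]
  induction Coalgebra.comul (R := ℂ) x using TensorProduct.induction_on with
  | zero => simp
  | tmul a b => rw [theta₂_tmul, RingEquiv.symm_apply_apply]; simp [starD_apply, mul_comm]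
  | add a b ha hb => simp only [map_add, ha, hb]

theorem starD_algebraMap (c : ℂ) :
    starD (algebraMap ℂ (Dual ℓ q) c) = algebraMap ℂ (Dual ℓ q) (starRingEnd ℂ c) := by
  rw [Algebra.algebraMap_eq_smul_one, Algebra.algebraMap_eq_smul_one, starD_smul]
  congr 1
  refine dual_ext fun x => ?_
  change starRingEnd ℂ (Coalgebra.counit (R := ℂ) (theta x)) = Coalgebra.counit (R := ℂ) x
  rw [counit_theta, Complex.conj_conj]

theorem starD_mem {f : Dual ℓ q} (hf : f ∈ coordAlg ℓ q) : starD f ∈ coordAlg ℓ q := by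
  induction hf using Algebra.adjoin_induction with
  | mem f hf =>
    rcases hf with ⟨p, rfl⟩ | ⟨p, rfl⟩
    · exact starD_coef_mem _ _
    · rw [starD_starD]; exact coef_mem _ _
  | algebraMap c => rw [starD_algebraMap]; exact Subalgebra.algebraMap_mem _ _
  | add f g _ _ hf hg => rw [starD_add]; exact add_mem hf hg
  | mul f g _ _ hf hg => rw [starD_mul]; exact mul_mem hg hf

theorem ractD_coef_mem (i j : Idx (ℓ + 1)) (h : U ℓ q) : ractD (coef q i j) h ∈ coordAlg ℓ q := by
  have e : ractD (coef q i j) h = ∑ k, vecRep h i k • coef q k j := by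
    refine dual_ext fun x => ?_
    rw [ractD_apply, WithConv.ofConv_sum, LinearMap.sum_apply]
    change vecRep (h * x) i j = ∑ k, vecRep h i k * vecRep x k j
    rw [map_mul, Matrix.mul_apply]
  rw [e]
  exact sum_mem fun k _ => Subalgebra.smul_mem _ (coef_mem _ _) _

theorem ractD_starD (f : Dual ℓ q) (h : U ℓ q) : ractD (starD f) h = starD (ractD f (theta h)) :=
  dual_ext fun x => by simp [ractD_apply, starD_apply]

theorem ractD_mem {f : Dual ℓ q} (hf : f ∈ coordAlg ℓ q) (h : U ℓ q) :
    ractD f h ∈ coordAlg ℓ q := by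
  induction hf using Algebra.adjoin_induction generalizing h with
  | mem f hf =>
    rcases hf with ⟨p, rfl⟩ | ⟨p, rfl⟩
    · exact ractD_coef_mem _ _ _
    · dsimp only
      rw [ractD_starD]; exact starD_mem (ractD_coef_mem _ _ _)
  | algebraMap c =>
    have e : ractD (algebraMap ℂ (Dual ℓ q) c) h =
        Coalgebra.counit (R := ℂ) h • algebraMap ℂ (Dual ℓ q) c := by
      refine dual_ext fun x => ?_
      rw [ractD_apply]
      change c • Coalgebra.counit (R := ℂ) (h * x) =
        Coalgebra.counit (R := ℂ) h • (c • Coalgebra.counit (R := ℂ) x)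
      rw [Bialgebra.counit_mul]; simp only [smul_eq_mul]; ring
    rw [e]
    exact Subalgebra.smul_mem _ (Subalgebra.algebraMap_mem _ _) _
  | add f g _ _ hf hg => exact add_mem (hf h) (hg h)
  | mul f g _ _ hf hg =>
    have key : ∀ z : U ℓ q ⊗[ℂ] U ℓ q, (WithConv.toConv
        ((LinearMap.mul' ℂ ℂ ∘ₗ TensorProduct.map f.ofConv g.ofConv) ∘ₗ LinearMap.mulLeft ℂ z ∘ₗ
          Coalgebra.comul (R := ℂ)) : Dual ℓ q) ∈ coordAlg ℓ q := by
      intro z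
      induction z using TensorProduct.induction_on with
      | zero => convert Subalgebra.zero_mem (coordAlg ℓ q) using 1; exact dual_ext fun x => by simp
      | tmul a b =>
        convert mul_mem (hf a) (hg b) using 1
        refine dual_ext fun x => ?_
        rw [dual_mul_apply]
        change LinearMap.mul' ℂ ℂ (TensorProduct.map f.ofConv g.ofConv
          ((a ⊗ₜ b) * Coalgebra.comul (R := ℂ) x)) = _
        induction Coalgebra.comul (R := ℂ) x using TensorProduct.induction_on with
        | zero => simp
        | tmul c d => simp [ractD_apply]
        | add c d hc hd => simp only [mul_add, map_add, hc, hd]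
      | add a b ha hb =>
        convert add_mem ha hb using 1
        exact dual_ext fun x => by simp [add_mul]
    convert key (Coalgebra.comul (R := ℂ) h) using 1
    refine dual_ext fun x => ?_
    rw [ractD_apply, dual_mul_apply, Bialgebra.comul_mul]
    rfl

/-- The coordinate algebra as a type. -/
abbrev A (ℓ : ℕ) (q : Set.Ioo (0 : ℝ) 1) : Type := ↥(coordAlg ℓ q)

/-- The right action `a ◁ h = ⟨h, a₍₁₎⟩ a₍₂₎` on the coordinate algebra. -/
def ract (a : A ℓ q) (h : U ℓ q) : A ℓ q := ⟨ractD a h, ractD_mem a.2 h⟩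

/-- The involution of the coordinate algebra. -/
def starA (a : A ℓ q) : A ℓ q := ⟨starD a, starD_mem a.2⟩

/-- The left action `L_h a = a ◁ S⁻¹(h)` on the coordinate algebra. -/
def leftAct (h : U ℓ q) (a : A ℓ q) : A ℓ q := ract a (Sinv h)

/-- `K_i`. -/
def K (ℓ : ℕ) (q : Set.Ioo (0 : ℝ) 1) (i : ℕ) : U ℓ q :=
  if h : i ∈ Finset.Icc 1 ℓ then gen q (.K ⟨i, h⟩) else 1

/-- `E_i`. -/
def E (ℓ : ℕ) (q : Set.Ioo (0 : ℝ) 1) (i : ℕ) : U ℓ q :=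
  if h : i ∈ Finset.Icc 1 ℓ then gen q (.E ⟨i, h⟩) else 0

/-- `κ = K̂ ^ (1/ℓ)`. -/
def kap (ℓ : ℕ) (q : Set.Ioo (0 : ℝ) 1) : U ℓ q := gen q .kap

/-- `κ⁻¹`. -/
def kapinv (ℓ : ℕ) (q : Set.Ioo (0 : ℝ) 1) : U ℓ q := gen q .kapinv

/-- `K̂ = (K₁ K₂² ⋯ K_ℓ^ℓ) ^ (2/(ℓ+1))`. -/
def Khat (ℓ : ℕ) (q : Set.Ioo (0 : ℝ) 1) : U ℓ q := kap ℓ q ^ ℓ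

/-- `K̂⁻¹`. -/
def Khatinv (ℓ : ℕ) (q : Set.Ioo (0 : ℝ) 1) : U ℓ q := kapinv ℓ q ^ ℓ

/-- `K_a K_{a+1} ⋯ K_b`; equal to `1` if `b < a`. -/
def Kprod (ℓ : ℕ) (q : Set.Ioo (0 : ℝ) 1) (a b : ℕ) : U ℓ q :=
  ((List.range' a (b + 1 - a)).map (K ℓ q)).prod

/-- `[a, b]_q = a b - q⁻¹ b a`. -/
def qcomm (a b : U ℓ q) : U ℓ q := a * b - qpow q (-1) • (b * a)

/-- `Mrec n j = M_{j,j+n}`, where `M_{j,j} = E_j` and `M_{j,k} = [E_j, M_{j+1,k}]_q`. -/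
def Mrec (ℓ : ℕ) (q : Set.Ioo (0 : ℝ) 1) : ℕ → ℕ → U ℓ q
  | 0, j => E ℓ q j
  | n + 1, j => qcomm (E ℓ q j) (Mrec ℓ q n (j + 1))

/-- `M_{j,k}` for `j ≤ k`. -/
def M (ℓ : ℕ) (q : Set.Ioo (0 : ℝ) 1) (j k : ℕ) : U ℓ q := Mrec ℓ q (k - j) j

/-- `(K_j ⋯ K_m) (K_{k+1} ⋯ K_m) c`. For `m = ℓ` and `c = K̂⁻¹` this is `N_{j,k}`. -/
def Naux (ℓ : ℕ) (q : Set.Ioo (0 : ℝ) 1) (m : ℕ) (c : U ℓ q) (j k : ℕ) : U ℓ q :=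
  Kprod ℓ q j m * Kprod ℓ q (k + 1) m * c

/-- `N_{j,k} = (K_j ⋯ K_ℓ) (K_{k+1} ⋯ K_ℓ) K̂⁻¹`. -/
def Nel (ℓ : ℕ) (q : Set.Ioo (0 : ℝ) 1) (j k : ℕ) : U ℓ q := Naux ℓ q ℓ (Khatinv ℓ q) j k

/-- `X_i = N_{i,ℓ} M_{i,ℓ}^*`. -/
def X (ℓ : ℕ) (q : Set.Ioo (0 : ℝ) 1) (i : ℕ) : U ℓ q := Nel ℓ q i ℓ * star (M ℓ q i ℓ)

/-- The number `(q - q⁻¹) ^ (-2)`. -/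
def rho (q : Set.Ioo (0 : ℝ) 1) : ℂ := ((qpow q 1 - qpow q (-1)) ^ 2)⁻¹

/-- The Casimir of `U_q(su(m+1))`, where `c` stands for the inverse of the element `K̂` of that
algebra. -/
def casimirAux (ℓ : ℕ) (q : Set.Ioo (0 : ℝ) 1) (m : ℕ) (c : U ℓ q) : U ℓ q :=
  (∑ i ∈ Finset.Icc 1 m, (rho q * qpow q ((m : ℝ) + 2 - 2 * i)) • Naux ℓ q m c i (i - 1) ^ 2)
    + (rho q * qpow q (-(m : ℝ))) • c ^ 2
    + (∑ j ∈ Finset.Icc 1 m, ∑ k ∈ Finset.Icc j m, qpow q ((m : ℝ) + 1 - 2 * j) •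
        (star (M ℓ q j k) * Naux ℓ q m c j k ^ 2 * M ℓ q j k))
    - (rho q * qnum q ((m : ℝ) + 1)) • 1

/-- The Casimir `C_q` of `U_q(su(ℓ+1))`. -/
def Cq (ℓ : ℕ) (q : Set.Ioo (0 : ℝ) 1) : U ℓ q := casimirAux ℓ q ℓ (Khatinv ℓ q)

/-- The Casimir of the subalgebra `U_q(su(ℓ))`. The element
`(K₁ K₂² ⋯ K_{ℓ-1}^(ℓ-1)) ^ (2/ℓ)` of that algebra is `κ ^ (ℓ+1) K_ℓ⁻²`. -/
def CqSub (ℓ : ℕ) (q : Set.Ioo (0 : ℝ) 1) : U ℓ q :=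
  casimirAux ℓ q (ℓ - 1) (kapinv ℓ q ^ (ℓ + 1) * K ℓ q ℓ ^ 2)

/-- Number of pairs `(a, b) ∈ t × u` with `b < a`: the length of the shuffle of `t` and `u`. -/
def shuffleLen (t u : Finset (Idx ℓ)) : ℕ := ((t ×ˢ u).filter fun p => p.2 < p.1).card

/-- The product of the `q`-Grassmann algebra. An element is given by its components with respect
to increasing multi-indices, that is, subsets of `{1, …, ℓ}`; the degree is the cardinality. -/
def wedge (q : Set.Ioo (0 : ℝ) 1) (v w : Finset (Idx ℓ) → ℂ) (s : Finset (Idx ℓ)) : ℂ :=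
  ∑ t ∈ s.powerset, (-qpow q (-1)) ^ shuffleLen t (s \ t) * v t * w (s \ t)

/-- The matrix of left exterior multiplication `w ↦ e^i ∧ w`. -/
def extL (q : Set.Ioo (0 : ℝ) 1) (i : Idx ℓ) : Matrix (Finset (Idx ℓ)) (Finset (Idx ℓ)) ℂ :=
  fun s t => wedge q (Pi.single {i} 1) (Pi.single t 1) s

/-- Left contraction with `e^i`, the adjoint of left exterior multiplication. -/
def intL (q : Set.Ioo (0 : ℝ) 1) (i : Idx ℓ) : Matrix (Finset (Idx ℓ)) (Finset (Idx ℓ)) ℂ :=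
  (extL q i).conjTranspose

/-- The algebraic tensor product of the coordinate algebra and the `q`-Grassmann algebra. -/
abbrev Form (ℓ : ℕ) (q : Set.Ioo (0 : ℝ) 1) : Type := Finset (Idx ℓ) → A ℓ q

/-- The operator `L_h ⊗ T`. -/
def tensorOp (h : U ℓ q) (T : Matrix (Finset (Idx ℓ)) (Finset (Idx ℓ)) ℂ) (ω : Form ℓ q) :
    Form ℓ q :=
  fun s => ∑ t, T s t • leftAct h (ω t)

/-- The Dolbeault operator `∑ L_{K̂ X_i} ⊗ e^L_{e^i}`. -/
def dbar (ω : Form ℓ q) : Form ℓ q :=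
  ∑ i : Idx ℓ, tensorOp (Khat ℓ q * X ℓ q i) (extL q i) ω

/-- The operator `∑ L_{X_i^* K̂} ⊗ i^L_{e^i}`. -/
def dbarDag (ω : Form ℓ q) : Form ℓ q :=
  ∑ i : Idx ℓ, tensorOp (star (X ℓ q i) * Khat ℓ q) (intL q i) ω

/-- The integer `j # s`, where `j' = j + 1`. -/
def hash (j j' : Idx ℓ) (s : Finset (Idx ℓ)) : ℤ :=
  (if j ∈ s then 1 else 0) - (if j' ∈ s then 1 else 0)

/-- The matrix of `K_j` on the `q`-Grassmann algebra, where `j' = j + 1`. -/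
def sigK (q : Set.Ioo (0 : ℝ) 1) (j j' : Idx ℓ) :
    Matrix (Finset (Idx ℓ)) (Finset (Idx ℓ)) ℂ :=
  Matrix.diagonal fun s => qpow q ((hash j j' s : ℝ) / 2)

/-- The matrix of `E_j` on the `q`-Grassmann algebra, where `j' = j + 1`:
`(E_j w)_s = w_{s'}` if `j # s = 1`, where `s'` is `s` with `j` replaced by `j + 1`. -/
def sigE (j j' : Idx ℓ) : Matrix (Finset (Idx ℓ)) (Finset (Idx ℓ)) ℂ :=
  fun s t => if hash j j' s = 1 ∧ t = insert j' (s.erase j) then 1 else 0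

/-- The matrix of `F_j` on the `q`-Grassmann algebra, where `j' = j + 1`:
`(F_j w)_s = w_{s'}` if `j # s = -1`, where `s'` is `s` with `j + 1` replaced by `j`. -/
def sigF (j j' : Idx ℓ) : Matrix (Finset (Idx ℓ)) (Finset (Idx ℓ)) ℂ :=
  fun s t => if hash j j' s = -1 ∧ t = insert j (s.erase j') then 1 else 0

/-- The twisted antiholomorphic `k`-forms: the elements `ω` of degree `k` with
`(L_{h₍₁₎} ⊗ σ(h₍₂₎)) ω = ε(h) ω` for all `h` in the algebra generated by `K_j^{±1}`, `E_j`, `F_j`,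
`j < ℓ`, and `K̂^{±1}`. Both sides are multiplicative in `h`, so that the condition is required on
the generators; `σ(K̂)` is the scalar `q ^ (k - ℓ N / (ℓ+1))`. -/
structure IsForm (k : ℕ) (N : ℤ) (ω : Form ℓ q) : Prop where
  degree : ∀ s : Finset (Idx ℓ), s.card ≠ k → ω s = 0
  inv_K : ∀ j j' : Idx ℓ, (j : ℕ) + 1 = j' → tensorOp (gen q (.K j)) (sigK q j j') ω = ω
  inv_E : ∀ j j' : Idx ℓ, (j : ℕ) + 1 = j' →
    tensorOp (gen q (.E j)) (sigK q j j') ω + tensorOp (gen q (.Kinv j)) (sigE j j') ω = 0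
  inv_F : ∀ j j' : Idx ℓ, (j : ℕ) + 1 = j' →
    tensorOp (gen q (.F j)) (sigK q j j') ω + tensorOp (gen q (.Kinv j)) (sigF j j') ω = 0
  inv_Khat : tensorOp (Khat ℓ q)
    (qpow q ((k : ℝ) - (ℓ : ℝ) * N / ((ℓ : ℝ) + 1)) •
      (1 : Matrix (Finset (Idx ℓ)) (Finset (Idx ℓ)) ℂ)) ω = ω

/-- The Dirac operator, equal to `q ^ ((k-N)/2) ∂̄ + q ^ ((k-N-1)/2) ∂̄†` in degree `k`. -/
def dirac (N : ℤ) (ω : Form ℓ q) : Form ℓ q :=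
  dbar (fun s => qpow q (((s.card : ℝ) - N) / 2) • ω s)
    + dbarDag (fun s => qpow q (((s.card : ℝ) - N - 1) / 2) • ω s)

/-- The right action `ω ◁ h`, component by component. -/
def formAct (ω : Form ℓ q) (h : U ℓ q) : Form ℓ q := fun s => ract (ω s) h

/-- The Haar state of the coordinate algebra: the normalised functional that is invariant under
the right action. -/
structure IsHaar (φ : A ℓ q →ₗ[ℂ] ℂ) : Prop where
  map_one : φ 1 = 1
  inv : ∀ (a : A ℓ q) (h : U ℓ q), φ (ract a h) = Coalgebra.counit (R := ℂ) h * φ a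

/-- The inner product `φ (ω† η)` on forms. -/
def formInner (φ : A ℓ q →ₗ[ℂ] ℂ) (ω η : Form ℓ q) : ℂ := φ (∑ s, starA (ω s) * η s)

end QProj

end

open QProj

/-! The operators `∂̄` and `∂̄†` act through the right action of `S⁻¹(K̂ X_i)` and `S⁻¹(X_i^* K̂)`.
Since `S⁻¹` reverses products, it turns the root vectors `M_{i,ℓ}` and `M_{i,ℓ}^*` into the vectors
`Mop` and `Mopst`, in which every deformed commutator has its factors in the opposite order. The
claimed Laplacians are written with the original vectors. The heart of the proof is the comparison
of the two families, which is possible only on twisted forms.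

A form is a family of components indexed by subsets `s` of `{1, …, ℓ}`. Invariance says that `E_j`,
`F_j` with `j < ℓ` move one element of `s`, and that `P_j = K_j ⋯ K_ℓ` acts by a power of `q`
depending only on whether `j ∈ s` and on `k - N` (`IsForm.equi`, `IsForm.pHalf`). Only `K_ℓ` needs
care: the conditions determine `K_ℓ ^ (2ℓ)`, and the root is fixed because `K_ℓ` is diagonalisable
on the coordinate algebra with positive eigenvalues (`eigen_of_pow`, `ract_K_of_pow`).

Formula (2) rests on four facts. The expansion of `M_{i,ℓ}^*` in the opposite vectors has
coefficients `M_{i,m}^*` with `m < ℓ`, whose action on forms is known; hence the two versions of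
`∂̄` agree up to a power of `-q⁻¹` (`FInv.dR_eq`). The commutator of `Mop` and `Mst` is a torus
element times a root vector with last index below `ℓ`, again known on forms (`Mop_mul_Mst_self`,
`Mop_mul_Mst_of_lt`, `Mop_mul_Mst_of_gt`). The sum of the `P_i² M_{i,ℓ}^* M_{i,ℓ}` can be rewritten
with one opposite factor in each term (`sum_Mst_mul_M`). The scalars left over are geometric sums
(`laplace_scalar`). Together these give `Equi.laplace`.

Formula (3) is (2) read through a Hodge duality: `s` is replaced by its complement and the action is
twisted by the automorphism `swap`, which exchanges `E_i` with `F_i` and inverts the torus. This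
exchanges the exterior derivative and its adjoint up to powers of `-q` (`dR_twist`, `dlt_twist`), so
`Equi.laplace` for the twisted module is `Equi.dual_laplace`. For this reason everything is stated
for an arbitrary right module.

For (4), the quadratic relation `Khat_mul_X_mul`, a consequence of the Serre relations, gives `∂̄² =
0 = ∂̄†²`, and `(1 + q) D²` is then a combination of (2) and (3). Formula (1) regroups the terms of
the Casimir. For (5), the part of `C_q` in the Levi subalgebra acts on each degree by a scalar
(`Equi.levi`). For (6), `S⁻¹(C_q) = swap(C_q)`, so the same duality handles the second Casimir.
Statement (0) is the invariance of the Haar state in the form of an adjunction (`haar_ract`). -/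

noncomputable section

namespace QProj

variable {ℓ : ℕ} {q : Set.Ioo (0 : ℝ) 1}

/-! ### The number `q` -/

/-- The number `q`, as a complex number. -/
def qc (q : Set.Ioo (0 : ℝ) 1) : ℂ := qpow q 1

theorem qc_ne (q : Set.Ioo (0 : ℝ) 1) : qc q ≠ 0 := qpow_ne q 1

theorem qpow_one (q : Set.Ioo (0 : ℝ) 1) : qpow q 1 = qc q := rfl

theorem qpow_neg_one (q : Set.Ioo (0 : ℝ) 1) : qpow q (-1) = (qc q)⁻¹ := qpow_neg q 1

theorem qpow_intCast (q : Set.Ioo (0 : ℝ) 1) (n : ℤ) : qpow q n = qc q ^ n := by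
  simp [qpow, qc, Real.rpow_intCast]

theorem qpow_natCast (q : Set.Ioo (0 : ℝ) 1) (n : ℕ) : qpow q n = qc q ^ n := by
  simpa using qpow_intCast q n

theorem qc_eq (q : Set.Ioo (0 : ℝ) 1) : qc q = ((q : ℝ) : ℂ) := by simp [qc, qpow]

theorem qc_sq_ne_one (q : Set.Ioo (0 : ℝ) 1) : qc q ^ 2 ≠ 1 := by
  rw [qc_eq]
  have h1 := q.2.1
  have h2 := q.2.2
  have : (q : ℝ) ^ 2 < 1 := by nlinarith
  exact_mod_cast this.ne

theorem qc_sq_sub_one_ne (q : Set.Ioo (0 : ℝ) 1) : qc q ^ 2 - 1 ≠ 0 :=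
  sub_ne_zero.2 (qc_sq_ne_one q)

theorem qc_sub_inv_ne (q : Set.Ioo (0 : ℝ) 1) : qc q - (qc q)⁻¹ ≠ 0 := by
  have h := qc_sq_sub_one_ne q
  have h0 := qc_ne q
  intro h1
  apply h
  field_simp at h1
  simpa using h1

theorem star_qc (q : Set.Ioo (0 : ℝ) 1) : star (qc q) = qc q := conj_qpow q 1

/-! ### Generators with indices in `ℕ` -/

/-- `F_i = E_i^*`. -/
def F (ℓ : ℕ) (q : Set.Ioo (0 : ℝ) 1) (i : ℕ) : U ℓ q := star (E ℓ q i)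

/-- `K_i⁻¹`. -/
def Kinv (ℓ : ℕ) (q : Set.Ioo (0 : ℝ) 1) (i : ℕ) : U ℓ q :=
  if h : i ∈ Finset.Icc 1 ℓ then gen q (.Kinv ⟨i, h⟩) else 1

theorem E_mem {i : ℕ} (h : i ∈ Finset.Icc 1 ℓ) : E ℓ q i = gen q (.E ⟨i, h⟩) := dif_pos h

theorem K_mem {i : ℕ} (h : i ∈ Finset.Icc 1 ℓ) : K ℓ q i = gen q (.K ⟨i, h⟩) := dif_pos h

theorem Kinv_mem {i : ℕ} (h : i ∈ Finset.Icc 1 ℓ) : Kinv ℓ q i = gen q (.Kinv ⟨i, h⟩) := dif_pos h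

theorem F_mem {i : ℕ} (h : i ∈ Finset.Icc 1 ℓ) : F ℓ q i = gen q (.F ⟨i, h⟩) := by
  rw [F, E_mem h, star_gen]; rfl

theorem E_not_mem {i : ℕ} (h : i ∉ Finset.Icc 1 ℓ) : E ℓ q i = 0 := dif_neg h

theorem F_not_mem {i : ℕ} (h : i ∉ Finset.Icc 1 ℓ) : F ℓ q i = 0 := by
  rw [F, E_not_mem h, star_zero]

theorem star_E (i : ℕ) : star (E ℓ q i) = F ℓ q i := rfl

theorem star_F (i : ℕ) : star (F ℓ q i) = E ℓ q i := star_star _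

theorem K_mul_Kinv (i : ℕ) : K ℓ q i * Kinv ℓ q i = 1 := by
  unfold K Kinv; split_ifs
  · exact sat_gen.K_mul_Kinv _
  · exact one_mul 1

theorem Kinv_mul_K (i : ℕ) : Kinv ℓ q i * K ℓ q i = 1 := by
  unfold K Kinv; split_ifs
  · exact sat_gen.Kinv_mul_K _
  · exact one_mul 1

theorem E_mul_F_of_ne {i j : ℕ} (h : i ≠ j) : E ℓ q i * F ℓ q j = F ℓ q j * E ℓ q i := by
  by_cases hi : i ∈ Finset.Icc 1 ℓ
  · by_cases hj : j ∈ Finset.Icc 1 ℓ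
    · rw [E_mem hi, F_mem hj]
      exact sat_gen.E_F_ne _ _ fun e => h (congrArg Subtype.val e)
    · simp [F_not_mem hj]
  · simp [E_not_mem hi]

theorem E_mul_F_self {i : ℕ} (h1 : 1 ≤ i) (h2 : i ≤ ℓ) :
    E ℓ q i * F ℓ q i = F ℓ q i * E ℓ q i +
      (qc q - (qc q)⁻¹)⁻¹ • (K ℓ q i ^ 2 - Kinv ℓ q i ^ 2) := by
  have hi : i ∈ Finset.Icc 1 ℓ := Finset.mem_Icc.2 ⟨h1, h2⟩
  have := sat_gen.E_F (q := q) ⟨i, hi⟩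
  rw [qpow_neg_one, qpow_one] at this
  rw [E_mem hi, F_mem hi, K_mem hi, Kinv_mem hi, ← this]
  abel

theorem E_comm_of_lt {i j : ℕ} (h : i + 1 < j) : E ℓ q i * E ℓ q j = E ℓ q j * E ℓ q i := by
  by_cases hi : i ∈ Finset.Icc 1 ℓ
  · by_cases hj : j ∈ Finset.Icc 1 ℓ
    · rw [E_mem hi, E_mem hj]
      exact sat_gen.comm_E _ _ (by unfold Near; dsimp only; omega)
    · simp [E_not_mem hj]
  · simp [E_not_mem hi]

theorem F_comm_of_lt {i j : ℕ} (h : i + 1 < j) : F ℓ q i * F ℓ q j = F ℓ q j * F ℓ q i := by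
  rw [F, F, ← star_mul, ← star_mul, E_comm_of_lt h]

theorem F_serre_succ (i : ℕ) : F ℓ q i * F ℓ q i * F ℓ q (i + 1) + F ℓ q (i + 1) * F ℓ q i * F ℓ q i =
    (qc q + (qc q)⁻¹) • (F ℓ q i * F ℓ q (i + 1) * F ℓ q i) := by
  by_cases hi : i ∈ Finset.Icc 1 ℓ
  · by_cases hj : i + 1 ∈ Finset.Icc 1 ℓ
    · rw [F_mem hi, F_mem hj, ← qpow_neg_one, ← qpow_one]
      exact sat_gen.serre_F _ _ (Or.inl rfl)
    · simp [F_not_mem hj]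
  · simp [F_not_mem hi]

theorem F_succ_serre (i : ℕ) :
    F ℓ q (i + 1) * F ℓ q (i + 1) * F ℓ q i + F ℓ q i * F ℓ q (i + 1) * F ℓ q (i + 1) =
    (qc q + (qc q)⁻¹) • (F ℓ q (i + 1) * F ℓ q i * F ℓ q (i + 1)) := by
  by_cases hi : i ∈ Finset.Icc 1 ℓ
  · by_cases hj : i + 1 ∈ Finset.Icc 1 ℓ
    · rw [F_mem hi, F_mem hj, ← qpow_neg_one, ← qpow_one]
      exact sat_gen.serre_F _ _ (Or.inr rfl)
    · simp [F_not_mem hj]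
  · simp [F_not_mem hi]

/-! ### The torus -/

/-- The group-like elements generated by the `K_i`, `κ` and their inverses. -/
def torus (ℓ : ℕ) (q : Set.Ioo (0 : ℝ) 1) : Submonoid (U ℓ q) :=
  Submonoid.closure (Set.range (fun i => gen q (.K i)) ∪ Set.range (fun i => gen q (.Kinv i)) ∪
    {kap ℓ q, kapinv ℓ q})

theorem torus_comm {g h : U ℓ q} (hg : g ∈ torus ℓ q) (hh : h ∈ torus ℓ q) : Commute g h := by
  have hs := sat_gen (ℓ := ℓ) (q := q)
  have kapK : ∀ i, Commute (kap ℓ q) (gen q (.K i)) := hs.kap_K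
  have kapKinv : ∀ i, Commute (kap ℓ q) (gen q (.Kinv i)) := fun i => by
    obtain ⟨u, hu, hu'⟩ := hs.isUnitK i
    have := kapK i
    rw [← hu] at this; rw [← hu']
    exact this.units_inv_right
  have kapinvK : ∀ i, Commute (kapinv ℓ q) (gen q (.K i)) := fun i => by
    obtain ⟨u, hu, hu'⟩ := hs.isUnitkap
    have := kapK i
    rw [kap, ← hu] at this; rw [kapinv, ← hu']
    exact this.units_inv_left
  have kk : Commute (kap ℓ q) (kapinv ℓ q) := hs.kap_mul_kapinv.trans hs.kapinv_mul_kap.symm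
  refine Submonoid.closure_induction₂ (motive := fun x y _ _ => Commute x y) ?_ ?_ ?_ ?_ ?_ hg hh
  · rintro _ _ ((⟨i, rfl⟩ | ⟨i, rfl⟩) | (rfl | rfl)) ((⟨j, rfl⟩ | ⟨j, rfl⟩) | (rfl | rfl))
    · exact hs.commKK i j
    · exact (hs.commKinvK j i).symm
    · exact (kapK i).symm
    · exact (kapinvK i).symm
    · exact hs.commKinvK i j
    · exact hs.commKinvKinv i j
    · exact (kapKinv i).symm
    · exact (hs.commkapinvKinv i).symm
    · exact kapK j
    · exact kapKinv j
    · exact Commute.refl _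
    · exact kk
    · exact kapinvK j
    · exact hs.commkapinvKinv j
    · exact kk.symm
    · exact Commute.refl _
  · exact fun x _ => Commute.one_left x
  · exact fun x _ => Commute.one_right x
  · exact fun x y z _ _ _ h1 h2 => h1.mul_left h2
  · exact fun x y z _ _ _ h1 h2 => h1.mul_right h2

theorem star_torus {g : U ℓ q} (hg : g ∈ torus ℓ q) : star g = g := by
  induction hg using Submonoid.closure_induction with
  | mem x hx =>
    rcases hx with (⟨i, rfl⟩ | ⟨i, rfl⟩) | (rfl | rfl) <;> simp [kap, kapinv, star_gen, starGen]
  | one => exact star_one _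
  | mul x y hx hy h1 h2 => rw [star_mul, h1, h2]; exact torus_comm hy hx

theorem K_mem_torus (i : ℕ) : K ℓ q i ∈ torus ℓ q := by
  unfold K; split_ifs
  · exact Submonoid.subset_closure (Or.inl (Or.inl ⟨_, rfl⟩))
  · exact one_mem _

theorem Kinv_mem_torus (i : ℕ) : Kinv ℓ q i ∈ torus ℓ q := by
  unfold Kinv; split_ifs
  · exact Submonoid.subset_closure (Or.inl (Or.inr ⟨_, rfl⟩))
  · exact one_mem _

theorem kap_mem_torus : kap ℓ q ∈ torus ℓ q := Submonoid.subset_closure (Or.inr (Or.inl rfl))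

theorem kapinv_mem_torus : kapinv ℓ q ∈ torus ℓ q := Submonoid.subset_closure (Or.inr (Or.inr rfl))

theorem kap_mul_kapinv : kap ℓ q * kapinv ℓ q = 1 := sat_gen.kap_mul_kapinv

theorem kapinv_mul_kap : kapinv ℓ q * kap ℓ q = 1 := sat_gen.kapinv_mul_kap

/-- `P_i = K_i ⋯ K_ℓ`. -/
def P (ℓ : ℕ) (q : Set.Ioo (0 : ℝ) 1) (i : ℕ) : U ℓ q := Kprod ℓ q i ℓ

theorem Kprod_of_lt {a b : ℕ} (h : b < a) : Kprod ℓ q a b = 1 := by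
  simp [Kprod, show b + 1 - a = 0 by omega]

theorem Kprod_eq_mul {a b : ℕ} (h : a ≤ b) : Kprod ℓ q a b = K ℓ q a * Kprod ℓ q (a + 1) b := by
  rw [Kprod, show b + 1 - a = (b + 1 - (a + 1)) + 1 by omega, List.range'_succ, List.map_cons,
    List.prod_cons]
  rfl

theorem Kprod_mem_torus (a b : ℕ) : Kprod ℓ q a b ∈ torus ℓ q := by
  refine Submonoid.list_prod_mem _ fun x hx => ?_
  obtain ⟨i, -, rfl⟩ := List.mem_map.1 hx
  exact K_mem_torus i

theorem P_mem_torus (i : ℕ) : P ℓ q i ∈ torus ℓ q := Kprod_mem_torus i ℓ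

theorem P_last : P ℓ q (ℓ + 1) = 1 := Kprod_of_lt (Nat.lt_succ_self ℓ)

theorem P_eq_mul {i : ℕ} (h : i ≤ ℓ) : P ℓ q i = K ℓ q i * P ℓ q (i + 1) := Kprod_eq_mul h

/-- `P_i⁻¹`. -/
def Pinv (ℓ : ℕ) (q : Set.Ioo (0 : ℝ) 1) (i : ℕ) : U ℓ q :=
  ((List.range' i (ℓ + 1 - i)).map (Kinv ℓ q)).prod

theorem Pinv_mem_torus (i : ℕ) : Pinv ℓ q i ∈ torus ℓ q := by
  refine Submonoid.list_prod_mem _ fun x hx => ?_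
  obtain ⟨i, -, rfl⟩ := List.mem_map.1 hx
  exact Kinv_mem_torus i

theorem Pinv_last : Pinv ℓ q (ℓ + 1) = 1 := by simp [Pinv]

theorem Pinv_eq_mul {i : ℕ} (h : i ≤ ℓ) : Pinv ℓ q i = Kinv ℓ q i * Pinv ℓ q (i + 1) := by
  rw [Pinv, show ℓ + 1 - i = (ℓ + 1 - (i + 1)) + 1 by omega, List.range'_succ, List.map_cons,
    List.prod_cons]
  rfl

/-- Downward induction. -/
theorem downInd {k : ℕ} {p : ℕ → Prop} (base : p k) (step : ∀ j, j < k → p (j + 1) → p j) :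
    ∀ j, j ≤ k → p j := by
  intro j hj
  obtain ⟨n, rfl⟩ := Nat.exists_eq_add_of_le hj
  induction n generalizing j with
  | zero => exact base
  | succ n ih =>
    refine step j (by omega) (ih (j + 1) ?_ ?_ (by omega))
    · rwa [show j + 1 + n = j + (n + 1) by omega]
    · rwa [show j + 1 + n = j + (n + 1) by omega]

theorem P_mul_Pinv {i : ℕ} (h : i ≤ ℓ + 1) : P ℓ q i * Pinv ℓ q i = 1 := by
  refine downInd (p := fun i => P ℓ q i * Pinv ℓ q i = 1) ?_ ?_ i h
  · rw [P_last, Pinv_last, one_mul]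
  · intro j hj ih
    rw [P_eq_mul (by omega), Pinv_eq_mul (by omega),
      (torus_comm (Kinv_mem_torus j) (Pinv_mem_torus (j + 1))).eq, mul_assoc,
      ← mul_assoc (P ℓ q (j + 1)), ih, one_mul, K_mul_Kinv]

theorem Pinv_mul_P {i : ℕ} (h : i ≤ ℓ + 1) : Pinv ℓ q i * P ℓ q i = 1 := by
  rw [(torus_comm (Pinv_mem_torus i) (P_mem_torus i)).eq, P_mul_Pinv h]

/-! ### Characters -/

/-- The element `g` satisfies `g E_i = q ^ (c i) E_i g` and `g F_i = q ^ (- c i) F_i g`. -/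
structure Chr (g : U ℓ q) (c : ℕ → ℝ) : Prop where
  E : ∀ i, 1 ≤ i → i ≤ ℓ → g * E ℓ q i = qpow q (c i) • (QProj.E ℓ q i * g)
  F : ∀ i, 1 ≤ i → i ≤ ℓ → g * F ℓ q i = qpow q (-c i) • (QProj.F ℓ q i * g)

theorem Chr.one : Chr (1 : U ℓ q) 0 := ⟨fun i _ _ => by simp [qpow_zero], fun i _ _ => by simp [qpow_zero]⟩

theorem Chr.mul {g h : U ℓ q} {c d : ℕ → ℝ} (hg : Chr g c) (hh : Chr h d) : Chr (g * h) (c + d) := by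
  constructor <;> intro i h1 h2
  · rw [mul_assoc, hh.E i h1 h2, mul_smul_comm, ← mul_assoc, hg.E i h1 h2, smul_mul_assoc, smul_smul,
      ← qpow_add, mul_assoc, Pi.add_apply, add_comm]
  · rw [mul_assoc, hh.F i h1 h2, mul_smul_comm, ← mul_assoc, hg.F i h1 h2, smul_mul_assoc, smul_smul,
      ← qpow_add, mul_assoc, Pi.add_apply, neg_add, add_comm]

theorem Chr.congr {g : U ℓ q} {c d : ℕ → ℝ} (hg : Chr g c)
    (h : ∀ i, 1 ≤ i → i ≤ ℓ → c i = d i) : Chr g d :=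
  ⟨fun i a b => by rw [← h i a b]; exact hg.E i a b, fun i a b => by rw [← h i a b]; exact hg.F i a b⟩

theorem Chr.pow {g : U ℓ q} {c : ℕ → ℝ} (hg : Chr g c) (n : ℕ) : Chr (g ^ n) (fun i => n * c i) := by
  induction n with
  | zero => rw [pow_zero]; exact Chr.one.congr fun i _ _ => by simp
  | succ n ih =>
    rw [pow_succ]
    convert ih.mul hg using 1
    funext i; push_cast; rw [Pi.add_apply]; ring

theorem Chr.inv {g g' : U ℓ q} {c : ℕ → ℝ} (hg : Chr g c) (h1 : g * g' = 1) (h2 : g' * g = 1) :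
    Chr g' (fun i => -c i) := by
  have key : ∀ (x : U ℓ q) (r : ℝ), g * x = qpow q r • (x * g) →
      g' * x = qpow q (-r) • (x * g') := fun x r hx => by
    have : x * g = qpow q (-r) • (g * x) := by
      rw [hx, smul_smul, ← qpow_add, neg_add_cancel, qpow_zero, one_smul]
    calc g' * x = g' * (x * g) * g' := by rw [mul_assoc, mul_assoc, h1, mul_one]
      _ = _ := by rw [this, mul_smul_comm, smul_mul_assoc, ← mul_assoc, h2, one_mul]
  exact ⟨fun i a b => key _ _ (hg.E i a b), fun i a b => key _ _ (hg.F i a b)⟩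

/-- The character of `K_i`. -/
def chrK (i j : ℕ) : ℝ := if i = j then 1 else if i + 1 = j ∨ j + 1 = i then -1 / 2 else 0

theorem Chr.K {i : ℕ} (h1 : 1 ≤ i) (h2 : i ≤ ℓ) : Chr (K ℓ q i) (chrK i) := by
  have hi : i ∈ Finset.Icc 1 ℓ := Finset.mem_Icc.2 ⟨h1, h2⟩
  have hw : ∀ j (hj : j ∈ Finset.Icc 1 ℓ), wt (ℓ := ℓ) ⟨i, hi⟩ ⟨j, hj⟩ = chrK i j := fun j hj => by
    simp only [wt, chrK, Near, Subtype.mk.injEq]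
  constructor <;> intro j a b
  · have hj : j ∈ Finset.Icc 1 ℓ := Finset.mem_Icc.2 ⟨a, b⟩
    rw [K_mem hi, E_mem hj, sat_gen.K_E, hw]
  · have hj : j ∈ Finset.Icc 1 ℓ := Finset.mem_Icc.2 ⟨a, b⟩
    rw [K_mem hi, F_mem hj, sat_gen.K_F, hw]

theorem Chr.Kinv {i : ℕ} (h1 : 1 ≤ i) (h2 : i ≤ ℓ) : Chr (Kinv ℓ q i) (fun j => -chrK i j) :=
  (Chr.K h1 h2).inv (K_mul_Kinv i) (Kinv_mul_K i)

theorem Chr.kap : Chr (kap ℓ q) (fun j => if j = ℓ then 1 / (ℓ : ℝ) else 0) := by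
  constructor <;> intro j a b
  · have hj : j ∈ Finset.Icc 1 ℓ := Finset.mem_Icc.2 ⟨a, b⟩
    rw [E_mem hj, QProj.kap, sat_gen.kap_E]; rfl
  · have hj : j ∈ Finset.Icc 1 ℓ := Finset.mem_Icc.2 ⟨a, b⟩
    rw [F_mem hj, QProj.kap, sat_gen.kap_F]; rfl

theorem Chr.Khat : Chr (Khat ℓ q) (fun j => if j = ℓ then 1 else 0) := by
  refine (Chr.kap.pow ℓ).congr fun i h1 h2 => ?_
  have : (ℓ : ℝ) ≠ 0 := by norm_cast; omega
  split_ifs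
  · field_simp
  · simp

theorem Khat_mul_Khatinv : Khat ℓ q * Khatinv ℓ q = 1 := by
  rw [Khat, Khatinv, ← (torus_comm kap_mem_torus kapinv_mem_torus).mul_pow, kap_mul_kapinv, one_pow]

theorem Khatinv_mul_Khat : Khatinv ℓ q * Khat ℓ q = 1 := by
  rw [Khat, Khatinv, ← (torus_comm kapinv_mem_torus kap_mem_torus).mul_pow, kapinv_mul_kap, one_pow]

theorem Khat_mem_torus : Khat ℓ q ∈ torus ℓ q := pow_mem kap_mem_torus _

theorem Khatinv_mem_torus : Khatinv ℓ q ∈ torus ℓ q := pow_mem kapinv_mem_torus _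

theorem Chr.Khatinv : Chr (Khatinv ℓ q) (fun j => if j = ℓ then -1 else 0) :=
  (Chr.Khat.inv Khat_mul_Khatinv Khatinv_mul_Khat).congr fun i _ _ => by split_ifs <;> simp

/-- The character of `P_i`, doubled. -/
def chrP (ℓ i j : ℕ) : ℤ :=
  (if i = j then 1 else 0) - (if j + 1 = i then 1 else 0) + (if j = ℓ then 1 else 0)

theorem Chr.P {i : ℕ} (h1 : 1 ≤ i) (h2 : i ≤ ℓ + 1) :
    Chr (P ℓ q i) (fun j => (chrP ℓ i j : ℝ) / 2) := by
  refine downInd (k := ℓ + 1)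
    (p := fun i => 1 ≤ i → Chr (QProj.P ℓ q i) (fun j => (chrP ℓ i j : ℝ) / 2)) ?_ ?_ i h2 h1
  · intro _
    rw [P_last]
    refine Chr.one.congr fun j a b => ?_
    have e1 : ¬ ℓ + 1 = j := by omega
    simp only [chrP, e1, Pi.zero_apply, Nat.add_right_cancel_iff, if_false]
    split_ifs <;> simp
  · intro i hi ih h1
    rw [P_eq_mul (by omega)]
    refine ((Chr.K h1 (by omega)).mul (ih (by omega))).congr fun j a b => ?_
    simp only [Pi.add_apply, chrK, chrP, Nat.add_right_cancel_iff]
    rcases Nat.lt_trichotomy i j with h | h | h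
    · have e1 : ¬ i = j := by omega
      have e2 : ¬ j + 1 = i := by omega
      have e3 : ¬ j = i := by omega
      simp only [e1, e2, e3, if_false, or_false]
      split_ifs <;> norm_num
    · subst h
      simp
      split_ifs <;> norm_num
    · have e1 : ¬ i = j := by omega
      have e2 : ¬ i + 1 = j := by omega
      have e3 : ¬ j = i := by omega
      simp only [e1, e2, e3, if_false, false_or]
      split_ifs <;> norm_num

theorem Chr.P_sq {i : ℕ} (h1 : 1 ≤ i) (h2 : i ≤ ℓ + 1) :
    Chr (QProj.P ℓ q i ^ 2) (fun j => (chrP ℓ i j : ℝ)) :=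
  ((Chr.P h1 h2).pow 2).congr fun j _ _ => by push_cast; ring

/-! ### Root vectors -/

theorem M_self (j : ℕ) : M ℓ q j j = E ℓ q j := by simp [M, Mrec]

theorem M_eq {j k : ℕ} (h : j < k) :
    M ℓ q j k = E ℓ q j * M ℓ q (j + 1) k - (qc q)⁻¹ • (M ℓ q (j + 1) k * E ℓ q j) := by
  rw [M, show k - j = (k - (j + 1)) + 1 by omega, Mrec, qcomm, qpow_neg_one]
  rfl

/-- `Mop j k` is obtained like `M j k`, with the products in the opposite order. -/
def MopRec (ℓ : ℕ) (q : Set.Ioo (0 : ℝ) 1) : ℕ → ℕ → U ℓ q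
  | 0, j => E ℓ q j
  | n + 1, j => qcomm (MopRec ℓ q n (j + 1)) (E ℓ q j)

/-- The root vectors for the opposite order of the products. -/
def Mop (ℓ : ℕ) (q : Set.Ioo (0 : ℝ) 1) (j k : ℕ) : U ℓ q := MopRec ℓ q (k - j) j

theorem Mop_self (j : ℕ) : Mop ℓ q j j = E ℓ q j := by simp [Mop, MopRec]

theorem Mop_eq {j k : ℕ} (h : j < k) :
    Mop ℓ q j k = Mop ℓ q (j + 1) k * E ℓ q j - (qc q)⁻¹ • (E ℓ q j * Mop ℓ q (j + 1) k) := by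
  rw [Mop, show k - j = (k - (j + 1)) + 1 by omega, MopRec, qcomm, qpow_neg_one]
  rfl

theorem star_qc_inv (q : Set.Ioo (0 : ℝ) 1) : star (qc q)⁻¹ = (qc q)⁻¹ := by
  rw [star_inv₀, star_qc]

/-- The root vector `M_{j,k}^*`. -/
def Mst (ℓ : ℕ) (q : Set.Ioo (0 : ℝ) 1) (j k : ℕ) : U ℓ q := star (M ℓ q j k)

/-- The adjoint of `Mop j k`. -/
def Mopst (ℓ : ℕ) (q : Set.Ioo (0 : ℝ) 1) (j k : ℕ) : U ℓ q := star (Mop ℓ q j k)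

theorem Mst_self (j : ℕ) : Mst ℓ q j j = F ℓ q j := by rw [Mst, M_self, star_E]

theorem Mopst_self (j : ℕ) : Mopst ℓ q j j = F ℓ q j := by rw [Mopst, Mop_self, star_E]

theorem Mst_eq {j k : ℕ} (h : j < k) :
    Mst ℓ q j k = Mst ℓ q (j + 1) k * F ℓ q j - (qc q)⁻¹ • (F ℓ q j * Mst ℓ q (j + 1) k) := by
  rw [Mst, M_eq h, star_sub, star_mul, star_smul, star_mul, star_qc_inv]; rfl

theorem Mopst_eq {j k : ℕ} (h : j < k) :
    Mopst ℓ q j k = F ℓ q j * Mopst ℓ q (j + 1) k - (qc q)⁻¹ • (Mopst ℓ q (j + 1) k * F ℓ q j) := by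
  rw [Mopst, Mop_eq h, star_sub, star_mul, star_smul, star_mul, star_qc_inv]; rfl

/-- Both `x * y` and `y * x` pick up the factor `a * b`, so weights are multiplicative on deformed
commutators whatever the parameter. -/
theorem smul_comm_of_mul {T : Type*} [Ring T] [Algebra ℂ T] {g x y : T} {a b : ℂ} (c : ℂ)
    (hx : g * x = a • (x * g)) (hy : g * y = b • (y * g)) :
    g * (x * y - c • (y * x)) = (a * b) • ((x * y - c • (y * x)) * g) := by
  have h1 : g * (x * y) = (a * b) • (x * y * g) := by
    rw [← mul_assoc, hx, smul_mul_assoc, mul_assoc, hy, mul_smul_comm, smul_smul, mul_assoc]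
  have h2 : g * (y * x) = (a * b) • (y * x * g) := by
    rw [← mul_assoc, hy, smul_mul_assoc, mul_assoc, hx, mul_smul_comm, smul_smul, mul_assoc, mul_comm]
  rw [mul_sub, mul_smul_comm, h1, h2, sub_mul, smul_sub, smul_mul_assoc, smul_comm c]

theorem sum_Icc_eq_add {R : Type*} [AddCommMonoid R] (c : ℕ → R) {j k : ℕ} (h : j ≤ k) :
    ∑ m ∈ Finset.Icc j k, c m = c j + ∑ m ∈ Finset.Icc (j + 1) k, c m := by
  rw [← Finset.insert_Icc_add_one_left_eq_Icc h, Finset.sum_insert (by simp)]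

theorem Chr.M {g : U ℓ q} {c : ℕ → ℝ} (hg : Chr g c) {j k : ℕ} (hj : 1 ≤ j) (hk : k ≤ ℓ)
    (h : j ≤ k) : g * M ℓ q j k = qpow q (∑ m ∈ Finset.Icc j k, c m) • (QProj.M ℓ q j k * g) := by
  refine downInd (k := k) (p := fun j => 1 ≤ j → g * QProj.M ℓ q j k =
    qpow q (∑ m ∈ Finset.Icc j k, c m) • (QProj.M ℓ q j k * g)) ?_ ?_ j h hj
  · intro h1
    rw [M_self, Finset.Icc_self, Finset.sum_singleton, hg.E k h1 hk]
  · intro j hj ih h1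
    rw [M_eq hj, smul_comm_of_mul _ (hg.E j h1 (by omega)) (ih (by omega)), ← qpow_add,
      sum_Icc_eq_add c hj.le]

theorem Chr.Mop {g : U ℓ q} {c : ℕ → ℝ} (hg : Chr g c) {j k : ℕ} (hj : 1 ≤ j) (hk : k ≤ ℓ)
    (h : j ≤ k) : g * Mop ℓ q j k = qpow q (∑ m ∈ Finset.Icc j k, c m) • (QProj.Mop ℓ q j k * g) := by
  refine downInd (k := k) (p := fun j => 1 ≤ j → g * QProj.Mop ℓ q j k =
    qpow q (∑ m ∈ Finset.Icc j k, c m) • (QProj.Mop ℓ q j k * g)) ?_ ?_ j h hj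
  · intro h1
    rw [Mop_self, Finset.Icc_self, Finset.sum_singleton, hg.E k h1 hk]
  · intro j hj ih h1
    rw [Mop_eq hj, smul_comm_of_mul _ (ih (by omega)) (hg.E j h1 (by omega)), ← qpow_add,
      sum_Icc_eq_add c hj.le, add_comm]

theorem Chr.Mst {g : U ℓ q} {c : ℕ → ℝ} (hg : Chr g c) {j k : ℕ} (hj : 1 ≤ j) (hk : k ≤ ℓ)
    (h : j ≤ k) : g * Mst ℓ q j k = qpow q (-∑ m ∈ Finset.Icc j k, c m) • (QProj.Mst ℓ q j k * g) := by
  refine downInd (k := k) (p := fun j => 1 ≤ j → g * QProj.Mst ℓ q j k =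
    qpow q (-∑ m ∈ Finset.Icc j k, c m) • (QProj.Mst ℓ q j k * g)) ?_ ?_ j h hj
  · intro h1
    rw [Mst_self, Finset.Icc_self, Finset.sum_singleton, hg.F k h1 hk]
  · intro j hj ih h1
    rw [Mst_eq hj, smul_comm_of_mul _ (ih (by omega)) (hg.F j h1 (by omega)), ← qpow_add,
      sum_Icc_eq_add c hj.le, neg_add, add_comm]

theorem Chr.Mopst {g : U ℓ q} {c : ℕ → ℝ} (hg : Chr g c) {j k : ℕ} (hj : 1 ≤ j) (hk : k ≤ ℓ)
    (h : j ≤ k) :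
    g * Mopst ℓ q j k = qpow q (-∑ m ∈ Finset.Icc j k, c m) • (QProj.Mopst ℓ q j k * g) := by
  refine downInd (k := k) (p := fun j => 1 ≤ j → g * QProj.Mopst ℓ q j k =
    qpow q (-∑ m ∈ Finset.Icc j k, c m) • (QProj.Mopst ℓ q j k * g)) ?_ ?_ j h hj
  · intro h1
    rw [Mopst_self, Finset.Icc_self, Finset.sum_singleton, hg.F k h1 hk]
  · intro j hj ih h1
    rw [Mopst_eq hj, smul_comm_of_mul _ (hg.F j h1 (by omega)) (ih (by omega)), ← qpow_add,
      sum_Icc_eq_add c hj.le, neg_add]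

/-- The weight of a root vector is the sum of the weights of its simple factors. Since `P_i ^ 2` can
have nonzero weight only at `i`, `i - 1` and `ℓ`, only the membership of these three indices in `[j,
k]` counts. -/
theorem sum_chrP {i j k : ℕ} (hi : 1 ≤ i) : ∑ m ∈ Finset.Icc j k, chrP ℓ i m =
    (if j ≤ i ∧ i ≤ k then 1 else 0) - (if j + 1 ≤ i ∧ i ≤ k + 1 then 1 else 0)
      + (if j ≤ ℓ ∧ ℓ ≤ k then 1 else 0) := by
  have e : ∀ m, (m + 1 = i) = (m = i - 1) := fun m => by rw [eq_iff_iff]; omega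
  simp only [chrP, Finset.sum_add_distrib, Finset.sum_sub_distrib, Finset.sum_ite_eq,
    Finset.sum_ite_eq', Finset.mem_Icc, e]
  congr 2
  split_ifs <;> first | rfl | omega

/-! ### Commutation relations between root vectors -/

theorem commute_M {x : U ℓ q} {j k : ℕ} (hjk : j ≤ k) (h : ∀ i, j ≤ i → i ≤ k → Commute x (E ℓ q i)) :
    Commute x (M ℓ q j k) := by
  refine downInd (k := k) (p := fun j' => j ≤ j' → Commute x (M ℓ q j' k)) ?_ ?_ j hjk le_rfl
  · intro _; rw [M_self]; exact h k hjk le_rfl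
  · intro i hi ih hji
    rw [M_eq hi]
    have h1 := h i hji hi.le
    have h2 := ih (by omega)
    exact (h1.mul_right h2).sub_right ((h2.mul_right h1).smul_right _)

theorem commute_Mop {x : U ℓ q} {j k : ℕ} (hjk : j ≤ k)
    (h : ∀ i, j ≤ i → i ≤ k → Commute x (E ℓ q i)) : Commute x (Mop ℓ q j k) := by
  refine downInd (k := k) (p := fun j' => j ≤ j' → Commute x (Mop ℓ q j' k)) ?_ ?_ j hjk le_rfl
  · intro _; rw [Mop_self]; exact h k hjk le_rfl
  · intro i hi ih hji
    rw [Mop_eq hi]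
    have h1 := h i hji hi.le
    have h2 := ih (by omega)
    exact (h2.mul_right h1).sub_right ((h1.mul_right h2).smul_right _)

theorem commute_star {x y : U ℓ q} (h : Commute x y) : Commute (star x) (star y) := by
  have := congrArg star h.eq
  rw [star_mul, star_mul] at this
  exact this.symm

theorem commute_Mst {x : U ℓ q} {j k : ℕ} (hjk : j ≤ k)
    (h : ∀ i, j ≤ i → i ≤ k → Commute x (F ℓ q i)) : Commute x (Mst ℓ q j k) := by
  have := commute_star (commute_M (x := star x) hjk fun i h1 h2 => by
    have := commute_star (h i h1 h2); rwa [star_F] at this)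
  rwa [star_star] at this

theorem commute_Mopst {x : U ℓ q} {j k : ℕ} (hjk : j ≤ k)
    (h : ∀ i, j ≤ i → i ≤ k → Commute x (F ℓ q i)) : Commute x (Mopst ℓ q j k) := by
  have := commute_star (commute_Mop (x := star x) hjk fun i h1 h2 => by
    have := commute_star (h i h1 h2); rwa [star_F] at this)
  rwa [star_star] at this

theorem commute_E_F {i j : ℕ} (h : i ≠ j) : Commute (E ℓ q i) (F ℓ q j) := E_mul_F_of_ne h

/-! ### Comparison of the two orders of the brackets. -/

/-- The number `(-q⁻¹) ^ (ℓ - j)`. -/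
def gam (ℓ : ℕ) (q : Set.Ioo (0 : ℝ) 1) (j : ℕ) : ℂ := (-(qc q)⁻¹) ^ (ℓ - j)

theorem gam_last : gam ℓ q ℓ = 1 := by simp [gam]

theorem gam_eq {j : ℕ} (h : j < ℓ) : gam ℓ q j = -(qc q)⁻¹ * gam ℓ q (j + 1) := by
  rw [gam, gam, show ℓ - j = (ℓ - (j + 1)) + 1 by omega, pow_succ']

/-- Iterated deformed commutators for one choice of the order of the factors, in terms of those for
the opposite choice. -/
theorem iterated_bracket_expand {T : Type*} [Ring T] [Algebra ℂ T] (n : ℕ) (e x y : ℕ → T)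
    (z : ℕ → ℕ → T) (r t u w a : ℂ) (ha : t = a * w) (hx0 : x n = y n)
    (hx : ∀ i, i < n → x i = r • (e i * x (i + 1)) + t • (x (i + 1) * e i))
    (hy : ∀ i, i < n → y i = u • (e i * y (i + 1)) + w • (y (i + 1) * e i))
    (hz0 : ∀ i, z i i = e i)
    (hz : ∀ i m, i < m → z i m = r • (e i * z (i + 1) m) + t • (z (i + 1) m * e i))
    (hc : ∀ i j, i + 1 < j → j ≤ n → Commute (e i) (y j)) (i : ℕ) (hi : i ≤ n) :
    x i = a ^ (n - i) • y i +
      (r - a * u) • ∑ m ∈ Finset.Ico i n, a ^ (n - (m + 1)) • (z i m * y (m + 1)) := by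
  refine downInd (k := n) (p := fun i => x i = a ^ (n - i) • y i +
      (r - a * u) • ∑ m ∈ Finset.Ico i n, a ^ (n - (m + 1)) • (z i m * y (m + 1))) ?_ ?_ i hi
  · simp [hx0]
  · intro i hi ih
    -- For `m > i` the factor `y (m + 1)` commutes with `e i`, so bracketing with `e i` only extends
    -- the left factor from `z (i + 1) m` to `z i m`.
    have hsum : r • (e i * ∑ m ∈ Finset.Ico (i + 1) n, a ^ (n - (m + 1)) • (z (i + 1) m * y (m + 1)))
        + t • ((∑ m ∈ Finset.Ico (i + 1) n, a ^ (n - (m + 1)) • (z (i + 1) m * y (m + 1))) * e i) =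
        ∑ m ∈ Finset.Ico (i + 1) n, a ^ (n - (m + 1)) • (z i m * y (m + 1)) := by
      rw [Finset.mul_sum, Finset.sum_mul, Finset.smul_sum, Finset.smul_sum, ← Finset.sum_add_distrib]
      refine Finset.sum_congr rfl fun m hm => ?_
      rw [Finset.mem_Ico] at hm
      have := (hc i (m + 1) (by omega) (by omega)).eq
      rw [hz i m (by omega), add_mul, smul_mul_assoc, smul_mul_assoc, mul_smul_comm, smul_mul_assoc,
        mul_assoc _ (y (m + 1)), ← this]
      simp only [mul_assoc]
      module
    have hpow : a ^ (n - i) = a * a ^ (n - (i + 1)) := by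
      rw [show n - i = (n - (i + 1)) + 1 by omega, pow_succ']
    -- With `t = a * w`, the bracket `r e y + t y e` equals `a (u e y + w y e) + (r - a u) e y`. The
    -- excess is the new summand `m = i`.
    rw [Finset.sum_eq_sum_Ico_succ_bot hi, hz0, ← hsum, hx i hi, ih, hpow, hy i hi]
    simp only [mul_add, add_mul, mul_smul_comm, smul_mul_assoc]
    rw [ha]
    module

/-- Here the ratio of the two brackets is `-q⁻¹`; for the adjoints below it is `-q`. The correction
terms begin with a root vector whose last index is below `ℓ`, that is, with an element of the Levi
subalgebra, which acts explicitly on forms. -/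
theorem M_expand {i : ℕ} (hi : i ≤ ℓ) : M ℓ q i ℓ = gam ℓ q i • Mop ℓ q i ℓ +
    (1 - (qc q)⁻¹ ^ 2) • ∑ m ∈ Finset.Ico i ℓ, gam ℓ q (m + 1) • (M ℓ q i m * Mop ℓ q (m + 1) ℓ) := by
  have := iterated_bracket_expand ℓ (E ℓ q) (fun i => M ℓ q i ℓ) (fun i => Mop ℓ q i ℓ) (M ℓ q)
    1 (-(qc q)⁻¹) (-(qc q)⁻¹) 1 (-(qc q)⁻¹) (by ring) (by rw [M_self, Mop_self])
    (fun i hi => by rw [M_eq hi]; module) (fun i hi => by rw [Mop_eq hi]; module) M_self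
    (fun i m h => by rw [M_eq h]; module)
    (fun i j h1 h2 => commute_Mop h2 fun k h3 _ => E_comm_of_lt (by omega)) i hi
  rw [this, gam, show 1 - (qc q)⁻¹ ^ 2 = 1 - -(qc q)⁻¹ * -(qc q)⁻¹ by ring]
  rfl

theorem Mst_expand {i : ℕ} (hi : i ≤ ℓ) : Mst ℓ q i ℓ = (-qc q) ^ (ℓ - i) • Mopst ℓ q i ℓ +
    (qc q - (qc q)⁻¹) • ∑ m ∈ Finset.Ico i ℓ,
      (-qc q) ^ (ℓ - (m + 1)) • (Mst ℓ q i m * Mopst ℓ q (m + 1) ℓ) := by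
  have := iterated_bracket_expand ℓ (F ℓ q) (fun i => Mst ℓ q i ℓ) (fun i => Mopst ℓ q i ℓ)
    (Mst ℓ q) (-(qc q)⁻¹) 1 1 (-(qc q)⁻¹) (-qc q) (by simp [qc_ne]) (by rw [Mst_self, Mopst_self])
    (fun i hi => by rw [Mst_eq hi]; module) (fun i hi => by rw [Mopst_eq hi]; module) Mst_self
    (fun i m h => by rw [Mst_eq h]; module)
    (fun i j h1 h2 => commute_Mopst h2 fun k h3 _ => F_comm_of_lt (by omega)) i hi
  rw [this, show qc q - (qc q)⁻¹ = -(qc q)⁻¹ - -qc q * 1 by ring]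

/-! ### Commutators of root vectors with generators and with Levi root vectors. -/

theorem sum_chrK_succ {i k : ℕ} (h : i < k) : ∑ m ∈ Finset.Icc (i + 1) k, chrK i m = -1 / 2 := by
  rw [Finset.sum_eq_single (i + 1)]
  · simp [chrK]
  · intro m hm hne
    rw [Finset.mem_Icc] at hm
    rw [chrK, if_neg (by omega), if_neg (by omega)]
  · intro h'; exact absurd (Finset.mem_Icc.2 ⟨le_rfl, h⟩) h'

theorem K_sq_mul_Mst {i k : ℕ} (h1 : 1 ≤ i) (h : i < k) (hk : k ≤ ℓ) :
    K ℓ q i ^ 2 * Mst ℓ q (i + 1) k = qc q • (Mst ℓ q (i + 1) k * K ℓ q i ^ 2) := by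
  rw [((Chr.K h1 (by omega)).pow 2).Mst (by omega) hk h, ← Finset.mul_sum, sum_chrK_succ h,
    ← qpow_one]
  norm_num

theorem Kinv_sq_mul_Mst {i k : ℕ} (h1 : 1 ≤ i) (h : i < k) (hk : k ≤ ℓ) :
    Kinv ℓ q i ^ 2 * Mst ℓ q (i + 1) k = (qc q)⁻¹ • (Mst ℓ q (i + 1) k * Kinv ℓ q i ^ 2) := by
  rw [((Chr.Kinv h1 (by omega)).pow 2).Mst (by omega) hk h, ← Finset.mul_sum,
    Finset.sum_neg_distrib, sum_chrK_succ h, ← qpow_neg_one]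
  norm_num

theorem Kinv_sq_mul_Mop {i k : ℕ} (h1 : 1 ≤ i) (h : i < k) (hk : k ≤ ℓ) :
    Kinv ℓ q i ^ 2 * Mop ℓ q (i + 1) k = qc q • (Mop ℓ q (i + 1) k * Kinv ℓ q i ^ 2) := by
  rw [((Chr.Kinv h1 (by omega)).pow 2).Mop (by omega) hk h, ← Finset.mul_sum,
    Finset.sum_neg_distrib, sum_chrK_succ h, ← qpow_one]
  norm_num

/-- The commutator of `E_i` and `M_{i,k}^*`. -/
theorem E_mul_Mst {i k : ℕ} (h1 : 1 ≤ i) (h : i < k) (hk : k ≤ ℓ) :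
    E ℓ q i * Mst ℓ q i k = Mst ℓ q i k * E ℓ q i -
      (qc q)⁻¹ • (Mst ℓ q (i + 1) k * Kinv ℓ q i ^ 2) := by
  have hc : E ℓ q i * Mst ℓ q (i + 1) k = Mst ℓ q (i + 1) k * E ℓ q i :=
    commute_Mst h fun j hj _ => commute_E_F (by omega)
  have hEF := E_mul_F_self (q := q) h1 (show i ≤ ℓ by omega)
  have hK := K_sq_mul_Mst (q := q) h1 h hk
  have hKi := Kinv_sq_mul_Mst (q := q) h1 h hk
  have e1 : E ℓ q i * (Mst ℓ q (i + 1) k * F ℓ q i) = Mst ℓ q (i + 1) k * (E ℓ q i * F ℓ q i) := by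
    rw [← mul_assoc, hc, mul_assoc]
  have e2 : E ℓ q i * (F ℓ q i * Mst ℓ q (i + 1) k) = E ℓ q i * F ℓ q i * Mst ℓ q (i + 1) k :=
    (mul_assoc _ _ _).symm
  have e3 : F ℓ q i * E ℓ q i * Mst ℓ q (i + 1) k = F ℓ q i * Mst ℓ q (i + 1) k * E ℓ q i := by
    rw [mul_assoc, hc, mul_assoc]
  have hq := qc_ne q
  have hq' := qc_sq_sub_one_ne q
  rw [Mst_eq h, mul_sub, mul_smul_comm, e1, e2, hEF, mul_add, add_mul, smul_mul_assoc, sub_mul, hK,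
    hKi, e3, sub_mul, smul_mul_assoc, mul_smul_comm, mul_sub, mul_assoc (Mst ℓ q (i + 1) k) (F ℓ q i)]
  match_scalars <;> field_simp <;> ring

theorem K_mul_Kinv_sq (i : ℕ) : K ℓ q i ^ 2 * Kinv ℓ q i ^ 2 = 1 := by
  rw [← (torus_comm (K_mem_torus i) (Kinv_mem_torus i)).mul_pow, K_mul_Kinv, one_pow]

theorem P_sq_eq_mul {i : ℕ} (h : i ≤ ℓ) : P ℓ q i ^ 2 = K ℓ q i ^ 2 * P ℓ q (i + 1) ^ 2 := by
  rw [P_eq_mul h, (torus_comm (K_mem_torus i) (P_mem_torus _)).mul_pow]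

theorem Pinv_sq_eq_mul {i : ℕ} (h : i ≤ ℓ) :
    Pinv ℓ q i ^ 2 = Kinv ℓ q i ^ 2 * Pinv ℓ q (i + 1) ^ 2 := by
  rw [Pinv_eq_mul h, (torus_comm (Kinv_mem_torus i) (Pinv_mem_torus _)).mul_pow]

theorem P_sq_mul_Kinv_sq {i : ℕ} (h : i ≤ ℓ) :
    P ℓ q i ^ 2 * Kinv ℓ q i ^ 2 = P ℓ q (i + 1) ^ 2 := by
  rw [P_sq_eq_mul h, (torus_comm (pow_mem (K_mem_torus i) 2) (pow_mem (P_mem_torus _) 2)).eq,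
    mul_assoc, K_mul_Kinv_sq, mul_one]

theorem P_sq_mul_E {i j : ℕ} (h1 : 1 ≤ i) (h2 : i ≤ ℓ + 1) (h3 : 1 ≤ j) (h4 : j ≤ ℓ) :
    P ℓ q i ^ 2 * E ℓ q j = qc q ^ chrP ℓ i j • (E ℓ q j * P ℓ q i ^ 2) := by
  rw [(Chr.P_sq h1 h2).E j h3 h4, qpow_intCast]

theorem P_sq_mul_F {i j : ℕ} (h1 : 1 ≤ i) (h2 : i ≤ ℓ + 1) (h3 : 1 ≤ j) (h4 : j ≤ ℓ) :
    P ℓ q i ^ 2 * F ℓ q j = qc q ^ (-chrP ℓ i j) • (F ℓ q j * P ℓ q i ^ 2) := by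
  rw [(Chr.P_sq h1 h2).F j h3 h4, ← qpow_intCast]; push_cast; rfl

theorem P_sq_mul_M {i j k : ℕ} (h1 : 1 ≤ i) (h2 : i ≤ ℓ + 1) (h3 : 1 ≤ j) (h4 : k ≤ ℓ) (h : j ≤ k) :
    P ℓ q i ^ 2 * M ℓ q j k = qc q ^ (∑ m ∈ Finset.Icc j k, chrP ℓ i m) • (M ℓ q j k * P ℓ q i ^ 2) := by
  rw [(Chr.P_sq h1 h2).M h3 h4 h, ← qpow_intCast]; push_cast; rfl

/-- The factor `K_i⁻²` in `E_mul_Mst` is absorbed by `P_i²`, which becomes `P_{i+1}²`. With this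
normalisation the commutator has the same shape as its left factor, and the recursion in
`P_sq_mul_Mst_mul_M` closes. -/
theorem P_sq_commutator {i k : ℕ} (h1 : 1 ≤ i) (h : i < k) (hk : k ≤ ℓ) :
    P ℓ q i ^ 2 * (Mst ℓ q i k * E ℓ q i - E ℓ q i * Mst ℓ q i k) =
      P ℓ q (i + 1) ^ 2 * Mst ℓ q (i + 1) k := by
  have h3 : (qc q)⁻¹ • (Mst ℓ q (i + 1) k * Kinv ℓ q i ^ 2) = Kinv ℓ q i ^ 2 * Mst ℓ q (i + 1) k := by
    rw [Kinv_sq_mul_Mst h1 h hk]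
  rw [E_mul_Mst h1 h hk, sub_sub_cancel, h3, ← mul_assoc, P_sq_mul_Kinv_sq (by omega)]

/-- For `i = j - 1` the two terms of the bracket defining `M_{i,k}^*` each yield the correction `q⁻²
F_{j-1} M_{j+1,k}^* K_j⁻²`, with opposite signs. For smaller `i` only generators `F_i` commuting
with `E_j` are added. -/
theorem commute_E_Mst {i j k : ℕ} (hi : 1 ≤ i) (hij : i < j) (hjk : j < k) (hk : k ≤ ℓ) :
    Commute (E ℓ q j) (Mst ℓ q i k) := by
  obtain ⟨j, rfl⟩ : ∃ j', j = j' + 1 := ⟨j - 1, by omega⟩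
  refine downInd (k := j) (p := fun i => 1 ≤ i → Commute (E ℓ q (j + 1)) (Mst ℓ q i k)) ?_ ?_ i
    (by omega) hi
  · intro h1
    have e1 := E_mul_Mst (q := q) (show 1 ≤ j + 1 by omega) hjk hk
    have e2 : E ℓ q (j + 1) * F ℓ q j = F ℓ q j * E ℓ q (j + 1) := E_mul_F_of_ne (by omega)
    have e3 : F ℓ q j * Mst ℓ q (j + 1 + 1) k = Mst ℓ q (j + 1 + 1) k * F ℓ q j :=
      commute_Mst (by omega) fun i h3 _ => F_comm_of_lt (by omega)
    have e4 : Kinv ℓ q (j + 1) ^ 2 * F ℓ q j = (qc q)⁻¹ • (F ℓ q j * Kinv ℓ q (j + 1) ^ 2) := by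
      rw [((Chr.Kinv (ℓ := ℓ) (q := q) (show 1 ≤ j + 1 by omega) (by omega)).pow 2).F j h1 (by omega),
        ← qpow_neg_one]
      norm_num [chrK]
    have e5 : E ℓ q (j + 1) * (Mst ℓ q (j + 1) k * F ℓ q j) =
        Mst ℓ q (j + 1) k * F ℓ q j * E ℓ q (j + 1) -
        ((qc q)⁻¹ * (qc q)⁻¹) • (F ℓ q j * Mst ℓ q (j + 1 + 1) k * Kinv ℓ q (j + 1) ^ 2) := by
      rw [← mul_assoc, e1, sub_mul, mul_assoc, e2, smul_mul_assoc, mul_assoc _ (Kinv ℓ q (j + 1) ^ 2),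
        e4, mul_smul_comm, smul_smul, ← mul_assoc, ← mul_assoc, e3]
    have e6 : E ℓ q (j + 1) * (F ℓ q j * Mst ℓ q (j + 1) k) =
        F ℓ q j * Mst ℓ q (j + 1) k * E ℓ q (j + 1) -
        (qc q)⁻¹ • (F ℓ q j * Mst ℓ q (j + 1 + 1) k * Kinv ℓ q (j + 1) ^ 2) := by
      rw [← mul_assoc, e2, mul_assoc, e1, mul_sub, mul_smul_comm, ← mul_assoc, ← mul_assoc]
    rw [Commute, SemiconjBy, Mst_eq (by omega : j < k), mul_sub, mul_smul_comm, e5, e6, sub_mul,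
      smul_mul_assoc]
    module
  · intro i hi ih h1
    have h2 := ih (by omega)
    have h3 : Commute (E ℓ q (j + 1)) (F ℓ q i) := commute_E_F (by omega)
    rw [Mst_eq (by omega : i < k)]
    exact (h2.mul_right h3).sub_right ((h3.mul_right h2).smul_right _)

/-- Moving `M_{i,m}` to the left of `M_{i,ℓ}^*`. -/
theorem P_sq_mul_Mst_mul_M {i m : ℕ} (h1 : 1 ≤ i) (him : i ≤ m) (hm : m < ℓ) :
    P ℓ q i ^ 2 * Mst ℓ q i ℓ * M ℓ q i m = P ℓ q i ^ 2 * M ℓ q i m * Mst ℓ q i ℓ +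
      (1 - (qc q)⁻¹ ^ 2) • ∑ p ∈ Finset.Icc (i + 1) m, P ℓ q p ^ 2 * M ℓ q p m * Mst ℓ q p ℓ +
      P ℓ q (m + 1) ^ 2 * Mst ℓ q (m + 1) ℓ := by
  refine downInd (k := m) (p := fun i => 1 ≤ i → P ℓ q i ^ 2 * Mst ℓ q i ℓ * M ℓ q i m =
    P ℓ q i ^ 2 * M ℓ q i m * Mst ℓ q i ℓ +
      (1 - (qc q)⁻¹ ^ 2) • ∑ p ∈ Finset.Icc (i + 1) m, P ℓ q p ^ 2 * M ℓ q p m * Mst ℓ q p ℓ +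
      P ℓ q (m + 1) ^ 2 * Mst ℓ q (m + 1) ℓ) ?_ ?_ i him h1
  · intro h1
    rw [Finset.Icc_eq_empty (by omega), Finset.sum_empty, smul_zero, add_zero, M_self,
      ← P_sq_commutator h1 hm le_rfl]
    noncomm_ring
  · intro i hi ih h1
    have hc := P_sq_commutator (q := q) h1 (show i < ℓ by omega) le_rfl
    have hB : Mst ℓ q i ℓ * M ℓ q (i + 1) m = M ℓ q (i + 1) m * Mst ℓ q i ℓ :=
      commute_M hi fun j h3 h4 => (commute_E_Mst h1 (by omega) (by omega) le_rfl).symm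
    have hP : P ℓ q i ^ 2 * M ℓ q (i + 1) m = M ℓ q (i + 1) m * P ℓ q i ^ 2 := by
      rw [P_sq_mul_M h1 (by omega) (by omega) hm.le hi, sum_chrP h1, if_neg (by omega),
        if_neg (by omega), if_neg (by omega)]
      simp
    have hP' : M ℓ q (i + 1) m * P ℓ q (i + 1) ^ 2 =
        (qc q)⁻¹ • (P ℓ q (i + 1) ^ 2 * M ℓ q (i + 1) m) := by
      rw [P_sq_mul_M (by omega) (by omega) (by omega) hm.le hi, sum_chrP (by omega),
        if_pos (by omega), if_neg (by omega), if_neg (by omega)]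
      simp [smul_smul, qc_ne]
    have hc' : P ℓ q i ^ 2 * Mst ℓ q i ℓ * E ℓ q i = P ℓ q i ^ 2 * E ℓ q i * Mst ℓ q i ℓ +
        P ℓ q (i + 1) ^ 2 * Mst ℓ q (i + 1) ℓ := by
      rw [← hc]; noncomm_ring
    have f1 : P ℓ q i ^ 2 * Mst ℓ q i ℓ * (E ℓ q i * M ℓ q (i + 1) m) =
        P ℓ q i ^ 2 * (E ℓ q i * M ℓ q (i + 1) m) * Mst ℓ q i ℓ +
        P ℓ q (i + 1) ^ 2 * Mst ℓ q (i + 1) ℓ * M ℓ q (i + 1) m := by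
      rw [← mul_assoc, hc', add_mul, mul_assoc _ (Mst ℓ q i ℓ), hB]
      simp only [mul_assoc]
    have f2 : P ℓ q i ^ 2 * Mst ℓ q i ℓ * (M ℓ q (i + 1) m * E ℓ q i) =
        P ℓ q i ^ 2 * (M ℓ q (i + 1) m * E ℓ q i) * Mst ℓ q i ℓ +
        (qc q)⁻¹ • (P ℓ q (i + 1) ^ 2 * M ℓ q (i + 1) m * Mst ℓ q (i + 1) ℓ) := by
      rw [← mul_assoc, mul_assoc _ (Mst ℓ q i ℓ), hB, ← mul_assoc (P ℓ q i ^ 2), hP, mul_assoc,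
        mul_assoc, ← mul_assoc (P ℓ q i ^ 2), hc', mul_add, ← mul_assoc _ (P ℓ q (i + 1) ^ 2), hP',
        ← mul_assoc (P ℓ q i ^ 2) (M ℓ q (i + 1) m), hP, smul_mul_assoc]
      simp only [mul_assoc]
    -- The correction in `f1` is expanded by the induction hypothesis, while that in `f2` enters
    -- with `q⁻²`. Their difference is the summand `p = i + 1`, with its factor `1 - q⁻²`.
    rw [M_eq hi, mul_sub, mul_smul_comm, f1, f2, ih (by omega), sum_Icc_eq_add _ (by omega : i + 1 ≤ m),
      mul_sub, mul_smul_comm, sub_mul, smul_mul_assoc]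
    module

theorem geom_sum_Icc {x : ℂ} (hx : x ≠ 1) (n : ℕ) :
    ∑ i ∈ Finset.Icc 1 n, x ^ i = (x - x ^ (n + 1)) / (1 - x) := by
  have h : 1 - x ≠ 0 := sub_ne_zero.2 hx.symm
  induction n with
  | zero => simp
  | succ n ih => rw [Finset.sum_Icc_succ_top (by omega), ih]; field_simp; ring

theorem one_sub_qc_inv_sq_ne (q : Set.Ioo (0 : ℝ) 1) : 1 - (qc q)⁻¹ ^ 2 ≠ 0 := by
  have h := qc_sq_sub_one_ne q
  have h0 := qc_ne q
  intro h1
  apply h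
  field_simp at h1
  simpa using h1

/-- The second order part of the Laplacian, in terms of the two kinds of root vectors. -/
theorem sum_Mst_mul_M : ∑ i ∈ Finset.Icc 1 ℓ, ((qc q)⁻¹ ^ 2) ^ i • (P ℓ q i ^ 2 * Mst ℓ q i ℓ * M ℓ q i ℓ) =
    (qc q)⁻¹ ^ 2 • ∑ j ∈ Finset.Icc 1 ℓ, gam ℓ q j • ((P ℓ q j ^ 2 * Mst ℓ q j ℓ +
      (1 - (qc q)⁻¹ ^ 2) • ∑ p ∈ Finset.Ico 1 j, P ℓ q p ^ 2 * M ℓ q p (j - 1) * Mst ℓ q p ℓ) *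
        Mop ℓ q j ℓ) := by
  set x := (qc q)⁻¹ ^ 2 with hx
  have hx1 : 1 - x ≠ 0 := one_sub_qc_inv_sq_ne q
  -- the sum for a fixed index of the last factor
  have key : ∀ m, m < ℓ → ∑ i ∈ Finset.Icc 1 m, x ^ i • (P ℓ q i ^ 2 * Mst ℓ q i ℓ * M ℓ q i m) =
      x • ∑ p ∈ Finset.Icc 1 m, P ℓ q p ^ 2 * M ℓ q p m * Mst ℓ q p ℓ +
      ((x - x ^ (m + 1)) / (1 - x)) • (P ℓ q (m + 1) ^ 2 * Mst ℓ q (m + 1) ℓ) := by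
    intro m hm
    have e : ∀ i ∈ Finset.Icc 1 m, x ^ i • (P ℓ q i ^ 2 * Mst ℓ q i ℓ * M ℓ q i m) =
        x ^ i • (P ℓ q i ^ 2 * M ℓ q i m * Mst ℓ q i ℓ) +
        ∑ p ∈ Finset.Icc (i + 1) m, (x ^ i * (1 - x)) • (P ℓ q p ^ 2 * M ℓ q p m * Mst ℓ q p ℓ) +
        x ^ i • (P ℓ q (m + 1) ^ 2 * Mst ℓ q (m + 1) ℓ) := fun i hi => by
      rw [Finset.mem_Icc] at hi
      rw [P_sq_mul_Mst_mul_M hi.1 hi.2 hm, smul_add, smul_add, smul_smul, Finset.smul_sum]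
    rw [Finset.sum_congr rfl e, Finset.sum_add_distrib, Finset.sum_add_distrib, ← Finset.sum_smul,
      geom_sum_Icc (fun h => hx1 (by rw [h]; ring))]
    congr 1
    -- Summing over `i < p` first gives a geometric sum: `(1 - x) ∑_{i<p} x^i = x - x^p`. Added to
    -- the coefficient `x^p` of the first sum, this leaves `x` for every `p`.
    rw [Finset.sum_sigma', Finset.sum_bij' (i := fun a _ => (⟨a.2, a.1⟩ : (_ : ℕ) × ℕ))
      (j := fun a _ => (⟨a.2, a.1⟩ : (_ : ℕ) × ℕ))
      (t := (Finset.Icc 1 m).sigma fun p => Finset.Icc 1 (p - 1))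
      (g := fun a => (x ^ a.2 * (1 - x)) • (P ℓ q a.1 ^ 2 * M ℓ q a.1 m * Mst ℓ q a.1 ℓ))]
    · rw [Finset.sum_sigma, ← Finset.sum_add_distrib, Finset.smul_sum]
      refine Finset.sum_congr rfl fun p hp => ?_
      rw [Finset.mem_Icc] at hp
      dsimp only
      rw [← Finset.sum_smul, ← Finset.sum_mul, geom_sum_Icc (fun h => hx1 (by rw [h]; ring)),
        div_mul_cancel₀ _ hx1, ← add_smul, Nat.sub_add_cancel hp.1]
      congr 1; ring
    · rintro ⟨a, b⟩ h; simp only [Finset.mem_sigma, Finset.mem_Icc] at h ⊢; omega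
    · rintro ⟨a, b⟩ h; simp only [Finset.mem_sigma, Finset.mem_Icc] at h ⊢; omega
    · rintro ⟨a, b⟩ h; rfl
    · rintro ⟨a, b⟩ h; rfl
    · rintro ⟨a, b⟩ h; rfl
  have e : ∀ i ∈ Finset.Icc 1 ℓ, x ^ i • (P ℓ q i ^ 2 * Mst ℓ q i ℓ * M ℓ q i ℓ) =
      (x ^ i * gam ℓ q i) • (P ℓ q i ^ 2 * Mst ℓ q i ℓ * Mop ℓ q i ℓ) +
      ∑ m ∈ Finset.Ico i ℓ, ((1 - x) * gam ℓ q (m + 1)) •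
        (x ^ i • (P ℓ q i ^ 2 * Mst ℓ q i ℓ * M ℓ q i m) * Mop ℓ q (m + 1) ℓ) := fun i hi => by
    rw [Finset.mem_Icc] at hi
    rw [M_expand hi.2, mul_add, smul_add, mul_smul_comm, smul_smul, mul_smul_comm, Finset.mul_sum,
      Finset.smul_sum, Finset.smul_sum, ← hx]
    congr 1
    refine Finset.sum_congr rfl fun m _ => ?_
    rw [mul_smul_comm, smul_mul_assoc, smul_smul, smul_smul, smul_smul, mul_assoc _ (M ℓ q i m)]
    congr 1; ring
  -- The double sum is regrouped by the last factor, with `j = m + 1`. The coefficient of `P_j²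
  -- M_{j,ℓ}^* Mop_{j,ℓ}` becomes `γ_j (x^j + (x - x^j)) = x γ_j`, where `γ_j` is `gam ℓ q j`.
  rw [Finset.sum_congr rfl e, Finset.sum_add_distrib, Finset.sum_sigma',
    Finset.sum_bij' (i := fun a _ => (⟨a.2 + 1, a.1⟩ : (_ : ℕ) × ℕ))
      (j := fun a _ => (⟨a.2, a.1 - 1⟩ : (_ : ℕ) × ℕ))
      (t := (Finset.Icc 1 ℓ).sigma fun p => Finset.Icc 1 (p - 1))
      (g := fun a => ((1 - x) * gam ℓ q a.1) •
        (x ^ a.2 • (P ℓ q a.2 ^ 2 * Mst ℓ q a.2 ℓ * M ℓ q a.2 (a.1 - 1)) * Mop ℓ q a.1 ℓ))]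
  · rw [Finset.sum_sigma, ← Finset.sum_add_distrib, Finset.smul_sum]
    refine Finset.sum_congr rfl fun j hj => ?_
    rw [Finset.mem_Icc] at hj
    dsimp only
    have hj' : Finset.Icc 1 (j - 1) = Finset.Ico 1 j := by ext; simp; omega
    rw [← Finset.smul_sum, ← Finset.sum_mul, key (j - 1) (by omega), Nat.sub_add_cancel hj.1, hj',
      add_mul, add_mul, smul_mul_assoc, smul_mul_assoc, smul_mul_assoc]
    match_scalars <;> field_simp <;> ring
  · rintro ⟨a, b⟩ h; simp only [Finset.mem_sigma, Finset.mem_Icc, Finset.mem_Ico] at h ⊢; omega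
  · rintro ⟨a, b⟩ h; simp only [Finset.mem_sigma, Finset.mem_Icc, Finset.mem_Ico] at h ⊢; omega
  · rintro ⟨a, b⟩ h; rfl
  · rintro ⟨a, b⟩ h
    simp only [Finset.mem_sigma, Finset.mem_Icc] at h
    simp only [Sigma.mk.injEq, heq_eq_eq, and_true]; omega
  · rintro ⟨a, b⟩ h; rfl

/-! ### Commutators of opposite root vectors. -/

theorem Chr.Pinv_sq {i : ℕ} (h1 : 1 ≤ i) (h2 : i ≤ ℓ + 1) :
    Chr (Pinv ℓ q i ^ 2) (fun j => -(chrP ℓ i j : ℝ)) := by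
  have hc := torus_comm (Pinv_mem_torus (ℓ := ℓ) (q := q) i) (P_mem_torus i)
  refine (Chr.P_sq h1 h2).inv ?_ ?_
  · rw [← hc.symm.mul_pow, P_mul_Pinv h2, one_pow]
  · rw [← hc.mul_pow, Pinv_mul_P h2, one_pow]

/-- Since `F_i` commutes with `Mop_{i+1,ℓ}`, it suffices to bracket the diagonal commutator with
`F_i`: the weights make the `P⁻²` terms cancel and leave the `P²` term. The diagonal case is a
hypothesis because its own induction step in `Mop_mul_Mst_self` uses this lemma. -/
theorem Mop_mul_Mst_pred {i : ℕ} (h1 : 1 ≤ i) (h : i < ℓ)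
    (hd : Mop ℓ q (i + 1) ℓ * Mst ℓ q (i + 1) ℓ = Mst ℓ q (i + 1) ℓ * Mop ℓ q (i + 1) ℓ +
      (gam ℓ q (i + 1) * (qc q - (qc q)⁻¹)⁻¹) • (P ℓ q (i + 1) ^ 2 - Pinv ℓ q (i + 1) ^ 2)) :
    Mop ℓ q (i + 1) ℓ * Mst ℓ q i ℓ = Mst ℓ q i ℓ * Mop ℓ q (i + 1) ℓ +
      ((qc q)⁻¹ * gam ℓ q (i + 1)) • (P ℓ q (i + 1) ^ 2 * F ℓ q i) := by
  have hF : Mop ℓ q (i + 1) ℓ * F ℓ q i = F ℓ q i * Mop ℓ q (i + 1) ℓ :=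
    (commute_Mop h fun j h3 _ => (commute_E_F (by omega)).symm).symm
  have hchr : chrP ℓ (i + 1) i = -1 := by simp [chrP, h.ne]
  have hP : F ℓ q i * P ℓ q (i + 1) ^ 2 = (qc q)⁻¹ • (P ℓ q (i + 1) ^ 2 * F ℓ q i) := by
    rw [P_sq_mul_F (by omega) (by omega) h1 h.le, hchr]; simp [smul_smul, qc_ne]
  have hPi : F ℓ q i * Pinv ℓ q (i + 1) ^ 2 = qc q • (Pinv ℓ q (i + 1) ^ 2 * F ℓ q i) := by
    rw [(Chr.Pinv_sq (by omega) (by omega)).F i h1 h.le, hchr]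
    simp [smul_smul, qc_ne, qpow_neg_one]
  have e1 : Mop ℓ q (i + 1) ℓ * (Mst ℓ q (i + 1) ℓ * F ℓ q i) =
      Mst ℓ q (i + 1) ℓ * F ℓ q i * Mop ℓ q (i + 1) ℓ + (gam ℓ q (i + 1) * (qc q - (qc q)⁻¹)⁻¹) •
        (P ℓ q (i + 1) ^ 2 * F ℓ q i - Pinv ℓ q (i + 1) ^ 2 * F ℓ q i) := by
    rw [← mul_assoc, hd, add_mul, mul_assoc, hF, ← mul_assoc, smul_mul_assoc, sub_mul]
  have e2 : Mop ℓ q (i + 1) ℓ * (F ℓ q i * Mst ℓ q (i + 1) ℓ) =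
      F ℓ q i * Mst ℓ q (i + 1) ℓ * Mop ℓ q (i + 1) ℓ + (gam ℓ q (i + 1) * (qc q - (qc q)⁻¹)⁻¹) •
        ((qc q)⁻¹ • (P ℓ q (i + 1) ^ 2 * F ℓ q i) - qc q • (Pinv ℓ q (i + 1) ^ 2 * F ℓ q i)) := by
    rw [← mul_assoc, hF, mul_assoc, hd, mul_add, mul_smul_comm, mul_sub, hP, hPi, ← mul_assoc]
  have hq := qc_ne q
  have hq' := qc_sq_sub_one_ne q
  rw [Mst_eq h, mul_sub, mul_smul_comm, e1, e2, sub_mul, smul_mul_assoc]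
  match_scalars <;> field_simp <;> ring

/-- The analogue of the relation between `E_i` and `F_i`. Pairing `M^*` with the opposite vector
`Mop`, rather than with `M`, leaves a pure torus element on the right. -/
theorem Mop_mul_Mst_self {j : ℕ} (h1 : 1 ≤ j) (h : j ≤ ℓ) :
    Mop ℓ q j ℓ * Mst ℓ q j ℓ = Mst ℓ q j ℓ * Mop ℓ q j ℓ +
      (gam ℓ q j * (qc q - (qc q)⁻¹)⁻¹) • (P ℓ q j ^ 2 - Pinv ℓ q j ^ 2) := by
  refine downInd (k := ℓ) (p := fun j => 1 ≤ j → Mop ℓ q j ℓ * Mst ℓ q j ℓ =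
    Mst ℓ q j ℓ * Mop ℓ q j ℓ +
      (gam ℓ q j * (qc q - (qc q)⁻¹)⁻¹) • (P ℓ q j ^ 2 - Pinv ℓ q j ^ 2)) ?_ ?_ j h h1
  · intro h1
    rw [Mop_self, Mst_self, gam_last, one_mul, P_sq_eq_mul le_rfl, Pinv_sq_eq_mul le_rfl, P_last,
      Pinv_last, one_pow, mul_one, mul_one, E_mul_F_self h1 le_rfl]
  · intro j hj ih h1
    have hd := ih (by omega)
    have hp := Mop_mul_Mst_pred h1 hj hd
    have hE := E_mul_Mst (q := q) h1 hj le_rfl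
    have hEF := E_mul_F_self (q := q) h1 hj.le
    have hchr : chrP ℓ (j + 1) j = -1 := by simp [chrP, hj.ne]
    have hP : E ℓ q j * P ℓ q (j + 1) ^ 2 = qc q • (P ℓ q (j + 1) ^ 2 * E ℓ q j) := by
      rw [P_sq_mul_E (by omega) (by omega) h1 hj.le, hchr]; simp [smul_smul, qc_ne]
    have hK := Kinv_sq_mul_Mop (q := q) h1 hj le_rfl
    have hPK : P ℓ q j ^ 2 = P ℓ q (j + 1) ^ 2 * K ℓ q j ^ 2 := by
      rw [P_sq_eq_mul hj.le, (torus_comm (pow_mem (K_mem_torus j) 2) (pow_mem (P_mem_torus _) 2)).eq]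
    have hPK' : Pinv ℓ q j ^ 2 = Pinv ℓ q (j + 1) ^ 2 * Kinv ℓ q j ^ 2 := by
      rw [Pinv_sq_eq_mul hj.le,
        (torus_comm (pow_mem (Kinv_mem_torus j) 2) (pow_mem (Pinv_mem_torus _) 2)).eq]
    set a := Mop ℓ q (j + 1) ℓ
    set B := Mst ℓ q (j + 1) ℓ
    set C := Mst ℓ q j ℓ
    set e := E ℓ q j
    set f := F ℓ q j
    set p := P ℓ q (j + 1) ^ 2
    set p' := Pinv ℓ q (j + 1) ^ 2
    set k := K ℓ q j ^ 2
    set k' := Kinv ℓ q j ^ 2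
    have e1 : a * e * C = C * (a * e) + ((qc q)⁻¹ * gam ℓ q (j + 1)) • (p * (f * e)) -
        (qc q)⁻¹ • (B * a * k' + (gam ℓ q (j + 1) * (qc q - (qc q)⁻¹)⁻¹) • (p * k' - p' * k')) := by
      rw [mul_assoc, hE, mul_sub, ← mul_assoc, hp, add_mul, mul_assoc C, smul_mul_assoc, mul_assoc p,
        mul_smul_comm, ← mul_assoc a, hd, add_mul, smul_mul_assoc, sub_mul]
    have e2 : e * a * C = C * (e * a) + gam ℓ q (j + 1) • (p * (e * f)) - B * a * k' := by
      rw [mul_assoc, hp, mul_add, ← mul_assoc, hE, sub_mul, mul_assoc C, smul_mul_assoc, mul_assoc B,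
        hK, mul_smul_comm, mul_smul_comm, ← mul_assoc e, hP, smul_mul_assoc, smul_smul, smul_smul,
        inv_mul_cancel₀ (qc_ne q), one_smul, mul_assoc, mul_assoc p]
      simp only [mul_assoc]
      match_scalars <;> field_simp [qc_ne q]
    have hq := qc_ne q
    have hq' := qc_sq_sub_one_ne q
    -- The terms in `B * a * k'` cancel. Replacing `e * f` by `f * e` cancels the terms in `p * f *
    -- e`, and the remaining torus terms combine as `p (k - k') + (p - p') k' = p k - p' k'`.
    rw [Mop_eq hj, sub_mul, smul_mul_assoc, e1, e2, hEF, gam_eq hj, hPK, hPK', mul_sub, mul_smul_comm,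
      mul_add, mul_smul_comm, mul_sub]
    match_scalars <;> field_simp <;> ring

/-- For `i < j - 1` the generator `F_i` commutes with `Mop_{j,ℓ}` and with `P_j²`, so bracketing
with it merely lengthens the root vector in the correction. The induction starts at `i = j - 1`. -/
theorem Mop_mul_Mst_of_lt {i j : ℕ} (h1 : 1 ≤ i) (hij : i < j) (hj : j ≤ ℓ) :
    Mop ℓ q j ℓ * Mst ℓ q i ℓ = Mst ℓ q i ℓ * Mop ℓ q j ℓ +
      ((qc q)⁻¹ * gam ℓ q j) • (P ℓ q j ^ 2 * Mst ℓ q i (j - 1)) := by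
  obtain ⟨j, rfl⟩ : ∃ j', j = j' + 1 := ⟨j - 1, by omega⟩
  rw [Nat.add_sub_cancel]
  refine downInd (k := j) (p := fun i => 1 ≤ i → Mop ℓ q (j + 1) ℓ * Mst ℓ q i ℓ =
    Mst ℓ q i ℓ * Mop ℓ q (j + 1) ℓ +
      ((qc q)⁻¹ * gam ℓ q (j + 1)) • (P ℓ q (j + 1) ^ 2 * Mst ℓ q i j)) ?_ ?_ i (by omega) h1
  · intro h1
    rw [Mst_self]
    exact Mop_mul_Mst_pred h1 hj (Mop_mul_Mst_self (by omega) hj)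
  · intro i hi ih h1
    have ih := ih (by omega)
    have hF : Mop ℓ q (j + 1) ℓ * F ℓ q i = F ℓ q i * Mop ℓ q (j + 1) ℓ :=
      (commute_Mop hj fun k h3 _ => (commute_E_F (by omega)).symm).symm
    have hP : F ℓ q i * P ℓ q (j + 1) ^ 2 = P ℓ q (j + 1) ^ 2 * F ℓ q i := by
      rw [P_sq_mul_F (by omega) (by omega) h1 (by omega)]
      simp [chrP, show ¬ j + 1 = i by omega, show ¬ i = j by omega, show ¬ i = ℓ by omega]
    have e1 : Mop ℓ q (j + 1) ℓ * (Mst ℓ q (i + 1) ℓ * F ℓ q i) =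
        Mst ℓ q (i + 1) ℓ * F ℓ q i * Mop ℓ q (j + 1) ℓ + ((qc q)⁻¹ * gam ℓ q (j + 1)) •
          (P ℓ q (j + 1) ^ 2 * (Mst ℓ q (i + 1) j * F ℓ q i)) := by
      rw [← mul_assoc, ih, add_mul, mul_assoc, hF, ← mul_assoc, smul_mul_assoc, mul_assoc (_ ^ 2)]
    have e2 : Mop ℓ q (j + 1) ℓ * (F ℓ q i * Mst ℓ q (i + 1) ℓ) =
        F ℓ q i * Mst ℓ q (i + 1) ℓ * Mop ℓ q (j + 1) ℓ + ((qc q)⁻¹ * gam ℓ q (j + 1)) •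
          (P ℓ q (j + 1) ^ 2 * (F ℓ q i * Mst ℓ q (i + 1) j)) := by
      rw [← mul_assoc, hF, mul_assoc, ih, mul_add, mul_smul_comm, ← mul_assoc, ← mul_assoc (F ℓ q i),
        hP, mul_assoc (_ ^ 2)]
    rw [Mst_eq (by omega : i < ℓ), mul_sub, mul_smul_comm, e1, e2, Mst_eq hi, sub_mul, smul_mul_assoc,
      mul_sub, mul_smul_comm]
    module

/-! ### An automorphism exchanging `E_i` and `F_i` -/

/-- The automorphism `E_i ↔ F_i`, `K_i ↦ K_i⁻¹`, `κ ↦ κ⁻¹` on generators. -/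
def swapGen (q : Set.Ioo (0 : ℝ) 1) : Gen ℓ → U ℓ q
  | .K i => gen q (.Kinv i)
  | .Kinv i => gen q (.K i)
  | .E i => gen q (.F i)
  | .F i => gen q (.E i)
  | .kap => gen q .kapinv
  | .kapinv => gen q .kap

theorem sat_swap : Sat q (swapGen (ℓ := ℓ) q) := by
  have g := sat_gen (ℓ := ℓ) (q := q)
  constructor <;> simp only [swapGen]
  · exact g.Kinv_mul_K
  · exact g.K_mul_Kinv
  · exact g.kapinv_mul_kap
  · exact g.kap_mul_kapinv
  · exact fun i j => g.commKinvKinv i j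
  · exact fun i => g.commkapinvKinv i
  · exact g.Kinv_F
  · exact g.Kinv_E
  · exact g.kapinv_F
  · exact g.kapinv_E
  · intro i; rw [← neg_sub, g.E_F, ← smul_neg, neg_sub]
  · exact fun i j h => (g.E_F_ne j i h.symm).symm
  · exact g.serre_F
  · exact g.serre_E
  · exact g.comm_F
  · exact g.comm_E
  · exact g.root_inv

/-- The automorphism `E_i ↔ F_i`, `K_i ↦ K_i⁻¹`, `κ ↦ κ⁻¹`. -/
def swap : U ℓ q →ₐ[ℂ] U ℓ q := lift _ sat_swap

theorem swap_E (i : ℕ) : swap (E ℓ q i) = F ℓ q i := by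
  by_cases h : i ∈ Finset.Icc 1 ℓ
  · rw [E_mem h, F_mem h, swap, lift_gen]; rfl
  · rw [E_not_mem h, F_not_mem h, map_zero]

theorem swap_F (i : ℕ) : swap (F ℓ q i) = E ℓ q i := by
  by_cases h : i ∈ Finset.Icc 1 ℓ
  · rw [E_mem h, F_mem h, swap, lift_gen]; rfl
  · rw [E_not_mem h, F_not_mem h, map_zero]

theorem swap_K (i : ℕ) : swap (K ℓ q i) = Kinv ℓ q i := by
  unfold K Kinv; split_ifs
  · rw [swap, lift_gen]; rfl
  · exact map_one _

theorem swap_Kinv (i : ℕ) : swap (Kinv ℓ q i) = K ℓ q i := by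
  unfold K Kinv; split_ifs
  · rw [swap, lift_gen]; rfl
  · exact map_one _

theorem swap_P (i : ℕ) : swap (P ℓ q i) = Pinv ℓ q i := by
  simp only [P, Kprod, Pinv, map_list_prod, List.map_map]
  congr 1
  exact List.map_congr_left fun i _ => swap_K i

/-- The automorphism `swap` keeps the order of products, whereas the involution reverses it.
Therefore `M` goes to `Mopst`, not to `Mst`. -/
theorem swap_M {j k : ℕ} (h : j ≤ k) : swap (M ℓ q j k) = Mopst ℓ q j k := by
  refine downInd (p := fun j => swap (M ℓ q j k) = Mopst ℓ q j k) ?_ ?_ j h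
  · rw [M_self, Mopst_self, swap_E]
  · intro j hj ih
    rw [M_eq hj, Mopst_eq hj, map_sub, map_smul, map_mul, map_mul, ih, swap_E]

theorem swap_Mst {j k : ℕ} (h : j ≤ k) : swap (Mst ℓ q j k) = Mop ℓ q j k := by
  refine downInd (p := fun j => swap (Mst ℓ q j k) = Mop ℓ q j k) ?_ ?_ j h
  · rw [Mst_self, Mop_self, swap_F]
  · intro j hj ih
    rw [Mst_eq hj, Mop_eq hj, map_sub, map_smul, map_mul, map_mul, ih, swap_F]

theorem swap_Mop {j k : ℕ} (h : j ≤ k) : swap (Mop ℓ q j k) = Mst ℓ q j k := by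
  refine downInd (p := fun j => swap (Mop ℓ q j k) = Mst ℓ q j k) ?_ ?_ j h
  · rw [Mst_self, Mop_self, swap_E]
  · intro j hj ih
    rw [Mst_eq hj, Mop_eq hj, map_sub, map_smul, map_mul, map_mul, ih, swap_E]

/-- This is `Mop_mul_Mst_of_lt` transported by `swap`, which exchanges `Mop` with `Mst` and inverts
`P`. -/
theorem Mop_mul_Mst_of_gt {i j : ℕ} (h1 : 1 ≤ j) (hij : j < i) (hi : i ≤ ℓ) :
    Mop ℓ q j ℓ * Mst ℓ q i ℓ = Mst ℓ q i ℓ * Mop ℓ q j ℓ -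
      ((qc q)⁻¹ * gam ℓ q i) • (Pinv ℓ q i ^ 2 * Mop ℓ q j (i - 1)) := by
  have := congrArg swap (Mop_mul_Mst_of_lt (q := q) h1 hij hi)
  rw [map_mul, map_add, map_mul, map_smul, map_mul, map_pow, swap_Mop hi, swap_Mst (by omega),
    swap_Mst (by omega), swap_P] at this
  rw [this, add_sub_cancel_right]

/-- The commutator of `F_i` and the root vector `Mop i k`. -/
theorem Mop_mul_F {i : ℕ} (h1 : 1 ≤ i) (h : i < ℓ) :
    Mop ℓ q i ℓ * F ℓ q i = F ℓ q i * Mop ℓ q i ℓ + K ℓ q i ^ 2 * Mop ℓ q (i + 1) ℓ := by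
  have e := E_mul_Mst (q := q) h1 h le_rfl
  rw [← Kinv_sq_mul_Mst h1 h le_rfl] at e
  have := congrArg swap e
  rw [map_sub, map_mul, map_mul, map_mul, map_pow, swap_E, swap_Mst h.le, swap_Mst h, swap_Kinv] at this
  rw [this, sub_add_cancel]

/-- For `i < j` this is `commute_E_Mst` transported by `swap`. For `i > j` the generator `E_j` does
not occur in `Mop_{i,ℓ}`. -/
theorem commute_F_Mop {i j : ℕ} (hi : 1 ≤ i) (hij : i ≠ j) (hj : j < ℓ) (hi' : i ≤ ℓ) :
    Commute (F ℓ q j) (Mop ℓ q i ℓ) := by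
  rcases lt_or_gt_of_ne hij with h | h
  · have e := commute_E_Mst (q := q) hi h hj le_rfl
    have := congrArg swap e.eq
    rw [map_mul, map_mul, swap_E, swap_Mst hi'] at this
    exact this
  · exact commute_Mop hi' fun k h3 _ => (commute_E_F (by omega)).symm

/-! ### Counting elements of finite sets of natural numbers -/

/-- Number of elements below `a`. -/
def nlt (s : Finset ℕ) (a : ℕ) : ℕ := (s.filter (· < a)).card

/-- Number of elements above `a`. -/
def ngt (s : Finset ℕ) (a : ℕ) : ℕ := (s.filter (a < ·)).card

/-- Number of elements strictly between `a` and `b`. -/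
def nbtw (s : Finset ℕ) (a b : ℕ) : ℕ := (s.filter fun x => a < x ∧ x < b).card

/-- The set `s` with `i` replaced by `j`. -/
def move (s : Finset ℕ) (i j : ℕ) : Finset ℕ := insert j (s.erase i)

theorem nlt_add_ngt {s : Finset ℕ} {a : ℕ} (h : a ∉ s) : nlt s a + ngt s a = s.card := by
  rw [nlt, ngt, ← Finset.card_union_of_disjoint]
  · congr 1; ext x; grind
  · rw [Finset.disjoint_left]; grind

theorem nlt_add_ngt_of_mem {s : Finset ℕ} {a : ℕ} (h : a ∈ s) : nlt s a + ngt s a + 1 = s.card := by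
  have e1 : nlt s a = nlt (s.erase a) a := by unfold nlt; congr 1; ext x; grind
  have e2 : ngt s a = ngt (s.erase a) a := by unfold ngt; congr 1; ext x; grind
  rw [e1, e2, nlt_add_ngt (Finset.notMem_erase a s), Finset.card_erase_add_one h]

theorem nlt_insert {s : Finset ℕ} {j : ℕ} (a : ℕ) (h : j ∉ s) :
    nlt (insert j s) a = nlt s a + if j < a then 1 else 0 := by
  unfold nlt
  rw [Finset.filter_insert]
  split_ifs
  · rw [Finset.card_insert_of_notMem (by simp [h])]
  · rfl

theorem ngt_insert {s : Finset ℕ} {j : ℕ} (a : ℕ) (h : j ∉ s) :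
    ngt (insert j s) a = ngt s a + if a < j then 1 else 0 := by
  unfold ngt
  rw [Finset.filter_insert]
  split_ifs
  · rw [Finset.card_insert_of_notMem (by simp [h])]
  · rfl

theorem nlt_erase {s : Finset ℕ} {j : ℕ} (a : ℕ) (h : j ∈ s) :
    nlt (s.erase j) a + (if j < a then 1 else 0) = nlt s a := by
  rw [← nlt_insert a (Finset.notMem_erase j s), Finset.insert_erase h]

theorem ngt_eq {s : Finset ℕ} {i j : ℕ} (h : i < j) :
    ngt s i = nbtw s i j + (if j ∈ s then 1 else 0) + ngt s j := by
  have e : s.filter (i < ·) = (s.filter fun x => i < x ∧ x < j) ∪ (s.filter (· = j)) ∪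
      s.filter (j < ·) := by ext x; grind
  rw [ngt, e, Finset.card_union_of_disjoint, Finset.card_union_of_disjoint, Finset.filter_eq']
  · unfold nbtw ngt; split_ifs <;> simp
  · rw [Finset.disjoint_left]; grind
  · rw [Finset.disjoint_left]; grind

theorem nlt_eq {s : Finset ℕ} {i j : ℕ} (h : i < j) :
    nlt s j = nlt s i + (if i ∈ s then 1 else 0) + nbtw s i j := by
  have e : s.filter (· < j) = (s.filter (· < i)) ∪ (s.filter (· = i)) ∪
      (s.filter fun x => i < x ∧ x < j) := by ext x; grind
  rw [nlt, e, Finset.card_union_of_disjoint, Finset.card_union_of_disjoint, Finset.filter_eq']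
  · unfold nbtw nlt; split_ifs <;> simp
  · rw [Finset.disjoint_left]; grind
  · rw [Finset.disjoint_left]; grind

theorem nbtw_congr {s t : Finset ℕ} {a b a' b' : ℕ}
    (h : ∀ x, (x ∈ s ∧ a < x ∧ x < b) ↔ (x ∈ t ∧ a' < x ∧ x < b')) : nbtw s a b = nbtw t a' b' := by
  unfold nbtw; congr 1; ext x; simpa using h x

/-- As `i` runs through `u`, the number of elements above it takes each of the values `0, …, |u| -
1` once. -/
theorem geom_sum_ngt (x : ℂ) (u : Finset ℕ) : (1 - x) * ∑ i ∈ u, x ^ ngt u i = 1 - x ^ u.card := by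
  induction u using Finset.induction_on_min with
  | empty => simp
  | insert a u ha ih =>
    have hau : a ∉ u := fun h => lt_irrefl _ (ha a h)
    have e1 : ngt u a = u.card := by
      unfold ngt; congr 1; ext x; simpa using ha x
    have e2 : ∑ i ∈ u, x ^ ngt (insert a u) i = ∑ i ∈ u, x ^ ngt u i := by
      refine Finset.sum_congr rfl fun i hi => ?_
      rw [ngt_insert _ hau, if_neg (ha i hi).not_gt, add_zero]
    rw [Finset.sum_insert hau, mul_add, e2, ih, ngt_insert _ hau, if_neg (lt_irrefl a), add_zero, e1,
      Finset.card_insert_of_notMem hau]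
    ring

theorem geom_sum_nlt (x : ℂ) (u : Finset ℕ) : (1 - x) * ∑ i ∈ u, x ^ nlt u i = 1 - x ^ u.card := by
  induction u using Finset.induction_on_max with
  | empty => simp
  | insert a u ha ih =>
    have hau : a ∉ u := fun h => lt_irrefl _ (ha a h)
    have e1 : nlt u a = u.card := by
      unfold nlt; congr 1; ext x; simpa using ha x
    have e2 : ∑ i ∈ u, x ^ nlt (insert a u) i = ∑ i ∈ u, x ^ nlt u i := by
      refine Finset.sum_congr rfl fun i hi => ?_
      rw [nlt_insert _ hau, if_neg (ha i hi).not_gt, add_zero]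
    rw [Finset.sum_insert hau, mul_add, e2, ih, nlt_insert _ hau, if_neg (lt_irrefl a), add_zero, e1,
      Finset.card_insert_of_notMem hau]
    ring

/-- Within the part of `s` below `j`, the elements between `i` and `j` are exactly those above `i`,
so `geom_sum_ngt` applies. -/
theorem geom_sum_below (x : ℂ) (s : Finset ℕ) (j : ℕ) :
    (1 - x) * ∑ i ∈ s.filter (· < j), x ^ nbtw s i j = 1 - x ^ nlt s j := by
  rw [nlt, ← geom_sum_ngt x (s.filter (· < j))]
  congr 1
  refine Finset.sum_congr rfl fun i hi => ?_
  congr 1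
  unfold nbtw ngt; congr 1; ext x; grind

theorem geom_sum_above (x : ℂ) (s : Finset ℕ) (j : ℕ) :
    (1 - x) * ∑ i ∈ s.filter (j < ·), x ^ nbtw s j i = 1 - x ^ ngt s j := by
  rw [ngt, ← geom_sum_nlt x (s.filter (j < ·))]
  congr 1
  refine Finset.sum_congr rfl fun i hi => ?_
  congr 1
  unfold nbtw nlt; congr 1; ext x; grind

/-- The elements `j` of the complement of `s` are enumerated by `j - #{i ∈ s | i < j}`. -/
theorem sum_compl_pow (y : ℂ) {n : ℕ} {s : Finset ℕ} (hs : s ⊆ Finset.Icc 1 n) :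
    ∑ j ∈ Finset.Icc 1 n \ s, y ^ (j - nlt s j) = ∑ r ∈ Finset.Icc 1 (n - s.card), y ^ r := by
  have key : ∀ m, m ≤ n → (s ∩ Finset.Icc 1 m).card ≤ m ∧
      ∑ j ∈ Finset.Icc 1 m \ s, y ^ (j - nlt s j) =
        ∑ r ∈ Finset.Icc 1 (m - (s ∩ Finset.Icc 1 m).card), y ^ r := by
    intro m hm
    have hle : ∀ m, (s ∩ Finset.Icc 1 m).card ≤ m := fun m =>
      (Finset.card_le_card Finset.inter_subset_right).trans (by simp)
    refine ⟨hle m, ?_⟩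
    induction m with
    | zero => simp
    | succ m ih =>
      have e0 : Finset.Icc 1 (m + 1) = insert (m + 1) (Finset.Icc 1 m) := by ext x; simp; omega
      have e1 : nlt s (m + 1) = (s ∩ Finset.Icc 1 m).card := by
        unfold nlt; congr 1; ext x
        simp only [Finset.mem_filter, Finset.mem_inter, Finset.mem_Icc]
        constructor
        · intro h; have := Finset.mem_Icc.1 (hs h.1); exact ⟨h.1, by omega⟩
        · intro h; exact ⟨h.1, by omega⟩
      have hm' := hle m
      by_cases h : m + 1 ∈ s
      · rw [e0, Finset.insert_sdiff_of_mem _ h, ih (by omega), Finset.inter_insert_of_mem h,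
          Finset.card_insert_of_notMem (by simp), Nat.add_sub_add_right]
      · rw [e0, Finset.insert_sdiff_of_notMem _ h, Finset.sum_insert (by simp), ih (by omega),
          Finset.inter_insert_of_notMem h, e1, Nat.sub_add_comm hm', Finset.sum_Icc_succ_top (by omega),
          add_comm]
  have := (key n le_rfl).2
  rwa [Finset.inter_eq_left.2 hs] at this

theorem nlt_lt {n : ℕ} {s : Finset ℕ} (hs : s ⊆ Finset.Icc 1 n) {j : ℕ} (hj : 1 ≤ j) :
    nlt s j < j := by
  have : nlt s j ≤ (Finset.Icc 1 (j - 1)).card := Finset.card_le_card fun x hx => by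
    rw [Finset.mem_filter] at hx
    have := Finset.mem_Icc.1 (hs hx.1)
    rw [Finset.mem_Icc]; omega
  rw [Nat.card_Icc] at this
  omega

/-! ### Right modules and equivariant families -/

/-- A right module over `U`. -/
structure RAct (ℓ : ℕ) (q : Set.Ioo (0 : ℝ) 1) (V : Type*) [AddCommGroup V] [Module ℂ V] where
  act : V →ₗ[ℂ] U ℓ q →ₗ[ℂ] V
  act_mul : ∀ v g h, act v (g * h) = act (act v g) h
  act_one : ∀ v, act v 1 = v

variable {V : Type*} [AddCommGroup V] [Module ℂ V]

/-- The twist of a right module by the automorphism `swap`. -/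
def RAct.twist (r : RAct ℓ q V) : RAct ℓ q V where
  act := r.act.compl₂ swap.toLinearMap
  act_mul v g h := by simp [r.act_mul]
  act_one v := by simp [r.act_one]

theorem RAct.twist_act (r : RAct ℓ q V) (v : V) (h : U ℓ q) : r.twist.act v h = r.act v (swap h) := rfl

/-- The elements `E_j` with `j < ℓ` act on the components of `ω` as on the exterior algebra. -/
def EInv (r : RAct ℓ q V) (ω : Finset ℕ → V) : Prop :=
  ∀ j, 1 ≤ j → j < ℓ → ∀ s ⊆ Finset.Icc 1 ℓ,
    r.act (ω s) (E ℓ q j) = if j ∈ s ∧ j + 1 ∉ s then ω (move s j (j + 1)) else 0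

/-- The elements `F_j` with `j < ℓ` act on the components of `ω` as on the exterior algebra. -/
def FInv (r : RAct ℓ q V) (ω : Finset ℕ → V) : Prop :=
  ∀ j, 1 ≤ j → j < ℓ → ∀ s ⊆ Finset.Icc 1 ℓ,
    r.act (ω s) (F ℓ q j) = if j + 1 ∈ s ∧ j ∉ s then ω (move s (j + 1) j) else 0

/-- The components of `ω` are eigenvectors of `P_j ^ 2`, with the exponents of the exterior algebra
shifted by `d`. -/
def PWt (r : RAct ℓ q V) (d : ℤ) (ω : Finset ℕ → V) : Prop :=
  ∀ j, 1 ≤ j → j ≤ ℓ → ∀ s ⊆ Finset.Icc 1 ℓ,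
    r.act (ω s) (P ℓ q j ^ 2) = qc q ^ ((if j ∈ s then 1 else 0) + d) • ω s

theorem move_subset {n : ℕ} {s : Finset ℕ} (hs : s ⊆ Finset.Icc 1 n) {i j : ℕ} (h1 : 1 ≤ j)
    (h2 : j ≤ n) : move s i j ⊆ Finset.Icc 1 n := by
  intro x hx
  rw [move, Finset.mem_insert, Finset.mem_erase] at hx
  rcases hx with rfl | hx
  · exact Finset.mem_Icc.2 ⟨h1, h2⟩
  · exact hs hx.2

/-- The iterated bracket carries the element `j` up to `m + 1`, with a factor `-q⁻¹` for each
element of `s` that it jumps over. In the induction, if `j + 1 ∈ s` only the second term of the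
bracket contributes, and this is the source of the factor; otherwise only the first one does. -/
theorem EInv.act_M {r : RAct ℓ q V} {ω : Finset ℕ → V} (hE : EInv r ω) {j m : ℕ} (h1 : 1 ≤ j)
    (hjm : j ≤ m) (hm : m < ℓ) {s : Finset ℕ} (hs : s ⊆ Finset.Icc 1 ℓ) :
    r.act (ω s) (M ℓ q j m) = if j ∈ s ∧ m + 1 ∉ s then
      (-(qc q)⁻¹) ^ nbtw s j (m + 1) • ω (move s j (m + 1)) else 0 := by
  refine downInd (k := m) (p := fun j => 1 ≤ j → ∀ s ⊆ Finset.Icc 1 ℓ,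
    r.act (ω s) (M ℓ q j m) = if j ∈ s ∧ m + 1 ∉ s then
      (-(qc q)⁻¹) ^ nbtw s j (m + 1) • ω (move s j (m + 1)) else 0) ?_ ?_ j hjm h1 s hs
  · intro h1 s hs
    rw [M_self, hE m h1 hm s hs]
    have : nbtw s m (m + 1) = 0 := by
      unfold nbtw; rw [Finset.card_eq_zero]; ext x; grind
    rw [this, pow_zero, one_smul]
  · intro j hj ih h1 s hs
    have ih := ih (by omega)
    rw [M_eq hj, map_sub, map_smul, r.act_mul, r.act_mul, hE j h1 (by omega) s hs, ih s hs]
    by_cases ha : j ∈ s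
    · by_cases hb : j + 1 ∈ s
      · rw [if_neg (by tauto), map_zero, LinearMap.zero_apply, zero_sub]
        by_cases hc : m + 1 ∈ s
        · rw [if_neg (by tauto), if_neg (by tauto)]; simp
        · rw [if_pos ⟨hb, hc⟩, if_pos ⟨ha, hc⟩, map_smul, LinearMap.smul_apply,
            hE j h1 (by omega) _ (move_subset hs (by omega) (by omega)), if_pos (by
              unfold move; grind)]
          have e1 : move (move s (j + 1) (m + 1)) j (j + 1) = move s j (m + 1) := by
            ext x; unfold move; grind
          have e2 : nbtw s j (m + 1) = nbtw s (j + 1) (m + 1) + 1 := by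
            have e : s.filter (fun x => j < x ∧ x < m + 1) =
                insert (j + 1) (s.filter fun x => j + 1 < x ∧ x < m + 1) := by ext x; grind
            rw [nbtw, e, Finset.card_insert_of_notMem (by simp)]; rfl
          rw [e1, e2, smul_smul, pow_succ', ← neg_smul, neg_mul_eq_neg_mul]
      · rw [if_pos ⟨ha, hb⟩, if_neg (by tauto : ¬ (j + 1 ∈ s ∧ m + 1 ∉ s)), map_zero,
          LinearMap.zero_apply, smul_zero, sub_zero, ih _ (move_subset hs (by omega) (by omega))]
        have e0 : (j + 1 ∈ move s j (j + 1) ∧ m + 1 ∉ move s j (j + 1)) ↔ (j ∈ s ∧ m + 1 ∉ s) := by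
          unfold move; grind
        have e1 : move (move s j (j + 1)) (j + 1) (m + 1) = move s j (m + 1) := by
          ext x; unfold move; grind
        have e2 : nbtw (move s j (j + 1)) (j + 1) (m + 1) = nbtw s j (m + 1) :=
          nbtw_congr fun x => by unfold move; grind
        simp only [e0, e1, e2]
    · rw [if_neg (by tauto), if_neg (by tauto : ¬ (j ∈ s ∧ m + 1 ∉ s)), map_zero,
        LinearMap.zero_apply, zero_sub, neg_eq_zero]
      split_ifs with hc
      · rw [map_smul, LinearMap.smul_apply, hE j h1 (by omega) _ (move_subset hs (by omega) (by omega)),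
          if_neg (by unfold move; grind)]
        simp
      · simp

/-- The reverse move, from `m + 1` down to `j`. Again the presence of `j + 1` in `s` decides which
term of the bracket survives. -/
theorem FInv.act_Mst {r : RAct ℓ q V} {ω : Finset ℕ → V} (hF : FInv r ω) {j m : ℕ} (h1 : 1 ≤ j)
    (hjm : j ≤ m) (hm : m < ℓ) {s : Finset ℕ} (hs : s ⊆ Finset.Icc 1 ℓ) :
    r.act (ω s) (Mst ℓ q j m) = if m + 1 ∈ s ∧ j ∉ s then
      (-(qc q)⁻¹) ^ nbtw s j (m + 1) • ω (move s (m + 1) j) else 0 := by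
  refine downInd (k := m) (p := fun j => 1 ≤ j → ∀ s ⊆ Finset.Icc 1 ℓ,
    r.act (ω s) (Mst ℓ q j m) = if m + 1 ∈ s ∧ j ∉ s then
      (-(qc q)⁻¹) ^ nbtw s j (m + 1) • ω (move s (m + 1) j) else 0) ?_ ?_ j hjm h1 s hs
  · intro h1 s hs
    rw [Mst_self, hF m h1 hm s hs]
    have : nbtw s m (m + 1) = 0 := by
      unfold nbtw; rw [Finset.card_eq_zero]; ext x; grind
    rw [this, pow_zero, one_smul]
  · intro j hj ih h1 s hs
    have ih := ih (by omega)
    rw [Mst_eq hj, map_sub, map_smul, r.act_mul, r.act_mul, hF j h1 (by omega) s hs, ih s hs]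
    by_cases ha : j ∈ s
    · rw [if_neg (by tauto : ¬ (j + 1 ∈ s ∧ j ∉ s)), if_neg (by tauto : ¬ (m + 1 ∈ s ∧ j ∉ s)),
        map_zero, LinearMap.zero_apply, smul_zero, sub_zero]
      split_ifs with hc
      · rw [map_smul, LinearMap.smul_apply, hF j h1 (by omega) _ (move_subset hs (by omega) (by omega)),
          if_neg (by unfold move; grind), smul_zero]
      · simp
    · by_cases hb : j + 1 ∈ s
      · rw [if_neg (by tauto : ¬ (m + 1 ∈ s ∧ j + 1 ∉ s)), if_pos ⟨hb, ha⟩, map_zero,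
          LinearMap.zero_apply, zero_sub, ih _ (move_subset hs (by omega) (by omega))]
        have e0 : (m + 1 ∈ move s (j + 1) j ∧ j + 1 ∉ move s (j + 1) j) ↔ (m + 1 ∈ s ∧ j ∉ s) := by
          unfold move; grind
        have e1 : move (move s (j + 1) j) (m + 1) (j + 1) = move s (m + 1) j := by
          ext x; unfold move; grind
        have e2 : nbtw s j (m + 1) = nbtw (move s (j + 1) j) (j + 1) (m + 1) + 1 := by
          have e : s.filter (fun x => j < x ∧ x < m + 1) =
              insert (j + 1) ((move s (j + 1) j).filter fun x => j + 1 < x ∧ x < m + 1) := by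
            ext x; unfold move; grind
          rw [nbtw, e, Finset.card_insert_of_notMem (by simp)]; rfl
        simp only [e0, e2]
        split_ifs
        · rw [e1, smul_smul, pow_succ', ← neg_smul, neg_mul_eq_neg_mul]
        · simp
      · rw [if_neg (by tauto : ¬ (j + 1 ∈ s ∧ j ∉ s)), map_zero, LinearMap.zero_apply, smul_zero,
          sub_zero]
        by_cases hc : m + 1 ∈ s
        · rw [if_pos ⟨hc, hb⟩, if_pos ⟨hc, ha⟩, map_smul, LinearMap.smul_apply,
            hF j h1 (by omega) _ (move_subset hs (by omega) (by omega)), if_pos (by unfold move; grind)]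
          have e1 : move (move s (m + 1) (j + 1)) (j + 1) j = move s (m + 1) j := by
            ext x; unfold move; grind
          have e2 : nbtw s (j + 1) (m + 1) = nbtw s j (m + 1) := nbtw_congr fun x => by grind
          rw [e1, e2]
        · rw [if_neg (by tauto), if_neg (by tauto)]; simp

/-! ### Complements -/

/-- The family of the components with complementary indices. -/
def compl {V : Type*} (ℓ : ℕ) (ω : Finset ℕ → V) (s : Finset ℕ) : V := ω (Finset.Icc 1 ℓ \ s)

theorem compl_compl {V : Type*} {ω : Finset ℕ → V} {s : Finset ℕ} (hs : s ⊆ Finset.Icc 1 ℓ) :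
    compl ℓ ω (Finset.Icc 1 ℓ \ s) = ω s := by
  rw [compl, Finset.sdiff_sdiff_eq_self hs]

theorem Icc_sdiff_move {s : Finset ℕ} (hs : s ⊆ Finset.Icc 1 ℓ) {i j : ℕ} (hi : i ∈ s) (hj : j ∉ s)
    (hj' : j ∈ Finset.Icc 1 ℓ) :
    Finset.Icc 1 ℓ \ move s i j = move (Finset.Icc 1 ℓ \ s) j i := by
  have := hs hi
  ext x; unfold move
  simp only [Finset.mem_sdiff, Finset.mem_insert, Finset.mem_erase]
  by_cases h1 : x = i <;> by_cases h2 : x = j <;> subst_vars <;> tauto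

/-- Moving `j + 1` to `j` in the complement is moving `j` to `j + 1` in the set, and the twist
exchanges `E_j` with `F_j`. -/
theorem FInv.compl {r : RAct ℓ q V} {ω : Finset ℕ → V} (hF : FInv r ω) :
    EInv r.twist (compl ℓ ω) := by
  intro j h1 h2 s hs
  have hj : j ∈ Finset.Icc 1 ℓ := Finset.mem_Icc.2 (by omega)
  have hj' : j + 1 ∈ Finset.Icc 1 ℓ := Finset.mem_Icc.2 (by omega)
  rw [RAct.twist_act, swap_E, QProj.compl, hF j h1 h2 _ Finset.sdiff_subset]
  have e : (j + 1 ∈ Finset.Icc 1 ℓ \ s ∧ j ∉ Finset.Icc 1 ℓ \ s) ↔ (j ∈ s ∧ j + 1 ∉ s) := by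
    simp only [Finset.mem_sdiff]; tauto
  simp only [e]
  split_ifs with h
  · rw [QProj.compl, Icc_sdiff_move hs h.1 h.2 hj']
  · rfl

theorem EInv.compl {r : RAct ℓ q V} {ω : Finset ℕ → V} (hE : EInv r ω) :
    FInv r.twist (compl ℓ ω) := by
  intro j h1 h2 s hs
  have hj : j ∈ Finset.Icc 1 ℓ := Finset.mem_Icc.2 (by omega)
  have hj' : j + 1 ∈ Finset.Icc 1 ℓ := Finset.mem_Icc.2 (by omega)
  rw [RAct.twist_act, swap_F, QProj.compl, hE j h1 h2 _ Finset.sdiff_subset]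
  have e : (j ∈ Finset.Icc 1 ℓ \ s ∧ j + 1 ∉ Finset.Icc 1 ℓ \ s) ↔ (j + 1 ∈ s ∧ j ∉ s) := by
    simp only [Finset.mem_sdiff]; tauto
  simp only [e]
  split_ifs with h
  · rw [QProj.compl, Icc_sdiff_move hs h.1 h.2 hj]
  · rfl

theorem P_sq_mul_Pinv_sq {i : ℕ} (h : i ≤ ℓ + 1) : P ℓ q i ^ 2 * Pinv ℓ q i ^ 2 = 1 := by
  rw [← (torus_comm (P_mem_torus i) (Pinv_mem_torus i)).mul_pow, P_mul_Pinv h, one_pow]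

theorem PWt.act_Pinv {r : RAct ℓ q V} {d : ℤ} {ω : Finset ℕ → V} (hP : PWt r d ω) {j : ℕ}
    (h1 : 1 ≤ j) (h2 : j ≤ ℓ) {s : Finset ℕ} (hs : s ⊆ Finset.Icc 1 ℓ) :
    r.act (ω s) (Pinv ℓ q j ^ 2) = qc q ^ (-((if j ∈ s then 1 else 0) + d)) • ω s := by
  have h := congrArg (fun v => r.act v (Pinv ℓ q j ^ 2)) (hP j h1 h2 s hs)
  simp only [← r.act_mul, map_smul, LinearMap.smul_apply] at h
  rw [P_sq_mul_Pinv_sq (by omega), r.act_one] at h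
  conv_rhs => rw [h]
  rw [smul_smul, ← zpow_add₀ (qc_ne q), neg_add_cancel, zpow_zero, one_smul]

/-- The complement replaces the indicator of `j ∈ s` by one minus it, and the twist changes the sign
of the exponent: `-(1 - 1_{j∈s} + d) = 1_{j∈s} + (-d - 1)`. -/
theorem PWt.compl {r : RAct ℓ q V} {d : ℤ} {ω : Finset ℕ → V} (hP : PWt r d ω) :
    PWt r.twist (-d - 1) (compl ℓ ω) := by
  intro j h1 h2 s hs
  have hj : j ∈ Finset.Icc 1 ℓ := Finset.mem_Icc.2 (by omega)
  rw [RAct.twist_act, map_pow, swap_P, QProj.compl, hP.act_Pinv h1 h2 Finset.sdiff_subset]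
  congr 2
  by_cases h : j ∈ s <;> simp [h, -Finset.mem_Icc, hj, sub_eq_add_neg]

/-- The shift `d` drops out of the quotient of `P_j²` by `P_{j+1}²`. -/
theorem PWt.act_K {r : RAct ℓ q V} {d : ℤ} {ω : Finset ℕ → V} (hP : PWt r d ω) {j : ℕ}
    (h1 : 1 ≤ j) (h2 : j < ℓ) {s : Finset ℕ} (hs : s ⊆ Finset.Icc 1 ℓ) :
    r.act (ω s) (K ℓ q j ^ 2) =
      qc q ^ ((if j ∈ s then (1 : ℤ) else 0) - (if j + 1 ∈ s then 1 else 0)) • ω s := by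
  have h := hP j h1 h2.le s hs
  rw [P_sq_eq_mul h2.le, (torus_comm (pow_mem (K_mem_torus j) 2) (pow_mem (P_mem_torus _) 2)).eq,
    r.act_mul, hP (j + 1) (by omega) h2 s hs, map_smul, LinearMap.smul_apply] at h
  have := congrArg (fun v => qc q ^ (-((if j + 1 ∈ s then 1 else 0) + d)) • v) h
  simp only [smul_smul, ← zpow_add₀ (qc_ne q)] at this
  rw [neg_add_cancel, zpow_zero, one_smul] at this
  rw [this]; congr 2; abel

/-- Duality reduces this to `FInv.act_Mst` on the complementary family. Hence the opposite root
vector picks up `-q⁻¹` for the intermediate indices that are not in `s`. -/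
theorem EInv.act_Mop {r : RAct ℓ q V} {ω : Finset ℕ → V} (hE : EInv r ω) {j m : ℕ} (h1 : 1 ≤ j)
    (hjm : j ≤ m) (hm : m < ℓ) {s : Finset ℕ} (hs : s ⊆ Finset.Icc 1 ℓ) (hj : j ∈ s)
    (hm' : m + 1 ∉ s) :
    r.act (ω s) (Mop ℓ q j m) =
      (-(qc q)⁻¹) ^ nbtw (Finset.Icc 1 ℓ \ s) j (m + 1) • ω (move s j (m + 1)) := by
  have hm1 : m + 1 ∈ Finset.Icc 1 ℓ := Finset.mem_Icc.2 (by omega)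
  have h := hE.compl.act_Mst h1 hjm hm (s := Finset.Icc 1 ℓ \ s) Finset.sdiff_subset
  rw [RAct.twist_act, swap_Mst hjm, compl_compl hs, if_pos (by simp only [Finset.mem_sdiff]; tauto),
    ← Icc_sdiff_move hs hj hm' hm1, compl_compl (move_subset hs (by omega) (by omega))] at h
  exact h

/-! ### The exterior derivative and its adjoint -/

/-- The exterior derivative, with the generators multiplied from the right. -/
def dR (r : RAct ℓ q V) (ω : Finset ℕ → V) (s : Finset ℕ) : V :=
  ∑ i ∈ s, (-(qc q)⁻¹) ^ ngt s i • r.act (ω (s.erase i)) (Mst ℓ q i ℓ)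

/-- The exterior derivative, with the generators multiplied from the left. -/
def dL (r : RAct ℓ q V) (ω : Finset ℕ → V) (s : Finset ℕ) : V :=
  ∑ i ∈ s, ((-(qc q)⁻¹) ^ nlt s i * (-qc q) ^ (ℓ - i)) • r.act (ω (s.erase i)) (Mopst ℓ q i ℓ)

/-- The adjoint of the exterior derivative. -/
def dlt (r : RAct ℓ q V) (η : Finset ℕ → V) (s : Finset ℕ) : V :=
  ∑ j ∈ Finset.Icc 1 ℓ \ s,
    ((-(qc q)⁻¹) ^ nlt s j * gam ℓ q j) • r.act (η (insert j s)) (Mop ℓ q j ℓ)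

theorem sum_Ico_succ_ite {W : Type*} [AddCommMonoid W] {n : ℕ} {s : Finset ℕ}
    (hs : s ⊆ Finset.Icc 1 n) (i : ℕ) (f : ℕ → W) :
    ∑ m ∈ Finset.Ico i n, (if m + 1 ∈ s then f (m + 1) else 0) = ∑ j ∈ s.filter (i < ·), f j := by
  rw [← Finset.sum_filter]
  refine Finset.sum_nbij' (· + 1) (· - 1) ?_ ?_ ?_ ?_ ?_
  · intro m hm; simp only [Finset.mem_filter, Finset.mem_Ico] at hm ⊢; exact ⟨hm.2, by omega⟩
  · intro j hj
    simp only [Finset.mem_filter, Finset.mem_Ico] at hj ⊢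
    have := Finset.mem_Icc.1 (hs hj.1)
    rw [show j - 1 + 1 = j by omega]
    exact ⟨by omega, hj.1⟩
  · intro m _; simp
  · intro j hj
    simp only [Finset.mem_filter] at hj
    omega
  · intro m _; rfl

theorem neg_qc_inv_pow_mul (q : Set.Ioo (0 : ℝ) 1) (n : ℕ) : (-(qc q)⁻¹) ^ n * (-qc q) ^ n = 1 := by
  rw [← mul_pow, neg_mul_neg, inv_mul_cancel₀ (qc_ne q), one_pow]

/-- The two forms of the exterior derivative agree up to a factor. -/
theorem FInv.dR_eq {r : RAct ℓ q V} {ω : Finset ℕ → V} (hF : FInv r ω) {s : Finset ℕ}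
    (hs : s ⊆ Finset.Icc 1 ℓ) : dR r ω s = (-(qc q)⁻¹) ^ (s.card - 1) • dL r ω s := by
  have hq := qc_ne q
  set c := -(qc q)⁻¹ with hc
  set g : ℕ → V := fun j => (-qc q) ^ (ℓ - j) • r.act (ω (s.erase j)) (Mopst ℓ q j ℓ) with hg
  -- In the expansion of `M_{i,ℓ}^*`, the factor `M_{i,m}^*` acts on the component `s \ {i}` by
  -- replacing `m + 1` with `i`. The result is the component `s \ {m + 1}`, so each correction is a
  -- multiple of the term `j = m + 1` of `dL`.
  have h1 : ∀ i ∈ s, c ^ ngt s i • r.act (ω (s.erase i)) (Mst ℓ q i ℓ) =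
      c ^ ngt s i • g i + ∑ j ∈ s.filter (i < ·),
        ((qc q - (qc q)⁻¹) * c ^ ngt s i * c ^ nbtw s i j) • g j := by
    intro i hi
    have hi' := Finset.mem_Icc.1 (hs hi)
    rw [Mst_expand hi'.2, map_add, smul_add, map_smul]
    congr 1
    rw [map_smul, map_sum, smul_smul, Finset.smul_sum, ← sum_Ico_succ_ite hs i]
    refine Finset.sum_congr rfl fun m hm => ?_
    rw [Finset.mem_Ico] at hm
    rw [map_smul, r.act_mul, hF.act_Mst (by omega) hm.1 hm.2 ((Finset.erase_subset _ _).trans hs)]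
    have e0 : (m + 1 ∈ s.erase i ∧ i ∉ s.erase i) ↔ m + 1 ∈ s := by
      simp only [Finset.mem_erase]; constructor
      · tauto
      · intro h; exact ⟨⟨by omega, h⟩, by tauto⟩
    simp only [e0]
    split_ifs with h
    · have e1 : move (s.erase i) (m + 1) i = s.erase (m + 1) := by
        ext x; unfold move; grind
      have e2 : nbtw (s.erase i) i (m + 1) = nbtw s i (m + 1) := nbtw_congr fun x => by grind
      rw [e1, e2, map_smul, LinearMap.smul_apply, hg]
      simp only [smul_smul, ← hc]
      congr 1; ring
    · simp
  rw [dR, Finset.sum_congr rfl h1, Finset.sum_add_distrib]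
  have h2 : ∑ i ∈ s, ∑ j ∈ s.filter (i < ·), ((qc q - (qc q)⁻¹) * c ^ ngt s i * c ^ nbtw s i j) • g j =
      ∑ j ∈ s, ∑ i ∈ s.filter (· < j), ((qc q - (qc q)⁻¹) * c ^ ngt s i * c ^ nbtw s i j) • g j :=
    Finset.sum_comm' fun i j => by simp only [Finset.mem_filter]; tauto
  rw [h2, ← Finset.sum_add_distrib, dL, Finset.smul_sum]
  refine Finset.sum_congr rfl fun j hj => ?_
  rw [← Finset.sum_smul, ← add_smul]
  simp only [hg, smul_smul]
  congr 1
  rw [← mul_assoc]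
  congr 1
  -- The contributions to the term `j` from all `i < j` sum to `-c^{ngt s j} (1 - c^{2 nlt s j})`.
  -- Adding the term's own coefficient leaves `c^{ngt s j + 2 nlt s j}`, that is `c^{|s| - 1}` times
  -- the coefficient `c^{nlt s j}` in `dL`.
  have h3 : ∑ i ∈ s.filter (· < j), (qc q - (qc q)⁻¹) * c ^ ngt s i * c ^ nbtw s i j =
      -c ^ ngt s j * ((1 - c ^ 2) * ∑ i ∈ s.filter (· < j), (c ^ 2) ^ nbtw s i j) := by
    rw [Finset.mul_sum, Finset.mul_sum]
    refine Finset.sum_congr rfl fun i hi => ?_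
    rw [Finset.mem_filter] at hi
    rw [ngt_eq hi.2, if_pos hj, pow_add, pow_succ, ← pow_mul, two_mul, pow_add]
    have : (qc q - (qc q)⁻¹) * c = -(1 - c ^ 2) := by rw [hc]; field_simp
    linear_combination c ^ nbtw s i j * c ^ ngt s j * c ^ nbtw s i j * this
  rw [h3, geom_sum_below, ← nlt_add_ngt_of_mem hj, Nat.add_sub_cancel, ← hc, pow_add, ← pow_mul, two_mul, pow_add]
  ring1

/-- Needed in order to apply `FInv.dR_eq` to `dlt r ω`. The generator `F_m` commutes with every
`Mop_{j,ℓ}` except `j = m`, where the commutator is `K_m² Mop_{m+1,ℓ}`. -/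
theorem PWt.FInv_dlt {r : RAct ℓ q V} {d : ℤ} {ω : Finset ℕ → V} (hP : PWt r d ω) (hF : FInv r ω) :
    FInv r (dlt r ω) := by
  intro m h1 hm s hs
  have hq := qc_ne q
  have hmI : m ∈ Finset.Icc 1 ℓ := Finset.mem_Icc.2 (by omega)
  have hmI' : m + 1 ∈ Finset.Icc 1 ℓ := Finset.mem_Icc.2 (by omega)
  have hins : ∀ j ∈ Finset.Icc 1 ℓ \ s, insert j s ⊆ Finset.Icc 1 ℓ := fun j hj =>
    Finset.insert_subset (Finset.mem_sdiff.1 hj).1 hs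
  have key : ∀ j ∈ Finset.Icc 1 ℓ \ s, j ≠ m → r.act (r.act (ω (insert j s)) (Mop ℓ q j ℓ)) (F ℓ q m) =
      if m + 1 ∈ insert j s ∧ m ∉ s then r.act (ω (move (insert j s) (m + 1) m)) (Mop ℓ q j ℓ) else 0 := by
    intro j hj hne
    have hj' := Finset.mem_Icc.1 (Finset.mem_sdiff.1 hj).1
    rw [← r.act_mul, ← (commute_F_Mop hj'.1 hne hm hj'.2).eq, r.act_mul, hF m h1 hm _ (hins j hj)]
    have e : (m + 1 ∈ insert j s ∧ m ∉ insert j s) ↔ (m + 1 ∈ insert j s ∧ m ∉ s) := by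
      simp only [Finset.mem_insert]; tauto
    simp only [e]
    split_ifs
    · rfl
    · simp
  have key' : m ∉ s → r.act (r.act (ω (insert m s)) (Mop ℓ q m ℓ)) (F ℓ q m) =
      qc q ^ (1 - (if m + 1 ∈ s then (1 : ℤ) else 0)) •
        r.act (ω (insert m s)) (Mop ℓ q (m + 1) ℓ) := by
    intro hms
    have hsub := hins m (Finset.mem_sdiff.2 ⟨hmI, hms⟩)
    rw [← r.act_mul, Mop_mul_F h1 hm, map_add, r.act_mul, r.act_mul, hF m h1 hm _ hsub, if_neg (by simp),
      map_zero, LinearMap.zero_apply, zero_add, hP.act_K h1 hm hsub, map_smul, LinearMap.smul_apply]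
    simp
  rw [dlt, map_sum, LinearMap.sum_apply]
  simp only [map_smul, LinearMap.smul_apply]
  by_cases hms : m ∈ s
  · rw [if_neg (by tauto)]
    refine Finset.sum_eq_zero fun j hj => ?_
    rw [key j hj (by rintro rfl; exact (Finset.mem_sdiff.1 hj).2 hms), if_neg (by tauto), smul_zero]
  · have eD : Finset.Icc 1 ℓ \ s = insert m ((Finset.Icc 1 ℓ \ s).erase m) :=
      (Finset.insert_erase (Finset.mem_sdiff.2 ⟨hmI, hms⟩)).symm
    rw [eD, Finset.sum_insert (Finset.notMem_erase _ _), key' hms]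
    -- If `m + 1 ∈ s`, the commutator from `j = m` supplies the summand `m + 1` of the moved
    -- component, and the other summands match one by one. If `m + 1 ∉ s`, it cancels the summand `j
    -- = m + 1`, because `K_m²` acts by `q` and `gam_m = -q⁻¹ gam_{m+1}`.
    by_cases hm1 : m + 1 ∈ s
    · rw [if_pos (show m + 1 ∈ s ∧ m ∉ s from ⟨hm1, hms⟩), if_pos hm1, dlt]
      have eD' : Finset.Icc 1 ℓ \ move s (m + 1) m =
          insert (m + 1) ((Finset.Icc 1 ℓ \ s).erase m) := by
        ext x; unfold move
        simp only [Finset.mem_sdiff, Finset.mem_insert, Finset.mem_erase]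
        by_cases h1 : x = m <;> by_cases h2 : x = m + 1 <;> subst_vars <;> first | tauto | omega
      rw [eD', Finset.sum_insert (by simp [hm1])]
      congr 1
      · have e1 : insert (m + 1) (move s (m + 1) m) = insert m s := by
          ext x; unfold move; grind
        have e2 : nlt (move s (m + 1) m) (m + 1) = nlt s m + 1 := by
          have : nlt (s.erase (m + 1)) (m + 1) = nlt s m := by
            unfold nlt; congr 1; ext x; grind
          rw [move, nlt_insert _ (by grind), this, if_pos (by omega)]
        rw [e1, e2, gam_eq hm, smul_smul]
        congr 1
        rw [sub_self, zpow_zero, mul_one, pow_succ, mul_assoc]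
      · refine Finset.sum_congr rfl fun j hj => ?_
        rw [Finset.mem_erase] at hj
        have hj1 : j ≠ m + 1 := by rintro rfl; exact (Finset.mem_sdiff.1 hj.2).2 hm1
        rw [key j hj.2 hj.1, if_pos ⟨Finset.mem_insert_of_mem hm1, hms⟩]
        have e1 : move (insert j s) (m + 1) m = insert j (move s (m + 1) m) := by
          ext x; unfold move; grind
        have e2 : nlt (move s (m + 1) m) j = nlt s j := by
          rw [move, nlt_insert _ (by grind)]
          have := nlt_erase j hm1
          split_ifs at this ⊢ <;> omega
        rw [e1, e2]
    · rw [if_neg (by tauto : ¬ (m + 1 ∈ s ∧ m ∉ s)), if_neg hm1]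
      have eD' : (Finset.Icc 1 ℓ \ s).erase m = insert (m + 1) (((Finset.Icc 1 ℓ \ s).erase m).erase (m + 1)) :=
        (Finset.insert_erase (by simp only [Finset.mem_erase, Finset.mem_sdiff]; exact ⟨by omega, hmI', hm1⟩)).symm
      rw [eD', Finset.sum_insert (Finset.notMem_erase _ _),
        key (m + 1) (Finset.mem_sdiff.2 ⟨hmI', hm1⟩) (by omega), if_pos ⟨Finset.mem_insert_self _ _, hms⟩,
        Finset.sum_eq_zero, add_zero]
      · have e1 : move (insert (m + 1) s) (m + 1) m = insert m s := by
          ext x; unfold move; grind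
        have e2 : nlt s (m + 1) = nlt s m := by
          unfold nlt; congr 1; ext x; grind
        rw [e1, e2, gam_eq hm, smul_smul, ← add_smul]
        convert zero_smul ℂ _
        rw [sub_zero, zpow_one]
        linear_combination (-(qc q)⁻¹) ^ nlt s m * gam ℓ q (m + 1) * (-(inv_mul_cancel₀ hq))
      · intro j hj
        rw [Finset.mem_erase, Finset.mem_erase] at hj
        rw [key j hj.2.2 hj.2.1, if_neg, smul_zero]
        rw [Finset.mem_insert]; rintro ⟨h | h, -⟩
        · exact hj.1 h.symm
        · exact hm1 h

/-! ### The Laplacian -/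

theorem nbtw_sdiff {n : ℕ} {s : Finset ℕ} {i j : ℕ} (hj : 1 ≤ j) (hi : i ≤ n) :
    nbtw (Finset.Icc 1 n \ s) j i + nbtw s j i = i - j - 1 := by
  rw [nbtw, nbtw, ← Finset.card_union_of_disjoint, ← Nat.card_Ioo]
  · congr 1; ext x
    simp only [Finset.mem_union, Finset.mem_filter, Finset.mem_sdiff, Finset.mem_Icc, Finset.mem_Ioo]
    by_cases h : x ∈ s <;> simp [h]
    omega
  · rw [Finset.disjoint_left]; intro x hx hx'
    simp only [Finset.mem_filter, Finset.mem_sdiff] at hx hx'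
    tauto

theorem neg_qc_pow_mul_pow_add (q : Set.Ioo (0 : ℝ) 1) (m b : ℕ) :
    (-qc q) ^ m * (-(qc q)⁻¹) ^ (m + b) = (-(qc q)⁻¹) ^ b := by
  rw [pow_add, ← mul_assoc, mul_comm ((-qc q) ^ m), neg_qc_inv_pow_mul, one_mul]

theorem neg_qc_pow_add_mul_pow (q : Set.Ioo (0 : ℝ) 1) (m b : ℕ) :
    (-qc q) ^ (m + b) * (-(qc q)⁻¹) ^ m = (-qc q) ^ b := by
  rw [pow_add, mul_right_comm, mul_comm ((-qc q) ^ m), neg_qc_inv_pow_mul, one_mul]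

/-- An equivariant family with the weights of the exterior algebra. -/
structure Equi (r : RAct ℓ q V) (d : ℤ) (ω : Finset ℕ → V) : Prop where
  hE : EInv r ω
  hF : FInv r ω
  hP : PWt r d ω

theorem Equi.compl {r : RAct ℓ q V} {d : ℤ} {ω : Finset ℕ → V} (h : Equi r d ω) :
    Equi r.twist (-d - 1) (compl ℓ ω) := ⟨h.hF.compl, h.hE.compl, h.hP.compl⟩

/-- The two orders in which `i` is removed and `j` inserted differ by the commutator of `Mop_{j,ℓ}`
and `M_{i,ℓ}^*`. Its correction is a torus element times a Levi root vector that moves `j` back to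
`i`, hence a scalar on the component `s`. -/
theorem Equi.laplace_pair {r : RAct ℓ q V} {d : ℤ} {ω : Finset ℕ → V} (h : Equi r d ω)
    {s : Finset ℕ} (hs : s ⊆ Finset.Icc 1 ℓ) {i j : ℕ} (hi : i ∈ s) (hj : j ∈ Finset.Icc 1 ℓ \ s) :
    ((qc q)⁻¹ ^ 2 * (-qc q) ^ s.card * ((-(qc q)⁻¹) ^ nlt s j * (-(qc q)⁻¹) ^ ngt (insert j s) i)) •
      r.act (r.act (ω (move s i j)) (Mst ℓ q i ℓ)) (Mop ℓ q j ℓ) +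
    ((qc q)⁻¹ * (-qc q) ^ (s.card - 1) * ((-(qc q)⁻¹) ^ ngt s i * (-(qc q)⁻¹) ^ nlt (s.erase i) j)) •
      r.act (r.act (ω (move s i j)) (Mop ℓ q j ℓ)) (Mst ℓ q i ℓ) =
    (if i < j then ((qc q)⁻¹ * (1 - (qc q)⁻¹ ^ 2) * (-(qc q)⁻¹) ^ nbtw s i j) •
      r.act (r.act (ω (move s i j)) (Mst ℓ q i ℓ)) (Mop ℓ q j ℓ) else 0) +
    (gam ℓ q j * (if i < j then qc q ^ (d - 1) * ((qc q)⁻¹ ^ 2) ^ nbtw s i j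
      else qc q ^ (-1 - d) * (qc q ^ 2) ^ nbtw s j i)) • ω s := by
  have hq := qc_ne q
  rw [Finset.mem_sdiff] at hj
  have hi' := Finset.mem_Icc.1 (hs hi)
  have hj' := Finset.mem_Icc.1 hj.1
  have ht : move s i j ⊆ Finset.Icc 1 ℓ := move_subset hs hj'.1 hj'.2
  have hji : j ≠ i := fun h => hj.2 (h ▸ hi)
  have hit : i ∉ move s i j := by unfold move; grind
  have hjt : j ∈ move s i j := by unfold move; grind
  have hback : move (move s i j) j i = s := by ext x; unfold move; grind
  have hcard := nlt_add_ngt hj.2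
  have hcard' := nlt_add_ngt_of_mem hi
  set T := r.act (r.act (ω (move s i j)) (Mst ℓ q i ℓ)) (Mop ℓ q j ℓ) with hT
  rcases lt_or_gt_of_ne hji with hlt | hlt
  · rw [if_neg hlt.not_gt, if_neg hlt.not_gt, zero_add]
    have n1 := ngt_insert i hj.2
    have n2 := nlt_eq (s := s) hlt
    have n3 := nlt_erase j hi
    rw [if_neg hlt.not_gt, add_zero] at n1 n3
    rw [if_neg hj.2, add_zero] at n2
    have hM : r.act (r.act (ω (move s i j)) (Mop ℓ q j ℓ)) (Mst ℓ q i ℓ) =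
        T - ((qc q)⁻¹ * gam ℓ q i * qc q ^ (-d) *
          (-(qc q)⁻¹) ^ nbtw (Finset.Icc 1 ℓ \ move s i j) j i) • ω s := by
      rw [← r.act_mul, Mop_mul_Mst_of_gt hj'.1 hlt hi'.2, map_sub, r.act_mul, map_smul, r.act_mul,
        h.hP.act_Pinv hi'.1 hi'.2 ht, map_smul, LinearMap.smul_apply,
        h.hE.act_Mop hj'.1 (by omega) (by omega) ht hjt (by rwa [Nat.sub_add_cancel hi'.1]),
        Nat.sub_add_cancel hi'.1, hback, if_neg hit, smul_smul, smul_smul, zero_add]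
    have n4 := nbtw_sdiff (s := move s i j) (i := i) hj'.1 hi'.2
    have n5 : nbtw (move s i j) j i = nbtw s j i := nbtw_congr fun x => by unfold move; grind
    rw [n5] at n4
    have hg : gam ℓ q i * (-(qc q)⁻¹) ^ nbtw (Finset.Icc 1 ℓ \ move s i j) j i =
        gam ℓ q j * (-qc q) ^ (nbtw s j i + 1) := by
      rw [gam, gam, ← pow_add, show ℓ - j = (nbtw s j i + 1) +
        (ℓ - i + nbtw (Finset.Icc 1 ℓ \ move s i j) j i) by omega, mul_comm, neg_qc_pow_mul_pow_add]
    have p1 : (-qc q) ^ s.card * ((-(qc q)⁻¹) ^ nlt s j * (-(qc q)⁻¹) ^ ngt (insert j s) i) =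
        (-qc q) ^ (nbtw s j i + 1) := by
      rw [← pow_add, n1, show s.card = nlt s j + ngt s i + (nbtw s j i + 1) by omega,
        neg_qc_pow_add_mul_pow]
    have p2 : (-qc q) ^ (s.card - 1) * ((-(qc q)⁻¹) ^ ngt s i * (-(qc q)⁻¹) ^ nlt (s.erase i) j) =
        (-qc q) ^ (nbtw s j i) := by
      rw [← pow_add, n3, show s.card - 1 = ngt s i + nlt s j + nbtw s j i by omega,
        neg_qc_pow_add_mul_pow]
    rw [mul_assoc, p1, mul_assoc, p2, hM, smul_sub, smul_smul, ← add_sub_assoc, ← add_smul,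
      sub_eq_add_neg, ← neg_smul]
    -- For `j < i` the second order terms cancel, and only the scalar remains.
    have z1 : (qc q)⁻¹ ^ 2 * (-qc q) ^ (nbtw s j i + 1) + (qc q)⁻¹ * (-qc q) ^ nbtw s j i = 0 := by
      rw [pow_succ (-qc q)]; field_simp; ring
    rw [z1, zero_smul, zero_add]
    congr 1
    have e1 : qc q ^ (-1 - d) = (qc q)⁻¹ * qc q ^ (-d) := by
      rw [← zpow_neg_one, ← zpow_add₀ hq]; rfl
    have e2 : (-qc q) ^ nbtw s j i * (-qc q) ^ nbtw s j i = (qc q ^ 2) ^ nbtw s j i := by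
      rw [← mul_pow]; ring
    rw [pow_succ (-qc q)] at hg
    rw [e1, ← e2]
    have e3 : (qc q)⁻¹ * qc q = 1 := inv_mul_cancel₀ hq
    linear_combination (-(qc q)⁻¹ * (-qc q) ^ nbtw s j i * (qc q)⁻¹ * qc q ^ (-d)) * hg +
      (qc q)⁻¹ * (-qc q) ^ nbtw s j i * (-qc q) ^ nbtw s j i * gam ℓ q j * qc q ^ (-d) * e3
  · rw [if_pos hlt, if_pos hlt]
    have n1 := ngt_insert i hj.2
    have n2 := ngt_eq (s := s) hlt
    have n3 := nlt_erase j hi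
    rw [if_pos hlt] at n1 n3
    rw [if_neg hj.2, add_zero] at n2
    have hM : r.act (r.act (ω (move s i j)) (Mop ℓ q j ℓ)) (Mst ℓ q i ℓ) =
        T + ((qc q)⁻¹ * gam ℓ q j * qc q ^ (1 + d) * (-(qc q)⁻¹) ^ nbtw s i j) • ω s := by
      have n5 : nbtw (move s i j) i j = nbtw s i j := nbtw_congr fun x => by unfold move; grind
      rw [← r.act_mul, Mop_mul_Mst_of_lt hi'.1 hlt hj'.2, map_add, r.act_mul, map_smul, r.act_mul,
        h.hP j hj'.1 hj'.2 _ ht, map_smul, LinearMap.smul_apply,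
        h.hF.act_Mst (m := j - 1) hi'.1 (by omega) (by omega) ht, Nat.sub_add_cancel hj'.1, if_pos hjt,
        if_pos (show j ∈ move s i j ∧ i ∉ move s i j from ⟨hjt, hit⟩), hback, smul_smul, smul_smul, n5]
    have p1 : (-qc q) ^ s.card * ((-(qc q)⁻¹) ^ nlt s j * (-(qc q)⁻¹) ^ ngt (insert j s) i) =
        (-(qc q)⁻¹) ^ (nbtw s i j + 1) := by
      rw [← pow_add, n1, show nlt s j + (ngt s i + 1) = s.card + (nbtw s i j + 1) by omega,
        neg_qc_pow_mul_pow_add]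
    have p2 : (-qc q) ^ (s.card - 1) * ((-(qc q)⁻¹) ^ ngt s i * (-(qc q)⁻¹) ^ nlt (s.erase i) j) =
        (-(qc q)⁻¹) ^ (nbtw s i j) := by
      rw [← pow_add, show ngt s i + nlt (s.erase i) j = (s.card - 1) + nbtw s i j by omega,
        neg_qc_pow_mul_pow_add]
    -- For `i < j` the second order terms add up with the factor `1 - q⁻²`; they match those
    -- produced by `sum_Mst_mul_M`.
    rw [mul_assoc, p1, mul_assoc, p2, hM, smul_add, smul_smul, ← add_assoc, ← add_smul]
    have e1 : qc q ^ (d - 1) = (qc q)⁻¹ ^ 2 * qc q ^ (1 + d) := by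
      rw [inv_pow, ← zpow_natCast, ← zpow_neg, ← zpow_add₀ hq]; congr 1; push_cast; ring
    have e2 : (-(qc q)⁻¹) ^ nbtw s i j * (-(qc q)⁻¹) ^ nbtw s i j = ((qc q)⁻¹ ^ 2) ^ nbtw s i j := by
      rw [← mul_pow]; ring
    rw [e1, ← e2]
    congr 2
    · rw [pow_succ (-(qc q)⁻¹)]; ring1
    · ring1

/-- The number `[n]` for an integer `n`. -/
def qint (q : Set.Ioo (0 : ℝ) 1) (n : ℤ) : ℂ := (qc q ^ n - qc q ^ (-n)) / (qc q - (qc q)⁻¹)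

theorem gam_sq_mul {j : ℕ} (hj : j ≤ ℓ) : (qc q ^ 2) ^ ℓ * (gam ℓ q j * gam ℓ q j) = (qc q ^ 2) ^ j := by
  have hq := qc_ne q
  rw [gam, ← mul_pow, neg_mul_neg, show (qc q)⁻¹ * (qc q)⁻¹ = (qc q ^ 2)⁻¹ by field_simp, inv_pow]
  obtain ⟨e, rfl⟩ := Nat.exists_eq_add_of_le hj
  rw [Nat.add_sub_cancel_left, pow_add, mul_assoc, mul_inv_cancel₀ (by positivity), mul_one]

/-- After multiplication by `q^{2ℓ}` the squares of the numbers `gam` become `q^{2j}`. The sum over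
`i` splits into two geometric sums, over the elements of `s` below and above `j`, and the resulting
sum over the complement is enumerated by `sum_compl_pow`. -/
theorem laplace_scalar {s : Finset ℕ} (hs : s ⊆ Finset.Icc 1 ℓ) (d : ℤ) :
    ∑ i ∈ s, (qc q)⁻¹ * gam ℓ q i *
        (gam ℓ q i * (qc q - (qc q)⁻¹)⁻¹ * (qc q ^ (1 + d) - qc q ^ (-(1 + d)))) +
      ∑ j ∈ Finset.Icc 1 ℓ \ s, ∑ i ∈ s, gam ℓ q j *
        (gam ℓ q j * (if i < j then qc q ^ (d - 1) * ((qc q)⁻¹ ^ 2) ^ nbtw s i j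
          else qc q ^ (-1 - d) * (qc q ^ 2) ^ nbtw s j i)) =
      qc q ^ (-(ℓ : ℤ)) * qint q s.card * qint q (ℓ + 1 + d - s.card) := by
  have hq := qc_ne q
  have hq1 := qc_sq_ne_one q
  have hq2 := one_sub_qc_inv_sq_ne q
  have hq3 := qc_sub_inv_ne q
  have hy1 : 1 - qc q ^ 2 ≠ 0 := sub_ne_zero.2 hq1.symm
  have hk : s.card ≤ ℓ := by simpa using Finset.card_le_card hs
  set y := qc q ^ 2 with hy
  have hy0 : y ≠ 0 := pow_ne_zero _ hq
  have hxy : (qc q)⁻¹ ^ 2 = y⁻¹ := by rw [hy, inv_pow]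
  rw [hxy] at hq2 ⊢
  have inner : ∀ j ∈ Finset.Icc 1 ℓ \ s, y ^ ℓ * ∑ i ∈ s, gam ℓ q j *
        (gam ℓ q j * (if i < j then qc q ^ (d - 1) * (y⁻¹) ^ nbtw s i j
          else qc q ^ (-1 - d) * y ^ nbtw s j i)) =
      (qc q ^ (d - 1) / (1 - y⁻¹) + qc q ^ (-1 - d) / (1 - y)) * y ^ j -
        (qc q ^ (d - 1) / (1 - y⁻¹) + qc q ^ (-1 - d) / (1 - y) * y ^ s.card) * y ^ (j - nlt s j) := by
    intro j hj
    rw [Finset.mem_sdiff] at hj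
    have hj' := Finset.mem_Icc.1 hj.1
    have hlt := nlt_lt hs hj'.1
    have hcard := nlt_add_ngt hj.2
    have e1 : ∑ i ∈ s, (if i < j then qc q ^ (d - 1) * (y⁻¹) ^ nbtw s i j
          else qc q ^ (-1 - d) * y ^ nbtw s j i) =
        qc q ^ (d - 1) * ((1 - y⁻¹ ^ nlt s j) / (1 - y⁻¹)) +
          qc q ^ (-1 - d) * ((1 - y ^ ngt s j) / (1 - y)) := by
      rw [Finset.sum_ite, ← geom_sum_below, ← geom_sum_above, mul_div_cancel_left₀ _ hq2,
        mul_div_cancel_left₀ _ hy1, Finset.mul_sum, Finset.mul_sum]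
      congr 2
      ext i
      simp only [Finset.mem_filter]
      constructor
      · rintro ⟨h1, h2⟩
        refine ⟨h1, lt_of_le_of_ne (not_lt.1 h2) ?_⟩
        rintro rfl; exact hj.2 h1
      · rintro ⟨h1, h2⟩; exact ⟨h1, h2.not_gt⟩
    have e2 : y ^ j = y ^ (j - nlt s j) * y ^ nlt s j := by rw [← pow_add]; congr 1; omega
    have e3 : y ^ s.card = y ^ nlt s j * y ^ ngt s j := by rw [← pow_add, hcard]
    have e4 : y⁻¹ ^ nlt s j * y ^ nlt s j = 1 := by
      rw [← mul_pow, inv_mul_cancel₀ hy0, one_pow]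
    rw [← Finset.mul_sum, ← Finset.mul_sum, e1, ← mul_assoc (gam ℓ q j), ← mul_assoc, gam_sq_mul hj'.2, e2, e3]
    linear_combination (-(qc q ^ (d - 1) / (1 - y⁻¹) * y ^ (j - nlt s j))) * e4
  have hmul : ∀ a b : ℂ, y ^ ℓ * a = y ^ ℓ * b → a = b := fun a b h =>
    mul_left_cancel₀ (pow_ne_zero _ hy0) h
  apply hmul
  -- The diagonal coefficient equals the coefficient of `y ^ j` in `inner`. The sums over `s` and
  -- over its complement therefore merge into one geometric sum over `1, …, ℓ`.
  have hα : (qc q)⁻¹ * (qc q - (qc q)⁻¹)⁻¹ * (qc q ^ (1 + d) - qc q ^ (-(1 + d))) =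
      qc q ^ (d - 1) / (1 - y⁻¹) + qc q ^ (-1 - d) / (1 - y) := by
    rw [zpow_sub₀ hq, zpow_sub₀ hq, zpow_neg, zpow_neg, zpow_add₀ hq, zpow_one]
    have hd := zpow_ne_zero d hq
    generalize qc q ^ d = z at hd ⊢
    have h1 : qc q ^ 2 - 1 ≠ 0 := sub_ne_zero.2 hq1
    have h3 : qc q - (qc q)⁻¹ = (qc q ^ 2 - 1) / qc q := by field_simp
    have h4 : 1 - y⁻¹ = (qc q ^ 2 - 1) / qc q ^ 2 := by rw [hy]; field_simp
    have h5 : 1 - y = -(qc q ^ 2 - 1) := by rw [hy]; ring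
    rw [h3, h4, h5]
    field_simp
    ring
  have first : y ^ ℓ * ∑ i ∈ s, (qc q)⁻¹ * gam ℓ q i *
        (gam ℓ q i * (qc q - (qc q)⁻¹)⁻¹ * (qc q ^ (1 + d) - qc q ^ (-(1 + d)))) =
      ∑ i ∈ s, (qc q ^ (d - 1) / (1 - y⁻¹) + qc q ^ (-1 - d) / (1 - y)) * y ^ i := by
    rw [Finset.mul_sum]
    refine Finset.sum_congr rfl fun i hi => ?_
    rw [← hα, ← gam_sq_mul (q := q) (Finset.mem_Icc.1 (hs hi)).2]
    ring
  rw [mul_add, first, Finset.mul_sum, Finset.sum_congr rfl inner, Finset.sum_sub_distrib,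
    ← Finset.mul_sum, ← Finset.mul_sum, ← Finset.mul_sum, sum_compl_pow y hs, add_sub_assoc',
    ← mul_add, add_comm (∑ i ∈ s, y ^ i), Finset.sum_sdiff hs, geom_sum_Icc hq1, geom_sum_Icc hq1]
  -- Writing `ℓ = k + e` removes the truncated subtraction and leaves a rational identity in `q`,
  -- `q^d`, `q^k` and `q^e`.
  obtain ⟨e, he⟩ := Nat.exists_eq_add_of_le hk
  rw [← hα, qint, qint, show (ℓ : ℤ) + 1 + d - s.card = (e : ℤ) + 1 + d by rw [he]; push_cast; ring,
    show ℓ - s.card = e by omega, zpow_sub₀ hq, zpow_sub₀ hq, he]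
  generalize s.card = k
  have hyn : ∀ n : ℕ, y ^ n = (qc q ^ n) ^ 2 := fun n => by rw [hy, ← pow_mul, mul_comm, pow_mul]
  simp only [pow_add, pow_one, hyn]
  simp only [zpow_neg, zpow_add₀ hq, zpow_one, zpow_natCast, pow_add]
  have hd := zpow_ne_zero d hq
  have hk0 := pow_ne_zero k hq
  have he0 := pow_ne_zero e hq
  generalize qc q ^ d = z at hd ⊢
  generalize qc q ^ k = x at hk0 ⊢
  generalize qc q ^ e = w at he0 ⊢
  have h1 : qc q ^ 2 - 1 ≠ 0 := sub_ne_zero.2 hq1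
  have h3 : qc q - (qc q)⁻¹ = (qc q ^ 2 - 1) / qc q := by field_simp
  have h4 : 1 - y⁻¹ = (qc q ^ 2 - 1) / qc q ^ 2 := by rw [hy]; field_simp
  have h5 : 1 - y = -(qc q ^ 2 - 1) := by rw [hy]; ring
  rw [h3, h4, h5, hy]
  field_simp
  ring

/-- After an element `j ∉ s` is inserted, either `j` itself is removed, which gives the diagonal
terms, or some `i ∈ s` is, which exchanges `i` for `j`. -/
theorem dlt_dR (r : RAct ℓ q V) (ω : Finset ℕ → V) (s : Finset ℕ) :
    dlt r (dR r ω) s = ∑ j ∈ Finset.Icc 1 ℓ \ s,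
        ((-(qc q)⁻¹) ^ s.card * gam ℓ q j) • r.act (r.act (ω s) (Mst ℓ q j ℓ)) (Mop ℓ q j ℓ) +
      ∑ j ∈ Finset.Icc 1 ℓ \ s, ∑ i ∈ s,
        (gam ℓ q j * ((-(qc q)⁻¹) ^ nlt s j * (-(qc q)⁻¹) ^ ngt (insert j s) i)) •
          r.act (r.act (ω (move s i j)) (Mst ℓ q i ℓ)) (Mop ℓ q j ℓ) := by
  rw [dlt, ← Finset.sum_add_distrib]
  refine Finset.sum_congr rfl fun j hj => ?_
  have hjs := (Finset.mem_sdiff.1 hj).2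
  rw [dR, Finset.sum_insert hjs, map_add, LinearMap.add_apply, smul_add, Finset.erase_insert hjs,
    ngt_insert _ hjs, if_neg (lt_irrefl j), add_zero, map_smul, LinearMap.smul_apply, smul_smul,
    ← nlt_add_ngt hjs, pow_add, map_sum, LinearMap.sum_apply, Finset.smul_sum]
  congr 1
  · congr 1; ring1
  · refine Finset.sum_congr rfl fun i hi => ?_
    have hij : j ≠ i := fun h => hjs (h ▸ hi)
    rw [map_smul, LinearMap.smul_apply, smul_smul, Finset.erase_insert_of_ne hij]
    congr 1; ring1

theorem Icc_sdiff_erase {s : Finset ℕ} (hs : s ⊆ Finset.Icc 1 ℓ) {i : ℕ} (hi : i ∈ s) :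
    Finset.Icc 1 ℓ \ s.erase i = insert i (Finset.Icc 1 ℓ \ s) := by
  have := hs hi
  ext x
  simp only [Finset.mem_sdiff, Finset.mem_insert, Finset.mem_erase]
  by_cases h : x = i
  · subst h; tauto
  · tauto

/-- The mirror image of `dlt_dR`: the diagonal terms are now indexed by `s`, and the off-diagonal
ones run over the same pairs `(i, j)`. -/
theorem dR_dlt (r : RAct ℓ q V) (ω : Finset ℕ → V) {s : Finset ℕ} (hs : s ⊆ Finset.Icc 1 ℓ) :
    dR r (dlt r ω) s = ∑ i ∈ s,
        ((-(qc q)⁻¹) ^ (s.card - 1) * gam ℓ q i) • r.act (r.act (ω s) (Mop ℓ q i ℓ)) (Mst ℓ q i ℓ) +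
      ∑ j ∈ Finset.Icc 1 ℓ \ s, ∑ i ∈ s,
        (gam ℓ q j * ((-(qc q)⁻¹) ^ ngt s i * (-(qc q)⁻¹) ^ nlt (s.erase i) j)) •
          r.act (r.act (ω (move s i j)) (Mop ℓ q j ℓ)) (Mst ℓ q i ℓ) := by
  rw [Finset.sum_comm, dR, ← Finset.sum_add_distrib]
  refine Finset.sum_congr rfl fun i hi => ?_
  have e : nlt (s.erase i) i = nlt s i := by
    have := nlt_erase i hi; rwa [if_neg (lt_irrefl i), add_zero] at this
  rw [dlt, Icc_sdiff_erase hs hi, Finset.sum_insert (by simp [hi]), map_add, LinearMap.add_apply,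
    smul_add, Finset.insert_erase hi, e, ← nlt_add_ngt_of_mem hi, Nat.add_sub_cancel, pow_add,
    map_smul, LinearMap.smul_apply, smul_smul, map_sum, LinearMap.sum_apply, Finset.smul_sum]
  congr 1
  · congr 1; ring1
  · refine Finset.sum_congr rfl fun j hj => ?_
    rw [map_smul, LinearMap.smul_apply, smul_smul]
    congr 1; ring1

/-- The identity `QProj.sum_Mst_mul_M` is applied to one component. The factors `P_j²` contribute
`q^d`, which is divided out, and a further `q` when `j ∈ s`; the Levi vectors `M_{p,j-1}` exchange
`p ∈ s` for `j ∉ s`. -/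
theorem Equi.sum_Mst_mul_M {r : RAct ℓ q V} {d : ℤ} {ω : Finset ℕ → V} (h : Equi r d ω)
    {s : Finset ℕ} (hs : s ⊆ Finset.Icc 1 ℓ) :
    ∑ i ∈ Finset.Icc 1 ℓ, (((qc q)⁻¹ ^ 2) ^ i * (if i ∈ s then qc q else 1)) •
        r.act (ω s) (Mst ℓ q i ℓ * M ℓ q i ℓ) =
      ∑ j ∈ Finset.Icc 1 ℓ, ((qc q)⁻¹ ^ 2 * gam ℓ q j * (if j ∈ s then qc q else 1)) •
          r.act (r.act (ω s) (Mst ℓ q j ℓ)) (Mop ℓ q j ℓ) +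
        ∑ j ∈ Finset.Icc 1 ℓ \ s, ∑ i ∈ s, gam ℓ q j • (if i < j then
          ((qc q)⁻¹ * (1 - (qc q)⁻¹ ^ 2) * (-(qc q)⁻¹) ^ nbtw s i j) •
          r.act (r.act (ω (move s i j)) (Mst ℓ q i ℓ)) (Mop ℓ q j ℓ) else 0) := by
  have hq := qc_ne q
  have hw : ∀ j ∈ Finset.Icc 1 ℓ, r.act (ω s) (P ℓ q j ^ 2) =
      (qc q ^ d * (if j ∈ s then qc q else 1)) • ω s := by
    intro j hj
    rw [Finset.mem_Icc] at hj
    rw [h.hP j hj.1 hj.2 s hs, add_comm, zpow_add₀ hq]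
    congr 2; split_ifs <;> simp
  have key := congrArg (fun x => (qc q ^ d)⁻¹ • r.act (ω s) x) (QProj.sum_Mst_mul_M (ℓ := ℓ) (q := q))
  simp only [map_sum, map_smul, Finset.smul_sum] at key
  have hd := zpow_ne_zero d hq
  refine Eq.trans (Finset.sum_congr rfl fun i hi => ?_) (key.trans ?_)
  · conv_rhs => rw [mul_assoc (P ℓ q i ^ 2), r.act_mul, hw i hi, map_smul, LinearMap.smul_apply,
      smul_smul, smul_smul]
    congr 1; field_simp
  have hD : ∀ f : ℕ → V, ∑ j ∈ Finset.Icc 1 ℓ \ s, f j =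
      ∑ j ∈ Finset.Icc 1 ℓ, if j ∈ s then 0 else f j := by
    intro f
    rw [← Finset.sum_sdiff hs, Finset.sum_eq_zero (s := s) (fun j hj => by rw [if_pos hj]), add_zero]
    exact Finset.sum_congr rfl fun j hj => by rw [if_neg (Finset.mem_sdiff.1 hj).2]
  rw [hD, ← Finset.sum_add_distrib]
  refine Finset.sum_congr rfl fun j hj => ?_
  have hj' := Finset.mem_Icc.1 hj
  rw [add_mul, map_add, mul_assoc, r.act_mul, hw j hj, map_smul, LinearMap.smul_apply, r.act_mul,
    ← Finset.smul_sum, smul_mul_assoc, map_smul, r.act_mul, map_sum, map_sum, LinearMap.sum_apply]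
  have hin : ∀ p ∈ Finset.Ico 1 j, r.act (r.act (ω s) (P ℓ q p ^ 2 * M ℓ q p (j - 1) * Mst ℓ q p ℓ)) (Mop ℓ q j ℓ) =
      if p ∈ s then (if j ∈ s then 0 else (qc q ^ d * qc q * (-(qc q)⁻¹) ^ nbtw s p j) •
        r.act (r.act (ω (move s p j)) (Mst ℓ q p ℓ)) (Mop ℓ q j ℓ)) else 0 := by
    intro p hp
    rw [Finset.mem_Ico] at hp
    rw [r.act_mul, r.act_mul, hw p (Finset.mem_Icc.2 (by omega)), map_smul, LinearMap.smul_apply,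
      h.hE.act_M (m := j - 1) hp.1 (by omega) (by omega) hs, Nat.sub_add_cancel hj'.1]
    by_cases h1 : p ∈ s <;> by_cases h2 : j ∈ s <;> simp [h1, h2, smul_smul]
  rw [Finset.sum_congr rfl hin, smul_add, smul_add, smul_add, smul_smul, smul_smul, smul_smul,
    smul_smul, smul_smul]
  congr 1
  · congr 1; field_simp
  · rw [← Finset.sum_filter]
    by_cases hjs : j ∈ s
    · simp [hjs]
    · simp only [if_neg hjs]
      rw [← Finset.smul_sum, ← Finset.sum_filter]
      have ef : (Finset.Ico 1 j).filter (· ∈ s) = s.filter (· < j) := by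
        ext x
        simp only [Finset.mem_filter, Finset.mem_Ico]
        constructor
        · tauto
        · rintro ⟨h1, h2⟩; exact ⟨⟨(Finset.mem_Icc.1 (hs h1)).1, h2⟩, h1⟩
      rw [ef, Finset.smul_sum, Finset.smul_sum]
      rw [Finset.smul_sum]
      refine Finset.sum_congr rfl fun i _ => ?_
      rw [smul_smul, smul_smul, smul_smul]
      congr 1; field_simp

/-- The Laplacian of an equivariant family. -/
theorem Equi.laplace {r : RAct ℓ q V} {d : ℤ} {ω : Finset ℕ → V} (h : Equi r d ω)
    {s : Finset ℕ} (hs : s ⊆ Finset.Icc 1 ℓ) :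
    ((qc q)⁻¹ ^ 2 * (-qc q) ^ s.card) • dlt r (dR r ω) s +
      ((qc q)⁻¹ * (-qc q) ^ (s.card - 1)) • dR r (dlt r ω) s =
    ∑ i ∈ Finset.Icc 1 ℓ, (((qc q)⁻¹ ^ 2) ^ i * (if i ∈ s then qc q else 1)) •
        r.act (ω s) (Mst ℓ q i ℓ * M ℓ q i ℓ) +
      (qc q ^ (-(ℓ : ℤ)) * qint q s.card * qint q (ℓ + 1 + d - s.card)) • ω s := by
  have hq := qc_ne q
  rw [h.sum_Mst_mul_M hs, ← laplace_scalar hs, dlt_dR, dR_dlt r ω hs, ← Finset.sum_sdiff hs]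
  have hdiag : ∀ i ∈ s, r.act (r.act (ω s) (Mop ℓ q i ℓ)) (Mst ℓ q i ℓ) =
      r.act (r.act (ω s) (Mst ℓ q i ℓ)) (Mop ℓ q i ℓ) +
        (gam ℓ q i * (qc q - (qc q)⁻¹)⁻¹ * (qc q ^ (1 + d) - qc q ^ (-(1 + d)))) • ω s := by
    intro i hi
    have hi' := Finset.mem_Icc.1 (hs hi)
    rw [← r.act_mul, Mop_mul_Mst_self hi'.1 hi'.2, map_add, r.act_mul, map_smul, map_sub,
      h.hP i hi'.1 hi'.2 s hs, h.hP.act_Pinv hi'.1 hi'.2 hs, if_pos hi, ← sub_smul, smul_smul]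
  have c1 : (-qc q) ^ s.card * (-(qc q)⁻¹) ^ s.card = 1 := by rw [mul_comm, neg_qc_inv_pow_mul]
  have c2 : (-qc q) ^ (s.card - 1) * (-(qc q)⁻¹) ^ (s.card - 1) = 1 := by
    rw [mul_comm, neg_qc_inv_pow_mul]
  -- The diagonal terms with `j ∉ s` come from `dlt_dR` and those with `j ∈ s` from `dR_dlt`, the
  -- latter after reordering by `hdiag`. Together they form the first sum in `Equi.sum_Mst_mul_M`,
  -- and the off-diagonal terms are treated pair by pair.
  have t1 : ((qc q)⁻¹ ^ 2 * (-qc q) ^ s.card) • ∑ j ∈ Finset.Icc 1 ℓ \ s,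
        ((-(qc q)⁻¹) ^ s.card * gam ℓ q j) • r.act (r.act (ω s) (Mst ℓ q j ℓ)) (Mop ℓ q j ℓ) =
      ∑ j ∈ Finset.Icc 1 ℓ \ s, ((qc q)⁻¹ ^ 2 * gam ℓ q j * (if j ∈ s then qc q else 1)) •
          r.act (r.act (ω s) (Mst ℓ q j ℓ)) (Mop ℓ q j ℓ) := by
    rw [Finset.smul_sum]
    refine Finset.sum_congr rfl fun j hj => ?_
    rw [smul_smul, if_neg (Finset.mem_sdiff.1 hj).2]
    congr 1
    linear_combination (qc q)⁻¹ ^ 2 * gam ℓ q j * c1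
  have t2 : ((qc q)⁻¹ * (-qc q) ^ (s.card - 1)) • ∑ i ∈ s,
        ((-(qc q)⁻¹) ^ (s.card - 1) * gam ℓ q i) • r.act (r.act (ω s) (Mop ℓ q i ℓ)) (Mst ℓ q i ℓ) =
      ∑ j ∈ s, ((qc q)⁻¹ ^ 2 * gam ℓ q j * (if j ∈ s then qc q else 1)) •
          r.act (r.act (ω s) (Mst ℓ q j ℓ)) (Mop ℓ q j ℓ) + (∑ i ∈ s, (qc q)⁻¹ * gam ℓ q i *
        (gam ℓ q i * (qc q - (qc q)⁻¹)⁻¹ * (qc q ^ (1 + d) - qc q ^ (-(1 + d))))) • ω s := by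
    rw [Finset.smul_sum, Finset.sum_smul, ← Finset.sum_add_distrib]
    refine Finset.sum_congr rfl fun i hi => ?_
    have c3 : (qc q)⁻¹ * qc q = 1 := inv_mul_cancel₀ hq
    rw [smul_smul, hdiag i hi, smul_add, smul_smul, if_pos hi]
    congr 2
    · linear_combination (qc q)⁻¹ * gam ℓ q i * c2 - (qc q)⁻¹ * gam ℓ q i * c3
    · linear_combination (qc q)⁻¹ * gam ℓ q i * c2 *
        (gam ℓ q i * (qc q - (qc q)⁻¹)⁻¹ * (qc q ^ (1 + d) - qc q ^ (-(1 + d))))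
  have t3 : ((qc q)⁻¹ ^ 2 * (-qc q) ^ s.card) • ∑ j ∈ Finset.Icc 1 ℓ \ s, ∑ i ∈ s,
        (gam ℓ q j * ((-(qc q)⁻¹) ^ nlt s j * (-(qc q)⁻¹) ^ ngt (insert j s) i)) •
          r.act (r.act (ω (move s i j)) (Mst ℓ q i ℓ)) (Mop ℓ q j ℓ) +
      ((qc q)⁻¹ * (-qc q) ^ (s.card - 1)) • ∑ j ∈ Finset.Icc 1 ℓ \ s, ∑ i ∈ s,
        (gam ℓ q j * ((-(qc q)⁻¹) ^ ngt s i * (-(qc q)⁻¹) ^ nlt (s.erase i) j)) •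
          r.act (r.act (ω (move s i j)) (Mop ℓ q j ℓ)) (Mst ℓ q i ℓ) =
      ∑ j ∈ Finset.Icc 1 ℓ \ s, ∑ i ∈ s, gam ℓ q j • (if i < j then
          ((qc q)⁻¹ * (1 - (qc q)⁻¹ ^ 2) * (-(qc q)⁻¹) ^ nbtw s i j) •
          r.act (r.act (ω (move s i j)) (Mst ℓ q i ℓ)) (Mop ℓ q j ℓ) else 0) +
      (∑ j ∈ Finset.Icc 1 ℓ \ s, ∑ i ∈ s, gam ℓ q j *
        (gam ℓ q j * (if i < j then qc q ^ (d - 1) * ((qc q)⁻¹ ^ 2) ^ nbtw s i j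
          else qc q ^ (-1 - d) * (qc q ^ 2) ^ nbtw s j i))) • ω s := by
    simp only [Finset.smul_sum, Finset.sum_smul, ← Finset.sum_add_distrib]
    refine Finset.sum_congr rfl fun j hj => Finset.sum_congr rfl fun i hi => ?_
    have := congrArg (fun v => gam ℓ q j • v) (h.laplace_pair hs hi hj)
    simp only [smul_add, smul_smul] at this ⊢
    rw [← this]
    congr 2 <;> ring1
  rw [smul_add, smul_add, add_smul, add_add_add_comm, t1, t2, t3]
  abel

/-! ### The dual Laplacian -/

theorem ngt_sdiff {n : ℕ} {s : Finset ℕ} (hs : s ⊆ Finset.Icc 1 n) (i : ℕ) :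
    ngt (Finset.Icc 1 n \ s) i + ngt s i = n - i := by
  rw [ngt, ngt, ← Finset.card_union_of_disjoint, ← Nat.card_Ioc]
  · congr 1; ext x
    simp only [Finset.mem_union, Finset.mem_filter, Finset.mem_sdiff, Finset.mem_Icc, Finset.mem_Ioc]
    by_cases h : x ∈ s
    · have := Finset.mem_Icc.1 (hs h); simp [h, this]
    · simp [h]; omega
  · rw [Finset.disjoint_left]; intro x hx hx'
    simp only [Finset.mem_filter, Finset.mem_sdiff] at hx hx'
    tauto

theorem nlt_sdiff {n : ℕ} {s : Finset ℕ} (hs : s ⊆ Finset.Icc 1 n) {i : ℕ} (hi : i ≤ n) :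
    nlt (Finset.Icc 1 n \ s) i + nlt s i = i - 1 := by
  rw [nlt, nlt, ← Finset.card_union_of_disjoint, ← Nat.card_Ico]
  · congr 1; ext x
    simp only [Finset.mem_union, Finset.mem_filter, Finset.mem_sdiff, Finset.mem_Icc, Finset.mem_Ico]
    by_cases h : x ∈ s
    · have := Finset.mem_Icc.1 (hs h); simp [h, this]
    · simp [h]; omega
  · rw [Finset.disjoint_left]; intro x hx hx'
    simp only [Finset.mem_filter, Finset.mem_sdiff] at hx hx'
    tauto

theorem Icc_sdiff_sdiff_erase {s : Finset ℕ} (hs : s ⊆ Finset.Icc 1 ℓ) {i : ℕ}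
    (hi : i ∈ Finset.Icc 1 ℓ \ s) : Finset.Icc 1 ℓ \ (Finset.Icc 1 ℓ \ s).erase i = insert i s := by
  rw [Icc_sdiff_erase Finset.sdiff_subset hi, Finset.sdiff_sdiff_eq_self hs]

/-- Removing an element from the complement inserts it into `s`, and `swap` sends `M_{i,ℓ}^*` to
`Mop_{i,ℓ}`. The powers combine through `nlt s i + (ℓ - i) = |s| + ngt` of the complement at `i`.
Only the components that occur are related, so that the lemma also applies to composites. -/
theorem dR_twist {r : RAct ℓ q V} {η ω : Finset ℕ → V} {s : Finset ℕ} (hs : s ⊆ Finset.Icc 1 ℓ)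
    (h : ∀ i ∈ Finset.Icc 1 ℓ \ s, η ((Finset.Icc 1 ℓ \ s).erase i) = ω (insert i s)) :
    dR r.twist η (Finset.Icc 1 ℓ \ s) = (-qc q) ^ s.card • dlt r ω s := by
  rw [dR, dlt, Finset.smul_sum]
  refine Finset.sum_congr rfl fun i hi => ?_
  have hi' := Finset.mem_sdiff.1 hi
  have hi'' := Finset.mem_Icc.1 hi'.1
  rw [h i hi, RAct.twist_act, swap_Mst hi''.2, smul_smul]
  congr 1
  have n1 := nlt_add_ngt hi'.2
  have n2 := ngt_sdiff hs i
  rw [gam, ← pow_add, show nlt s i + (ℓ - i) = s.card + ngt (Finset.Icc 1 ℓ \ s) i by omega,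
    neg_qc_pow_mul_pow_add]

/-- The converse duality. It produces `dR` rather than `dL` because `swap` sends `Mop_{i,ℓ}` to
`M_{i,ℓ}^*`. -/
theorem dlt_twist {r : RAct ℓ q V} {η ω : Finset ℕ → V} {s : Finset ℕ} (hs : s ⊆ Finset.Icc 1 ℓ)
    (h : ∀ i ∈ s, η (insert i (Finset.Icc 1 ℓ \ s)) = ω (s.erase i)) :
    dlt r.twist η (Finset.Icc 1 ℓ \ s) = (-(qc q)⁻¹) ^ (ℓ - s.card) • dR r ω s := by
  rw [dR, dlt, Finset.smul_sum, Finset.sdiff_sdiff_eq_self hs]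
  have hk : s.card ≤ ℓ := by simpa using Finset.card_le_card hs
  refine Finset.sum_congr rfl fun i hi => ?_
  have hi' := Finset.mem_Icc.1 (hs hi)
  rw [h i hi, RAct.twist_act, swap_Mop hi'.2, smul_smul]
  congr 1
  have n1 := nlt_add_ngt_of_mem hi
  have n2 := nlt_sdiff hs hi'.2
  rw [gam, ← pow_add, ← pow_add]
  congr 1
  omega

theorem dR_smul (r : RAct ℓ q V) (c : ℂ) (ω : Finset ℕ → V) (s : Finset ℕ) :
    dR r (fun t => c • ω t) s = c • dR r ω s := by
  rw [dR, dR, Finset.smul_sum]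
  exact Finset.sum_congr rfl fun i _ => by rw [map_smul, LinearMap.smul_apply, smul_comm]

theorem dlt_smul (r : RAct ℓ q V) (c : ℂ) (ω : Finset ℕ → V) (s : Finset ℕ) :
    dlt r (fun t => c • ω t) s = c • dlt r ω s := by
  rw [dlt, dlt, Finset.smul_sum]
  exact Finset.sum_congr rfl fun i _ => by rw [map_smul, LinearMap.smul_apply, smul_comm]

theorem dlt_dR_twist {r : RAct ℓ q V} {ω : Finset ℕ → V} {s : Finset ℕ} (hs : s ⊆ Finset.Icc 1 ℓ) :
    dlt r.twist (dR r.twist (compl ℓ ω)) (Finset.Icc 1 ℓ \ s) =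
      ((-(qc q)⁻¹) ^ (ℓ - s.card) * (-qc q) ^ (s.card - 1)) • dR r (dlt r ω) s := by
  rw [dlt_twist (ω := fun t => (-qc q) ^ (s.card - 1) • dlt r ω t) hs, dR_smul, smul_smul]
  intro i hi
  rw [← Icc_sdiff_erase hs hi, dR_twist (ω := ω) ((Finset.erase_subset _ _).trans hs),
    Finset.card_erase_of_mem hi]
  intro j hj
  rw [compl, Icc_sdiff_sdiff_erase ((Finset.erase_subset _ _).trans hs) hj]

theorem dR_dlt_twist {r : RAct ℓ q V} {ω : Finset ℕ → V} {s : Finset ℕ} (hs : s ⊆ Finset.Icc 1 ℓ) :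
    dR r.twist (dlt r.twist (compl ℓ ω)) (Finset.Icc 1 ℓ \ s) =
      ((-qc q) ^ s.card * (-(qc q)⁻¹) ^ (ℓ - s.card - 1)) • dlt r (dR r ω) s := by
  rw [dR_twist (ω := fun t => (-(qc q)⁻¹) ^ (ℓ - s.card - 1) • dR r ω t) hs, dlt_smul, smul_smul]
  intro i hi
  have hi' := Finset.mem_sdiff.1 hi
  have hsub : insert i s ⊆ Finset.Icc 1 ℓ := Finset.insert_subset hi'.1 hs
  have e : (Finset.Icc 1 ℓ \ s).erase i = Finset.Icc 1 ℓ \ insert i s := by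
    rw [← Icc_sdiff_sdiff_erase hs hi, Finset.sdiff_sdiff_eq_self
      ((Finset.erase_subset _ _).trans Finset.sdiff_subset)]
  rw [e, dlt_twist (ω := ω) hsub, Finset.card_insert_of_notMem hi'.2, Nat.sub_sub]
  intro j hj
  rw [← Icc_sdiff_erase hsub hj, compl_compl ((Finset.erase_subset _ _).trans hsub)]

/-- The companion of the Laplacian of an equivariant family. -/
theorem Equi.dual_laplace {r : RAct ℓ q V} {d : ℤ} {ω : Finset ℕ → V} (h : Equi r d ω)
    {s : Finset ℕ} (hs : s ⊆ Finset.Icc 1 ℓ) :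
    ((qc q)⁻¹ * (-qc q) ^ s.card) • dlt r (dR r ω) s +
      ((qc q)⁻¹ ^ 2 * (-qc q) ^ (s.card - 1)) • dR r (dlt r ω) s =
    ∑ i ∈ Finset.Icc 1 ℓ, (((qc q)⁻¹ ^ 2) ^ i * (if i ∈ s then 1 else qc q)) •
        r.act (ω s) (Mop ℓ q i ℓ * Mopst ℓ q i ℓ) +
      (qc q ^ (-(ℓ : ℤ)) * qint q (ℓ - s.card) * qint q (s.card - d)) • ω s := by
  have hk : s.card ≤ ℓ := by simpa using Finset.card_le_card hs
  have hcard : (Finset.Icc 1 ℓ \ s).card = ℓ - s.card := by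
    rw [Finset.card_sdiff_of_subset hs, Nat.card_Icc, Nat.add_sub_cancel]
  -- The complement has size `ℓ - |s|` and shift `-d - 1`, so the second quantum integer becomes `ℓ
  -- + 1 + (-d - 1) - (ℓ - |s|) = |s| - d`.
  have key := h.compl.laplace (s := Finset.Icc 1 ℓ \ s) Finset.sdiff_subset
  rw [dlt_dR_twist hs, dR_dlt_twist hs, hcard, compl_compl hs] at key
  have c1 := neg_qc_inv_pow_mul q (ℓ - s.card)
  have c2 := neg_qc_inv_pow_mul q (ℓ - s.card - 1)
  rw [add_comm]
  refine Eq.trans ?_ (key.trans ?_)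
  · rw [smul_smul, smul_smul]
    congr 2
    · linear_combination (-(qc q)⁻¹ ^ 2 * (-qc q) ^ (s.card - 1)) * c1
    · linear_combination (-(qc q)⁻¹ * (-qc q) ^ s.card) * c2
  · congr 1
    · refine Finset.sum_congr rfl fun i hi => ?_
      have hi' := Finset.mem_Icc.1 hi
      rw [RAct.twist_act, map_mul, swap_Mst hi'.2, swap_M hi'.2]
      congr 2
      simp only [Finset.mem_sdiff, hi, true_and]
      split_ifs <;> rfl
    · congr 3
      · rw [Nat.cast_sub hk]
      · rw [Nat.cast_sub hk]; ring

/-! ### The Casimir of the Levi subalgebra -/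

theorem rho_eq (q : Set.Ioo (0 : ℝ) 1) : rho q = ((qc q - (qc q)⁻¹) ^ 2)⁻¹ := by
  rw [rho, qpow_one, qpow_neg_one]

/-- With `x = q⁻²`, the inner sums are geometric in the number of elements of `s` above `j`, and the
sums over the complement are evaluated by `sum_compl_pow`. Only the size of `s` survives. -/
theorem levi_scalar {s : Finset ℕ} (hs : s ⊆ Finset.Icc 1 ℓ) :
    ∑ i ∈ Finset.Icc 1 ℓ, rho q * qc q ^ (ℓ + 2) * ((qc q)⁻¹ ^ 2) ^ i * (if i ∈ s then qc q ^ 2 else 1) +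
      ∑ j ∈ Finset.Icc 1 ℓ \ s, ∑ i ∈ s.filter (j < ·),
        qc q ^ (ℓ + 2) * ((qc q)⁻¹ ^ 2) ^ j * ((qc q)⁻¹ ^ 2) ^ nbtw s j i =
      rho q * (qc q * (qint q ℓ + (qc q - (qc q)⁻¹) * qc q ^ ((ℓ : ℤ) - s.card + 1) * qint q s.card)) := by
  have hq := qc_ne q
  have hk : s.card ≤ ℓ := by simpa using Finset.card_le_card hs
  have hx1 := one_sub_qc_inv_sq_ne q
  have hq1 := qc_sq_ne_one q
  have h1 : qc q ^ 2 - 1 ≠ 0 := sub_ne_zero.2 hq1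
  set x := (qc q)⁻¹ ^ 2 with hx
  have hx0 : x ≠ 0 := pow_ne_zero _ (inv_ne_zero hq)
  have hxq : x * qc q ^ 2 = 1 := by rw [hx, inv_pow, inv_mul_cancel₀ (pow_ne_zero 2 hq)]
  have hne : x ≠ 1 := fun h => hx1 (by rw [h, sub_self])
  -- This trades the geometric denominator `1 - x` for the normalisation `rho` of the torus part.
  have hrho : rho q * (qc q ^ 2 - 1) * (1 - x) = 1 := by
    rw [rho_eq, hx]; field_simp
  have inner : ∀ j ∈ Finset.Icc 1 ℓ \ s, ∑ i ∈ s.filter (j < ·),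
        qc q ^ (ℓ + 2) * x ^ j * x ^ nbtw s j i =
      rho q * qc q ^ (ℓ + 2) * (qc q ^ 2 - 1) * (x ^ j - x ^ s.card * x ^ (j - nlt s j)) := by
    intro j hj
    rw [Finset.mem_sdiff] at hj
    have hj' := Finset.mem_Icc.1 hj.1
    have hlt := nlt_lt hs hj'.1
    have hcard := nlt_add_ngt hj.2
    have e : x ^ s.card * x ^ (j - nlt s j) = x ^ j * x ^ ngt s j := by
      rw [← pow_add, ← pow_add]; congr 1; omega
    have g := geom_sum_above x s j
    rw [← Finset.mul_sum, e]
    linear_combination rho q * qc q ^ (ℓ + 2) * (qc q ^ 2 - 1) * x ^ j * g -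
      qc q ^ (ℓ + 2) * x ^ j * (∑ i ∈ s.filter (j < ·), x ^ nbtw s j i) * hrho
  have first : ∑ i ∈ Finset.Icc 1 ℓ, rho q * qc q ^ (ℓ + 2) * x ^ i * (if i ∈ s then qc q ^ 2 else 1) =
      rho q * qc q ^ (ℓ + 2) * (∑ i ∈ Finset.Icc 1 ℓ \ s, x ^ i + qc q ^ 2 * ∑ i ∈ s, x ^ i) := by
    rw [← Finset.sum_sdiff hs, mul_add, Finset.mul_sum, Finset.mul_sum, Finset.mul_sum]
    congr 1
    · exact Finset.sum_congr rfl fun i hi => by rw [if_neg (Finset.mem_sdiff.1 hi).2, mul_one]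
    · exact Finset.sum_congr rfl fun i hi => by rw [if_pos hi]; ring
  have tot : ∑ i ∈ Finset.Icc 1 ℓ \ s, x ^ i + ∑ i ∈ s, x ^ i = (x - x ^ (ℓ + 1)) / (1 - x) := by
    rw [Finset.sum_sdiff hs, geom_sum_Icc hne]
  rw [first, Finset.sum_congr rfl inner, ← Finset.mul_sum, Finset.sum_sub_distrib, ← Finset.mul_sum,
    sum_compl_pow x hs, geom_sum_Icc hne]
  have e1 : x ^ s.card * x ^ (ℓ - s.card + 1) = x ^ (ℓ + 1) := by
    rw [← pow_add]; congr 1; omega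
  have e2 : (qc q ^ 2 - 1) * ((x - x ^ (ℓ - s.card + 1)) / (1 - x)) = 1 - x ^ (ℓ - s.card) := by
    rw [pow_succ]
    field_simp
    linear_combination (1 - x ^ (ℓ - s.card)) * hxq
  have e3 : qc q ^ 2 * ((x - x ^ (ℓ + 1)) / (1 - x)) = (1 - x ^ ℓ) / (1 - x) := by
    rw [pow_succ]
    field_simp
    linear_combination (1 - x ^ ℓ) * hxq
  have e4 : x ^ s.card * x ^ (ℓ - s.card) = x ^ ℓ := by rw [← pow_add]; congr 1; omega
  calc _ = rho q * qc q ^ (ℓ + 2) * ((1 - x ^ ℓ) / (1 - x) - (x ^ s.card - x ^ ℓ)) := by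
        rw [← e3, ← tot, ← e4]
        linear_combination (-(rho q * qc q ^ (ℓ + 2) * x ^ s.card)) * e2
    _ = _ := by
      have hxn : ∀ n : ℕ, x ^ n = ((qc q ^ n) ^ 2)⁻¹ := fun n => by
        rw [hx, ← pow_mul, mul_comm, pow_mul, inv_pow, inv_pow]
      rw [hxn, hxn, hx, qint, qint, rho_eq, zpow_add₀ hq, zpow_sub₀ hq]
      simp only [zpow_neg, zpow_natCast, zpow_one, pow_add]
      have a1 := pow_ne_zero ℓ hq
      have a2 := pow_ne_zero s.card hq
      generalize qc q ^ ℓ = y at a1 ⊢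
      generalize qc q ^ s.card = z at a2 ⊢
      field_simp
      ring

/-- The Casimir of the Levi subalgebra acts on an equivariant family by a scalar. -/
theorem Equi.levi {r : RAct ℓ q V} {d : ℤ} {ω : Finset ℕ → V} (h : Equi r d ω)
    {s : Finset ℕ} (hs : s ⊆ Finset.Icc 1 ℓ) :
    ∑ i ∈ Finset.Icc 1 ℓ, (rho q * qc q ^ (ℓ + 2) * ((qc q)⁻¹ ^ 2) ^ i) •
        r.act (ω s) (P ℓ q i ^ 2 * P ℓ q i ^ 2) +
      ∑ j ∈ Finset.Icc 1 ℓ, ∑ m ∈ Finset.Ico j ℓ, (qc q ^ (ℓ + 1) * ((qc q)⁻¹ ^ 2) ^ j) •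
        r.act (ω s) (Mst ℓ q j m * (P ℓ q j ^ 2 * P ℓ q (m + 1) ^ 2) * M ℓ q j m) =
      (qc q ^ d * qc q ^ d * (rho q * (qc q * (qint q ℓ +
        (qc q - (qc q)⁻¹) * qc q ^ ((ℓ : ℤ) - s.card + 1) * qint q s.card)))) • ω s := by
  have hq := qc_ne q
  rw [← levi_scalar hs, mul_add, add_smul, Finset.mul_sum, Finset.sum_smul]
  congr 1
  · refine Finset.sum_congr rfl fun i hi => ?_
    have hi' := Finset.mem_Icc.1 hi
    rw [r.act_mul, h.hP i hi'.1 hi'.2 s hs, map_smul, LinearMap.smul_apply, h.hP i hi'.1 hi'.2 s hs,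
      smul_smul, smul_smul, zpow_add₀ hq]
    congr 1
    split_ifs
    · rw [zpow_one]; ring
    · rw [zpow_zero]; ring
  -- The vector `M_{j,m}^*` acts nontrivially only for `j ∉ s` and `m + 1 ∈ s`. It then moves `m +
  -- 1` to `j`, the torus contributes `q^{2d+1}`, and `M_{j,m}` moves the element back, so that the
  -- factor `(-q⁻¹)^{nbtw}` is squared.
  · rw [← Finset.sum_sdiff hs, Finset.sum_eq_zero (s := s), add_zero, Finset.mul_sum, Finset.sum_smul]
    · refine Finset.sum_congr rfl fun j hj => ?_
      rw [Finset.mem_sdiff] at hj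
      have hj' := Finset.mem_Icc.1 hj.1
      rw [← sum_Ico_succ_ite hs, Finset.mul_sum, Finset.sum_smul]
      refine Finset.sum_congr rfl fun m hm => ?_
      rw [Finset.mem_Ico] at hm
      rw [r.act_mul, r.act_mul, h.hF.act_Mst hj'.1 hm.1 hm.2 hs]
      by_cases hms : m + 1 ∈ s
      · have ht : move s (m + 1) j ⊆ Finset.Icc 1 ℓ := move_subset hs hj'.1 hj'.2
        have hjt : j ∈ move s (m + 1) j := by unfold move; grind
        have hmt : m + 1 ∉ move s (m + 1) j := by unfold move; grind
        have hback : move (move s (m + 1) j) j (m + 1) = s := by ext x; unfold move; grind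
        have hn : nbtw (move s (m + 1) j) j (m + 1) = nbtw s j (m + 1) :=
          nbtw_congr fun x => by unfold move; grind
        rw [if_pos (show m + 1 ∈ s ∧ j ∉ s from ⟨hms, hj.2⟩), if_pos hms, map_smul,
          LinearMap.smul_apply, r.act_mul, h.hP j hj'.1 hj'.2 _ ht]
        simp only [map_smul, LinearMap.smul_apply]
        rw [h.hP (m + 1) (by omega) (by omega) _ ht, if_pos hjt, if_neg hmt]
        simp only [map_smul, LinearMap.smul_apply]
        rw [h.hE.act_M hj'.1 hm.1 hm.2 ht, if_pos (show _ ∧ _ from ⟨hjt, hmt⟩), hback, hn]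
        simp only [smul_smul]
        congr 1
        have e : ((qc q)⁻¹ ^ 2) ^ nbtw s j (m + 1) =
            (-(qc q)⁻¹) ^ nbtw s j (m + 1) * (-(qc q)⁻¹) ^ nbtw s j (m + 1) := by
          rw [← mul_pow]; ring
        rw [e, zpow_add₀ hq, zero_add, zpow_one]
        ring1
      · rw [if_neg (by tauto : ¬ (m + 1 ∈ s ∧ j ∉ s)), if_neg hms]; simp
    · intro j hj
      have hj' := Finset.mem_Icc.1 (hs hj)
      refine Finset.sum_eq_zero fun m hm => ?_
      rw [Finset.mem_Ico] at hm
      rw [r.act_mul, r.act_mul, h.hF.act_Mst hj'.1 hm.1 hm.2 hs,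
        if_neg (by tauto : ¬ (m + 1 ∈ s ∧ j ∉ s))]
      simp

/-! ### The inverse antipode -/

theorem Sinv_one : Sinv (1 : U ℓ q) = 1 := by simp [Sinv]

theorem Sinv_add (x y : U ℓ q) : Sinv (x + y) = Sinv x + Sinv y := by simp [Sinv]

theorem Sinv_sub (x y : U ℓ q) : Sinv (x - y) = Sinv x - Sinv y := by simp [Sinv]

theorem Sinv_smul (c : ℂ) (x : U ℓ q) : Sinv (c • x) = c • Sinv x := by simp [Sinv]

theorem Sinv_sum {ι : Type*} (s : Finset ι) (f : ι → U ℓ q) :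
    Sinv (∑ i ∈ s, f i) = ∑ i ∈ s, Sinv (f i) := by simp [Sinv]

theorem Sinv_pow (x : U ℓ q) (n : ℕ) : Sinv (x ^ n) = Sinv x ^ n := by simp [Sinv]

theorem Sinv_gen (x : Gen ℓ) : Sinv (gen q x) = (antipodeGen q (-1) x).unop := by
  rw [Sinv, antipodeInvHom, lift_gen]

theorem Sinv_E (i : ℕ) : Sinv (E ℓ q i) = -(qc q)⁻¹ • E ℓ q i := by
  by_cases h : i ∈ Finset.Icc 1 ℓ
  · rw [E_mem h, Sinv_gen, ← qpow_neg_one]; rfl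
  · rw [E_not_mem h]; simp [Sinv]

theorem Sinv_F (i : ℕ) : Sinv (F ℓ q i) = -qc q • F ℓ q i := by
  by_cases h : i ∈ Finset.Icc 1 ℓ
  · rw [F_mem h, Sinv_gen, ← qpow_one]; simp [antipodeGen]
  · rw [F_not_mem h]; simp [Sinv]

/-- One map reverses products and the other does not. They agree on the generators of the torus,
hence on all of it, because the torus is commutative. -/
theorem Sinv_torus {g : U ℓ q} (hg : g ∈ torus ℓ q) : Sinv g = swap g ∧ swap g ∈ torus ℓ q := by
  induction hg using Submonoid.closure_induction with
  | mem x hx =>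
    rcases hx with (⟨i, rfl⟩ | ⟨i, rfl⟩) | (rfl | rfl)
    · rw [swap, lift_gen]
      exact ⟨Sinv_gen _, Submonoid.subset_closure (Or.inl (Or.inr ⟨_, rfl⟩))⟩
    · rw [swap, lift_gen]
      exact ⟨Sinv_gen _, Submonoid.subset_closure (Or.inl (Or.inl ⟨_, rfl⟩))⟩
    · rw [swap, kap, lift_gen]
      exact ⟨Sinv_gen _, kapinv_mem_torus⟩
    · rw [swap, kapinv, lift_gen]
      exact ⟨Sinv_gen _, kap_mem_torus⟩
  | one => rw [Sinv_one, map_one]; exact ⟨rfl, one_mem _⟩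
  | mul x y _ _ hx hy =>
    rw [Sinv_mul, map_mul, hx.1, hy.1]
    exact ⟨torus_comm hy.2 hx.2, mul_mem hx.2 hy.2⟩

/-- Reversal of products turns each bracket into its opposite, with a factor `-q⁻¹` from each of the
`k - j + 1` generators. -/
theorem Sinv_M {j k : ℕ} (h : j ≤ k) :
    Sinv (M ℓ q j k) = (-(qc q)⁻¹) ^ (k - j + 1) • Mop ℓ q j k := by
  refine downInd (p := fun j => Sinv (M ℓ q j k) = (-(qc q)⁻¹) ^ (k - j + 1) • Mop ℓ q j k) ?_ ?_ j h
  · rw [M_self, Mop_self, Sinv_E]; simp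
  · intro j hj ih
    rw [M_eq hj, Mop_eq hj, Sinv_sub, Sinv_smul, Sinv_mul, Sinv_mul, ih, Sinv_E,
      show k - j + 1 = (k - (j + 1) + 1) + 1 by omega, pow_succ (-(qc q)⁻¹) (k - (j + 1) + 1)]
    simp only [smul_mul_assoc, mul_smul_comm]
    module

theorem Sinv_Mst {j k : ℕ} (h : j ≤ k) :
    Sinv (Mst ℓ q j k) = (-qc q) ^ (k - j + 1) • Mopst ℓ q j k := by
  refine downInd (p := fun j => Sinv (Mst ℓ q j k) = (-qc q) ^ (k - j + 1) • Mopst ℓ q j k) ?_ ?_ j h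
  · rw [Mst_self, Mopst_self, Sinv_F]; simp
  · intro j hj ih
    rw [Mst_eq hj, Mopst_eq hj, Sinv_sub, Sinv_smul, Sinv_mul, Sinv_mul, ih, Sinv_F,
      show k - j + 1 = (k - (j + 1) + 1) + 1 by omega, pow_succ (-qc q) (k - (j + 1) + 1)]
    simp only [smul_mul_assoc, mul_smul_comm]
    module

/-- On the elements `M_{j,k}^* g M_{j,k}` with `g` in the torus, the inverse antipode agrees with the
automorphism `swap`. -/
theorem Sinv_Mst_mul_M {j k : ℕ} (h : j ≤ k) {g : U ℓ q} (hg : g ∈ torus ℓ q) :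
    Sinv (Mst ℓ q j k * g * M ℓ q j k) = swap (Mst ℓ q j k * g * M ℓ q j k) := by
  rw [Sinv_mul, Sinv_mul, Sinv_M h, Sinv_Mst h, (Sinv_torus hg).1, map_mul, map_mul, swap_Mst h, swap_M h,
    smul_mul_assoc, mul_smul_comm, mul_smul_comm, smul_smul, neg_qc_inv_pow_mul, one_smul, mul_assoc]

/-! ### The elements `X_i` -/

theorem Nel_last (i : ℕ) : Nel ℓ q i ℓ = P ℓ q i * Khatinv ℓ q := by
  rw [Nel, Naux, Kprod_of_lt (Nat.lt_succ_self ℓ), mul_one]; rfl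

theorem Nel_mem_torus (i k : ℕ) : Nel ℓ q i k ∈ torus ℓ q :=
  mul_mem (mul_mem (Kprod_mem_torus _ _) (Kprod_mem_torus _ _)) Khatinv_mem_torus

theorem sum_chrP_self {i : ℕ} (h1 : 1 ≤ i) (h2 : i ≤ ℓ) :
    ∑ m ∈ Finset.Icc i ℓ, (chrP ℓ i m : ℝ) / 2 = 1 := by
  rw [← Finset.sum_div, ← Int.cast_sum, sum_chrP h1, if_pos (by omega), if_neg (by omega), if_pos (by omega)]
  norm_num

theorem sum_chrP_of_ne {i j : ℕ} (h1 : 1 ≤ i) (h2 : i ≤ ℓ) (h4 : j ≤ ℓ) (h : i ≠ j) :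
    ∑ m ∈ Finset.Icc j ℓ, (chrP ℓ i m : ℝ) / 2 = 1 / 2 := by
  rw [← Finset.sum_div, ← Int.cast_sum, sum_chrP h1]
  rcases lt_or_gt_of_ne h with h' | h'
  · rw [if_neg (by omega), if_neg (by omega), if_pos (by omega)]; norm_num
  · rw [if_pos (by omega), if_pos (by omega), if_pos (by omega)]; norm_num

/-- The weight of `M_{i,ℓ}` is `1` under `P_i` and `-1` under `K̂⁻¹`. -/
theorem commute_Nel_M {i : ℕ} (h1 : 1 ≤ i) (h2 : i ≤ ℓ) : Commute (Nel ℓ q i ℓ) (M ℓ q i ℓ) := by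
  have h := ((Chr.P (q := q) h1 (by omega : i ≤ ℓ + 1)).mul Chr.Khatinv).M h1 le_rfl h2
  rw [← Nel_last] at h
  simp only [Pi.add_apply] at h
  rw [Finset.sum_add_distrib, sum_chrP_self h1 h2, Finset.sum_ite_eq', if_pos (by simp [h2])] at h
  rw [add_neg_cancel, qpow_zero, one_smul] at h
  exact h

theorem commute_Nel_Mst {i : ℕ} (h1 : 1 ≤ i) (h2 : i ≤ ℓ) : Commute (Nel ℓ q i ℓ) (Mst ℓ q i ℓ) := by
  have := commute_star (commute_Nel_M (q := q) h1 h2)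
  rwa [star_torus (Nel_mem_torus _ _)] at this

theorem star_X (i : ℕ) : star (X ℓ q i) = M ℓ q i ℓ * Nel ℓ q i ℓ := by
  rw [X, star_mul, star_star, star_torus (Nel_mem_torus _ _)]

theorem X_mul_star_X {i : ℕ} (h1 : 1 ≤ i) (h2 : i ≤ ℓ) :
    X ℓ q i * star (X ℓ q i) = Mst ℓ q i ℓ * Nel ℓ q i ℓ ^ 2 * M ℓ q i ℓ := by
  rw [star_X, ← (commute_Nel_M h1 h2).eq, X, ← Mst, (commute_Nel_Mst h1 h2).eq, sq]
  simp only [mul_assoc]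

theorem X_mul_star_X' {i : ℕ} (h1 : 1 ≤ i) (h2 : i ≤ ℓ) :
    X ℓ q i * star (X ℓ q i) = Nel ℓ q i ℓ ^ 2 * (Mst ℓ q i ℓ * M ℓ q i ℓ) := by
  rw [X_mul_star_X h1 h2, ← ((commute_Nel_Mst h1 h2).pow_left 2).eq, mul_assoc]

theorem Khat_mul_X (i : ℕ) : Khat ℓ q * X ℓ q i = P ℓ q i * Mst ℓ q i ℓ := by
  rw [X, Nel_last, (torus_comm (P_mem_torus i) Khatinv_mem_torus).eq, ← mul_assoc, ← mul_assoc,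
    Khat_mul_Khatinv, one_mul, Mst]

theorem star_Khat : star (Khat ℓ q) = Khat ℓ q := star_torus Khat_mem_torus

theorem star_X_mul_Khat (i : ℕ) : star (X ℓ q i) * Khat ℓ q = star (Khat ℓ q * X ℓ q i) := by
  rw [star_mul, star_Khat]

theorem star_X_mul_Khat' (i : ℕ) : star (X ℓ q i) * Khat ℓ q = M ℓ q i ℓ * P ℓ q i := by
  rw [star_X_mul_Khat, Khat_mul_X, star_mul, star_torus (P_mem_torus i), Mst, star_star]

theorem Sinv_P (i : ℕ) : Sinv (P ℓ q i) = Pinv ℓ q i := by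
  rw [(Sinv_torus (P_mem_torus i)).1, swap_P]

/-- The reason for introducing the opposite root vectors: these are the elements through which `∂̄`
acts from the right. -/
theorem Sinv_Khat_mul_X {i : ℕ} (h : i ≤ ℓ) :
    Sinv (Khat ℓ q * X ℓ q i) = (-qc q) ^ (ℓ - i + 1) • (Mopst ℓ q i ℓ * Pinv ℓ q i) := by
  rw [Khat_mul_X, Sinv_mul, Sinv_Mst h, Sinv_P, smul_mul_assoc]

theorem Sinv_star_X_mul_Khat {i : ℕ} (h : i ≤ ℓ) :
    Sinv (star (X ℓ q i) * Khat ℓ q) = (-(qc q)⁻¹) ^ (ℓ - i + 1) • (Pinv ℓ q i * Mop ℓ q i ℓ) := by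
  rw [star_X_mul_Khat', Sinv_mul, Sinv_M h, Sinv_P, mul_smul_comm]

/-! ### Commutation relations between root vectors -/

/-- In the algebra of a chain of three simple roots the middle generator commutes with the
highest root vector. -/
theorem serre_middle {T : Type*} [Ring T] [Algebra ℂ T] {b f g : T} {x : ℂ} (hx : x ≠ 0)
    (hx2 : x + x⁻¹ ≠ 0) (hbg : b * g = g * b)
    (h1 : f * f * b + b * f * f = (x + x⁻¹) • (f * b * f))
    (h2 : f * f * g + g * f * f = (x + x⁻¹) • (f * g * f)) :
    f * ((b * f - x⁻¹ • (f * b)) * g - x⁻¹ • (g * (b * f - x⁻¹ • (f * b)))) =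
      ((b * f - x⁻¹ • (f * b)) * g - x⁻¹ • (g * (b * f - x⁻¹ • (f * b)))) * f := by
  have a1 : f * (b * (f * g)) = (x + x⁻¹)⁻¹ • (f * (f * (b * g)) + b * (f * (f * g))) := by
    have := congrArg (· * g) h1
    simp only [add_mul, smul_mul_assoc, mul_assoc] at this
    rw [this, inv_smul_smul₀ hx2]
  have a2 : b * (f * (g * f)) = (x + x⁻¹)⁻¹ • (b * (f * (f * g)) + g * (b * (f * f))) := by
    have := congrArg (b * ·) h2
    simp only [mul_add, mul_smul_comm, mul_assoc] at this
    rw [← mul_assoc b g, hbg, mul_assoc] at this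
    rw [this, inv_smul_smul₀ hx2]
  have a3 : f * (g * (f * b)) = (x + x⁻¹)⁻¹ • (f * (f * (b * g)) + g * (f * (f * b))) := by
    have := congrArg (· * b) h2
    simp only [add_mul, smul_mul_assoc, mul_assoc] at this
    rw [← hbg] at this
    rw [this, inv_smul_smul₀ hx2]
  have a4 : g * (f * (b * f)) = (x + x⁻¹)⁻¹ • (g * (f * (f * b)) + g * (b * (f * f))) := by
    have := congrArg (g * ·) h1
    simp only [mul_add, mul_smul_comm, mul_assoc] at this
    rw [this, inv_smul_smul₀ hx2]
  have a5 : f * (b * (g * f)) = f * (g * (b * f)) := by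
    rw [← mul_assoc b, hbg, mul_assoc]
  simp only [mul_sub, sub_mul, smul_mul_assoc, mul_smul_comm, mul_assoc, smul_sub, smul_smul]
  rw [a1, a2, a3, a4, a5]
  -- After the Serre substitutions the difference of the two sides is a multiple of `c (1 + x⁻²) -
  -- x⁻¹` with `c = (x + x⁻¹)⁻¹`, and this number is zero.
  have e : (x + x⁻¹)⁻¹ * (1 + x⁻¹ * x⁻¹) = x⁻¹ := by
    have : (1 + x⁻¹ * x⁻¹) = x⁻¹ * (x + x⁻¹) := by field_simp
    rw [this, mul_comm, mul_assoc, mul_inv_cancel₀ hx2, mul_one]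
  generalize (x + x⁻¹)⁻¹ = c at e ⊢
  generalize x⁻¹ = y at e ⊢
  rw [← sub_eq_zero]
  trans (c * (1 + y * y) - y) • (f * (f * (b * g)) - g * (b * (f * f)))
  · module
  · rw [e, sub_self, zero_smul]

theorem qc_add_inv_ne (q : Set.Ioo (0 : ℝ) 1) : qc q + (qc q)⁻¹ ≠ 0 := by
  rw [qc_eq]
  have h := q.2.1
  have : (0 : ℝ) < (q : ℝ) + (q : ℝ)⁻¹ := by positivity
  exact_mod_cast this.ne'

/-- `M_{i+1,ℓ}^*` is a bracket of `F_{i+1}` with an element that commutes with `F_i`, so the Serre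
relation between `F_i` and `F_{i+1}` carries over. -/
theorem F_serre_Mst {i : ℕ} (h : i < ℓ) :
    F ℓ q i * F ℓ q i * Mst ℓ q (i + 1) ℓ + Mst ℓ q (i + 1) ℓ * F ℓ q i * F ℓ q i =
      (qc q + (qc q)⁻¹) • (F ℓ q i * Mst ℓ q (i + 1) ℓ * F ℓ q i) := by
  rcases Nat.lt_or_ge (i + 1) ℓ with h' | h'
  · have hs := F_serre_succ (ℓ := ℓ) (q := q) i
    have hc : F ℓ q i * Mst ℓ q (i + 2) ℓ = Mst ℓ q (i + 2) ℓ * F ℓ q i :=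
      commute_Mst (by omega) fun j hj _ => F_comm_of_lt (by omega)
    rw [Mst_eq h']
    generalize Mst ℓ q (i + 1 + 1) ℓ = x at hc ⊢
    generalize F ℓ q (i + 1) = g at hs ⊢
    generalize F ℓ q i = f at hs hc ⊢
    have b1 := congrArg (x * ·) hs
    have b2 := congrArg (· * x) hs
    simp only [mul_add, add_mul, mul_smul_comm, smul_mul_assoc, mul_assoc] at b1 b2
    have hc' : ∀ y, f * (x * y) = x * (f * y) := fun y => by rw [← mul_assoc, hc, mul_assoc]
    simp only [mul_sub, sub_mul, mul_smul_comm, smul_mul_assoc, mul_assoc, hc', hc] at b1 b2 ⊢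
    trans (x * (f * (f * g)) + x * (g * (f * f))) -
      (qc q)⁻¹ • (f * (f * (g * x)) + g * (x * (f * f)))
    · module
    · rw [b1, b2]; module
  · obtain rfl : ℓ = i + 1 := by omega
    rw [Mst_self]
    exact F_serre_succ i

/-- An instance of `serre_middle` with the chain `M_{i+2,ℓ}^*`, `F_{i+1}`, `F_i`. -/
theorem commute_F_Mst {i : ℕ} (h : i + 1 < ℓ) : Commute (F ℓ q (i + 1)) (Mst ℓ q i ℓ) := by
  rw [Mst_eq (by omega), Mst_eq h]
  refine serre_middle (qc_ne q) (qc_add_inv_ne q) ?_ (F_serre_Mst h) ?_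
  · exact ((commute_Mst (by omega) fun j hj _ => F_comm_of_lt (by omega)).eq).symm
  · exact F_succ_serre i

/-- `F_i` commutes with `M_{j,ℓ}^*` when `i + 1 < j`, so a relation for `i + 1` passes to `i` by
bracketing. -/
theorem Mst_mul_Mst_of_commute {i j : ℕ} (hij : i + 1 < j) (hj : j ≤ ℓ)
    (h : Mst ℓ q j ℓ * Mst ℓ q (i + 1) ℓ = qc q • (Mst ℓ q (i + 1) ℓ * Mst ℓ q j ℓ)) :
    Mst ℓ q j ℓ * Mst ℓ q i ℓ = qc q • (Mst ℓ q i ℓ * Mst ℓ q j ℓ) := by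
  have hc : F ℓ q i * Mst ℓ q j ℓ = Mst ℓ q j ℓ * F ℓ q i :=
    commute_Mst hj fun k hk _ => F_comm_of_lt (by omega)
  rw [Mst_eq (by omega : i < ℓ)]
  generalize Mst ℓ q (i + 1) ℓ = x at h ⊢
  generalize Mst ℓ q j ℓ = y at h hc ⊢
  generalize F ℓ q i = f at hc ⊢
  have h' : ∀ z, y * (x * z) = qc q • (x * (y * z)) := fun z => by
    rw [← mul_assoc, h, smul_mul_assoc, mul_assoc]
  have hc' : ∀ z, y * (f * z) = f * (y * z) := fun z => by
    rw [← mul_assoc, ← hc, mul_assoc]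
  simp only [mul_sub, sub_mul, mul_smul_comm, smul_mul_assoc, mul_assoc, h', hc', h, hc]
  module

/-- The base case is a Serre relation. In the step, `M_{i+2,ℓ}^*` and `M_{i,ℓ}^*` commute up to `q`
by the previous lemma, and `F_{i+1}` commutes with `M_{i,ℓ}^*`. Bracketing the two gives the
relation for `M_{i+1,ℓ}^*`. -/
theorem Mst_mul_Mst_succ {i : ℕ} (h : i < ℓ) :
    Mst ℓ q (i + 1) ℓ * Mst ℓ q i ℓ = qc q • (Mst ℓ q i ℓ * Mst ℓ q (i + 1) ℓ) := by
  obtain ⟨n, rfl⟩ : ∃ n, ℓ = n + 1 := ⟨ℓ - 1, by omega⟩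
  refine downInd (k := n) (p := fun i => Mst (n + 1) q (i + 1) (n + 1) * Mst (n + 1) q i (n + 1) =
    qc q • (Mst (n + 1) q i (n + 1) * Mst (n + 1) q (i + 1) (n + 1))) ?_ ?_ i (by omega)
  · have hs := F_succ_serre (ℓ := n + 1) (q := q) n
    have hq := qc_ne q
    rw [Mst_eq (by omega : n < n + 1), Mst_self]
    generalize F (n + 1) q (n + 1) = x at hs ⊢
    generalize F (n + 1) q n = y at hs ⊢
    simp only [mul_sub, sub_mul, mul_smul_comm, smul_mul_assoc, mul_assoc, smul_sub, smul_smul] at hs ⊢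
    rw [mul_inv_cancel₀ hq, one_smul, sub_eq_sub_iff_add_eq_add, hs]
    module
  · intro i hi ih
    have h2 := Mst_mul_Mst_of_commute (by omega) (by omega) ih
    have hc := (commute_F_Mst (q := q) (show i + 1 < n + 1 by omega)).eq
    rw [Mst_eq (by omega : i + 1 < n + 1)]
    generalize Mst (n + 1) q (i + 1 + 1) (n + 1) = x at h2 ⊢
    generalize Mst (n + 1) q i (n + 1) = y at h2 hc ⊢
    generalize F (n + 1) q (i + 1) = f at hc ⊢
    have h2' : ∀ z, x * (y * z) = qc q • (y * (x * z)) := fun z => by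
      rw [← mul_assoc, h2, smul_mul_assoc, mul_assoc]
    have hc' : ∀ z, f * (y * z) = y * (f * z) := fun z => by rw [← mul_assoc, hc, mul_assoc]
    simp only [mul_sub, sub_mul, mul_smul_comm, smul_mul_assoc, mul_assoc, h2', hc', h2, hc]
    module

theorem Mst_mul_Mst {i j : ℕ} (hij : i < j) (hj : j ≤ ℓ) :
    Mst ℓ q j ℓ * Mst ℓ q i ℓ = qc q • (Mst ℓ q i ℓ * Mst ℓ q j ℓ) := by
  obtain ⟨n, rfl⟩ : ∃ n, j = n + 1 := ⟨j - 1, by omega⟩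
  refine downInd (k := n) (p := fun i => Mst ℓ q (n + 1) ℓ * Mst ℓ q i ℓ =
    qc q • (Mst ℓ q i ℓ * Mst ℓ q (n + 1) ℓ)) ?_ ?_ i (by omega)
  · exact Mst_mul_Mst_succ (by omega)
  · intro i hi ih
    exact Mst_mul_Mst_of_commute (by omega) hj ih

/-- The elements `K̂ X_i` commute up to a factor `q`. -/
theorem Khat_mul_X_mul {i j : ℕ} (hi : 1 ≤ i) (hij : i < j) (hj : j ≤ ℓ) :
    (Khat ℓ q * X ℓ q j) * (Khat ℓ q * X ℓ q i) = qc q • ((Khat ℓ q * X ℓ q i) * (Khat ℓ q * X ℓ q j)) := by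
  have h1 := (Chr.P (q := q) hi (by omega : i ≤ ℓ + 1)).Mst (j := j) (by omega) le_rfl hj
  have h2 := (Chr.P (q := q) (by omega : 1 ≤ j) (by omega : j ≤ ℓ + 1)).Mst hi le_rfl (by omega : i ≤ ℓ)
  -- For `i ≠ j` the weight of `P_i` on the root vector starting at `j` is `1/2`, and likewise with
  -- `i` and `j` exchanged. Both products therefore acquire the same factor, which cancels.
  rw [sum_chrP_of_ne hi (by omega) hj (by omega)] at h1
  rw [sum_chrP_of_ne (by omega) hj (by omega) (by omega)] at h2
  rw [Khat_mul_X, Khat_mul_X]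
  have h0 := qpow_ne q (-(1 / 2))
  have h1' : Mst ℓ q j ℓ * P ℓ q i = (qpow q (-(1 / 2)))⁻¹ • (P ℓ q i * Mst ℓ q j ℓ) := by
    rw [h1, inv_smul_smul₀ h0]
  have h2' : Mst ℓ q i ℓ * P ℓ q j = (qpow q (-(1 / 2)))⁻¹ • (P ℓ q j * Mst ℓ q i ℓ) := by
    rw [h2, inv_smul_smul₀ h0]
  have e1 : P ℓ q j * Mst ℓ q j ℓ * (P ℓ q i * Mst ℓ q i ℓ) =
      (qpow q (-(1 / 2)))⁻¹ • (P ℓ q i * P ℓ q j * (Mst ℓ q j ℓ * Mst ℓ q i ℓ)) := by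
    rw [mul_assoc, ← mul_assoc (Mst ℓ q j ℓ), h1', (torus_comm (P_mem_torus i) (P_mem_torus j)).eq]
    simp only [smul_mul_assoc, mul_smul_comm, mul_assoc]
  have e2 : P ℓ q i * Mst ℓ q i ℓ * (P ℓ q j * Mst ℓ q j ℓ) =
      (qpow q (-(1 / 2)))⁻¹ • (P ℓ q i * P ℓ q j * (Mst ℓ q i ℓ * Mst ℓ q j ℓ)) := by
    rw [mul_assoc, ← mul_assoc (Mst ℓ q i ℓ), h2']
    simp only [smul_mul_assoc, mul_smul_comm, mul_assoc]
  rw [e1, e2, Mst_mul_Mst hij hj, mul_smul_comm, smul_comm]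

/-! ### The Casimirs -/

theorem Kprod_succ_top {a b : ℕ} (h : a ≤ b + 1) : Kprod ℓ q a (b + 1) = Kprod ℓ q a b * K ℓ q (b + 1) := by
  rw [Kprod, Kprod, show b + 1 + 1 - a = (b + 1 - a) + 1 by omega, List.range'_concat, List.map_append,
    List.prod_append]
  simp [show a + (b + 1 - a) = b + 1 by omega]

/-- Passing to the subalgebra removes one `K_ℓ` from each of the two products. These are restored by
the `K_ℓ²` in the inverse of its element `K̂`, and the surplus `κ⁻¹` is compensated by `κ`. -/
theorem Nel_sq_eq {n j k : ℕ} (hj : j ≤ n + 1) (hk : k + 1 ≤ n + 1) :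
    Nel (n + 1) q j k ^ 2 = kap (n + 1) q ^ 2 *
      Naux (n + 1) q n (kapinv (n + 1) q ^ (n + 1 + 1) * K (n + 1) q (n + 1) ^ 2) j k ^ 2 := by
  have hkk : kap (n + 1) q ∈ torus (n + 1) q := kap_mem_torus
  have hki : kapinv (n + 1) q ∈ torus (n + 1) q := kapinv_mem_torus
  have hN : Naux (n + 1) q n (kapinv (n + 1) q ^ (n + 1 + 1) * K (n + 1) q (n + 1) ^ 2) j k ∈
      torus (n + 1) q := mul_mem (mul_mem (Kprod_mem_torus _ _) (Kprod_mem_torus _ _))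
    (mul_mem (pow_mem hki _) (pow_mem (K_mem_torus _) _))
  rw [← (torus_comm hkk hN).mul_pow]
  congr 1
  rw [Nel, Naux, Naux, Khatinv, Kprod_succ_top hj, Kprod_succ_top hk, pow_succ (kapinv (n + 1) q) (n + 1)]
  have c1 := (torus_comm (K_mem_torus (q := q) (ℓ := n + 1) (n + 1)) (Kprod_mem_torus (k + 1) n)).eq
  set a := Kprod (n + 1) q j n
  set b := Kprod (n + 1) q (k + 1) n
  have hab : a * b ∈ torus (n + 1) q := mul_mem (Kprod_mem_torus _ _) (Kprod_mem_torus _ _)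
  set y := K (n + 1) q (n + 1)
  set x := kapinv (n + 1) q ^ (n + 1)
  have hy : y ^ 2 ∈ torus (n + 1) q := pow_mem (K_mem_torus _) _
  have hx : x ∈ torus (n + 1) q := pow_mem hki _
  calc a * y * (b * y) * x = a * b * (y ^ 2 * x) := by
        rw [mul_assoc a, ← mul_assoc y, c1, sq]; simp only [mul_assoc]
    _ = a * b * (x * y ^ 2) := by rw [(torus_comm hy hx).eq]
    _ = (kap (n + 1) q * kapinv (n + 1) q) * (a * b * (x * y ^ 2)) := by rw [kap_mul_kapinv, one_mul]
    _ = kap (n + 1) q * (a * b * (kapinv (n + 1) q * (x * y ^ 2))) := by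
        rw [mul_assoc, ← mul_assoc (kapinv (n + 1) q), (torus_comm hki hab).eq]; simp only [mul_assoc]
    _ = _ := by rw [← mul_assoc (kapinv (n + 1) q), (torus_comm hki hx).eq]

theorem commute_kap_M {j k : ℕ} (hj : 1 ≤ j) (hjk : j ≤ k) (hk : k < ℓ) :
    Commute (kap ℓ q) (M ℓ q j k) := by
  have h := (Chr.kap (q := q)).M hj hk.le hjk
  rw [Finset.sum_eq_zero, qpow_zero, one_smul] at h
  · exact h
  · intro m hm; rw [Finset.mem_Icc] at hm; rw [if_neg (by omega)]

/-- With `Nel_sq_eq`, all terms of `C_q` not involving `M_{i,ℓ}` or `K̂⁻²` alone become `q κ²` times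
terms of `C'_q`. The torus term `i = ℓ` corresponds to the last torus term of `C'_q`, and `κ` passes
through `M_{j,k}^*` for `k < ℓ`. -/
theorem Cq_eq (hℓ : 1 ≤ ℓ) :
    Cq ℓ q = qpow q 1 • (kap ℓ q ^ 2 * (CqSub ℓ q + (rho q * qnum q ℓ) • 1))
      + (rho q * qpow q (-(ℓ : ℝ))) • Khatinv ℓ q ^ 2
      + ∑ i ∈ Finset.Icc 1 ℓ, qpow q ((ℓ : ℝ) + 1 - 2 * i) •
          (star (M ℓ q i ℓ) * Nel ℓ q i ℓ ^ 2 * M ℓ q i ℓ)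
      - (rho q * qnum q ((ℓ : ℝ) + 1)) • 1 := by
  obtain ⟨n, rfl⟩ : ∃ n, ℓ = n + 1 := ⟨ℓ - 1, by omega⟩
  rw [Cq, CqSub, casimirAux, casimirAux, Nat.add_sub_cancel]
  congr 1
  have hq : ∀ x : ℝ, qpow q 1 * (rho q * qpow q x) = rho q * qpow q (x + 1) := fun x => by
    rw [qpow_add]; ring
  have t1 : ∑ i ∈ Finset.Icc 1 (n + 1), (rho q * qpow q (((n + 1 : ℕ) : ℝ) + 2 - 2 * i)) •
        Naux (n + 1) q (n + 1) (Khatinv (n + 1) q) i (i - 1) ^ 2 =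
      qpow q 1 • (kap (n + 1) q ^ 2 * (∑ i ∈ Finset.Icc 1 n, (rho q * qpow q ((n : ℝ) + 2 - 2 * i)) •
        Naux (n + 1) q n (kapinv (n + 1) q ^ (n + 1 + 1) * K (n + 1) q (n + 1) ^ 2) i (i - 1) ^ 2
        + (rho q * qpow q (-(n : ℝ))) • (kapinv (n + 1) q ^ (n + 1 + 1) * K (n + 1) q (n + 1) ^ 2) ^ 2)) := by
    rw [Finset.sum_Icc_succ_top (by omega), mul_add, smul_add, Finset.mul_sum, Finset.smul_sum]
    congr 1
    · refine Finset.sum_congr rfl fun i hi => ?_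
      rw [Finset.mem_Icc] at hi
      rw [← Nel, Nel_sq_eq (by omega) (by omega), mul_smul_comm, smul_smul, hq]
      congr 3; push_cast; ring
    · rw [← Nel, Nel_sq_eq (by omega) (by omega), mul_smul_comm, smul_smul, hq]
      congr 1
      · congr 2; push_cast; ring
      · rw [Naux, Nat.add_sub_cancel, Kprod_of_lt (Nat.lt_succ_self n), one_mul, one_mul]
  have t2 : ∑ j ∈ Finset.Icc 1 (n + 1), ∑ k ∈ Finset.Icc j (n + 1),
        qpow q (((n + 1 : ℕ) : ℝ) + 1 - 2 * j) •
        (star (M (n + 1) q j k) * Naux (n + 1) q (n + 1) (Khatinv (n + 1) q) j k ^ 2 * M (n + 1) q j k) =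
      qpow q 1 • (kap (n + 1) q ^ 2 * (∑ j ∈ Finset.Icc 1 n, ∑ k ∈ Finset.Icc j n,
        qpow q ((n : ℝ) + 1 - 2 * j) • (star (M (n + 1) q j k) *
          Naux (n + 1) q n (kapinv (n + 1) q ^ (n + 1 + 1) * K (n + 1) q (n + 1) ^ 2) j k ^ 2 *
            M (n + 1) q j k))) +
      ∑ i ∈ Finset.Icc 1 (n + 1), qpow q (((n + 1 : ℕ) : ℝ) + 1 - 2 * i) •
          (star (M (n + 1) q i (n + 1)) * Nel (n + 1) q i (n + 1) ^ 2 * M (n + 1) q i (n + 1)) := by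
    have s1 : ∀ j ∈ Finset.Icc 1 (n + 1), ∑ k ∈ Finset.Icc j (n + 1),
        qpow q (((n + 1 : ℕ) : ℝ) + 1 - 2 * j) •
        (star (M (n + 1) q j k) * Naux (n + 1) q (n + 1) (Khatinv (n + 1) q) j k ^ 2 * M (n + 1) q j k) =
        ∑ k ∈ Finset.Icc j n, qpow q (((n + 1 : ℕ) : ℝ) + 1 - 2 * j) •
        (star (M (n + 1) q j k) * Naux (n + 1) q (n + 1) (Khatinv (n + 1) q) j k ^ 2 * M (n + 1) q j k) +
        qpow q (((n + 1 : ℕ) : ℝ) + 1 - 2 * j) •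
          (star (M (n + 1) q j (n + 1)) * Nel (n + 1) q j (n + 1) ^ 2 * M (n + 1) q j (n + 1)) :=
      fun j hj => by rw [Finset.sum_Icc_succ_top (Finset.mem_Icc.1 hj).2]; rfl
    rw [Finset.sum_congr rfl s1, Finset.sum_add_distrib]
    congr 1
    rw [Finset.sum_Icc_succ_top (by omega), Finset.Icc_eq_empty (by omega : ¬ n + 1 ≤ n), Finset.sum_empty,
      add_zero, Finset.mul_sum, Finset.smul_sum]
    refine Finset.sum_congr rfl fun j hj => ?_
    rw [Finset.mul_sum, Finset.smul_sum]
    refine Finset.sum_congr rfl fun k hk => ?_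
    rw [Finset.mem_Icc] at hj hk
    rw [← Nel, Nel_sq_eq (by omega) (by omega), mul_smul_comm, smul_smul, ← qpow_add]
    congr 1
    · congr 1; push_cast; ring
    · have := ((commute_star (commute_kap_M (q := q) hj.1 hk.1 (by omega : k < n + 1))).pow_left 2).eq
      rw [star_torus kap_mem_torus] at this
      rw [← mul_assoc (star _), ← this]
      simp only [mul_assoc]
  rw [t1, t2, ← Nat.cast_succ n, sub_add_cancel]
  simp only [smul_add, mul_add]
  abel

/-! ### The right action on the coordinate algebra -/

/-- The coordinate algebra as a right module. -/
def ractA (ℓ : ℕ) (q : Set.Ioo (0 : ℝ) 1) : RAct ℓ q (A ℓ q) where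
  act := LinearMap.mk₂ ℂ ract
    (fun a b h => Subtype.ext (dual_ext fun x => rfl))
    (fun c a h => Subtype.ext (dual_ext fun x => rfl))
    (fun a g h => Subtype.ext (dual_ext fun x => by
      simp [ract, ractD_apply, add_mul]))
    (fun c a h => Subtype.ext (dual_ext fun x => by
      simp [ract, ractD_apply]))
  act_mul a g h := Subtype.ext (dual_ext fun x => by
    simp [ract, ractD_apply, mul_assoc])
  act_one a := Subtype.ext (dual_ext fun x => by simp [ract, ractD_apply])

theorem ract_smul (c : ℂ) (a : A ℓ q) (h : U ℓ q) : ract (c • a) h = c • ract a h := rfl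

theorem ract_mul (a : A ℓ q) (g h : U ℓ q) : ract a (g * h) = ract (ract a g) h :=
  (ractA ℓ q).act_mul a g h

theorem ract_one (a : A ℓ q) : ract a 1 = a := (ractA ℓ q).act_one a

theorem ract_smul_right (c : ℂ) (a : A ℓ q) (h : U ℓ q) : ract a (c • h) = c • ract a h :=
  map_smul ((ractA ℓ q).act a) c h

theorem ract_add_right (a : A ℓ q) (g h : U ℓ q) : ract a (g + h) = ract a g + ract a h :=
  map_add ((ractA ℓ q).act a) g h

theorem ractD_mul_apply (f g : Dual ℓ q) (h x : U ℓ q) : (ractD (f * g) h).ofConv x =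
    LinearMap.mul' ℂ ℂ (TensorProduct.map f.ofConv g.ofConv
      (Coalgebra.comul (R := ℂ) h * Coalgebra.comul (R := ℂ) x)) := by
  rw [ractD_apply, dual_mul_apply, Bialgebra.comul_mul]

theorem mul_ractD_apply (f g : Dual ℓ q) (a b x : U ℓ q) : (ractD f a * ractD g b).ofConv x =
    LinearMap.mul' ℂ ℂ (TensorProduct.map f.ofConv g.ofConv
      ((a ⊗ₜ b) * Coalgebra.comul (R := ℂ) x)) := by
  rw [dual_mul_apply]
  induction Coalgebra.comul (R := ℂ) x using TensorProduct.induction_on with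
  | zero => simp
  | tmul c d => simp [ractD_apply]
  | add c d hc hd => simp only [mul_add, map_add, hc, hd]

theorem ractD_mul_of_tmul {h a b : U ℓ q} (hh : Coalgebra.comul (R := ℂ) h = a ⊗ₜ b) (f g : Dual ℓ q) :
    ractD (f * g) h = ractD f a * ractD g b :=
  dual_ext fun x => by rw [ractD_mul_apply, mul_ractD_apply, hh]

theorem ractD_mul_of_add {h a b c d : U ℓ q} (hh : Coalgebra.comul (R := ℂ) h = a ⊗ₜ b + c ⊗ₜ d)
    (f g : Dual ℓ q) : ractD (f * g) h = ractD f a * ractD g b + ractD f c * ractD g d :=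
  dual_ext fun x => by
    rw [ractD_mul_apply, hh, add_mul, map_add, map_add, ← mul_ractD_apply, ← mul_ractD_apply]; rfl

theorem mul_ract_of_tmul {h a b : U ℓ q} (hh : Coalgebra.comul (R := ℂ) h = a ⊗ₜ b) (f g : A ℓ q) :
    ract (f * g) h = ract f a * ract g b := Subtype.ext (ractD_mul_of_tmul hh _ _)

theorem mul_ract_of_add {h a b c d : U ℓ q} (hh : Coalgebra.comul (R := ℂ) h = a ⊗ₜ b + c ⊗ₜ d)
    (f g : A ℓ q) : ract (f * g) h = ract f a * ract g b + ract f c * ract g d :=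
  Subtype.ext (ractD_mul_of_add hh _ _)

/-! ### The Haar state -/

/-- Invariance is applied to `a * (b ◁ g⁻¹)`. -/
theorem haar_grouplike {φ : A ℓ q →ₗ[ℂ] ℂ} (hφ : IsHaar φ) {g g' : U ℓ q}
    (hg : Coalgebra.comul (R := ℂ) g = g ⊗ₜ g) (he : Coalgebra.counit (R := ℂ) g = (1 : ℂ))
    (h : g' * g = 1) (a b : A ℓ q) : φ (ract a g * b) = φ (a * ract b g') := by
  have := hφ.inv (a * ract b g') g
  rwa [mul_ract_of_tmul hg, ← ract_mul, h, ract_one, he, one_mul] at this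

/-- Invariance is applied to `a * (b ◁ K_i⁻¹)`, so that the first term of the coproduct returns `b`.
In the second term the factor `K_i⁻¹` is moved across by `haar_grouplike`, and conjugation by `K_i`
gives the constant `c`. -/
theorem haar_skew {φ : A ℓ q →ₗ[ℂ] ℂ} (hφ : IsHaar φ) {i : Idx ℓ} {e : U ℓ q} {c : ℂ}
    (h : Coalgebra.comul (R := ℂ) e = e ⊗ₜ gen q (.K i) + gen q (.Kinv i) ⊗ₜ e)
    (he : Coalgebra.counit (R := ℂ) e = (0 : ℂ))
    (hc : gen q (.Kinv i) * e * gen q (.K i) = c • e) (a b : A ℓ q) :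
    φ (ract a e * b) = φ (a * ract b (-c • e)) := by
  have h1 := hφ.inv (a * ract b (gen q (.Kinv i))) e
  rw [mul_ract_of_add h, ← ract_mul, sat_gen.Kinv_mul_K, ract_one, he, zero_mul, map_add,
    haar_grouplike hφ (g' := gen q (.K i)) (by rw [comul_gen]; rfl) (by rw [counit_gen]; rfl)
      (sat_gen.K_mul_Kinv i), ← ract_mul, ← ract_mul, ← mul_assoc, hc] at h1
  rw [eq_neg_of_add_eq_zero_left h1, ract_smul_right, ract_smul_right, mul_smul_comm, mul_smul_comm,
    map_smul, map_smul, neg_smul]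

/-- Invariance of the Haar state, as an adjunction. -/
theorem haar_ract {φ : A ℓ q →ₗ[ℂ] ℂ} (hφ : IsHaar φ) (h : U ℓ q) (a b : A ℓ q) :
    φ (ract a h * b) = φ (a * ract b (Sinv h)) := by
  induction h using U_induction generalizing a b with
  | halg c =>
    rw [Algebra.algebraMap_eq_smul_one, Sinv_smul, Sinv_one, ract_smul_right, ract_smul_right, ract_one,
      ract_one, smul_mul_assoc, mul_smul_comm]
  | hgen x =>
    rw [Sinv_gen]
    have g := sat_gen (ℓ := ℓ) (q := q)
    cases x with
    | K i => exact haar_grouplike hφ (comul_gen _) (counit_gen _) (g.Kinv_mul_K i) a b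
    | Kinv i => exact haar_grouplike hφ (comul_gen _) (counit_gen _) (g.K_mul_Kinv i) a b
    | kap => exact haar_grouplike hφ (comul_gen _) (counit_gen _) g.kapinv_mul_kap a b
    | kapinv => exact haar_grouplike hφ (comul_gen _) (counit_gen _) g.kap_mul_kapinv a b
    | E i =>
      refine haar_skew hφ (i := i) (comul_gen _) (counit_gen _) (c := qpow q (-1)) ?_ a b
      rw [g.Kinv_E, smul_mul_assoc, mul_assoc, g.Kinv_mul_K, mul_one, wt_self]
    | F i =>
      refine haar_skew hφ (i := i) (comul_gen _) (counit_gen _) (c := qpow q (- -1)) ?_ a b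
      rw [g.Kinv_F, smul_mul_assoc, mul_assoc, g.Kinv_mul_K, mul_one, wt_self, neg_neg]
  | hmul x y hx hy => rw [ract_mul, hy, hx, Sinv_mul, ract_mul]
  | hadd x y hx hy =>
    rw [ract_add_right, add_mul, map_add, hx, hy, Sinv_add, ract_add_right, mul_add, map_add]

theorem starA_add (a b : A ℓ q) : starA (a + b) = starA a + starA b := Subtype.ext (starD_add _ _)

theorem starA_smul (c : ℂ) (a : A ℓ q) : starA (c • a) = starRingEnd ℂ c • starA a :=
  Subtype.ext (starD_smul _ _)

theorem starA_zero : starA (0 : A ℓ q) = 0 := by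
  have := starA_smul (0 : ℂ) (0 : A ℓ q); simpa using this

theorem starA_sum {ι : Type*} (s : Finset ι) (f : ι → A ℓ q) :
    starA (∑ i ∈ s, f i) = ∑ i ∈ s, starA (f i) := by
  classical
  induction s using Finset.induction_on with
  | empty => simp [starA_zero]
  | insert i s hi ih => rw [Finset.sum_insert hi, Finset.sum_insert hi, starA_add, ih]

/-- The involution turns `◁ h` into `◁ S(h)^*`, and `S⁻¹(h^*) = S(h)^*` because `x ↦ S(x)^*` is an
involution. -/
theorem starA_leftAct (h : U ℓ q) (a : A ℓ q) : starA (leftAct (star h) a) = ract (starA a) h := by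
  refine Subtype.ext ?_
  change starD (ractD a.1 (Sinv (star h))) = ractD (starD a.1) h
  rw [ractD_starD, theta_apply]
  have : Sinv (star h) = star (S h) := by
    have := congrArg Sinv (congrArg star (theta_theta h))
    rw [theta_apply, star_star, Sinv_S] at this
    rw [← this, theta_apply]
  rw [this]

/-- The operator `∂̄†` is the Hermitian conjugate of `∂̄`. -/
theorem formInner_dbarDag {φ : A ℓ q →ₗ[ℂ] ℂ} (hφ : IsHaar φ) (ω η : Form ℓ q) :
    formInner φ (dbarDag ω) η = formInner φ ω (dbar η) := by
  have h1 : formInner φ (dbarDag ω) η = ∑ s, ∑ i : Idx ℓ, ∑ t,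
      extL q i t s * φ (starA (ω t) * leftAct (Khat ℓ q * X ℓ q i) (η s)) := by
    rw [formInner, map_sum]
    refine Finset.sum_congr rfl fun s _ => ?_
    rw [dbarDag, Finset.sum_apply, starA_sum, Finset.sum_mul, map_sum]
    refine Finset.sum_congr rfl fun i _ => ?_
    rw [tensorOp, starA_sum, Finset.sum_mul, map_sum]
    refine Finset.sum_congr rfl fun t _ => ?_
    rw [starA_smul, star_X_mul_Khat, starA_leftAct, smul_mul_assoc, map_smul, haar_ract hφ, intL,
      Matrix.conjTranspose_apply, smul_eq_mul]
    congr 1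
    exact star_star _
  have h2 : formInner φ ω (dbar η) = ∑ t, ∑ i : Idx ℓ, ∑ s,
      extL q i t s * φ (starA (ω t) * leftAct (Khat ℓ q * X ℓ q i) (η s)) := by
    rw [formInner, map_sum]
    refine Finset.sum_congr rfl fun t _ => ?_
    rw [dbar, Finset.sum_apply, Finset.mul_sum, map_sum]
    refine Finset.sum_congr rfl fun i _ => ?_
    rw [tensorOp, Finset.mul_sum, map_sum]
    refine Finset.sum_congr rfl fun s _ => ?_
    rw [mul_smul_comm, map_smul, smul_eq_mul]
  rw [h1, h2, Finset.sum_comm, Finset.sum_comm (s := Finset.univ (α := Finset (Idx ℓ)))]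
  refine Finset.sum_congr rfl fun i _ => ?_
  rw [Finset.sum_comm]

/-! ### Positivity of the torus on the coordinate algebra -/

open Polynomial in
/-- An operator on a space spanned by eigenvectors with positive eigenvalues has unique positive
roots. -/
theorem eigen_of_pow {W : Type*} [AddCommGroup W] [Module ℂ W] (T : Module.End ℂ W)
    (hspan : Submodule.span ℂ {v | ∃ x : ℝ, T v = qpow q x • v} = ⊤) {n : ℕ} (hn : n ≠ 0) {r : ℝ} {v : W}
    (hv : (T ^ n) v = qpow q r ^ n • v) : T v = qpow q r • v := by
  -- Every vector is annihilated by a polynomial in `T` all of whose roots are positive numbers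
  -- `q^x`.
  have hann : ∀ v : W, ∃ p : ℂ[X], aeval T p v = 0 ∧ ∀ z, p.eval z = 0 → ∃ x : ℝ, z = qpow q x := by
    intro v
    have hv : v ∈ Submodule.span ℂ {v | ∃ x : ℝ, T v = qpow q x • v} := by rw [hspan]; trivial
    induction hv using Submodule.span_induction with
    | mem v hv =>
      obtain ⟨x, hx⟩ := hv
      refine ⟨Polynomial.X - C (qpow q x), by simp [hx], fun z hz => ⟨x, ?_⟩⟩
      simpa [sub_eq_zero] using hz
    | zero => exact ⟨1, by simp, fun z hz => by simp at hz⟩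
    | add v w _ _ hv hw =>
      obtain ⟨p, hp, hp'⟩ := hv
      obtain ⟨r, hr, hr'⟩ := hw
      refine ⟨p * r, ?_, fun z hz => ?_⟩
      · have h1 : aeval T (p * r) v = 0 := by
          rw [mul_comm, map_mul, Module.End.mul_apply, hp, map_zero]
        have h2 : aeval T (p * r) w = 0 := by rw [map_mul, Module.End.mul_apply, hr, map_zero]
        rw [map_add, h1, h2, add_zero]
      · rw [eval_mul, mul_eq_zero] at hz
        exact hz.elim (hp' z) (hr' z)
    | smul c v _ hv =>
      obtain ⟨p, hp, hp'⟩ := hv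
      exact ⟨p, by rw [map_smul, hp, smul_zero], hp'⟩
  obtain ⟨p, hp, hp'⟩ := hann v
  set l := qpow q r with hl
  -- `R` is the quotient of `X^n - l^n` by `X - l`. At a positive number it is a sum of positive
  -- terms, hence it is coprime to `p`. As `T v - l v` is killed by both, it vanishes.
  set R : ℂ[X] := ∑ i ∈ Finset.range n, Polynomial.X ^ i * C l ^ (n - 1 - i) with hR
  have hmul : R * (Polynomial.X - C l) = Polynomial.X ^ n - C l ^ n := (Commute.all Polynomial.X (C l)).geom_sum₂_mul n
  have hcop : IsCoprime R p := by
    rw [Polynomial.isCoprime_iff_aeval_ne_zero_of_isAlgClosed ℂ ℂ]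
    intro z
    by_contra! hz
    simp only [coe_aeval_eq_eval] at hz
    obtain ⟨x, rfl⟩ := hp' z hz.2
    have h1 : R.eval (qpow q x) =
        ((∑ i ∈ Finset.range n, ((q : ℝ) ^ x) ^ i * ((q : ℝ) ^ r) ^ (n - 1 - i) : ℝ) : ℂ) := by
      rw [hR, eval_finsetSum]; simp [hl, qpow]
    have hpos : 0 < ∑ i ∈ Finset.range n, ((q : ℝ) ^ x) ^ i * ((q : ℝ) ^ r) ^ (n - 1 - i) := by
      have hq := q.2.1
      exact Finset.sum_pos (fun i _ => by positivity) (by simpa using hn)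
    rw [h1] at hz
    exact hpos.ne' (by exact_mod_cast hz.1)
  obtain ⟨a, b, hab⟩ := hcop
  have e1 : aeval T R (T v - l • v) = 0 := by
    have : T v - l • v = aeval T (Polynomial.X - C l) v := by simp
    rw [this, ← Module.End.mul_apply, ← map_mul, hmul, ← C_pow, map_sub, map_pow, aeval_X, aeval_C,
      LinearMap.sub_apply, hv, Module.algebraMap_end_apply, sub_self]
  have e2 : aeval T p (T v - l • v) = 0 := by
    have : T v - l • v = aeval T (Polynomial.X - C l) v := by simp
    rw [this, ← Module.End.mul_apply, ← map_mul, mul_comm, map_mul, Module.End.mul_apply, hp, map_zero]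
  have e3 : T v - l • v = aeval T (a * R + b * p) (T v - l • v) := by rw [hab]; simp
  rw [map_add, map_mul, map_mul, LinearMap.add_apply, Module.End.mul_apply, Module.End.mul_apply, e1, e2,
    map_zero, map_zero, add_zero] at e3
  exact sub_eq_zero.1 e3

theorem ractD_coef_K (i : Idx ℓ) (j k : Idx (ℓ + 1)) :
    ractD (coef q j k) (gen q (.K i)) = qpow q (wtV i j) • coef q j k := by
  refine dual_ext fun x => ?_
  change vecRep (gen q (.K i) * x) j k = qpow q (wtV i j) * vecRep x j k
  rw [map_mul, vecRep, lift_gen, vecGen, Matrix.diagonal_mul]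

theorem ractD_coef_Kinv (i : Idx ℓ) (j k : Idx (ℓ + 1)) :
    ractD (coef q j k) (gen q (.Kinv i)) = qpow q (-wtV i j) • coef q j k := by
  refine dual_ext fun x => ?_
  change vecRep (gen q (.Kinv i) * x) j k = qpow q (-wtV i j) * vecRep x j k
  rw [map_mul, vecRep, lift_gen, vecGen, Matrix.diagonal_mul]

/-- The matrix coefficients and their adjoints are weight vectors with real exponents, and exponents
add under products because `K_i` is group-like. -/
theorem coordAlg_le_span (i : Idx ℓ) {f : Dual ℓ q} (hf : f ∈ coordAlg ℓ q) :
    f ∈ Submodule.span ℂ {g : Dual ℓ q | g ∈ coordAlg ℓ q ∧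
      ∃ x : ℝ, ractD g (gen q (.K i)) = qpow q x • g} := by
  induction hf using Algebra.adjoin_induction with
  | mem f hf =>
    rcases hf with ⟨p, rfl⟩ | ⟨p, rfl⟩
    · exact Submodule.subset_span ⟨coef_mem _ _, _, ractD_coef_K i p.1 p.2⟩
    · refine Submodule.subset_span ⟨starD_coef_mem _ _, -wtV i p.1, ?_⟩
      dsimp only
      rw [ractD_starD, theta_gen, thetaGen, ractD_coef_Kinv, starD_smul, conj_qpow]
  | algebraMap c =>
    refine Submodule.subset_span ⟨Subalgebra.algebraMap_mem _ _, 0, dual_ext fun x => ?_⟩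
    rw [ractD_apply]
    change c • Coalgebra.counit (R := ℂ) (gen q (.K i) * x) =
      qpow q 0 * (c • Coalgebra.counit (R := ℂ) x)
    rw [Bialgebra.counit_mul, counit_gen, qpow_zero]; simp [counitGen]
  | add f g _ _ hf hg => exact add_mem hf hg
  | mul f g hf0 hg0 hf hg =>
    clear hf0 hg0
    induction hf using Submodule.span_induction with
    | zero => rw [zero_mul]; exact zero_mem _
    | add f f' _ _ hf hf' => rw [add_mul]; exact add_mem hf hf'
    | smul c f _ hf => rw [smul_mul_assoc]; exact Submodule.smul_mem _ _ hf
    | mem f hf =>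
      induction hg using Submodule.span_induction with
      | zero => rw [mul_zero]; exact zero_mem _
      | add g g' _ _ hg hg' => rw [mul_add]; exact add_mem hg hg'
      | smul c g _ hg => rw [mul_smul_comm]; exact Submodule.smul_mem _ _ hg
      | mem g hg =>
        obtain ⟨hf1, x, hx⟩ := hf
        obtain ⟨hg1, y, hy⟩ := hg
        refine Submodule.subset_span ⟨mul_mem hf1 hg1, x + y, ?_⟩
        rw [ractD_mul_of_tmul (comul_gen (.K i)), hx, hy, qpow_add, smul_mul_smul_comm]

/-- The defining relation of `κ` determines only a power of `K_ℓ` on a form. Diagonalisability with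
positive eigenvalues recovers `K_ℓ` itself. -/
theorem ract_K_of_pow (i : Idx ℓ) {n : ℕ} (hn : n ≠ 0) {r : ℝ} {a : A ℓ q}
    (h : ract a (gen q (.K i) ^ n) = qpow q r ^ n • a) : ract a (gen q (.K i)) = qpow q r • a := by
  set T : Module.End ℂ (A ℓ q) := (ractA ℓ q).act.flip (gen q (.K i)) with hT
  have hpow : ∀ m, (T ^ m) a = ract a (gen q (.K i) ^ m) := by
    intro m
    induction m with
    | zero => rw [pow_zero, pow_zero, ract_one]; rfl
    | succ m ih => rw [pow_succ', Module.End.mul_apply, ih, pow_succ, ract_mul]; rfl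
  refine eigen_of_pow (q := q) (r := r) (v := a) T ?_ hn (by rw [hpow, h])
  rw [eq_top_iff]
  rintro ⟨f, hf⟩ -
  have key := coordAlg_le_span i hf
  have : ∀ g ∈ Submodule.span ℂ {g : Dual ℓ q | g ∈ coordAlg ℓ q ∧
      ∃ x : ℝ, ractD g (gen q (.K i)) = qpow q x • g}, ∃ hg : g ∈ coordAlg ℓ q,
        (⟨g, hg⟩ : A ℓ q) ∈ Submodule.span ℂ {v | ∃ x : ℝ, T v = qpow q x • v} := by
    intro g hg
    induction hg using Submodule.span_induction with
    | mem g hg =>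
      obtain ⟨h1, x, hx⟩ := hg
      exact ⟨h1, Submodule.subset_span ⟨x, Subtype.ext hx⟩⟩
    | zero => exact ⟨zero_mem _, zero_mem _⟩
    | add g g' _ _ hg hg' =>
      obtain ⟨h1, h2⟩ := hg
      obtain ⟨h3, h4⟩ := hg'
      exact ⟨add_mem h1 h3, add_mem h2 h4⟩
    | smul c g _ hg =>
      obtain ⟨h1, h2⟩ := hg
      exact ⟨Subalgebra.smul_mem _ h1 c, Submodule.smul_mem _ c h2⟩
  exact (this f key).2

theorem eq_of_neg_smul_add_smul {V : Type*} [AddCommGroup V] [Module ℂ V] {c : ℂ} (hc : c ≠ 0) {v w : V}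
    (h : -c • v + c • w = 0) : v = w := by
  rw [neg_smul, neg_add_eq_zero] at h
  exact smul_right_injective _ hc h

/-! ### Components of forms, indexed by sets of natural numbers -/

/-- The subset of the index set given by a set of natural numbers. -/
def low (ℓ : ℕ) (t : Finset ℕ) : Finset (Idx ℓ) := t.subtype (· ∈ Finset.Icc 1 ℓ)

/-- A subset of the index set, as a set of natural numbers. -/
def up (s : Finset (Idx ℓ)) : Finset ℕ := s.map (Function.Embedding.subtype _)

/-- The components of a form, indexed by sets of natural numbers. -/
def flat (ω : Form ℓ q) (t : Finset ℕ) : A ℓ q := ω (low ℓ t)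

theorem mem_low {t : Finset ℕ} {j : Idx ℓ} : j ∈ low ℓ t ↔ (j : ℕ) ∈ t := Finset.mem_subtype

theorem mem_up {s : Finset (Idx ℓ)} {j : Idx ℓ} : (j : ℕ) ∈ up s ↔ j ∈ s := by
  simp [up]

theorem up_subset (s : Finset (Idx ℓ)) : up s ⊆ Finset.Icc 1 ℓ := by
  intro x hx
  obtain ⟨y, -, rfl⟩ := Finset.mem_map.1 hx
  exact y.2

theorem low_up (s : Finset (Idx ℓ)) : low ℓ (up s) = s := by
  ext j; rw [mem_low, mem_up]

theorem card_low {t : Finset ℕ} (ht : t ⊆ Finset.Icc 1 ℓ) : (low ℓ t).card = t.card := by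
  rw [low, Finset.card_subtype, Finset.filter_true_of_mem fun x hx => ht hx]

theorem low_erase (t : Finset ℕ) (j : Idx ℓ) : low ℓ (t.erase j) = (low ℓ t).erase j := by
  ext x; simp only [mem_low, Finset.mem_erase, ne_eq, Subtype.ext_iff]

theorem low_insert (t : Finset ℕ) (j : Idx ℓ) : low ℓ (insert (j : ℕ) t) = insert j (low ℓ t) := by
  ext x; simp only [mem_low, Finset.mem_insert, Subtype.ext_iff]

theorem flat_up (ω : Form ℓ q) (s : Finset (Idx ℓ)) : flat ω (up s) = ω s := by rw [flat, low_up]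

theorem tensorOp_diagonal (h : U ℓ q) (f : Finset (Idx ℓ) → ℂ) (ω : Form ℓ q) (s : Finset (Idx ℓ)) :
    tensorOp h (Matrix.diagonal f) ω s = f s • leftAct h (ω s) := by
  rw [tensorOp, Finset.sum_eq_single s]
  · rw [Matrix.diagonal_apply_eq]
  · intro t _ ht; rw [Matrix.diagonal_apply_ne _ ht.symm, zero_smul]
  · intro h; exact absurd (Finset.mem_univ _) h

theorem tensorOp_ite (h : U ℓ q) (p : Finset (Idx ℓ) → Prop) [DecidablePred p]
    (f : Finset (Idx ℓ) → Finset (Idx ℓ)) (c : Finset (Idx ℓ) → ℂ) (ω : Form ℓ q) (s : Finset (Idx ℓ)) :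
    tensorOp h (fun s t => if p s ∧ t = f s then c s else 0) ω s =
      if p s then c s • leftAct h (ω (f s)) else 0 := by
  unfold tensorOp
  dsimp only
  split_ifs with hp
  · rw [Finset.sum_eq_single (f s)]
    · rw [if_pos ⟨hp, rfl⟩]
    · intro t _ ht; rw [if_neg (fun h => ht h.2), zero_smul]
    · intro h; exact absurd (Finset.mem_univ _) h
  · exact Finset.sum_eq_zero fun t _ => by rw [if_neg (fun h => hp h.1), zero_smul]

theorem hash_eq_one {j j' : Idx ℓ} {s : Finset (Idx ℓ)} : hash j j' s = 1 ↔ j ∈ s ∧ j' ∉ s := by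
  unfold hash; split_ifs <;> simp_all

theorem hash_eq_neg_one {j j' : Idx ℓ} {s : Finset (Idx ℓ)} :
    hash j j' s = -1 ↔ j' ∈ s ∧ j ∉ s := by
  unfold hash; split_ifs <;> simp_all

theorem hash_swap_E {j j' : Idx ℓ} (h : (j : ℕ) + 1 = j') {s : Finset (Idx ℓ)} :
    hash j j' (insert j' (s.erase j)) = -1 := by
  have : j ≠ j' := fun e => by rw [e] at h; omega
  rw [hash_eq_neg_one]; simp [this]

theorem hash_swap_F {j j' : Idx ℓ} (h : (j : ℕ) + 1 = j') {s : Finset (Idx ℓ)} :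
    hash j j' (insert j (s.erase j')) = 1 := by
  have : j ≠ j' := fun e => by rw [e] at h; omega
  rw [hash_eq_one]; simp [this.symm]

theorem IsForm.ract_K {k : ℕ} {N : ℤ} {ω : Form ℓ q} (hω : IsForm k N ω) {j j' : Idx ℓ}
    (h : (j : ℕ) + 1 = j') (s : Finset (Idx ℓ)) :
    ract (ω s) (gen q (.K j)) = qpow q ((hash j j' s : ℝ) / 2) • ω s := by
  have h1 := congrFun (hω.inv_K j j' h) s
  rw [sigK, tensorOp_diagonal, leftAct, Sinv_gen] at h1
  change _ • ract (ω s) (gen q (.Kinv j)) = _ at h1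
  conv_lhs => rw [← h1]
  rw [ract_smul, ← ract_mul, sat_gen.Kinv_mul_K, ract_one]

theorem IsForm.ract_Khat {k : ℕ} {N : ℤ} {ω : Form ℓ q} (hω : IsForm k N ω) (s : Finset (Idx ℓ)) :
    ract (ω s) (Khat ℓ q) = qpow q ((k : ℝ) - ℓ * N / (ℓ + 1)) • ω s := by
  have h1 := congrFun hω.inv_Khat s
  rw [← Matrix.diagonal_one, ← Matrix.diagonal_smul, tensorOp_diagonal, leftAct, Khat, Sinv_pow, kap,
    Sinv_gen] at h1
  change (_ * 1 : ℂ) • ract (ω s) (Khatinv ℓ q) = _ at h1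
  rw [mul_one] at h1
  conv_lhs => rw [← h1]
  rw [ract_smul, ← ract_mul, Khatinv_mul_Khat, ract_one]

/-- In the invariance condition `S⁻¹(E_j) = -q⁻¹ E_j` and `S⁻¹(K_j⁻¹) = K_j`. The latter acts by
`q^{-1/2}` on the moved component, which equals `q⁻¹ q^{1/2}` from the first term, so all powers of
`q` drop out. -/
theorem IsForm.ract_E {k : ℕ} {N : ℤ} {ω : Form ℓ q} (hω : IsForm k N ω) {j j' : Idx ℓ}
    (h : (j : ℕ) + 1 = j') (s : Finset (Idx ℓ)) :
    ract (ω s) (gen q (.E j)) = if j ∈ s ∧ j' ∉ s then ω (insert j' (s.erase j)) else 0 := by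
  have h1 := congrFun (hω.inv_E j j' h) s
  have e : sigE j j' = fun s t => if hash j j' s = 1 ∧ t = insert j' (s.erase j) then (1 : ℂ) else 0 := rfl
  rw [Pi.add_apply, e, tensorOp_ite _ (fun s => hash j j' s = 1) _ (fun _ => 1), sigK, tensorOp_diagonal,
    leftAct, leftAct, Sinv_gen, Sinv_gen] at h1
  change _ • ract (ω s) (-qpow q (-1) • gen q (.E j)) + (if _ then (1 : ℂ) • ract _ (gen q (.K j)) else 0) = 0
    at h1
  rw [hω.ract_K h, hash_swap_E h, ract_smul_right, smul_smul, one_smul] at h1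
  have hne : qpow q ((hash j j' s : ℝ) / 2) * -qpow q (-1) ≠ 0 :=
    mul_ne_zero (qpow_ne _ _) (neg_ne_zero.2 (qpow_ne _ _))
  by_cases hh : hash j j' s = 1
  · rw [if_pos (hash_eq_one.1 hh)]
    rw [if_pos hh, hh, mul_neg, ← qpow_add,
      show ((1 : ℤ) : ℝ) / 2 + -1 = ((-1 : ℤ) : ℝ) / 2 by norm_num] at h1
    exact eq_of_neg_smul_add_smul (qpow_ne _ _) h1
  · rw [if_neg (fun h => hh (hash_eq_one.2 h))]
    rw [if_neg hh, add_zero] at h1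
    exact (smul_eq_zero.1 h1).resolve_left hne

theorem IsForm.ract_F {k : ℕ} {N : ℤ} {ω : Form ℓ q} (hω : IsForm k N ω) {j j' : Idx ℓ}
    (h : (j : ℕ) + 1 = j') (s : Finset (Idx ℓ)) :
    ract (ω s) (gen q (.F j)) = if j' ∈ s ∧ j ∉ s then ω (insert j (s.erase j')) else 0 := by
  have h1 := congrFun (hω.inv_F j j' h) s
  have e : sigF j j' = fun s t => if hash j j' s = -1 ∧ t = insert j (s.erase j') then (1 : ℂ) else 0 := rfl
  rw [Pi.add_apply, e, tensorOp_ite _ (fun s => hash j j' s = -1) _ (fun _ => 1), sigK, tensorOp_diagonal,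
    leftAct, leftAct, Sinv_gen, Sinv_gen] at h1
  change _ • ract (ω s) (-qpow q (- -1) • gen q (.F j)) + (if _ then (1 : ℂ) • ract _ (gen q (.K j)) else 0) = 0
    at h1
  rw [hω.ract_K h, hash_swap_F h, ract_smul_right, smul_smul, one_smul] at h1
  have hne : qpow q ((hash j j' s : ℝ) / 2) * -qpow q (- -1) ≠ 0 :=
    mul_ne_zero (qpow_ne _ _) (neg_ne_zero.2 (qpow_ne _ _))
  by_cases hh : hash j j' s = -1
  · rw [if_pos (hash_eq_neg_one.1 hh)]
    rw [if_pos hh, hh, mul_neg, ← qpow_add,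
      show ((-1 : ℤ) : ℝ) / 2 + - -1 = ((1 : ℤ) : ℝ) / 2 by norm_num] at h1
    exact eq_of_neg_smul_add_smul (qpow_ne _ _) h1
  · rw [if_neg (fun h => hh (hash_eq_neg_one.2 h))]
    rw [if_neg hh, add_zero] at h1
    exact (smul_eq_zero.1 h1).resolve_left hne

/-- The components are eigenvectors of `P_j`, with the exponents of the exterior algebra shifted
by `d`. -/
def PHalf {V : Type*} [AddCommGroup V] [Module ℂ V] (r : RAct ℓ q V) (d : ℤ) (ω : Finset ℕ → V) : Prop :=
  ∀ j, 1 ≤ j → j ≤ ℓ → ∀ s ⊆ Finset.Icc 1 ℓ,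
    r.act (ω s) (P ℓ q j) = qpow q ((((if j ∈ s then 1 else 0) + d : ℤ) : ℝ) / 2) • ω s

theorem PHalf.pwt {V : Type*} [AddCommGroup V] [Module ℂ V] {r : RAct ℓ q V} {d : ℤ}
    {ω : Finset ℕ → V} (h : PHalf r d ω) : PWt r d ω := by
  intro j h1 h2 s hs
  rw [pow_two, r.act_mul, h j h1 h2 s hs, map_smul, LinearMap.smul_apply, h j h1 h2 s hs, smul_smul,
    ← qpow_add, add_halves, qpow_intCast]

theorem rootProd_eq (f : ℕ → U ℓ q) :
    rootProd ℓ (fun i => f i) = ((List.range ℓ).map fun i => f (i + 1) ^ (i + 1)).prod := by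
  rw [rootProd, ← List.map_coe_finRange_eq_range, List.map_map]
  rfl

theorem kap_pow_eq :
    kap ℓ q ^ (ℓ * (ℓ + 1) / 2) = ((List.range ℓ).map fun i => K ℓ q (i + 1) ^ (i + 1)).prod := by
  rw [← rootProd_eq, kap, sat_gen.root]
  congr 1
  funext i
  rw [K_mem i.2]

theorem IsForm.act_K {k : ℕ} {N : ℤ} {ω : Form ℓ q} (hω : IsForm k N ω) {j : ℕ} (h1 : 1 ≤ j)
    (h2 : j < ℓ) (s : Finset ℕ) : ract (flat ω s) (K ℓ q j) =
      qpow q (((if j ∈ s then 1 else 0) - (if j + 1 ∈ s then 1 else 0)) / 2) • flat ω s := by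
  rw [K_mem (Finset.mem_Icc.2 ⟨h1, h2.le⟩), flat,
    hω.ract_K (j' := ⟨j + 1, Finset.mem_Icc.2 (by omega)⟩) rfl]
  simp [hash, mem_low]

theorem ract_pow_of_eq {a : A ℓ q} {x : U ℓ q} {r : ℝ} (h : ract a x = qpow q r • a) (n : ℕ) :
    ract a (x ^ n) = qpow q (n * r) • a := by
  induction n with
  | zero => simp [ract_one, qpow_zero]
  | succ n ih =>
    rw [pow_succ, ract_mul, ih, ract_smul, h, smul_smul, ← qpow_add]; congr 2; push_cast; ring

/-- Abel summation: the exponents `i (1_{i∈s} - 1_{i+1∈s})` for `i ≤ n` sum to the number of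
elements of `s` up to `n`, minus `n` if `n + 1 ∈ s`. -/
theorem IsForm.act_prefix {k : ℕ} {N : ℤ} {ω : Form ℓ q} (hω : IsForm k N ω) {s : Finset ℕ}
    (hs : s ⊆ Finset.Icc 1 ℓ) {n : ℕ} (hn : n < ℓ) :
    ract (flat ω s) ((List.range n).map fun i => K ℓ q (i + 1) ^ (i + 1)).prod =
      qpow q ((nlt s (n + 1) - n * (if n + 1 ∈ s then 1 else 0)) / 2) • flat ω s := by
  induction n with
  | zero =>
    have : nlt s 1 = 0 := by have := nlt_lt hs (le_refl 1); omega
    simp [ract_one, this, qpow_zero]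
  | succ n ih =>
    rw [List.range_succ, List.map_append, List.prod_append, ract_mul, ih (by omega), ract_smul]
    simp only [List.map_cons, List.map_nil, List.prod_cons, List.prod_nil, mul_one]
    rw [ract_pow_of_eq (hω.act_K (by omega) hn s), smul_smul, ← qpow_add]
    congr 2
    rw [nlt_eq (Nat.lt_succ_self (n + 1))]
    have : nbtw s (n + 1) (n + 1 + 1) = 0 := by
      rw [nbtw, Finset.card_eq_zero, Finset.filter_eq_empty_iff]; intro x _; omega
    rw [this]
    push_cast
    split_ifs <;> ring

/-- In the relation `K̂^{ℓ+1} = (∏ K_i^i)²` every factor except `K_ℓ^{2ℓ}` has a known eigenvalue.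
Division gives that of `K_ℓ^{2ℓ}`, and `ract_K_of_pow` takes the root. The degree `k` enters as the
size of `s`. -/
theorem IsForm.act_K_last {k : ℕ} {N : ℤ} {ω : Form ℓ q} (hω : IsForm k N ω) (hℓ : 1 ≤ ℓ) {s : Finset ℕ}
    (hs : s ⊆ Finset.Icc 1 ℓ) : ract (flat ω s) (K ℓ q ℓ) =
      qpow q (((((if ℓ ∈ s then 1 else 0) + (k - N) : ℤ)) : ℝ) / 2) • flat ω s := by
  by_cases hk : s.card = k
  swap
  · have h0 : flat ω s = 0 := hω.degree _ (by rwa [card_low hs])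
    rw [h0, smul_zero]
    exact congrArg (fun f => f (K ℓ q ℓ)) (map_zero (ractA ℓ q).act)
  have hmem : ℓ ∈ Finset.Icc 1 ℓ := Finset.mem_Icc.2 ⟨hℓ, le_rfl⟩
  rw [K_mem hmem]
  have hn : 2 * ℓ ≠ 0 := by omega
  refine ract_K_of_pow _ hn ?_
  rw [← K_mem hmem]
  obtain ⟨n, rfl⟩ : ∃ n, ℓ = n + 1 := ⟨ℓ - 1, by omega⟩
  set g : U (n + 1) q := ((List.range n).map fun i => K (n + 1) q (i + 1) ^ (i + 1)).prod with hg
  have hpre := hω.act_prefix hs (Nat.lt_succ_self n)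
  rw [← hg] at hpre
  have hroot : Khat (n + 1) q ^ (n + 2) = g * g * K (n + 1) q (n + 1) ^ (2 * (n + 1)) := by
    have h1 : kap (n + 1) q ^ ((n + 1) * (n + 1 + 1) / 2) = g * K (n + 1) q (n + 1) ^ (n + 1) := by
      rw [kap_pow_eq, List.range_succ, List.map_append, List.prod_append]; simp [hg]
    have h2 : (n + 1) * (n + 2) = (n + 1) * (n + 1 + 1) / 2 + (n + 1) * (n + 1 + 1) / 2 := by
      have := Nat.even_mul_succ_self (n + 1)
      obtain ⟨m, hm⟩ := this
      rw [show (n + 1) * (n + 2) = m + m from hm]; omega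
    have hc : Commute (K (n + 1) q (n + 1) ^ (n + 1)) g := by
      refine torus_comm (pow_mem (K_mem_torus _) _) (Submonoid.list_prod_mem _ fun x hx => ?_)
      obtain ⟨i, -, rfl⟩ := List.mem_map.1 hx
      exact pow_mem (K_mem_torus _) _
    rw [Khat, ← pow_mul, h2, pow_add, h1, two_mul, pow_add (K (n + 1) q (n + 1)) (n + 1) (n + 1),
      mul_assoc, ← mul_assoc (_ ^ _) g, hc.eq]
    simp only [mul_assoc]
  have h3 := ract_pow_of_eq (hω.ract_Khat (low (n + 1) s)) (n + 2)
  change ract (flat ω s) _ = _ • flat ω s at h3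
  rw [hroot, ract_mul, ract_mul, hpre, ract_smul, hpre, smul_smul, ← qpow_add, ract_smul] at h3
  have hcard : nlt s (n + 1) + (if n + 1 ∈ s then 1 else 0) = k := by
    rw [← hk]
    have hz : ngt s (n + 1) = 0 := by
      rw [ngt, Finset.card_eq_zero, Finset.filter_eq_empty_iff]
      intro x hx; have := Finset.mem_Icc.1 (hs hx); omega
    split_ifs with h
    · have := nlt_add_ngt_of_mem h; omega
    · have := nlt_add_ngt h; omega
  have hcard' : (nlt s (n + 1) : ℝ) = k - if n + 1 ∈ s then 1 else 0 := by
    rw [← hcard]; push_cast; ring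
  refine smul_right_injective _ (qpow_ne q _) (h3.trans ?_)
  dsimp only
  rw [smul_smul, qpow_pow, ← qpow_add]
  congr 2
  rw [hcard']
  have : ((n + 1 : ℕ) : ℝ) + 1 ≠ 0 := by positivity
  have : (n : ℝ) + 1 + 1 ≠ 0 := by positivity
  push_cast
  split_ifs <;> field_simp <;> ring

theorem IsForm.pHalf {k : ℕ} {N : ℤ} {ω : Form ℓ q} (hω : IsForm k N ω) :
    PHalf (ractA ℓ q) (k - N) (flat ω) := by
  intro j h1 h2 s hs
  refine downInd (k := ℓ) (p := fun j => 1 ≤ j → ract (flat ω s) (P ℓ q j) =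
    qpow q ((((if j ∈ s then 1 else 0) + (k - N) : ℤ) : ℝ) / 2) • flat ω s) ?_ ?_ j h2 h1
  · intro h
    rw [P_eq_mul le_rfl, P_last, mul_one, hω.act_K_last h hs]
  · intro j hj ih h
    rw [P_eq_mul hj.le, ract_mul, hω.act_K h hj, ract_smul, ih (by omega), smul_smul, ← qpow_add]
    congr 2
    push_cast
    ring

theorem IsForm.equi {k : ℕ} {N : ℤ} {ω : Form ℓ q} (hω : IsForm k N ω) :
    Equi (ractA ℓ q) (k - N) (flat ω) where
  hP := hω.pHalf.pwt
  hE j h1 h2 s _ := by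
    have hj : j ∈ Finset.Icc 1 ℓ := Finset.mem_Icc.2 ⟨h1, h2.le⟩
    have hj' : j + 1 ∈ Finset.Icc 1 ℓ := Finset.mem_Icc.2 (by omega)
    have := hω.ract_E (j := ⟨j, hj⟩) (j' := ⟨j + 1, hj'⟩) rfl (low ℓ s)
    rw [← low_erase, ← low_insert] at this
    simp only [mem_low] at this
    rw [E_mem hj]; exact this
  hF j h1 h2 s _ := by
    have hj : j ∈ Finset.Icc 1 ℓ := Finset.mem_Icc.2 ⟨h1, h2.le⟩
    have hj' : j + 1 ∈ Finset.Icc 1 ℓ := Finset.mem_Icc.2 (by omega)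
    have := hω.ract_F (j := ⟨j, hj⟩) (j' := ⟨j + 1, hj'⟩) rfl (low ℓ s)
    rw [← low_erase, ← low_insert] at this
    simp only [mem_low] at this
    rw [F_mem hj]; exact this

/-! ### The Dolbeault operators in components -/

/-- The operator `∂̄` in components. -/
def dolb (r : RAct ℓ q V) (ω : Finset ℕ → V) (t : Finset ℕ) : V :=
  ∑ i ∈ t, (-(qc q)⁻¹) ^ nlt t i • r.act (ω (t.erase i)) (Sinv (Khat ℓ q * X ℓ q i))

/-- The operator `∂̄†` in components. -/
def dolbDag (r : RAct ℓ q V) (ω : Finset ℕ → V) (t : Finset ℕ) : V :=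
  ∑ i ∈ Finset.Icc 1 ℓ \ t,
    (-(qc q)⁻¹) ^ nlt t i • r.act (ω (insert i t)) (Sinv (star (X ℓ q i) * Khat ℓ q))

theorem dolb_congr {r : RAct ℓ q V} {ω η : Finset ℕ → V} (h : ∀ s ⊆ Finset.Icc 1 ℓ, ω s = η s)
    {t : Finset ℕ} (ht : t ⊆ Finset.Icc 1 ℓ) : dolb r ω t = dolb r η t :=
  Finset.sum_congr rfl fun i _ => by rw [h _ ((Finset.erase_subset _ _).trans ht)]

theorem dolbDag_congr {r : RAct ℓ q V} {ω η : Finset ℕ → V} (h : ∀ s ⊆ Finset.Icc 1 ℓ, ω s = η s)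
    {t : Finset ℕ} (ht : t ⊆ Finset.Icc 1 ℓ) : dolbDag r ω t = dolbDag r η t :=
  Finset.sum_congr rfl fun i hi => by
    rw [h _ (Finset.insert_subset (Finset.mem_sdiff.1 hi).1 ht)]

theorem dolb_add (r : RAct ℓ q V) (ω η : Finset ℕ → V) (t : Finset ℕ) :
    dolb r (fun s => ω s + η s) t = dolb r ω t + dolb r η t := by
  simp only [dolb, map_add, LinearMap.add_apply, smul_add, Finset.sum_add_distrib]

theorem dolbDag_add (r : RAct ℓ q V) (ω η : Finset ℕ → V) (t : Finset ℕ) :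
    dolbDag r (fun s => ω s + η s) t = dolbDag r ω t + dolbDag r η t := by
  simp only [dolbDag, map_add, LinearMap.add_apply, smul_add, Finset.sum_add_distrib]

theorem dolb_smul (r : RAct ℓ q V) (c : ℂ) (ω : Finset ℕ → V) (t : Finset ℕ) :
    dolb r (fun s => c • ω s) t = c • dolb r ω t := by
  rw [dolb, dolb, Finset.smul_sum]
  exact Finset.sum_congr rfl fun i _ => by rw [map_smul, LinearMap.smul_apply, smul_comm]

theorem dolbDag_smul (r : RAct ℓ q V) (c : ℂ) (ω : Finset ℕ → V) (t : Finset ℕ) :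
    dolbDag r (fun s => c • ω s) t = c • dolbDag r ω t := by
  rw [dolbDag, dolbDag, Finset.smul_sum]
  exact Finset.sum_congr rfl fun i _ => by rw [map_smul, LinearMap.smul_apply, smul_comm]

theorem dlt_congr {r : RAct ℓ q V} {ω η : Finset ℕ → V} {t : Finset ℕ}
    (h : ∀ i ∈ Finset.Icc 1 ℓ \ t, ω (insert i t) = η (insert i t)) : dlt r ω t = dlt r η t :=
  Finset.sum_congr rfl fun i hi => by rw [h i hi]

theorem dL_congr {r : RAct ℓ q V} {ω η : Finset ℕ → V} {t : Finset ℕ}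
    (h : ∀ i ∈ t, ω (t.erase i) = η (t.erase i)) : dL r ω t = dL r η t :=
  Finset.sum_congr rfl fun i hi => by rw [h i hi]

theorem dL_smul (r : RAct ℓ q V) (c : ℂ) (ω : Finset ℕ → V) (s : Finset ℕ) :
    dL r (fun t => c • ω t) s = c • dL r ω s := by
  rw [dL, dL, Finset.smul_sum]
  exact Finset.sum_congr rfl fun i _ => by rw [map_smul, LinearMap.smul_apply, smul_comm]

theorem PHalf.congr {r : RAct ℓ q V} {d : ℤ} {ω η : Finset ℕ → V} (hω : PHalf r d ω) {c : ℂ}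
    (h : ∀ s ⊆ Finset.Icc 1 ℓ, η s = c • ω s) : PHalf r d η := by
  intro j h1 h2 s hs
  rw [h s hs, map_smul, LinearMap.smul_apply, hω j h1 h2 s hs, smul_comm]

theorem PHalf.act_Pinv {r : RAct ℓ q V} {d : ℤ} {ω : Finset ℕ → V} (hω : PHalf r d ω) {j : ℕ}
    (h1 : 1 ≤ j) (h2 : j ≤ ℓ) {s : Finset ℕ} (hs : s ⊆ Finset.Icc 1 ℓ) :
    r.act (ω s) (Pinv ℓ q j) = qpow q (-((((if j ∈ s then 1 else 0) + d : ℤ) : ℝ) / 2)) • ω s := by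
  have h := congrArg (fun v => r.act v (Pinv ℓ q j)) (hω j h1 h2 s hs)
  simp only [map_smul, LinearMap.smul_apply] at h
  rw [← r.act_mul, P_mul_Pinv (by omega), r.act_one] at h
  conv_rhs => rw [h]
  rw [smul_smul, ← qpow_add, neg_add_cancel, qpow_zero, one_smul]

theorem Mopst_mul_P {i j : ℕ} (hi : 1 ≤ i) (hi' : i ≤ ℓ) (hj : 1 ≤ j) (hj' : j ≤ ℓ) :
    Mopst ℓ q i ℓ * P ℓ q j = qpow q (if i = j then 1 else 1 / 2) • (P ℓ q j * Mopst ℓ q i ℓ) := by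
  have h := (Chr.P (q := q) hj (by omega : j ≤ ℓ + 1)).Mopst hi le_rfl hi'
  have e : ∑ m ∈ Finset.Icc i ℓ, (chrP ℓ j m : ℝ) / 2 = if i = j then 1 else 1 / 2 := by
    split_ifs with h
    · subst h; exact sum_chrP_self hi hi'
    · exact sum_chrP_of_ne hj hj' hi' (Ne.symm h)
  rw [h, e, smul_smul, ← qpow_add, add_neg_cancel, qpow_zero, one_smul]

theorem Mop_mul_P {i j : ℕ} (hi : 1 ≤ i) (hi' : i ≤ ℓ) (hj : 1 ≤ j) (hj' : j ≤ ℓ) :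
    Mop ℓ q i ℓ * P ℓ q j = qpow q (-(if i = j then 1 else 1 / 2)) • (P ℓ q j * Mop ℓ q i ℓ) := by
  have h := (Chr.P (q := q) hj (by omega : j ≤ ℓ + 1)).Mop hi le_rfl hi'
  have e : ∑ m ∈ Finset.Icc i ℓ, (chrP ℓ j m : ℝ) / 2 = if i = j then 1 else 1 / 2 := by
    split_ifs with h
    · subst h; exact sum_chrP_self hi hi'
    · exact sum_chrP_of_ne hj hj' hi' (Ne.symm h)
  rw [h, e, smul_smul, ← qpow_add, neg_add_cancel, qpow_zero, one_smul]

theorem Mopst_mul_Pinv {i : ℕ} (hi : 1 ≤ i) (hi' : i ≤ ℓ) :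
    Mopst ℓ q i ℓ * Pinv ℓ q i = (qc q)⁻¹ • (Pinv ℓ q i * Mopst ℓ q i ℓ) := by
  have h := congrArg (fun x => Pinv ℓ q i * x * Pinv ℓ q i) (Mopst_mul_P (q := q) hi hi' hi hi')
  simp only [if_true, qpow_one, mul_smul_comm, smul_mul_assoc] at h
  rw [mul_assoc, mul_assoc, P_mul_Pinv (by omega), mul_one, ← mul_assoc (Pinv ℓ q i) (P ℓ q i),
    Pinv_mul_P (by omega), one_mul] at h
  rw [h, inv_smul_smul₀ (qc_ne q)]

theorem PHalf.dL {r : RAct ℓ q V} {d : ℤ} {ω : Finset ℕ → V} (hω : PHalf r d ω) :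
    PHalf r (d + 1) (dL r ω) := by
  intro j h1 h2 s hs
  rw [QProj.dL, map_sum, LinearMap.sum_apply, Finset.smul_sum]
  refine Finset.sum_congr rfl fun i hi => ?_
  have hi' := Finset.mem_Icc.1 (hs hi)
  rw [map_smul, LinearMap.smul_apply, ← r.act_mul, Mopst_mul_P hi'.1 hi'.2 h1 h2, map_smul, r.act_mul,
    hω j h1 h2 _ ((Finset.erase_subset _ _).trans hs), map_smul, LinearMap.smul_apply,
    smul_smul (qpow q _) (qpow q _), ← qpow_add, smul_comm (qpow q _)]
  congr 3
  simp only [Finset.mem_erase]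
  by_cases hij : i = j
  · subst hij; simp [hi]; ring
  · simp [hij, Ne.symm hij]; ring

theorem PHalf.dlt {r : RAct ℓ q V} {d : ℤ} {ω : Finset ℕ → V} (hω : PHalf r d ω) :
    PHalf r (d - 1) (dlt r ω) := by
  intro j h1 h2 s hs
  rw [QProj.dlt, map_sum, LinearMap.sum_apply, Finset.smul_sum]
  refine Finset.sum_congr rfl fun i hi => ?_
  rw [Finset.mem_sdiff] at hi
  have hi' := Finset.mem_Icc.1 hi.1
  rw [map_smul, LinearMap.smul_apply, ← r.act_mul, Mop_mul_P hi'.1 hi'.2 h1 h2, map_smul, r.act_mul,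
    hω j h1 h2 _ (Finset.insert_subset hi.1 hs), map_smul, LinearMap.smul_apply,
    smul_smul (qpow q _) (qpow q _), ← qpow_add, smul_comm (qpow q _)]
  congr 3
  simp only [Finset.mem_insert]
  by_cases hij : i = j
  · subst hij; simp [hi.2]; ring
  · simp [hij, Ne.symm hij]; ring

/-- The factor `P_i⁻¹` acts on the component `s \ {i}`, where its exponent does not depend on `i`.
It therefore comes out of the sum, and the remaining powers of `-q` are those of `dL`. -/
theorem PHalf.dolb_eq {r : RAct ℓ q V} {d : ℤ} {ω : Finset ℕ → V} (hω : PHalf r d ω) {s : Finset ℕ}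
    (hs : s ⊆ Finset.Icc 1 ℓ) : dolb r ω s = (-qpow q (-((d : ℝ) / 2))) • QProj.dL r ω s := by
  rw [dolb, QProj.dL, Finset.smul_sum]
  refine Finset.sum_congr rfl fun i hi => ?_
  have hi' := Finset.mem_Icc.1 (hs hi)
  have hq := qc_ne q
  rw [Sinv_Khat_mul_X hi'.2, map_smul, Mopst_mul_Pinv hi'.1 hi'.2, map_smul, r.act_mul,
    hω.act_Pinv hi'.1 hi'.2 ((Finset.erase_subset _ _).trans hs), map_smul, LinearMap.smul_apply,
    smul_smul, smul_smul, smul_smul, smul_smul]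
  congr 1
  simp only [Finset.mem_erase, ne_eq, not_true_eq_false, false_and, if_false, zero_add, pow_succ]
  field_simp

/-- Here `P_i⁻¹` acts on the component `s ∪ {i}`, again with an exponent independent of `i`. -/
theorem PHalf.dolbDag_eq {r : RAct ℓ q V} {d : ℤ} {ω : Finset ℕ → V} (hω : PHalf r d ω) {s : Finset ℕ}
    (hs : s ⊆ Finset.Icc 1 ℓ) : dolbDag r ω s = (-qpow q (-(((d : ℝ) + 3) / 2))) • QProj.dlt r ω s := by
  rw [dolbDag, QProj.dlt, Finset.smul_sum]
  refine Finset.sum_congr rfl fun i hi => ?_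
  rw [Finset.mem_sdiff] at hi
  have hi' := Finset.mem_Icc.1 hi.1
  have e : qpow q (-(((d : ℝ) + 3) / 2)) = (qc q)⁻¹ * qpow q (-((((1 : ℤ) + d : ℤ) : ℝ) / 2)) := by
    rw [← qpow_neg_one, ← qpow_add]; congr 1; push_cast; ring
  rw [Sinv_star_X_mul_Khat hi'.2, map_smul, r.act_mul,
    hω.act_Pinv hi'.1 hi'.2 (Finset.insert_subset hi.1 hs), map_smul, LinearMap.smul_apply,
    smul_smul, smul_smul, smul_smul, e, gam, if_pos (Finset.mem_insert_self _ _)]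
  congr 1
  rw [pow_succ]
  ring

theorem Equi.dolbDag_dolb {r : RAct ℓ q V} {d : ℤ} {ω : Finset ℕ → V} (hω : Equi r d ω)
    (hP : PHalf r d ω) {s : Finset ℕ} (hs : s ⊆ Finset.Icc 1 ℓ) :
    dolbDag r (dolb r ω) s = (qc q ^ (-d - 2) * (-qc q) ^ s.card) • dlt r (dR r ω) s := by
  have h1 : PHalf r (d + 1) (dolb r ω) := hP.dL.congr fun s hs => hP.dolb_eq hs
  have h2 : dlt r (dolb r ω) s =
      dlt r (fun t => (-qpow q (-((d : ℝ) / 2)) * (-qc q) ^ s.card) • dR r ω t) s := by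
    refine dlt_congr fun i hi => ?_
    rw [Finset.mem_sdiff] at hi
    have hsub := Finset.insert_subset hi.1 hs
    rw [hP.dolb_eq hsub, hω.hF.dR_eq hsub, smul_smul, Finset.card_insert_of_notMem hi.2,
      Nat.add_sub_cancel, mul_assoc, mul_comm ((-qc q) ^ _), neg_qc_inv_pow_mul, mul_one]
  rw [h1.dolbDag_eq hs, h2, dlt_smul, smul_smul, ← mul_assoc, neg_mul_neg, ← qpow_add, ← qpow_intCast]
  congr 3
  push_cast
  ring

/-- The passage from `dL` to `dR` is made on `dlt r ω`, whose equivariance under the `F_j` is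
`PWt.FInv_dlt`. -/
theorem Equi.dolb_dolbDag {r : RAct ℓ q V} {d : ℤ} {ω : Finset ℕ → V} (hω : Equi r d ω)
    (hP : PHalf r d ω) {s : Finset ℕ} (hs : s ⊆ Finset.Icc 1 ℓ) :
    dolb r (dolbDag r ω) s = (qc q ^ (-d - 1) * (-qc q) ^ (s.card - 1)) • dR r (dlt r ω) s := by
  have h1 : PHalf r (d - 1) (dolbDag r ω) := hP.dlt.congr fun s hs => hP.dolbDag_eq hs
  have h2 : QProj.dL r (dolbDag r ω) s =
      QProj.dL r (fun t => (-qpow q (-(((d : ℝ) + 3) / 2))) • dlt r ω t) s :=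
    dL_congr fun i hi => hP.dolbDag_eq ((Finset.erase_subset _ _).trans hs)
  rw [h1.dolb_eq hs, h2, dL_smul, smul_smul, neg_mul_neg, ← qpow_add, (hω.hP.FInv_dlt hω.hF).dR_eq hs,
    smul_smul, mul_assoc, mul_comm ((-qc q) ^ _), neg_qc_inv_pow_mul, mul_one, ← qpow_intCast]
  congr 2
  push_cast
  ring

/-! ### Nilpotency -/

theorem sum_erase_eq_zero {t : Finset ℕ} {f : ℕ → ℕ → V}
    (h : ∀ i ∈ t, ∀ j ∈ t, i < j → f j i = -f i j) : ∑ j ∈ t, ∑ i ∈ t.erase j, f j i = 0 := by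
  set S := ∑ j ∈ t, ∑ i ∈ t.erase j, f j i with hS
  have e : S = ∑ j ∈ t, ∑ i ∈ t.erase j, f i j := by
    rw [hS]
    refine Finset.sum_comm' fun x y => ?_
    simp only [Finset.mem_erase]; tauto
  have h2 : S + S = 0 := by
    nth_rewrite 2 [e]
    rw [hS, ← Finset.sum_add_distrib]
    refine Finset.sum_eq_zero fun j hj => ?_
    rw [← Finset.sum_add_distrib]
    refine Finset.sum_eq_zero fun i hi => ?_
    rw [Finset.mem_erase] at hi
    rcases lt_or_gt_of_ne hi.1 with hij | hij
    · rw [h i hi.2 j hj hij, neg_add_cancel]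
    · rw [h j hj i hi.2 hij, add_neg_cancel]
  rw [← two_smul ℂ] at h2
  exact (smul_eq_zero.1 h2).resolve_left two_ne_zero

/-- For `i < j`, removing the two elements in the two orders gives coefficients with ratio `-q⁻¹`,
while the operators commute up to `q`. The terms cancel in pairs. -/
theorem dolb_dolb (r : RAct ℓ q V) (ω : Finset ℕ → V) {t : Finset ℕ} (ht : t ⊆ Finset.Icc 1 ℓ) :
    dolb r (dolb r ω) t = 0 := by
  have hq := qc_ne q
  have h : dolb r (dolb r ω) t = ∑ j ∈ t, ∑ i ∈ t.erase j,
      ((-(qc q)⁻¹) ^ nlt t j * (-(qc q)⁻¹) ^ nlt (t.erase j) i) • r.act (ω ((t.erase j).erase i))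
        (Sinv ((Khat ℓ q * X ℓ q j) * (Khat ℓ q * X ℓ q i))) := by
    rw [dolb]
    refine Finset.sum_congr rfl fun j _ => ?_
    rw [dolb, map_sum, LinearMap.sum_apply, Finset.smul_sum]
    refine Finset.sum_congr rfl fun i _ => ?_
    rw [map_smul, LinearMap.smul_apply, ← r.act_mul, ← Sinv_mul, smul_smul]
  rw [h]
  refine sum_erase_eq_zero fun i hi j hj hij => ?_
  have h1 := nlt_erase i hj
  have h2 := nlt_erase j hi
  rw [if_neg (by omega), add_zero] at h1
  rw [if_pos hij] at h2
  rw [Khat_mul_X_mul (Finset.mem_Icc.1 (ht hi)).1 hij (Finset.mem_Icc.1 (ht hj)).2, Sinv_smul, map_smul,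
    smul_smul, Finset.erase_right_comm, ← neg_smul, h1, ← h2, pow_succ]
  congr 1
  field_simp

theorem dolbDag_dolbDag (r : RAct ℓ q V) (ω : Finset ℕ → V) (t : Finset ℕ) :
    dolbDag r (dolbDag r ω) t = 0 := by
  have hq := qc_ne q
  have h : dolbDag r (dolbDag r ω) t = ∑ j ∈ Finset.Icc 1 ℓ \ t, ∑ i ∈ (Finset.Icc 1 ℓ \ t).erase j,
      ((-(qc q)⁻¹) ^ nlt t j * (-(qc q)⁻¹) ^ nlt (insert j t) i) • r.act (ω (insert i (insert j t)))
        (Sinv (star ((Khat ℓ q * X ℓ q i) * (Khat ℓ q * X ℓ q j)))) := by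
    rw [dolbDag]
    refine Finset.sum_congr rfl fun j _ => ?_
    rw [dolbDag, map_sum, LinearMap.sum_apply, Finset.smul_sum, Finset.sdiff_insert]
    refine Finset.sum_congr rfl fun i _ => ?_
    rw [map_smul, LinearMap.smul_apply, ← r.act_mul, ← Sinv_mul, smul_smul, star_mul, star_X_mul_Khat,
      star_X_mul_Khat]
  rw [h]
  refine sum_erase_eq_zero fun i hi j hj hij => ?_
  rw [Finset.mem_sdiff, Finset.mem_Icc] at hi hj
  rw [Khat_mul_X_mul hi.1.1 hij hj.1.2, star_smul, Sinv_smul, map_smul, smul_smul,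
    Finset.insert_comm, ← neg_smul, nlt_insert _ hj.2, nlt_insert _ hi.2, if_neg (by omega), if_pos hij, star_qc,
    pow_succ]
  congr 1
  field_simp
  ring

/-! ### The Laplacians on twisted forms -/

theorem qint_eq_qnum {n : ℤ} {x : ℝ} (h : (n : ℝ) = x) : qint q n = qnum q x := by
  rw [qint, qnum, ← h, ← Int.cast_neg, qpow_intCast, qpow_intCast, qpow_one, qpow_neg_one]

/-- The components of a twisted form of degree `k` with values in a right module. -/
structure TwForm (r : RAct ℓ q V) (k : ℕ) (N : ℤ) (ω : Finset ℕ → V) : Prop where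
  degree : ∀ s ⊆ Finset.Icc 1 ℓ, s.card ≠ k → ω s = 0
  equi : Equi r (k - N) ω
  half : PHalf r (k - N) ω
  khat : ∀ s ⊆ Finset.Icc 1 ℓ, r.act (ω s) (Khat ℓ q) = qpow q ((k : ℝ) - ℓ * N / (ℓ + 1)) • ω s

theorem TwForm.act_Khatinv {r : RAct ℓ q V} {k : ℕ} {N : ℤ} {ω : Finset ℕ → V} (h : TwForm r k N ω)
    {s : Finset ℕ} (hs : s ⊆ Finset.Icc 1 ℓ) :
    r.act (ω s) (Khatinv ℓ q) = qpow q (-((k : ℝ) - ℓ * N / (ℓ + 1))) • ω s := by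
  have h := congrArg (fun v => r.act v (Khatinv ℓ q)) (h.khat s hs)
  simp only [map_smul, LinearMap.smul_apply] at h
  rw [← r.act_mul, Khat_mul_Khatinv, r.act_one] at h
  conv_rhs => rw [h]
  rw [smul_smul, ← qpow_add, neg_add_cancel, qpow_zero, one_smul]

theorem act_sq_of_eq {r : RAct ℓ q V} {v : V} {x : U ℓ q} {a : ℝ} (h : r.act v x = qpow q a • v) :
    r.act v (x ^ 2) = qpow q (2 * a) • v := by
  rw [pow_two, r.act_mul, h, map_smul, LinearMap.smul_apply, h, smul_smul, ← qpow_add, two_mul]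

theorem TwForm.act_Nel_sq {r : RAct ℓ q V} {k : ℕ} {N : ℤ} {ω : Finset ℕ → V} (h : TwForm r k N ω)
    {i : ℕ} (h1 : 1 ≤ i) (h2 : i ≤ ℓ) {s : Finset ℕ} (hs : s ⊆ Finset.Icc 1 ℓ) :
    r.act (ω s) (Nel ℓ q i ℓ ^ 2) =
      qpow q ((if i ∈ s then 1 else 0) - (k - N) - 2 * N / (ℓ + 1)) • ω s := by
  have e : r.act (ω s) (Nel ℓ q i ℓ) =
      qpow q (((if i ∈ s then 1 else 0) - (k - N) - 2 * N / (ℓ + 1)) / 2) • ω s := by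
    rw [Nel_last, r.act_mul, h.half i h1 h2 s hs, map_smul, LinearMap.smul_apply, h.act_Khatinv hs, smul_smul,
      ← qpow_add]
    congr 2
    have : (ℓ : ℝ) + 1 ≠ 0 := by positivity
    push_cast
    field_simp
    ring
  rw [act_sq_of_eq e]
  congr 2
  ring

theorem swap_Khatinv : swap (Khatinv ℓ q) = Khat ℓ q := by
  rw [← (Sinv_torus Khatinv_mem_torus).1, Khatinv, Khat, Sinv_pow, kapinv, kap, Sinv_gen]; rfl

theorem TwForm.act_swap_Nel_sq {r : RAct ℓ q V} {k : ℕ} {N : ℤ} {ω : Finset ℕ → V} (h : TwForm r k N ω)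
    {i : ℕ} (h1 : 1 ≤ i) (h2 : i ≤ ℓ) {s : Finset ℕ} (hs : s ⊆ Finset.Icc 1 ℓ) :
    r.act (ω s) (swap (Nel ℓ q i ℓ ^ 2)) =
      qpow q (-((if i ∈ s then 1 else 0) - (k - N) - 2 * N / (ℓ + 1))) • ω s := by
  have e : r.act (ω s) (swap (Nel ℓ q i ℓ)) =
      qpow q (-((if i ∈ s then 1 else 0) - (k - N) - 2 * N / (ℓ + 1)) / 2) • ω s := by
    rw [Nel_last, map_mul, swap_P, swap_Khatinv, r.act_mul, h.half.act_Pinv h1 h2 hs, map_smul,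
      LinearMap.smul_apply, h.khat s hs, smul_smul, ← qpow_add]
    congr 2
    have : (ℓ : ℝ) + 1 ≠ 0 := by positivity
    push_cast
    field_simp
    ring
  rw [map_pow, act_sq_of_eq e]
  congr 2
  ring

theorem TwForm.act_X {r : RAct ℓ q V} {k : ℕ} {N : ℤ} {ω : Finset ℕ → V} (h : TwForm r k N ω)
    {i : ℕ} (h1 : 1 ≤ i) (h2 : i ≤ ℓ) {s : Finset ℕ} (hs : s ⊆ Finset.Icc 1 ℓ) :
    r.act (ω s) (X ℓ q i * star (X ℓ q i)) =
      qpow q ((if i ∈ s then 1 else 0) - (k - N) - 2 * N / (ℓ + 1)) •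
        r.act (ω s) (Mst ℓ q i ℓ * M ℓ q i ℓ) := by
  rw [X_mul_star_X' h1 h2, r.act_mul, h.act_Nel_sq h1 h2 hs, map_smul, LinearMap.smul_apply]

theorem Sinv_X_mul_star_X {i : ℕ} (h1 : 1 ≤ i) (h2 : i ≤ ℓ) :
    Sinv (X ℓ q i * star (X ℓ q i)) = swap (X ℓ q i * star (X ℓ q i)) := by
  rw [X_mul_star_X h1 h2, Sinv_Mst_mul_M h2 (pow_mem (Nel_mem_torus _ _) _)]

theorem TwForm.act_Sinv_X {r : RAct ℓ q V} {k : ℕ} {N : ℤ} {ω : Finset ℕ → V} (h : TwForm r k N ω)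
    {i : ℕ} (h1 : 1 ≤ i) (h2 : i ≤ ℓ) {s : Finset ℕ} (hs : s ⊆ Finset.Icc 1 ℓ) :
    r.act (ω s) (Sinv (X ℓ q i * star (X ℓ q i))) =
      qpow q (-((if i ∈ s then 1 else 0) - (k - N) - 2 * N / (ℓ + 1))) •
        r.act (ω s) (Mop ℓ q i ℓ * Mopst ℓ q i ℓ) := by
  rw [Sinv_X_mul_star_X h1 h2, X_mul_star_X' h1 h2, map_mul swap, map_mul swap, swap_M h2, swap_Mst h2, r.act_mul,
    h.act_swap_Nel_sq h1 h2 hs, map_smul, LinearMap.smul_apply]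

theorem qc_inv_sq_pow (q : Set.Ioo (0 : ℝ) 1) (i : ℕ) : ((qc q)⁻¹ ^ 2) ^ i = qpow q (-2 * (i : ℝ)) := by
  rw [← qpow_neg_one, ← pow_mul, qpow_pow]; congr 1; push_cast; ring

/-- After multiplication by `q^{k-N}` this is `Equi.laplace`. The factor `N_{i,ℓ}²` in `X_i X_i^*`
acts by a scalar whose dependence on `i ∈ s` is precisely the `q` in the coefficients there. -/
theorem TwForm.laplace {r : RAct ℓ q V} {k : ℕ} {N : ℤ} {ω : Finset ℕ → V} (h : TwForm r k N ω)
    {s : Finset ℕ} (hs : s ⊆ Finset.Icc 1 ℓ) :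
    dolb r (dolbDag r ω) s + dolbDag r (dolb r ω) s =
      r.act (ω s) (qpow q (2 * N / ((ℓ : ℝ) + 1)) •
              ∑ i ∈ Finset.Icc 1 ℓ, qpow q (-2 * (i : ℝ)) • (X ℓ q i * star (X ℓ q i))
            + (qpow q ((N : ℝ) - ℓ - k) * qnum q k * qnum q ((ℓ : ℝ) + 1 - N)) • 1) := by
  have hq := qc_ne q
  have hl := h.equi.laplace hs
  have key : qpow q (((k - N : ℤ) : ℝ)) • (dolb r (dolbDag r ω) s + dolbDag r (dolb r ω) s) =
      ∑ i ∈ Finset.Icc 1 ℓ, (((qc q)⁻¹ ^ 2) ^ i * (if i ∈ s then qc q else 1)) •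
        r.act (ω s) (Mst ℓ q i ℓ * M ℓ q i ℓ) +
      (qc q ^ (-(ℓ : ℤ)) * qint q s.card * qint q (ℓ + 1 + (k - N) - s.card)) • ω s := by
    rw [← hl, h.equi.dolb_dolbDag h.half hs, h.equi.dolbDag_dolb h.half hs, smul_add, add_comm, smul_smul,
      smul_smul, qpow_intCast, ← mul_assoc, ← mul_assoc, ← zpow_add₀ hq, ← zpow_add₀ hq]
    congr 3
    · rw [show (k - N : ℤ) + (-(k - N) - 2) = -2 by ring, inv_pow]; rfl
    · rw [show (k - N : ℤ) + (-(k - N) - 1) = -1 by ring]; simp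
  refine smul_right_injective _ (qpow_ne q ((k - N : ℤ) : ℝ)) (key.trans ?_)
  dsimp only
  by_cases hk : s.card = k
  swap
  · simp [h.degree s hs hk]
  rw [map_add, map_smul, map_smul, map_sum, r.act_one, smul_add, Finset.smul_sum, Finset.smul_sum]
  congr 1
  · refine Finset.sum_congr rfl fun i hi => ?_
    obtain ⟨h1, h2⟩ := Finset.mem_Icc.1 hi
    rw [map_smul, h.act_X h1 h2 hs, qc_inv_sq_pow, smul_smul, smul_smul, smul_smul]
    congr 1
    rw [show (if i ∈ s then qc q else 1) = qpow q (if i ∈ s then 1 else 0) by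
      split_ifs; exacts [rfl, (qpow_zero q).symm]]
    simp only [← qpow_add]
    congr 1
    push_cast
    ring
  · rw [smul_smul, hk, qint_eq_qnum (x := k) (by simp),
      qint_eq_qnum (x := (ℓ : ℝ) + 1 - N) (by push_cast; ring), ← mul_assoc, ← mul_assoc, ← qpow_add,
      ← qpow_intCast]
    congr 4
    push_cast
    ring

theorem TwForm.dual_laplace {r : RAct ℓ q V} {k : ℕ} {N : ℤ} {ω : Finset ℕ → V} (h : TwForm r k N ω)
    {s : Finset ℕ} (hs : s ⊆ Finset.Icc 1 ℓ) :
    qpow q (2 * ((k : ℝ) - N)) • (dolb r (dolbDag r ω) s + qpow q 2 • dolbDag r (dolb r ω) s) =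
      r.act (ω s) (qpow q (2 * ((ℓ : ℝ) + 1 - N) / ((ℓ : ℝ) + 1)) •
              ∑ i ∈ Finset.Icc 1 ℓ, qpow q (-2 * (i : ℝ)) • Sinv (X ℓ q i * star (X ℓ q i))
            + (qpow q (-(N : ℝ) - ℓ + k + 1) * qnum q ((ℓ : ℝ) - k) * qnum q N) • 1) := by
  have hq := qc_ne q
  have hl := h.equi.dual_laplace hs
  have key : qpow q (2 * ((k : ℝ) - N)) •
      (dolb r (dolbDag r ω) s + qpow q 2 • dolbDag r (dolb r ω) s) =
      qpow q ((k : ℝ) - N + 1) • (∑ i ∈ Finset.Icc 1 ℓ, (((qc q)⁻¹ ^ 2) ^ i * (if i ∈ s then 1 else qc q)) •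
        r.act (ω s) (Mop ℓ q i ℓ * Mopst ℓ q i ℓ) +
      (qc q ^ (-(ℓ : ℤ)) * qint q (ℓ - s.card) * qint q (s.card - (k - N))) • ω s) := by
    rw [← hl, h.equi.dolb_dolbDag h.half hs, h.equi.dolbDag_dolb h.half hs, smul_add, smul_add, add_comm,
      smul_smul, smul_smul, smul_smul, smul_smul, smul_smul]
    rw [← qpow_neg_one, qpow_pow, ← qpow_intCast, ← qpow_intCast]
    simp only [← mul_assoc, ← qpow_add]
    congr 4
    · push_cast; ring
    · push_cast; ring
  refine key.trans ?_
  by_cases hk : s.card = k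
  swap
  · simp [h.degree s hs hk]
  rw [map_add, map_smul, map_smul, map_sum, r.act_one, smul_add, Finset.smul_sum, Finset.smul_sum]
  congr 1
  · refine Finset.sum_congr rfl fun i hi => ?_
    obtain ⟨h1, h2⟩ := Finset.mem_Icc.1 hi
    rw [map_smul, h.act_Sinv_X h1 h2 hs, qc_inv_sq_pow, smul_smul, smul_smul, smul_smul]
    congr 1
    rw [show (if i ∈ s then 1 else qc q) = qpow q (1 - if i ∈ s then 1 else 0) by
      split_ifs <;> simp [qpow_zero, qpow_one]]
    simp only [← qpow_add]
    congr 1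
    have : (ℓ : ℝ) + 1 ≠ 0 := by positivity
    field_simp
    ring
  · rw [smul_smul, hk, qint_eq_qnum (x := (ℓ : ℝ) - k) (by push_cast; ring),
      qint_eq_qnum (x := N) (by push_cast; ring), ← mul_assoc, ← mul_assoc,
      ← qpow_intCast, ← qpow_add]
    congr 4
    push_cast
    ring

/-! ### The Dirac operator -/

/-- The Dirac operator in components. -/
def diracN (r : RAct ℓ q V) (N : ℤ) (ω : Finset ℕ → V) (t : Finset ℕ) : V :=
  dolb r (fun s => qpow q (((s.card : ℝ) - N) / 2) • ω s) t
    + dolbDag r (fun s => qpow q (((s.card : ℝ) - N - 1) / 2) • ω s) t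

theorem diracN_congr {r : RAct ℓ q V} {N : ℤ} {ω η : Finset ℕ → V}
    (h : ∀ s ⊆ Finset.Icc 1 ℓ, ω s = η s) {t : Finset ℕ} (ht : t ⊆ Finset.Icc 1 ℓ) :
    diracN r N ω t = diracN r N η t := by
  rw [diracN, diracN, dolb_congr (fun s hs => by rw [h s hs]) ht,
    dolbDag_congr (fun s hs => by rw [h s hs]) ht]

theorem TwForm.dolb_degree {r : RAct ℓ q V} {k : ℕ} {N : ℤ} {ω : Finset ℕ → V} (h : TwForm r k N ω)
    {s : Finset ℕ} (hs : s ⊆ Finset.Icc 1 ℓ) (hk : s.card ≠ k + 1) : dolb r ω s = 0 :=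
  Finset.sum_eq_zero fun i hi => by
    rw [h.degree _ ((Finset.erase_subset _ _).trans hs), map_zero, LinearMap.zero_apply, smul_zero]
    rw [Finset.card_erase_of_mem hi]
    have := Finset.card_pos.2 ⟨i, hi⟩
    omega

theorem TwForm.dolbDag_degree {r : RAct ℓ q V} {k : ℕ} {N : ℤ} {ω : Finset ℕ → V} (h : TwForm r k N ω)
    {s : Finset ℕ} (hs : s ⊆ Finset.Icc 1 ℓ) (hk : s.card + 1 ≠ k) : dolbDag r ω s = 0 :=
  Finset.sum_eq_zero fun i hi => by
    rw [Finset.mem_sdiff] at hi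
    rw [h.degree _ (Finset.insert_subset hi.1 hs), map_zero, LinearMap.zero_apply, smul_zero]
    rwa [Finset.card_insert_of_notMem hi.2]

theorem TwForm.diracN_eq {r : RAct ℓ q V} {k : ℕ} {N : ℤ} {ω : Finset ℕ → V} (h : TwForm r k N ω)
    {s : Finset ℕ} (hs : s ⊆ Finset.Icc 1 ℓ) : diracN r N ω s =
      qpow q (((k : ℝ) - N) / 2) • dolb r ω s + qpow q (((k : ℝ) - N - 1) / 2) • dolbDag r ω s := by
  rw [diracN, ← dolb_smul, ← dolbDag_smul]
  congr 1
  · refine dolb_congr (fun t ht => ?_) hs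
    by_cases hk : t.card = k
    · rw [hk]
    · rw [h.degree t ht hk, smul_zero, smul_zero]
  · refine dolbDag_congr (fun t ht => ?_) hs
    by_cases hk : t.card = k
    · rw [hk]
    · rw [h.degree t ht hk, smul_zero, smul_zero]

/-- Nilpotency leaves the two mixed terms, and the half-integral exponents of consecutive degrees
add up. -/
theorem TwForm.diracN_sq {r : RAct ℓ q V} {k : ℕ} {N : ℤ} {ω : Finset ℕ → V} (h : TwForm r k N ω)
    {s : Finset ℕ} (hs : s ⊆ Finset.Icc 1 ℓ) : diracN r N (diracN r N ω) s =
      qpow q ((k : ℝ) - N - 1) • dolb r (dolbDag r ω) s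
        + qpow q ((k : ℝ) - N) • dolbDag r (dolb r ω) s := by
  have h1 : ∀ (f : ℕ → ℝ), ∀ t ⊆ Finset.Icc 1 ℓ, qpow q (f t.card) • diracN r N ω t =
      (qpow q (f (k + 1)) * qpow q (((k : ℝ) - N) / 2)) • dolb r ω t
        + (qpow q (f (k - 1)) * qpow q (((k : ℝ) - N - 1) / 2)) • dolbDag r ω t := by
    intro f t ht
    rw [h.diracN_eq ht, smul_add, smul_smul, smul_smul]
    congr 1
    · by_cases hk : t.card = k + 1
      · rw [hk]
      · rw [h.dolb_degree ht hk, smul_zero, smul_zero]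
    · by_cases hk : t.card + 1 = k
      · rw [show t.card = k - 1 by omega]
      · rw [h.dolbDag_degree ht hk, smul_zero, smul_zero]
  rw [diracN, dolb_congr (h1 fun n => ((n : ℝ) - N) / 2) hs,
    dolbDag_congr (h1 fun n => ((n : ℝ) - N - 1) / 2) hs, dolb_add, dolb_smul, dolb_smul, dolbDag_add, dolbDag_smul,
    dolbDag_smul, dolb_dolb r ω hs, dolbDag_dolbDag, smul_zero, zero_add, smul_zero, add_zero, ← qpow_add,
    ← qpow_add]
  congr 1
  -- For `k = 0` the truncated `k - 1` gives a wrong exponent, but then `∂̄†` vanishes on the form.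
  · rcases Nat.eq_zero_or_pos k with rfl | hk
    · have : dolb r (dolbDag r ω) s = 0 :=
        Finset.sum_eq_zero fun i hi => by
          rw [h.dolbDag_degree ((Finset.erase_subset _ _).trans hs) (by omega), map_zero,
            LinearMap.zero_apply, smul_zero]
      rw [this, smul_zero, smul_zero]
    · congr 2
      rw [Nat.cast_sub hk]
      push_cast
      ring
  · congr 2
    push_cast
    ring

theorem TwForm.dirac_sq {r : RAct ℓ q V} {k : ℕ} {N : ℤ} {ω : Finset ℕ → V} (h : TwForm r k N ω)
    {s : Finset ℕ} (hs : s ⊆ Finset.Icc 1 ℓ) :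
    (1 + qpow q 1) • diracN r N (diracN r N ω) s =
          qpow q ((k : ℝ) - ((ℓ : ℝ) - 1) / ((ℓ : ℝ) + 1) * N) •
              ∑ i ∈ Finset.Icc 1 ℓ, qpow q (-2 * (i : ℝ)) • r.act (ω s) (X ℓ q i * star (X ℓ q i))
            + qpow q (((ℓ : ℝ) - 1) / ((ℓ : ℝ) + 1) * N - k + 1) •
              ∑ i ∈ Finset.Icc 1 ℓ, qpow q (-2 * (i : ℝ)) •
                r.act (ω s) (Sinv (X ℓ q i * star (X ℓ q i)))
            + (qpow q (-(ℓ : ℝ)) * (qnum q k * qnum q ((ℓ : ℝ) + 1 - N)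
                + qnum q ((ℓ : ℝ) - k) * qnum q N)) • ω s := by
  -- The two Laplacians are weighted so that `∂̄∂̄†` and `∂̄†∂̄` get the coefficients `(1 + q)
  -- q^{k-N-1}` and `(1 + q) q^{k-N}` of the square of the Dirac operator.
  have e : (1 + qpow q 1) • diracN r N (diracN r N ω) s =
      qpow q ((k : ℝ) - N) • (dolb r (dolbDag r ω) s + dolbDag r (dolb r ω) s) +
      qpow q (-((k : ℝ) - N) - 1) • (qpow q (2 * ((k : ℝ) - N)) •
        (dolb r (dolbDag r ω) s + qpow q 2 • dolbDag r (dolb r ω) s)) := by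
    have e1 : qpow q ((k : ℝ) - N) = qpow q 1 * qpow q ((k : ℝ) - N - 1) := by
      rw [← qpow_add]; congr 1; ring
    have e2 : qpow q (-((k : ℝ) - N) - 1) * qpow q (2 * ((k : ℝ) - N)) = qpow q ((k : ℝ) - N - 1) := by
      rw [← qpow_add]; congr 1; ring
    have e3 : qpow q 2 = qpow q 1 * qpow q 1 := by rw [← qpow_add]; norm_num
    rw [h.diracN_sq hs, smul_smul, e2, e1, e3]
    module
  rw [e, h.laplace hs, h.dual_laplace hs]
  simp only [map_add, map_smul, map_sum, r.act_one, smul_add, smul_smul, ← mul_assoc, ← qpow_add]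
  have : (ℓ : ℝ) + 1 ≠ 0 := by positivity
  have a1 : (k : ℝ) - N + 2 * N / (ℓ + 1) = k - (ℓ - 1) / (ℓ + 1) * N := by field_simp; ring
  have a2 : (k : ℝ) - N + (N - ℓ - k) = -ℓ := by ring
  have a3 : -((k : ℝ) - N) - 1 + 2 * (ℓ + 1 - N) / (ℓ + 1) = (ℓ - 1) / (ℓ + 1) * N - k + 1 := by
    field_simp; ring
  have a4 : -((k : ℝ) - N) - 1 + (-N - ℓ + k + 1) = -ℓ := by ring
  rw [a1, a2, a3, a4, mul_add, add_smul]
  simp only [mul_assoc]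
  abel

/-! ### The Casimir on twisted forms -/

/-- The part of the Casimir in the Levi subalgebra, without the power of `K̂`. -/
def leviCas (ℓ : ℕ) (q : Set.Ioo (0 : ℝ) 1) : U ℓ q :=
  ∑ i ∈ Finset.Icc 1 ℓ, (rho q * qc q ^ (ℓ + 2) * ((qc q)⁻¹ ^ 2) ^ i) • (P ℓ q i ^ 2 * P ℓ q i ^ 2) +
    ∑ j ∈ Finset.Icc 1 ℓ, ∑ m ∈ Finset.Ico j ℓ, (qc q ^ (ℓ + 1) * ((qc q)⁻¹ ^ 2) ^ j) •
      (Mst ℓ q j m * (P ℓ q j ^ 2 * P ℓ q (m + 1) ^ 2) * M ℓ q j m)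

/-- The eigenvalue of `leviCas`. -/
def leviVal (ℓ : ℕ) (q : Set.Ioo (0 : ℝ) 1) (d : ℤ) (n : ℕ) : ℂ :=
  qc q ^ d * qc q ^ d * (rho q * (qc q * (qint q ℓ +
    (qc q - (qc q)⁻¹) * qc q ^ ((ℓ : ℤ) - n + 1) * qint q n)))

theorem Equi.act_leviCas {r : RAct ℓ q V} {d : ℤ} {ω : Finset ℕ → V} (h : Equi r d ω)
    {s : Finset ℕ} (hs : s ⊆ Finset.Icc 1 ℓ) :
    r.act (ω s) (leviCas ℓ q) = leviVal ℓ q d s.card • ω s := by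
  rw [leviVal, ← h.levi hs, leviCas]
  simp only [map_add, map_sum, map_smul]

theorem Equi.act_swap_leviCas {r : RAct ℓ q V} {d : ℤ} {ω : Finset ℕ → V} (h : Equi r d ω)
    {s : Finset ℕ} (hs : s ⊆ Finset.Icc 1 ℓ) :
    r.act (ω s) (swap (leviCas ℓ q)) = leviVal ℓ q (-d - 1) (ℓ - s.card) • ω s := by
  have h1 := h.compl.act_leviCas (s := Finset.Icc 1 ℓ \ s) Finset.sdiff_subset
  rwa [RAct.twist_act, compl_compl hs, Finset.card_sdiff_of_subset hs, Nat.card_Icc,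
    Nat.add_sub_cancel] at h1

theorem commute_Khatinv_M {j k : ℕ} (hj : 1 ≤ j) (hjk : j ≤ k) (hk : k < ℓ) :
    Commute (Khatinv ℓ q) (M ℓ q j k) := by
  have h := (Chr.Khatinv (q := q)).M hj hk.le hjk
  rw [Finset.sum_eq_zero, qpow_zero, one_smul] at h
  · exact h
  · intro m hm; rw [Finset.mem_Icc] at hm; rw [if_neg (by omega)]

theorem commute_Khatinv_Mst {j k : ℕ} (hj : 1 ≤ j) (hjk : j ≤ k) (hk : k < ℓ) :
    Commute (Khatinv ℓ q) (Mst ℓ q j k) := by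
  have := commute_star (commute_Khatinv_M (q := q) hj hjk hk)
  rwa [star_torus Khatinv_mem_torus] at this

theorem Nel_sq (j k : ℕ) :
    Nel ℓ q j k ^ 2 = Khatinv ℓ q ^ 2 * (P ℓ q j ^ 2 * P ℓ q (k + 1) ^ 2) := by
  have h1 := torus_comm (P_mem_torus (q := q) (ℓ := ℓ) j) (P_mem_torus (k + 1))
  have h2 := torus_comm (mul_mem (P_mem_torus (q := q) (ℓ := ℓ) j) (P_mem_torus (k + 1))) Khatinv_mem_torus
  rw [← h1.mul_pow, ← h2.symm.mul_pow, ← h2.eq]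
  rfl

/-- The terms with last index `ℓ` are the `X_i X_i^*`. From all others `K̂⁻²` factors out on the
left, since it commutes with `M_{j,m}^*` for `m < ℓ`. -/
theorem Cq_eq_leviCas : Cq ℓ q = Khatinv ℓ q ^ 2 * leviCas ℓ q
      + (rho q * qpow q (-(ℓ : ℝ))) • Khatinv ℓ q ^ 2
      + ∑ i ∈ Finset.Icc 1 ℓ, qpow q ((ℓ : ℝ) + 1 - 2 * i) • (X ℓ q i * star (X ℓ q i))
      - (rho q * qnum q ((ℓ : ℝ) + 1)) • 1 := by
  have e : ∀ (a i : ℕ), qpow q ((ℓ : ℝ) + a - 2 * i) = qc q ^ (ℓ + a) * ((qc q)⁻¹ ^ 2) ^ i := by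
    intro a i
    rw [qc_inv_sq_pow, ← qpow_natCast, ← qpow_add]; congr 1; push_cast; ring
  have e1 := e 1
  have e2 := e 2
  push_cast at e1 e2
  have t1 : ∑ i ∈ Finset.Icc 1 ℓ, (rho q * qpow q ((ℓ : ℝ) + 2 - 2 * i)) •
      Naux ℓ q ℓ (Khatinv ℓ q) i (i - 1) ^ 2 = Khatinv ℓ q ^ 2 * ∑ i ∈ Finset.Icc 1 ℓ,
        (rho q * qc q ^ (ℓ + 2) * ((qc q)⁻¹ ^ 2) ^ i) • (P ℓ q i ^ 2 * P ℓ q i ^ 2) := by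
    rw [Finset.mul_sum]
    refine Finset.sum_congr rfl fun i hi => ?_
    have h1 := (Finset.mem_Icc.1 hi).1
    rw [e2, ← mul_assoc, mul_smul_comm]
    congr 1
    have := Nel_sq (q := q) (ℓ := ℓ) i (i - 1)
    rwa [Nat.sub_add_cancel h1] at this
  have t2 : ∑ j ∈ Finset.Icc 1 ℓ, ∑ k ∈ Finset.Icc j ℓ, qpow q ((ℓ : ℝ) + 1 - 2 * j) •
      (star (M ℓ q j k) * Naux ℓ q ℓ (Khatinv ℓ q) j k ^ 2 * M ℓ q j k) =
      Khatinv ℓ q ^ 2 * (∑ j ∈ Finset.Icc 1 ℓ, ∑ m ∈ Finset.Ico j ℓ,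
        (qc q ^ (ℓ + 1) * ((qc q)⁻¹ ^ 2) ^ j) •
          (Mst ℓ q j m * (P ℓ q j ^ 2 * P ℓ q (m + 1) ^ 2) * M ℓ q j m)) +
      ∑ i ∈ Finset.Icc 1 ℓ, qpow q ((ℓ : ℝ) + 1 - 2 * i) • (X ℓ q i * star (X ℓ q i)) := by
    rw [Finset.mul_sum, ← Finset.sum_add_distrib]
    refine Finset.sum_congr rfl fun j hj => ?_
    obtain ⟨h1, h2⟩ := Finset.mem_Icc.1 hj
    rw [← Finset.Ico_insert_right h2, Finset.sum_insert (by simp), add_comm, X_mul_star_X h1 h2, Finset.mul_sum]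
    congr 1
    refine Finset.sum_congr rfl fun m hm => ?_
    obtain ⟨h3, h4⟩ := Finset.mem_Ico.1 hm
    rw [e1, mul_smul_comm]
    congr 1
    have hc := ((commute_Khatinv_Mst (q := q) h1 h3 h4).pow_left 2).eq
    change Mst ℓ q j m * Nel ℓ q j m ^ 2 * M ℓ q j m = _
    rw [Nel_sq, ← mul_assoc, ← mul_assoc, ← hc]
    simp only [mul_assoc]
  rw [Cq, casimirAux, t1, t2, leviCas, mul_add]
  abel

/-- Every term lies in the torus or has the form `M^* g M` with `g` in the torus, where `S⁻¹` and
`swap` coincide. This opens the second Casimir to the duality by complements. -/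
theorem Sinv_Cq : Sinv (Cq ℓ q) = swap (Cq ℓ q) := by
  have hN : ∀ j k, Naux ℓ q ℓ (Khatinv ℓ q) j k ^ 2 ∈ torus ℓ q := fun j k =>
    pow_mem (Nel_mem_torus j k) 2
  simp only [Cq, casimirAux, Sinv_sub, Sinv_add, Sinv_sum, Sinv_smul, Sinv_one, map_sub, map_add, map_sum,
    map_smul, map_one]
  congr 2
  · congr 1
    · exact Finset.sum_congr rfl fun i _ => by rw [(Sinv_torus (hN _ _)).1]
    · rw [(Sinv_torus (pow_mem Khatinv_mem_torus 2)).1]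
  · refine Finset.sum_congr rfl fun j _ => Finset.sum_congr rfl fun k hk => ?_
    congr 1
    exact Sinv_Mst_mul_M (Finset.mem_Icc.1 hk).1 (hN j k)

theorem TwForm.act_Cq_sub {r : RAct ℓ q V} {k : ℕ} {N : ℤ} {ω : Finset ℕ → V} (h : TwForm r k N ω)
    {s : Finset ℕ} (hs : s ⊆ Finset.Icc 1 ℓ) :
    r.act (ω s) (Cq ℓ q - ∑ i ∈ Finset.Icc 1 ℓ, qpow q ((ℓ : ℝ) + 1 - 2 * i) •
            (X ℓ q i * star (X ℓ q i))) =
          (rho q * (qpow q (1 - 2 * N / ((ℓ : ℝ) + 1)) * (qnum q ℓ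
                + (qpow q 1 - qpow q (-1)) * qpow q ((ℓ : ℝ) - k + 1) * qnum q k)
              + qpow q (-2 * (k : ℝ) + ℓ * (2 * N / ((ℓ : ℝ) + 1) - 1))
              - qnum q ((ℓ : ℝ) + 1))) • ω s := by
  by_cases hk : s.card = k
  swap
  · simp [h.degree s hs hk]
  have e : Cq ℓ q - ∑ i ∈ Finset.Icc 1 ℓ, qpow q ((ℓ : ℝ) + 1 - 2 * i) • (X ℓ q i * star (X ℓ q i)) =
      Khatinv ℓ q ^ 2 * leviCas ℓ q + (rho q * qpow q (-(ℓ : ℝ))) • Khatinv ℓ q ^ 2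
      - (rho q * qnum q ((ℓ : ℝ) + 1)) • 1 := by
    rw [Cq_eq_leviCas]; abel
  rw [e, map_sub, map_add, map_smul, map_smul, r.act_mul, act_sq_of_eq (h.act_Khatinv hs), map_smul,
    LinearMap.smul_apply, h.equi.act_leviCas hs, r.act_one, hk, leviVal, smul_smul, smul_smul, ← add_smul,
    ← sub_smul]
  congr 1
  have h0 : (ℓ : ℝ) + 1 ≠ 0 := by positivity
  rw [qint_eq_qnum (x := ℓ) (by simp), qint_eq_qnum (x := k) (by simp), ← qpow_intCast, ← qpow_intCast,
    ← qpow_neg_one, ← qpow_one]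
  have a1 : qpow q (1 - 2 * N / ((ℓ : ℝ) + 1)) = qpow q (2 * -((k : ℝ) - ℓ * N / (ℓ + 1))) *
      (qpow q ((k - N : ℤ) : ℝ) * qpow q ((k - N : ℤ) : ℝ)) * qpow q 1 := by
    rw [← qpow_add, ← qpow_add, ← qpow_add]; congr 1; push_cast; field_simp; ring
  have a2 : qpow q (-2 * (k : ℝ) + ℓ * (2 * N / ((ℓ : ℝ) + 1) - 1)) =
      qpow q (-(ℓ : ℝ)) * qpow q (2 * -((k : ℝ) - ℓ * N / (ℓ + 1))) := by
    rw [← qpow_add]; congr 1; field_simp; ring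
  have a3 : (((ℓ : ℤ) - k + 1 : ℤ) : ℝ) = (ℓ : ℝ) - k + 1 := by push_cast; ring
  rw [a1, a2, a3]
  ring

/-- The value of `S⁻¹(C_q) - ∑ q^(ℓ+1-2i) S⁻¹(X_i X_i^*)` on twisted forms of degree `k`. -/
def dualVal (ℓ : ℕ) (q : Set.Ioo (0 : ℝ) 1) (k : ℕ) (N : ℤ) : ℂ :=
  qpow q (2 * ((k : ℝ) - ℓ * N / (ℓ + 1))) * leviVal ℓ q (-(k - N) - 1) (ℓ - k)
    + rho q * qpow q (-(ℓ : ℝ)) * qpow q (2 * ((k : ℝ) - ℓ * N / (ℓ + 1)))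
    - rho q * qnum q ((ℓ : ℝ) + 1)

theorem TwForm.act_Sinv_Cq {r : RAct ℓ q V} {k : ℕ} {N : ℤ} {ω : Finset ℕ → V} (h : TwForm r k N ω)
    {s : Finset ℕ} (hs : s ⊆ Finset.Icc 1 ℓ) :
    r.act (ω s) (Sinv (Cq ℓ q)) = ∑ i ∈ Finset.Icc 1 ℓ, qpow q ((ℓ : ℝ) + 1 - 2 * i) •
      r.act (ω s) (Sinv (X ℓ q i * star (X ℓ q i))) + dualVal ℓ q k N • ω s := by
  by_cases hk : s.card = k
  swap
  · simp [h.degree s hs hk]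
  have e : swap (Cq ℓ q) = (Khat ℓ q ^ 2 * swap (leviCas ℓ q)
      + (rho q * qpow q (-(ℓ : ℝ))) • Khat ℓ q ^ 2 - (rho q * qnum q ((ℓ : ℝ) + 1)) • 1)
      + ∑ i ∈ Finset.Icc 1 ℓ, qpow q ((ℓ : ℝ) + 1 - 2 * i) • Sinv (X ℓ q i * star (X ℓ q i)) := by
    rw [Cq_eq_leviCas]
    simp only [map_sub swap, map_add swap, map_sum swap, map_smul swap, map_one swap, map_mul swap, map_pow swap,
      swap_Khatinv]
    have : ∑ i ∈ Finset.Icc 1 ℓ, qpow q ((ℓ : ℝ) + 1 - 2 * i) • Sinv (X ℓ q i * star (X ℓ q i)) =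
        ∑ i ∈ Finset.Icc 1 ℓ, qpow q ((ℓ : ℝ) + 1 - 2 * i) • (swap (X ℓ q i) * swap (star (X ℓ q i))) :=
      Finset.sum_congr rfl fun i hi => by
        obtain ⟨h1, h2⟩ := Finset.mem_Icc.1 hi
        rw [Sinv_X_mul_star_X h1 h2, map_mul swap]
    rw [this]
    abel
  rw [Sinv_Cq, e, map_add, add_comm, map_sum]
  simp only [map_smul]
  congr 1
  rw [map_sub, map_add, map_smul, map_smul, r.act_mul, act_sq_of_eq (h.khat s hs), map_smul,
    LinearMap.smul_apply, h.equi.act_swap_leviCas hs, r.act_one, hk, smul_smul, smul_smul, ← add_smul,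
    ← sub_smul, dualVal]

/-- By `TwForm.act_Cq_sub` and `TwForm.act_Sinv_Cq` each second order sum in `TwForm.dirac_sq` is a
Casimir plus a scalar depending only on `ℓ`, `q`, `k` and `N`. The shift of the exponents by `-ℓ -
1` comes from `q^{-2i} = q^{-ℓ-1} q^{ℓ+1-2i}`. -/
theorem TwForm.exists_dirac_sq (ℓ : ℕ) (q : Set.Ioo (0 : ℝ) 1) (k : ℕ) (N : ℤ) :
    ∃ c : ℂ, ∀ (r : RAct ℓ q V) (ω : Finset ℕ → V), TwForm r k N ω → ∀ s ⊆ Finset.Icc 1 ℓ,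
      (1 + qpow q 1) • diracN r N (diracN r N ω) s =
          qpow q ((k : ℝ) - ((ℓ : ℝ) - 1) / ((ℓ : ℝ) + 1) * N - ℓ - 1) • r.act (ω s) (Cq ℓ q)
            + qpow q (((ℓ : ℝ) - 1) / ((ℓ : ℝ) + 1) * N - k - ℓ) • r.act (ω s) (Sinv (Cq ℓ q))
            + c • ω s := by
  obtain ⟨c₁, hc₁⟩ : ∃ c₁ : ℂ, ∀ (r : RAct ℓ q V) (ω : Finset ℕ → V), TwForm r k N ω →
      ∀ s ⊆ Finset.Icc 1 ℓ, r.act (ω s) (Cq ℓ q) = c₁ • ω s + ∑ i ∈ Finset.Icc 1 ℓ,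
        qpow q ((ℓ : ℝ) + 1 - 2 * i) • r.act (ω s) (X ℓ q i * star (X ℓ q i)) :=
    ⟨_, fun r ω h s hs => by
      have h1 := h.act_Cq_sub hs
      rw [map_sub, sub_eq_iff_eq_add, map_sum] at h1
      simp only [map_smul] at h1
      exact h1⟩
  set c₂ : ℂ := qpow q (-(ℓ : ℝ)) * (qnum q k * qnum q ((ℓ : ℝ) + 1 - N)
    + qnum q ((ℓ : ℝ) - k) * qnum q N) with hc₂
  refine ⟨c₂ - qpow q ((k : ℝ) - ((ℓ : ℝ) - 1) / ((ℓ : ℝ) + 1) * N - ℓ - 1) * c₁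
    - qpow q (((ℓ : ℝ) - 1) / ((ℓ : ℝ) + 1) * N - k - ℓ) * dualVal ℓ q k N, fun r ω h s hs => ?_⟩
  have e : ∀ y : ℕ → V, ∑ i ∈ Finset.Icc 1 ℓ, qpow q (-2 * (i : ℝ)) • y i =
      qpow q (-(ℓ : ℝ) - 1) • ∑ i ∈ Finset.Icc 1 ℓ, qpow q ((ℓ : ℝ) + 1 - 2 * i) • y i := by
    intro y
    rw [Finset.smul_sum]
    refine Finset.sum_congr rfl fun i _ => ?_
    rw [smul_smul, ← qpow_add]; congr 2; ring
  rw [h.dirac_sq hs, e fun i => r.act (ω s) (X ℓ q i * star (X ℓ q i)),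
    e fun i => r.act (ω s) (Sinv (X ℓ q i * star (X ℓ q i))), hc₁ r ω h s hs, h.act_Sinv_Cq hs, ← hc₂]
  have b1 : qpow q ((k : ℝ) - ((ℓ : ℝ) - 1) / ((ℓ : ℝ) + 1) * N - ℓ - 1) =
      qpow q ((k : ℝ) - ((ℓ : ℝ) - 1) / ((ℓ : ℝ) + 1) * N) * qpow q (-(ℓ : ℝ) - 1) := by
    rw [← qpow_add]; congr 1; ring
  have b2 : qpow q (((ℓ : ℝ) - 1) / ((ℓ : ℝ) + 1) * N - k - ℓ) =
      qpow q (((ℓ : ℝ) - 1) / ((ℓ : ℝ) + 1) * N - k + 1) * qpow q (-(ℓ : ℝ) - 1) := by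
    rw [← qpow_add]; congr 1; ring
  rw [b1, b2]
  generalize (∑ i ∈ Finset.Icc 1 ℓ, qpow q ((ℓ : ℝ) + 1 - 2 * i) •
    r.act (ω s) (X ℓ q i * star (X ℓ q i))) = A
  generalize (∑ i ∈ Finset.Icc 1 ℓ, qpow q ((ℓ : ℝ) + 1 - 2 * i) •
    r.act (ω s) (Sinv (X ℓ q i * star (X ℓ q i)))) = B
  module

/-! ### Passage to components -/

theorem up_low {t : Finset ℕ} (ht : t ⊆ Finset.Icc 1 ℓ) : up (low ℓ t) = t := by
  ext x
  constructor
  · intro hx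
    obtain ⟨y, hy, rfl⟩ := Finset.mem_map.1 hx
    exact mem_low.1 hy
  · intro hx
    exact Finset.mem_map.2 ⟨⟨x, ht hx⟩, mem_low.2 hx, rfl⟩

theorem shuffleLen_singleton (i : Idx ℓ) (s : Finset (Idx ℓ)) :
    shuffleLen {i} (s \ {i}) = nlt (up s) i := by
  have e : (({i} : Finset (Idx ℓ)) ×ˢ (s \ {i})).filter (fun p => p.2 < p.1) =
      (s.filter (· < i)).map ⟨fun b => (i, b), fun a b h => (Prod.mk.inj h).2⟩ := by
    ext ⟨a, b⟩
    simp only [Finset.mem_filter, Finset.mem_product, Finset.mem_singleton, Finset.mem_sdiff, Finset.mem_map]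
    constructor
    · rintro ⟨⟨rfl, hb, -⟩, hlt⟩; exact ⟨b, ⟨hb, hlt⟩, rfl⟩
    · rintro ⟨c, ⟨hc, hlt⟩, h⟩
      obtain ⟨rfl, rfl⟩ := Prod.mk.inj h
      exact ⟨⟨rfl, hc, hlt.ne⟩, hlt⟩
  rw [shuffleLen, e, Finset.card_map, nlt, up, Finset.filter_map, Finset.card_map]
  rfl

/-- Only the subset `{i}` contributes to the wedge product, and its shuffle length is the number of
elements of `s` below `i`. -/
theorem extL_apply (i : Idx ℓ) (s t : Finset (Idx ℓ)) :
    extL q i s t = if i ∈ s ∧ t = s.erase i then (-(qc q)⁻¹) ^ nlt (up s) i else 0 := by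
  rw [extL, wedge, qpow_neg_one]
  by_cases hi : i ∈ s
  · rw [Finset.sum_eq_single {i}]
    · rw [Pi.single_eq_same, mul_one, shuffleLen_singleton, Finset.sdiff_singleton_eq_erase]
      by_cases ht : t = s.erase i
      · rw [if_pos ⟨hi, ht⟩, ht, Pi.single_eq_same, mul_one]
      · rw [if_neg fun h => ht h.2, Pi.single_eq_of_ne (Ne.symm ht), mul_zero]
    · intro u _ hu
      rw [Pi.single_eq_of_ne hu, mul_zero, zero_mul]
    · intro h
      exact absurd (Finset.mem_powerset.2 (Finset.singleton_subset_iff.2 hi)) h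
  · rw [if_neg fun h => hi h.1]
    refine Finset.sum_eq_zero fun u hu => ?_
    rw [Pi.single_eq_of_ne, mul_zero, zero_mul]
    rintro rfl
    exact hi (Finset.singleton_subset_iff.1 (Finset.mem_powerset.1 hu))

theorem up_insert (s : Finset (Idx ℓ)) (i : Idx ℓ) : up (insert i s) = insert (i : ℕ) (up s) := by
  rw [up, Finset.map_insert]; rfl

theorem intL_apply (i : Idx ℓ) (s t : Finset (Idx ℓ)) :
    intL q i s t = if i ∉ s ∧ t = insert i s then (-(qc q)⁻¹) ^ nlt (up s) i else 0 := by
  rw [intL, Matrix.conjTranspose_apply, extL_apply]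
  by_cases h : i ∉ s ∧ t = insert i s
  · obtain ⟨h1, rfl⟩ := h
    have h2 : (i : ℕ) ∉ up s := fun h => h1 (mem_up.1 h)
    rw [if_pos ⟨Finset.mem_insert_self _ _, (Finset.erase_insert h1).symm⟩, if_pos ⟨h1, rfl⟩, star_pow,
      star_neg, star_qc_inv, up_insert, nlt_insert _ h2, if_neg (lt_irrefl _), add_zero]
  · rw [if_neg h, if_neg, star_zero]
    rintro ⟨h1, rfl⟩
    exact h ⟨Finset.notMem_erase _ _, (Finset.insert_erase h1).symm⟩

theorem sum_idx_ite {W : Type*} [AddCommMonoid W] {t : Finset ℕ} (ht : t ⊆ Finset.Icc 1 ℓ) (f : ℕ → W) :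
    ∑ i : Idx ℓ, (if (i : ℕ) ∈ t then f i else 0) = ∑ i ∈ t, f i := by
  rw [Finset.sum_coe_sort (Finset.Icc 1 ℓ) fun i => if i ∈ t then f i else 0, Finset.sum_ite_mem,
    Finset.inter_eq_right.2 ht]

theorem flat_dbar (ω : Form ℓ q) {t : Finset ℕ} (ht : t ⊆ Finset.Icc 1 ℓ) :
    flat (dbar ω) t = dolb (ractA ℓ q) (flat ω) t := by
  rw [flat, dbar, Finset.sum_apply, dolb]
  refine Eq.trans (Finset.sum_congr rfl fun i _ => ?_) (sum_idx_ite ht _)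
  have e : extL q i = fun s t => if i ∈ s ∧ t = s.erase i then (-(qc q)⁻¹) ^ nlt (up s) i else 0 := by
    funext s t; exact extL_apply i s t
  rw [e, tensorOp_ite _ (fun s => i ∈ s) (fun s => s.erase i) (fun s => (-(qc q)⁻¹) ^ nlt (up s) i), up_low ht,
    ← low_erase]
  simp only [mem_low]
  rfl

theorem flat_dbarDag (ω : Form ℓ q) {t : Finset ℕ} (ht : t ⊆ Finset.Icc 1 ℓ) :
    flat (dbarDag ω) t = dolbDag (ractA ℓ q) (flat ω) t := by
  rw [flat, dbarDag, Finset.sum_apply, dolbDag]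
  refine Eq.trans (Finset.sum_congr rfl fun i _ => ?_) (sum_idx_ite Finset.sdiff_subset _)
  have e : intL q i = fun s t => if i ∉ s ∧ t = insert i s then (-(qc q)⁻¹) ^ nlt (up s) i else 0 := by
    funext s t; exact intL_apply i s t
  rw [e, tensorOp_ite _ (fun s => i ∉ s) (fun s => insert i s) (fun s => (-(qc q)⁻¹) ^ nlt (up s) i), up_low ht,
    ← low_insert]
  simp only [mem_low, Finset.mem_sdiff, i.2, true_and]
  rfl

theorem flat_dirac (N : ℤ) (ω : Form ℓ q) {t : Finset ℕ} (ht : t ⊆ Finset.Icc 1 ℓ) :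
    flat (dirac N ω) t = diracN (ractA ℓ q) N (flat ω) t := by
  have h : flat (dirac N ω) t = flat (dbar fun s => qpow q (((s.card : ℝ) - N) / 2) • ω s) t +
      flat (dbarDag fun s => qpow q (((s.card : ℝ) - N - 1) / 2) • ω s) t := rfl
  rw [h, flat_dbar _ ht, flat_dbarDag _ ht, diracN,
    dolb_congr (fun s hs => show flat _ s = qpow q (((s.card : ℝ) - N) / 2) • flat ω s by
      rw [flat, card_low hs]; rfl) ht,
    dolbDag_congr (fun s hs => show flat _ s = qpow q (((s.card : ℝ) - N - 1) / 2) • flat ω s by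
      rw [flat, card_low hs]; rfl) ht]

theorem IsForm.twForm {k : ℕ} {N : ℤ} {ω : Form ℓ q} (hω : IsForm k N ω) :
    TwForm (ractA ℓ q) k N (flat ω) where
  degree s hs hk := hω.degree _ (by rwa [card_low hs])
  equi := hω.equi
  half := hω.pHalf
  khat s _ := hω.ract_Khat _

theorem flat_dbar_dbarDag (ω : Form ℓ q) (s : Finset (Idx ℓ)) :
    dbar (dbarDag ω) s = dolb (ractA ℓ q) (dolbDag (ractA ℓ q) (flat ω)) (up s) := by
  rw [← flat_up (dbar _), flat_dbar _ (up_subset s), dolb_congr (fun t ht => flat_dbarDag ω ht) (up_subset s)]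

theorem flat_dbarDag_dbar (ω : Form ℓ q) (s : Finset (Idx ℓ)) :
    dbarDag (dbar ω) s = dolbDag (ractA ℓ q) (dolb (ractA ℓ q) (flat ω)) (up s) := by
  rw [← flat_up (dbarDag _), flat_dbarDag _ (up_subset s), dolbDag_congr (fun t ht => flat_dbar ω ht) (up_subset s)]

theorem flat_dirac_dirac (N : ℤ) (ω : Form ℓ q) (s : Finset (Idx ℓ)) :
    dirac N (dirac N ω) s = diracN (ractA ℓ q) N (diracN (ractA ℓ q) N (flat ω)) (up s) := by
  rw [← flat_up (dirac _ _), flat_dirac _ _ (up_subset s),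
    diracN_congr (fun t ht => flat_dirac N ω ht) (up_subset s)]

theorem formAct_apply (ω : Form ℓ q) (h : U ℓ q) (s : Finset (Idx ℓ)) :
    formAct ω h s = (ractA ℓ q).act (flat ω (up s)) h := by rw [flat_up]; rfl

end QProj

end

/-! ### Assembly of the theorem from its components. -/

theorem mainTheorem7 (ℓ : ℕ) (hℓ : 1 ≤ ℓ) (q : Set.Ioo (0 : ℝ) 1) (N : ℤ) :
    -- `∂̄†` is the Hermitian conjugate of `∂̄` with respect to the inner product of the Haar state
    (∀ φ : A ℓ q →ₗ[ℂ] ℂ, IsHaar φ → ∀ ω η : Form ℓ q,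
      formInner φ (dbarDag ω) η = formInner φ ω (dbar η)) ∧
    -- the relation between the Casimirs of `U_q(su(ℓ+1))` and `U_q(su(ℓ))`
    Cq ℓ q = qpow q 1 • (kap ℓ q ^ 2 * (CqSub ℓ q + (rho q * qnum q ℓ) • 1))
      + (rho q * qpow q (-(ℓ : ℝ))) • Khatinv ℓ q ^ 2
      + ∑ i ∈ Finset.Icc 1 ℓ, qpow q ((ℓ : ℝ) + 1 - 2 * i) •
          (star (M ℓ q i ℓ) * Nel ℓ q i ℓ ^ 2 * M ℓ q i ℓ)
      - (rho q * qnum q ((ℓ : ℝ) + 1)) • 1 ∧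
    ∀ k : ℕ, k ≤ ℓ →
      (∀ ω : Form ℓ q, IsForm k N ω →
        -- the Laplacian
        dbar (dbarDag ω) + dbarDag (dbar ω) =
          formAct ω (qpow q (2 * N / ((ℓ : ℝ) + 1)) •
              ∑ i ∈ Finset.Icc 1 ℓ, qpow q (-2 * (i : ℝ)) • (X ℓ q i * star (X ℓ q i))
            + (qpow q ((N : ℝ) - ℓ - k) * qnum q k * qnum q ((ℓ : ℝ) + 1 - N)) • 1) ∧
        -- the companion formula
        qpow q (2 * ((k : ℝ) - N)) • (dbar (dbarDag ω) + qpow q 2 • dbarDag (dbar ω)) =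
          formAct ω (qpow q (2 * ((ℓ : ℝ) + 1 - N) / ((ℓ : ℝ) + 1)) •
              ∑ i ∈ Finset.Icc 1 ℓ, qpow q (-2 * (i : ℝ)) • Sinv (X ℓ q i * star (X ℓ q i))
            + (qpow q (-(N : ℝ) - ℓ + k + 1) * qnum q ((ℓ : ℝ) - k) * qnum q N) • 1) ∧
        -- the square of the Dirac operator
        (1 + qpow q 1) • dirac N (dirac N ω) =
          qpow q ((k : ℝ) - ((ℓ : ℝ) - 1) / ((ℓ : ℝ) + 1) * N) •
              ∑ i ∈ Finset.Icc 1 ℓ, qpow q (-2 * (i : ℝ)) •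
                formAct ω (X ℓ q i * star (X ℓ q i))
            + qpow q (((ℓ : ℝ) - 1) / ((ℓ : ℝ) + 1) * N - k + 1) •
              ∑ i ∈ Finset.Icc 1 ℓ, qpow q (-2 * (i : ℝ)) •
                formAct ω (Sinv (X ℓ q i * star (X ℓ q i)))
            + (qpow q (-(ℓ : ℝ)) * (qnum q k * qnum q ((ℓ : ℝ) + 1 - N)
                + qnum q ((ℓ : ℝ) - k) * qnum q N)) • ω ∧
        -- the difference between the Casimir and the second order operator
        formAct ω (Cq ℓ q - ∑ i ∈ Finset.Icc 1 ℓ, qpow q ((ℓ : ℝ) + 1 - 2 * i) •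
            (X ℓ q i * star (X ℓ q i))) =
          (rho q * (qpow q (1 - 2 * N / ((ℓ : ℝ) + 1)) * (qnum q ℓ
                + (qpow q 1 - qpow q (-1)) * qpow q ((ℓ : ℝ) - k + 1) * qnum q k)
              + qpow q (-2 * (k : ℝ) + ℓ * (2 * N / ((ℓ : ℝ) + 1) - 1))
              - qnum q ((ℓ : ℝ) + 1))) • ω) ∧
      -- the square of the Dirac operator in terms of the Casimirs, up to a constant
      ∃ c : ℂ, ∀ ω : Form ℓ q, IsForm k N ω →
        (1 + qpow q 1) • dirac N (dirac N ω) =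
          qpow q ((k : ℝ) - ((ℓ : ℝ) - 1) / ((ℓ : ℝ) + 1) * N - ℓ - 1) • formAct ω (Cq ℓ q)
            + qpow q (((ℓ : ℝ) - 1) / ((ℓ : ℝ) + 1) * N - k - ℓ) • formAct ω (Sinv (Cq ℓ q))
            + c • ω := by
  refine ⟨fun φ hφ ω η => formInner_dbarDag hφ ω η, Cq_eq hℓ, fun k _ => ⟨fun ω hω => ⟨?_, ?_, ?_, ?_⟩, ?_⟩⟩
  · funext s
    have h := hω.twForm.laplace (up_subset s)
    rw [← flat_dbar_dbarDag, ← flat_dbarDag_dbar, ← formAct_apply] at h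
    exact h
  · funext s
    have h := hω.twForm.dual_laplace (up_subset s)
    rw [← flat_dbar_dbarDag, ← flat_dbarDag_dbar, ← formAct_apply] at h
    exact h
  · funext s
    have h := hω.twForm.dirac_sq (up_subset s)
    rw [← flat_dirac_dirac, flat_up] at h
    simp only [Pi.add_apply, Pi.smul_apply, Finset.sum_apply]
    exact h
  · funext s
    have h := hω.twForm.act_Cq_sub (up_subset s)
    rw [← formAct_apply, flat_up] at h
    exact h
  · obtain ⟨c, hc⟩ := TwForm.exists_dirac_sq (V := A ℓ q) ℓ q k N
    refine ⟨c, fun ω hω => funext fun s => ?_⟩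
    have h := hc _ _ hω.twForm _ (up_subset s)
    rw [← flat_dirac_dirac, ← formAct_apply, ← formAct_apply, flat_up] at h
    exact h
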